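/- Let $R$ be a Dedekind domain (a field is allowed; for example $R=\mathbb Z$ or $R=\mathbb Q$). Complexes are $\mathbb Z$-graded complexes of $R$-modules with differential of degree $-1$; tensor products over $R$ carry the usual Koszul signs, and a complex is flat if its modules are flat. A domain $A_*$ in a flat complex $A$ is a family of $\Sigma_j$-invariant subcomplexes $A_j\subseteq A^{\otimes j}$ $(j\ge 0)$ with $A_0=R$, $A_1=A$ and $A_j\subseteq A_{j_1}\otimes\cdots\otimes A_{j_k}$ whenever $j=j_1+\cdots+j_k$, such that all these inclusions, and $A_j\subseteq A^{\otimes j}$, are quasi-isomorphisms. Let $\mathcal O$ be a (symmetric) operad of complexes. A partial $\mathcal O$-algebra is a domain $A_*$ in a flat complex $A$ with maps of complexes $\theta:\mathcal O(j)\otimes A_j\to A$ that are unital and $\Sigma_j$-equivariant, such that for all $j=j_1+\cdots+j_k$ the composite $$\mathcal O(j_1)\otimes\cdots\otimes\mathcal O(j_k)\otimes A_j\to \mathcal O(j_1)\otimes A_{j_1}\otimes\cdots\otimes\mathcal O(j_k)\otimes A_{j_k}\to A^{\otimes k}$$ takes its values in $A_k$ and $\theta$ is associative, that is, compatible with the composition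 $\mathcal O(k)\otimes\mathcal O(j_1)\otimes\cdots\otimes\mathcal O(j_k)\to\mathcal O(j)$. A morphism $A_*\to B_*$ is a map of complexes $f:A\to B$ with $f^{\otimes j}(A_j)\subseteq B_j$ that commutes with the maps $\theta$; it is a quasi-isomorphism if $f$ is one. An $\mathcal O$-algebra on a flat complex $B$ is regarded as the partial $\mathcal O$-algebra with $B_j=B^{\otimes j}$ for all $j$. Theorem. Suppose that each $\mathcal O(k)$ is a complex of projective $R[\Sigma_k]$-modules and that, for each $k$, the complex $\mathcal O(k)$ is bounded below or $k!$ is invertible in $R$ (the latter holds for every $k$ if $R=\mathbb Q$). Then there is a functor $W$ that assigns to each partial $\mathcal O$-algebra $A_*$ (on an arbitrary flat complex $A$) an $\mathcal O$-algebra $WA_*$ on a flat complex, such that $A_*$ and $WA_*$ are quasi-isomorphic as partial $\mathcal O$-algebras, naturally in $A_*$: they are connected by a finite zigzag of natural quasi-isomorphisms of partial $\mathcal O$-algebras. -/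

import Mathlib

open CategoryTheory
open scoped TensorProduct

universe u

/-- A complex over `R`: an `R`-module with a direct sum decomposition into homogeneous parts
`gr n`, `n ∈ ℤ`, and a differential of degree `-1`. -/
structure DGModule (R : Type u) [CommRing R] where
  carrier : Type u
  [grp : AddCommGroup carrier]
  [mod : Module R carrier]
  gr : ℤ → Submodule R carrier
  internal : DirectSum.IsInternal gr
  d : carrier →ₗ[R] carrier
  d_gr : ∀ (n : ℤ) (x : carrier), x ∈ gr n → d x ∈ gr (n - 1)
  d_d : ∀ x : carrier, d (d x) = 0

instance (R : Type u) [CommRing R] : CoeSort (DGModule R) (Type u) := ⟨DGModule.carrier⟩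

attribute [instance] DGModule.grp DGModule.mod

/-- For submodules `P`, `Q` stable under a differential `D`: `P` is contained in `Q`, and the
inclusion induces a bijection on homology. -/
def IsQuasiIncl {R M : Type*} [CommRing R] [AddCommGroup M] [Module R M]
    (D : M →ₗ[R] M) (P Q : Submodule R M) : Prop :=
  P ≤ Q ∧ (∀ x ∈ P, (∃ y ∈ Q, D y = x) → ∃ y ∈ P, D y = x) ∧
    (∀ z ∈ Q, D z = 0 → ∃ x ∈ P, D x = 0 ∧ ∃ y ∈ Q, D y = z - x)

/-- The sign `(-1)^n`, as an element of `R`. -/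
def sgn (R : Type*) [CommRing R] (n : ℤ) : R := ((n.negOnePow : ℤˣ) : ℤ)

theorem sgn_zero (R : Type*) [CommRing R] : sgn R 0 = 1 := by simp [sgn]

theorem sgn_add (R : Type*) [CommRing R] (m n : ℤ) : sgn R (m + n) = sgn R m * sgn R n := by
  simp [sgn, Int.negOnePow_add]

theorem sgn_mul_self (R : Type*) [CommRing R] (n : ℤ) : sgn R n * sgn R n = 1 := by
  rw [sgn, ← Int.cast_mul, ← Units.val_mul, Int.units_mul_self]; simp

theorem sgn_congr (R : Type*) [CommRing R] {m n : ℤ} (h : Even (m - n)) : sgn R m = sgn R n := by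
  rw [sgn, (Int.negOnePow_eq_iff m n).2 h, sgn]

theorem sgn_sum (R : Type*) [CommRing R] {ι : Type*} (s : Finset ι) (q : ι → ℤ) :
    sgn R (∑ i ∈ s, q i) = ∏ i ∈ s, sgn R (q i) := by
  classical
  induction s using Finset.induction_on with
  | empty => simp [sgn_zero]
  | insert i s hi ih => rw [Finset.prod_insert hi, Finset.sum_insert hi, sgn_add, ih]

/-- The Koszul sign of the permutation `σ` that moves the `l`-th of several factors, of degree
`q l`, to the place `σ l`. -/
def koszul (R : Type*) [CommRing R] {k : ℕ} (σ : Equiv.Perm (Fin k)) (q : Fin k → ℤ) : R :=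
  ∏ l : Fin k, ∏ m : Fin k, if l < m ∧ σ m < σ l then sgn R (q l * q m) else 1

theorem koszul_mul_self (R : Type*) [CommRing R] {k : ℕ} (σ : Equiv.Perm (Fin k))
    (q : Fin k → ℤ) : koszul R σ q * koszul R σ q = 1 := by
  rw [koszul, ← Finset.prod_mul_distrib]
  refine Finset.prod_eq_one fun l _ => ?_
  rw [← Finset.prod_mul_distrib]
  refine Finset.prod_eq_one fun m _ => ?_
  split_ifs
  · exact sgn_mul_self R _
  · exact one_mul 1

/-- The exponent of the sign of the unshuffle
`x₁ ⊗ ⋯ ⊗ x_k ⊗ y₁ ⊗ ⋯ ⊗ y_k ↦ x₁ ⊗ y₁ ⊗ ⋯ ⊗ x_k ⊗ y_k`, with `p i = |x_i|`, `q i = |y_i|`. -/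
def unshuffleExp {k : ℕ} (p q : Fin k → ℤ) : ℤ :=
  ∑ i : Fin k, (∑ l : Fin k, if i < l then p l else 0) * q i

theorem sum_arity {k : ℕ} (j : Fin k → ℕ) (l : ∀ i, Fin (j i) → ℕ) :
    (∑ s : Fin (∑ i, j i), l (finSigmaFinEquiv.symm s).1 (finSigmaFinEquiv.symm s).2)
      = ∑ i, ∑ m, l i m := by
  rw [← Fintype.sum_sigma']
  exact Fintype.sum_equiv finSigmaFinEquiv.symm _ _ (fun _ => rfl)

/-- The permutation of `k` blocks, the `i`-th of size `j (σ i)`, induced by `σ`. -/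
def blockPerm {k : ℕ} (σ : Equiv.Perm (Fin k)) (j : Fin k → ℕ) :
    Fin (∑ i, j (σ i)) ≃ Fin (∑ i, j i) :=
  finSigmaFinEquiv.symm.trans
    ((Equiv.sigmaCongrLeft (β := fun i => Fin (j i)) σ).trans finSigmaFinEquiv)

/-- The block sum `τ₁ ⊕ ⋯ ⊕ τ_k`. -/
def blockSum {k : ℕ} {j j' : Fin k → ℕ} (τ : ∀ i, Fin (j i) ≃ Fin (j' i)) :
    Fin (∑ i, j i) ≃ Fin (∑ i, j' i) :=
  finSigmaFinEquiv.symm.trans ((Equiv.sigmaCongrRight τ).trans finSigmaFinEquiv)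

namespace DGModule

variable {R : Type u} [CommRing R]

noncomputable section

/-- The linear map that is `x ↦ g n • x` on the part of degree `n`. -/
def diag (A : DGModule R) (g : ℤ → R) : A →ₗ[R] A :=
  DirectSum.toModule R ℤ A (fun n => g n • (A.gr n).subtype) ∘ₗ
    (LinearEquiv.ofBijective (DirectSum.coeLinearMap A.gr) A.internal).symm.toLinearMap

theorem diag_of_mem (A : DGModule R) (g : ℤ → R) {n : ℤ} {x : A} (hx : x ∈ A.gr n) :
    A.diag g x = g n • x := by
  have h : (LinearEquiv.ofBijective (DirectSum.coeLinearMap A.gr) A.internal).symm x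
      = DirectSum.lof R ℤ (fun n => A.gr n) n ⟨x, hx⟩ := by
    rw [LinearEquiv.symm_apply_eq]
    exact (DirectSum.coeLinearMap_lof A.gr n ⟨x, hx⟩).symm
  rw [diag, LinearMap.comp_apply, LinearEquiv.coe_coe, h]
  simp [DirectSum.toModule_lof]

/-- The sign operator `x ↦ (-1)^(n |x|) x`. -/
def eps (A : DGModule R) (n : ℤ) : A →ₗ[R] A := A.diag fun m => sgn R (n * m)

theorem eps_of_mem (A : DGModule R) (n : ℤ) {m : ℤ} {x : A} (hx : x ∈ A.gr m) :
    A.eps n x = sgn R (n * m) • x := by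
  rw [eps, diag_of_mem _ _ hx]

/-- The projection onto the part of even (`s = 0`) or odd (`s = 1`) degree. -/
def par (A : DGModule R) (s : Fin 2) : A →ₗ[R] A :=
  A.diag fun m => if m % 2 = ((s : ℕ) : ℤ) then 1 else 0

/-- The differential of the tensor power `A^{⊗ j}`:
`a₁ ⊗ ⋯ ⊗ a_j ↦ ∑ᵢ (-1)^(|a₁| + ⋯ + |a_{i-1}|) a₁ ⊗ ⋯ ⊗ d aᵢ ⊗ ⋯ ⊗ a_j`. -/
def tD (A : DGModule R) (j : ℕ) : (⨂[R]^j) A →ₗ[R] (⨂[R]^j) A :=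
  ∑ i : Fin j, PiTensorProduct.map
    (fun l => if l < i then A.eps 1 else if l = i then A.d else LinearMap.id)

/-- The part of degree `n` of `A^{⊗ j}`. -/
def tgr (A : DGModule R) (j : ℕ) (n : ℤ) : Submodule R ((⨂[R]^j) A) :=
  Submodule.span R {t | ∃ (q : Fin j → ℤ) (a : Fin j → A),
    (∀ l, a l ∈ A.gr (q l)) ∧ ∑ l, q l = n ∧ t = PiTensorProduct.tprod R a}

/-- The sign operator `x ↦ (-1)^(n |x|) x` of `A^{⊗ j}`. -/
def teps (A : DGModule R) (j : ℕ) (n : ℤ) : (⨂[R]^j) A →ₗ[R] (⨂[R]^j) A :=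
  PiTensorProduct.map (fun _ => A.eps n)

/-- The action of `σ` on `A^{⊗ j}`, which moves the `l`-th factor to the place `σ l`, with the
Koszul sign (see `tperm_tprod`). -/
def tperm (A : DGModule R) {j : ℕ} (σ : Equiv.Perm (Fin j)) : (⨂[R]^j) A →ₗ[R] (⨂[R]^j) A :=
  ∑ s : Fin j → Fin 2, koszul R σ (fun l => ((s l : ℕ) : ℤ)) •
    ((PiTensorProduct.reindex R (fun _ => (A : Type u)) σ).toLinearMap ∘ₗ
      PiTensorProduct.map (fun l => A.par (s l)))

/-- The canonical isomorphism `A^{⊗ (j₁ + ⋯ + j_k)} → A^{⊗ j₁} ⊗ ⋯ ⊗ A^{⊗ j_k}`. -/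
def split (A : DGModule R) {k : ℕ} (j : Fin k → ℕ) :
    (⨂[R]^(∑ i, j i)) A →ₗ[R] ⨂[R] i, (⨂[R]^(j i)) A :=
  PiTensorProduct.lift
    (((PiTensorProduct.tprod R (s := fun i => (⨂[R]^(j i)) A)).compMultilinearMap
      (fun i => PiTensorProduct.tprod R (s := fun _ : Fin (j i) => (A : Type u)))).domDomCongr
        finSigmaFinEquiv)

theorem split_tprod (A : DGModule R) {k : ℕ} (j : Fin k → ℕ) (a : Fin (∑ i, j i) → A) :
    A.split j (PiTensorProduct.tprod R a) = PiTensorProduct.tprod R (fun i =>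
      PiTensorProduct.tprod R (fun m => a (finSigmaFinEquiv ⟨i, m⟩))) := by
  simp [split]
  rfl

/-- A property that is closed under linear combinations and holds for the value of a multilinear
map at homogeneous elements holds for all its values. -/
theorem multilinear_mem (A : DGModule R) {ι : Type*} [Fintype ι] {N : Type*} [AddCommGroup N]
    [Module R N] (f : MultilinearMap R (fun _ : ι => (A : Type u)) N) (S : Submodule R N)
    (h : ∀ (q : ι → ℤ) (a : ι → A), (∀ l, a l ∈ A.gr (q l)) → f a ∈ S) (a : ι → A) : f a ∈ S := by
  classical
  have key : ∀ (t : Finset ι) (a : ι → A), (∀ l, l ∉ t → ∃ n, a l ∈ A.gr n) → f a ∈ S := by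
    intro t
    induction t using Finset.induction_on with
    | empty =>
      intro a ha
      choose q hq using fun l => ha l (by simp)
      exact h q a hq
    | insert i t hi ih =>
      intro a ha
      have hmem : a i ∈ ⨆ n, A.gr n := by
        rw [A.internal.submodule_iSup_eq_top]; trivial
      have hx : ∀ x : A, x ∈ ⨆ n, A.gr n → f (Function.update a i x) ∈ S := by
        intro x hx
        induction hx using Submodule.iSup_induction' with
        | mem n x hx =>
          apply ih
          intro l hl
          by_cases hli : l = i
          · subst hli; exact ⟨n, by simpa using hx⟩
          · rw [Function.update_of_ne hli]
            exact ha l (by simp [hli, hl])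
        | zero => rw [MultilinearMap.map_update_zero]; exact S.zero_mem
        | add x y _ _ hx hy => rw [MultilinearMap.map_update_add]; exact S.add_mem hx hy
      simpa using hx (a i) hmem
  exact key Finset.univ a (by simp)

/-- Linear maps on a tensor power agree if they agree on tensors of homogeneous elements. -/
theorem hom_ext (A : DGModule R) {j : ℕ} {N : Type*} [AddCommGroup N]
    [Module R N] (f g : (⨂[R]^j) A →ₗ[R] N)
    (h : ∀ (q : Fin j → ℤ) (a : Fin j → A), (∀ l, a l ∈ A.gr (q l)) →
      f (PiTensorProduct.tprod R a) = g (PiTensorProduct.tprod R a)) : f = g := by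
  ext a
  have := A.multilinear_mem ((f - g).compMultilinearMap (PiTensorProduct.tprod R)) ⊥
    (fun q a ha => by simpa [sub_eq_zero] using h q a ha) a
  simpa [sub_eq_zero] using this

theorem teps_tprod (A : DGModule R) {j : ℕ} (n : ℤ) (q : Fin j → ℤ) (a : Fin j → A)
    (ha : ∀ l, a l ∈ A.gr (q l)) :
    A.teps j n (PiTensorProduct.tprod R a)
      = sgn R (n * ∑ l, q l) • PiTensorProduct.tprod R a := by
  have h : (fun l => A.eps n (a l)) = fun l => sgn R (n * q l) • a l :=
    funext fun l => A.eps_of_mem n (ha l)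
  rw [teps, PiTensorProduct.map_tprod, h, MultilinearMap.map_smul_univ,
    Finset.mul_sum, sgn_sum]

theorem teps_of_mem (A : DGModule R) {j : ℕ} (n : ℤ) {m : ℤ} {x : (⨂[R]^j) A}
    (hx : x ∈ A.tgr j m) : A.teps j n x = sgn R (n * m) • x := by
  induction hx using Submodule.span_induction with
  | mem x h =>
    obtain ⟨q, a, ha, rfl, rfl⟩ := h
    exact A.teps_tprod n q a ha
  | zero => simp
  | add x y _ _ hx hy => rw [map_add, hx, hy, smul_add]
  | smul r x _ hx => rw [map_smul, hx, smul_comm]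

theorem tperm_tprod (A : DGModule R) {j : ℕ} (σ : Equiv.Perm (Fin j)) (q : Fin j → ℤ)
    (a : Fin j → A) (ha : ∀ l, a l ∈ A.gr (q l)) :
    A.tperm σ (PiTensorProduct.tprod R a)
      = koszul R σ q • PiTensorProduct.tprod R (fun l => a (σ.symm l)) := by
  classical
  have hlt : ∀ l, (q l % 2).toNat < 2 := fun l => by omega
  set s₀ : Fin j → Fin 2 := fun l => ⟨(q l % 2).toNat, hlt l⟩ with hs₀
  have hs₀v : ∀ l, (((s₀ l : Fin 2) : ℕ) : ℤ) = q l % 2 := fun l => by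
    simp only [hs₀]; omega
  have hpar : ∀ (s : Fin 2) (l : Fin j), A.par s (a l) = if s = s₀ l then a l else 0 := by
    intro s l
    rw [par, diag_of_mem _ _ (ha l)]
    have : (q l % 2 = ((s : ℕ) : ℤ)) ↔ s = s₀ l := by
      rw [← hs₀v l, Nat.cast_inj, Fin.ext_iff, eq_comm]
    by_cases h : s = s₀ l
    · rw [if_pos (this.2 h), if_pos h, one_smul]
    · rw [if_neg (fun h2 => h (this.1 h2)), if_neg h, zero_smul]
  have hk : koszul R σ (fun l => (((s₀ l : Fin 2) : ℕ) : ℤ)) = koszul R σ q := by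
    unfold koszul
    refine Finset.prod_congr rfl fun l _ => Finset.prod_congr rfl fun m _ => ?_
    split_ifs
    · refine sgn_congr R ?_
      simp only [hs₀v]
      rw [Int.even_sub, Int.even_mul, Int.even_mul, Int.even_iff, Int.even_iff, Int.even_iff,
        Int.even_iff]
      omega
    · rfl
  rw [tperm, LinearMap.sum_apply, Finset.sum_eq_single s₀]
  · have h0 : (fun l => A.par (s₀ l) (a l)) = a := by
      funext l; rw [hpar, if_pos rfl]
    rw [LinearMap.smul_apply, LinearMap.comp_apply, PiTensorProduct.map_tprod, h0,
      LinearEquiv.coe_coe, PiTensorProduct.reindex_tprod, hk]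
  · intro s _ hs
    obtain ⟨l, hl⟩ := Function.ne_iff.1 hs
    rw [LinearMap.smul_apply, LinearMap.comp_apply, PiTensorProduct.map_tprod,
      (PiTensorProduct.tprod R).map_coord_zero l (by rw [hpar, if_neg hl]), map_zero, smul_zero]
  · intro h; exact absurd (Finset.mem_univ _) h

/-- The subcomplex `P_{j₁} ⊗ ⋯ ⊗ P_{j_k}` of `A^{⊗ (j₁ + ⋯ + j_k)}`, for subcomplexes
`P_j ⊆ A^{⊗ j}`. -/
def prodSub (A : DGModule R) (P : ∀ j, Submodule R ((⨂[R]^j) A)) {k : ℕ} (j : Fin k → ℕ) :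
    Submodule R ((⨂[R]^(∑ i, j i)) A) :=
  (LinearMap.range (PiTensorProduct.mapIncl fun i => P (j i))).comap (A.split j)

end

end DGModule

/-- An operad of complexes over `R`. The symmetric group actions are recorded as a functor
`relabel` on the groupoid of the sets `Fin n` and their bijections: `relabel σ` renames the input
`i` as `σ i`, so that `relabel σ c = c σ⁻¹` in terms of the right action. All of the `∑ i, j i`
inputs of `comp j c x` are numbered in lexicographic order. -/
structure Operad (R : Type u) [CommRing R] where
  obj : ℕ → DGModule R
  relabel : ∀ {m n : ℕ}, (Fin m ≃ Fin n) → (obj m →ₗ[R] obj n)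
  relabel_refl : ∀ (n : ℕ) (c : obj n), relabel (Equiv.refl (Fin n)) c = c
  relabel_trans : ∀ {m n p : ℕ} (e : Fin m ≃ Fin n) (f : Fin n ≃ Fin p) (c : obj m),
    relabel (e.trans f) c = relabel f (relabel e c)
  relabel_gr : ∀ {m n : ℕ} (e : Fin m ≃ Fin n) (p : ℤ) (c : obj m),
    c ∈ (obj m).gr p → relabel e c ∈ (obj n).gr p
  relabel_d : ∀ {m n : ℕ} (e : Fin m ≃ Fin n) (c : obj m),
    relabel e ((obj m).d c) = (obj n).d (relabel e c)
  one : obj 1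
  one_gr : one ∈ (obj 1).gr 0
  d_one : (obj 1).d one = 0
  comp : ∀ {k : ℕ} (j : Fin k → ℕ),
    obj k →ₗ[R] MultilinearMap R (fun i => (obj (j i) : Type u)) (obj (∑ i, j i))
  comp_gr : ∀ {k : ℕ} (j : Fin k → ℕ) (p : ℤ) (q : Fin k → ℤ) (c : obj k) (x : ∀ i, obj (j i)),
    c ∈ (obj k).gr p → (∀ i, x i ∈ (obj (j i)).gr (q i)) →
      comp j c x ∈ (obj (∑ i, j i)).gr (p + ∑ i, q i)
  d_comp : ∀ {k : ℕ} (j : Fin k → ℕ) (c : obj k) (x : ∀ i, obj (j i)),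
    (obj (∑ i, j i)).d (comp j c x) = comp j ((obj k).d c) x +
      ∑ i, comp j ((obj k).eps 1 c) (fun l =>
        if l < i then (obj (j l)).eps 1 (x l) else if l = i then (obj (j l)).d (x l) else x l)
  comp_one : ∀ {k : ℕ} (c : obj k),
    relabel (finCongr (by simp)) (comp (fun _ : Fin k => 1) c (fun _ => one)) = c
  one_comp : ∀ {k : ℕ} (c : obj k),
    relabel (finCongr (by simp)) (comp (fun _ : Fin 1 => k) one (fun _ => c)) = c
  comp_assoc : ∀ {k : ℕ} (j : Fin k → ℕ) (l : ∀ i, Fin (j i) → ℕ) (p : Fin k → ℤ)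
    (q : ∀ i, Fin (j i) → ℤ) (c : obj k) (x : ∀ i, obj (j i)) (y : ∀ i m, obj (l i m)),
    (∀ i, x i ∈ (obj (j i)).gr (p i)) → (∀ i m, y i m ∈ (obj (l i m)).gr (q i m)) →
      relabel (finCongr (sum_arity j l))
        (comp (fun s => l (finSigmaFinEquiv.symm s).1 (finSigmaFinEquiv.symm s).2) (comp j c x)
          (fun s => y (finSigmaFinEquiv.symm s).1 (finSigmaFinEquiv.symm s).2)) =
      sgn R (unshuffleExp p (fun i => ∑ m, q i m)) •
        comp (fun i => ∑ m, l i m) c (fun i => comp (l i) (x i) (y i))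
  comp_relabel_inner : ∀ {k : ℕ} {j j' : Fin k → ℕ} (τ : ∀ i, Fin (j i) ≃ Fin (j' i)) (c : obj k)
    (x : ∀ i, obj (j i)),
    comp j' c (fun i => relabel (τ i) (x i)) = relabel (blockSum τ) (comp j c x)
  comp_relabel_outer : ∀ {k : ℕ} (σ : Equiv.Perm (Fin k)) (j : Fin k → ℕ) (q : Fin k → ℤ)
    (c : obj k) (x : ∀ i, obj (j i)), (∀ i, x i ∈ (obj (j i)).gr (q i)) →
      comp j (relabel σ c) x = koszul R σ (fun i => q (σ i)) •
        relabel (blockPerm σ j) (comp (fun i => j (σ i)) c (fun i => x (σ i)))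

namespace Operad

variable {R : Type u} [CommRing R]

/-- The action of the symmetric group `Σ_k` on `O(k)`. -/
def rep (O : Operad R) (k : ℕ) : Representation R (Equiv.Perm (Fin k)) (O.obj k) where
  toFun σ := O.relabel σ
  map_one' := LinearMap.ext fun c => O.relabel_refl k c
  map_mul' σ τ := LinearMap.ext fun c => O.relabel_trans τ σ c

end Operad

/-- A domain in a complex `A`: subcomplexes `A_j ⊆ A^{⊗ j}`, invariant under `Σ_j`, with `A_0 = R`
and `A_1 = A`, such that `A_j ⊆ A_{j₁} ⊗ ⋯ ⊗ A_{j_k}` for all ordered partitions of `j`, and such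
that all these inclusions, and `A_j ⊆ A^{⊗ j}`, are quasi-isomorphisms. -/
structure Domain {R : Type u} [CommRing R] (A : DGModule R) where
  sub : ∀ j, Submodule R ((⨂[R]^j) A)
  sub_zero : sub 0 = ⊤
  sub_one : sub 1 = ⊤
  graded : ∀ j, sub j ≤ ⨆ n, sub j ⊓ A.tgr j n
  d_mem : ∀ j, ∀ x ∈ sub j, A.tD j x ∈ sub j
  perm_mem : ∀ {j} (σ : Equiv.Perm (Fin j)), ∀ x ∈ sub j, A.tperm σ x ∈ sub j
  quasi : ∀ j, IsQuasiIncl (A.tD j) (sub j) ⊤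
  quasi_prod : ∀ {k : ℕ} (j : Fin k → ℕ),
    IsQuasiIncl (A.tD (∑ i, j i)) (sub (∑ i, j i)) (A.prodSub sub j)

namespace Domain

variable {R : Type u} [CommRing R] {A : DGModule R}

theorem teps_mem (S : Domain A) (j : ℕ) (n : ℤ) : ∀ x ∈ S.sub j, A.teps j n x ∈ S.sub j := by
  intro x hx
  have hx2 := S.graded j hx
  induction hx2 using Submodule.iSup_induction' with
  | mem m y hy =>
    rw [A.teps_of_mem n hy.2]
    exact Submodule.smul_mem _ _ hy.1
  | zero => simp
  | add y z hy hz ihy ihz =>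
    have hle : (⨆ n, S.sub j ⊓ A.tgr j n) ≤ S.sub j := iSup_le fun _ => inf_le_left
    rw [map_add]
    exact add_mem (ihy (hle hy)) (ihz (hle hz))

/-- The sign operator `x ↦ (-1)^(n |x|) x` of `A_j`. -/
noncomputable def eps (S : Domain A) (j : ℕ) (n : ℤ) : S.sub j →ₗ[R] S.sub j :=
  (A.teps j n).restrict (S.teps_mem j n)

/-- The domain with `A_j = A^{⊗ j}` for all `j`. -/
def full (A : DGModule R) : Domain A where
  sub _ := ⊤
  sub_zero := rfl
  sub_one := rfl
  graded j := by
    rw [← PiTensorProduct.span_tprod_eq_top, Submodule.span_le]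
    rintro _ ⟨a, rfl⟩
    refine A.multilinear_mem (PiTensorProduct.tprod R) _ (fun q a ha => ?_) a
    refine Submodule.mem_iSup_of_mem (∑ l, q l) ⟨?_, Submodule.subset_span ⟨q, a, ha, rfl, rfl⟩⟩
    exact Submodule.subset_span ⟨a, rfl⟩
  d_mem _ _ _ := trivial
  perm_mem _ _ _ := trivial
  quasi j := ⟨le_rfl, fun _ _ h => h, fun z _ hz => ⟨z, trivial, hz, 0, trivial, by simp⟩⟩
  quasi_prod {k} j := by
    refine ⟨fun z _ => ?_, fun _ _ ⟨y, _, hy⟩ => ⟨y, trivial, hy⟩,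
      fun z _ hz => ⟨z, trivial, hz, 0, zero_mem _, by simp⟩⟩
    have : LinearMap.range (PiTensorProduct.mapIncl
        fun i => (⊤ : Submodule R ((⨂[R]^(j i)) A))) = ⊤ := by
      rw [PiTensorProduct.mapIncl, PiTensorProduct.map_range_eq_span_tprod, eq_top_iff,
        ← PiTensorProduct.span_tprod_eq_top]
      refine Submodule.span_mono ?_
      rintro _ ⟨a, rfl⟩
      exact ⟨fun i => ⟨a i, trivial⟩, rfl⟩
    rw [DGModule.prodSub, this]
    trivial

end Domain

/-- A partial algebra over `O`: a flat complex `A`, a domain `A_*` in `A` and maps of complexes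
`θ : O(j) ⊗ A_j → A` that are unital and equivariant, such that for all ordered partitions
`j = j₁ + ⋯ + j_k` the composite
`O(j₁) ⊗ ⋯ ⊗ O(j_k) ⊗ A_j → O(j₁) ⊗ A_{j₁} ⊗ ⋯ ⊗ O(j_k) ⊗ A_{j_k} → A^{⊗ k}`
takes its values in `A_k` and is compatible with the composition of `O`. -/
structure PartialAlgebra {R : Type u} [CommRing R] (O : Operad R) where
  cx : DGModule R
  flat : Module.Flat R cx
  dom : Domain cx
  θ : ∀ {j : ℕ}, O.obj j →ₗ[R] dom.sub j →ₗ[R] cx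
  θ_gr : ∀ {j : ℕ} (p q : ℤ) (c : O.obj j) (x : dom.sub j), c ∈ (O.obj j).gr p →
    (x : (⨂[R]^j) cx) ∈ cx.tgr j q → θ c x ∈ cx.gr (p + q)
  d_θ : ∀ {j : ℕ} (c : O.obj j) (x : dom.sub j),
    cx.d (θ c x) = θ ((O.obj j).d c) x + θ ((O.obj j).eps 1 c) ⟨cx.tD j x, dom.d_mem j x x.2⟩
  θ_one : ∀ (a : cx) (h : PiTensorProduct.tprod R (fun _ : Fin 1 => a) ∈ dom.sub 1),
    θ O.one ⟨_, h⟩ = a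
  θ_relabel : ∀ {j : ℕ} (σ : Equiv.Perm (Fin j)) (c : O.obj j) (x : dom.sub j),
    θ (O.relabel σ c) ⟨cx.tperm σ x, dom.perm_mem σ x x.2⟩ = θ c x
  θ_mem : ∀ {k : ℕ} (j : Fin k → ℕ) (p : Fin k → ℤ) (x : ∀ i, O.obj (j i))
    (z : dom.sub (∑ i, j i)) (w : ⨂[R] i, dom.sub (j i)),
    (∀ i, x i ∈ (O.obj (j i)).gr (p i)) → cx.split j z = PiTensorProduct.mapIncl _ w →
      PiTensorProduct.map
        (fun i => θ (x i) ∘ₗ dom.eps (j i) (∑ l, if i < l then p l else 0)) w ∈ dom.sub k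
  θ_comp : ∀ {k : ℕ} (j : Fin k → ℕ) (p : Fin k → ℤ) (c : O.obj k) (x : ∀ i, O.obj (j i))
    (z : dom.sub (∑ i, j i)) (w : ⨂[R] i, dom.sub (j i))
    (hx : ∀ i, x i ∈ (O.obj (j i)).gr (p i)) (hw : cx.split j z = PiTensorProduct.mapIncl _ w),
      θ (O.comp j c x) z = θ c ⟨_, θ_mem j p x z w hx hw⟩

/-- An algebra over `O`, on a flat complex. -/
structure OperadAlgebra {R : Type u} [CommRing R] (O : Operad R) where
  cx : DGModule R
  flat : Module.Flat R cx
  act : ∀ {j : ℕ}, O.obj j →ₗ[R] MultilinearMap R (fun _ : Fin j => (cx : Type u)) cx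
  act_gr : ∀ {j : ℕ} (p : ℤ) (q : Fin j → ℤ) (c : O.obj j) (a : Fin j → cx),
    c ∈ (O.obj j).gr p → (∀ l, a l ∈ cx.gr (q l)) → act c a ∈ cx.gr (p + ∑ l, q l)
  d_act : ∀ {j : ℕ} (c : O.obj j) (a : Fin j → cx),
    cx.d (act c a) = act ((O.obj j).d c) a +
      ∑ i, act ((O.obj j).eps 1 c) (fun l =>
        if l < i then cx.eps 1 (a l) else if l = i then cx.d (a l) else a l)
  act_one : ∀ a : cx, act O.one (fun _ => a) = a
  act_relabel : ∀ {j : ℕ} (σ : Equiv.Perm (Fin j)) (q : Fin j → ℤ) (c : O.obj j)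
    (a : Fin j → cx), (∀ l, a l ∈ cx.gr (q l)) →
      act (O.relabel σ c) a = koszul R σ (fun l => q (σ l)) • act c (fun l => a (σ l))
  act_comp : ∀ {k : ℕ} (j : Fin k → ℕ) (p : Fin k → ℤ) (q : ∀ i, Fin (j i) → ℤ) (c : O.obj k)
    (x : ∀ i, O.obj (j i)) (a : ∀ i, Fin (j i) → cx),
    (∀ i, x i ∈ (O.obj (j i)).gr (p i)) → (∀ i m, a i m ∈ cx.gr (q i m)) →
      act (O.comp j c x) (fun s => a (finSigmaFinEquiv.symm s).1 (finSigmaFinEquiv.symm s).2) =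
        sgn R (unshuffleExp p (fun i => ∑ m, q i m)) • act c (fun i => act (x i) (a i))

namespace PartialAlgebra

variable {R : Type u} [CommRing R] {O : Operad R}

/-- A morphism of partial algebras: a map of complexes `f : A → B` such that `f^{⊗ j}` maps `A_j`
into `B_j`, compatible with the structure maps. -/
@[ext]
structure Hom (A B : PartialAlgebra O) where
  f : A.cx →ₗ[R] B.cx
  f_gr : ∀ (n : ℤ) (x : A.cx), x ∈ A.cx.gr n → f x ∈ B.cx.gr n
  f_d : ∀ x : A.cx, f (A.cx.d x) = B.cx.d (f x)
  map_mem : ∀ (j : ℕ) (x : A.dom.sub j),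
    PiTensorProduct.map (fun _ : Fin j => f) (x : (⨂[R]^j) A.cx) ∈ B.dom.sub j
  map_θ : ∀ {j : ℕ} (c : O.obj j) (x : A.dom.sub j), f (A.θ c x) = B.θ c ⟨_, map_mem j x⟩

instance : Category (PartialAlgebra O) where
  Hom A B := Hom A B
  id A :=
    { f := LinearMap.id
      f_gr := fun _ _ h => h
      f_d := fun _ => rfl
      map_mem := fun j x => by rw [PiTensorProduct.map_id]; exact x.2
      map_θ := fun c x => by simp [PiTensorProduct.map_id] }
  comp {A B C} g h :=
    { f := h.f ∘ₗ g.f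
      f_gr := fun n x hx => h.f_gr n _ (g.f_gr n x hx)
      f_d := fun x => by simp [g.f_d, h.f_d]
      map_mem := fun j x => by
        rw [PiTensorProduct.map_comp]
        exact h.map_mem j ⟨_, g.map_mem j x⟩
      map_θ := fun c x => by
        rw [LinearMap.comp_apply, g.map_θ, h.map_θ]
        congr 2
        rw [PiTensorProduct.map_comp]
        rfl }
  id_comp _ := rfl
  comp_id _ := rfl
  assoc _ _ _ := rfl

/-- A quasi-isomorphism of partial algebras: a morphism whose map of complexes `A → B` induces a
bijection on homology. -/
def IsQuasiIso {A B : PartialAlgebra O} (g : A ⟶ B) : Prop :=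
  (∀ x : A.cx, A.cx.d x = 0 → (∃ y, B.cx.d y = Hom.f g x) → ∃ x', A.cx.d x' = x) ∧
    (∀ y : B.cx, B.cx.d y = 0 → ∃ x, A.cx.d x = 0 ∧ ∃ y', B.cx.d y' = y - Hom.f g x)

/-- Two functors with values in partial algebras are quasi-isomorphic if they are related by a
zigzag of natural transformations all of whose components are quasi-isomorphisms. -/
def NaturallyQuasiIsomorphic {C : Type*} [Category C] (F G : C ⥤ PartialAlgebra O) : Prop :=
  Relation.EqvGen (fun F' G' : C ⥤ PartialAlgebra O =>
    ∃ τ : F' ⟶ G', ∀ X : C, IsQuasiIso (τ.app X)) F G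

end PartialAlgebra

namespace OperadAlgebra

variable {R : Type u} [CommRing R] {O : Operad R}

/-- A morphism of algebras over `O`. -/
@[ext]
structure Hom (A B : OperadAlgebra O) where
  f : A.cx →ₗ[R] B.cx
  f_gr : ∀ (n : ℤ) (x : A.cx), x ∈ A.cx.gr n → f x ∈ B.cx.gr n
  f_d : ∀ x : A.cx, f (A.cx.d x) = B.cx.d (f x)
  map_act : ∀ {j : ℕ} (c : O.obj j) (a : Fin j → A.cx),
    f (A.act c a) = B.act c (fun l => f (a l))

instance : Category (OperadAlgebra O) where
  Hom A B := Hom A B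
  id A :=
    { f := LinearMap.id
      f_gr := fun _ _ h => h
      f_d := fun _ => rfl
      map_act := fun _ _ => rfl }
  comp {A B C} g h :=
    { f := h.f ∘ₗ g.f
      f_gr := fun n x hx => h.f_gr n _ (g.f_gr n x hx)
      f_d := fun x => by simp [g.f_d, h.f_d]
      map_act := fun c a => by simp [g.map_act, h.map_act] }
  id_comp _ := rfl
  comp_id _ := rfl
  assoc _ _ _ := rfl

theorem lift_comp (A : OperadAlgebra O) {k : ℕ} (j : Fin k → ℕ) (p : Fin k → ℤ) (c : O.obj k)
    (x : ∀ i, O.obj (j i)) (hx : ∀ i, x i ∈ (O.obj (j i)).gr (p i))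
    (z : (⨂[R]^(∑ i, j i)) A.cx) :
    PiTensorProduct.lift (A.act (O.comp j c x)) z =
      PiTensorProduct.lift (A.act c) (PiTensorProduct.map (fun i =>
        PiTensorProduct.lift (A.act (x i)) ∘ₗ
          A.cx.teps (j i) (∑ l, if i < l then p l else 0)) (A.cx.split j z)) := by
  have : PiTensorProduct.lift (A.act (O.comp j c x)) =
      PiTensorProduct.lift (A.act c) ∘ₗ PiTensorProduct.map (fun i =>
        PiTensorProduct.lift (A.act (x i)) ∘ₗ
          A.cx.teps (j i) (∑ l, if i < l then p l else 0)) ∘ₗ A.cx.split j := by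
    refine A.cx.hom_ext _ _ fun q a ha => ?_
    have h1 := A.act_comp j p (fun i m => q (finSigmaFinEquiv ⟨i, m⟩)) c x
      (fun i m => a (finSigmaFinEquiv ⟨i, m⟩)) hx (fun i m => ha _)
    simp only [Sigma.eta, Equiv.apply_symm_apply] at h1
    simp only [LinearMap.comp_apply, DGModule.split_tprod, PiTensorProduct.map_tprod,
      PiTensorProduct.lift.tprod]
    rw [h1]
    have h2 : ∀ i, A.cx.teps (j i) (∑ l, if i < l then p l else 0)
        (PiTensorProduct.tprod R (fun m => a (finSigmaFinEquiv ⟨i, m⟩))) = _ := fun i =>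
      A.cx.teps_tprod _ (fun m => q (finSigmaFinEquiv ⟨i, m⟩)) _ (fun m => ha _)
    simp only [h2, map_smul, PiTensorProduct.lift.tprod]
    rw [MultilinearMap.map_smul_univ, unshuffleExp, sgn_sum]
  rw [this]; rfl

/-- An algebra over `O`, regarded as a partial algebra with `A_j = A^{⊗ j}` for all `j`. -/
noncomputable def toPartialObj (A : OperadAlgebra O) : PartialAlgebra O where
  cx := A.cx
  flat := A.flat
  dom := Domain.full A.cx
  θ {j} := (PiTensorProduct.lift.toLinearMap ∘ₗ A.act).compl₂
    ((Domain.full A.cx).sub j).subtype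
  θ_gr {j} p q c x hc hx := by
    obtain ⟨x, hx0⟩ := x
    change PiTensorProduct.lift (A.act c) x ∈ _
    replace hx : x ∈ A.cx.tgr j q := hx
    clear hx0
    induction hx using Submodule.span_induction with
    | mem x h =>
      obtain ⟨q, a, ha, rfl, rfl⟩ := h
      rw [PiTensorProduct.lift.tprod]
      exact A.act_gr p q c a hc ha
    | zero => rw [map_zero]; exact zero_mem _
    | add x y _ _ hx hy => rw [map_add]; exact add_mem hx hy
    | smul r x _ hx => rw [map_smul]; exact Submodule.smul_mem _ _ hx
  d_θ {j} c x := by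
    have h : A.cx.d ∘ₗ PiTensorProduct.lift (A.act c) =
        PiTensorProduct.lift (A.act ((O.obj j).d c)) +
          PiTensorProduct.lift (A.act ((O.obj j).eps 1 c)) ∘ₗ A.cx.tD j := by
      ext a
      simp only [LinearMap.compMultilinearMap_apply, LinearMap.comp_apply, LinearMap.add_apply,
        PiTensorProduct.lift.tprod, A.d_act, DGModule.tD, LinearMap.sum_apply, map_sum,
        PiTensorProduct.map_tprod]
      congr 1
      refine Finset.sum_congr rfl fun i _ => ?_
      congr 1
      funext l
      split_ifs <;> rfl
    exact LinearMap.congr_fun h x.1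
  θ_one a h := by
    change PiTensorProduct.lift (A.act O.one) (PiTensorProduct.tprod R fun _ : Fin 1 => a) = a
    rw [PiTensorProduct.lift.tprod, A.act_one]
  θ_relabel {j} σ c x := by
    have h : PiTensorProduct.lift (A.act (O.relabel σ c)) ∘ₗ A.cx.tperm σ =
        PiTensorProduct.lift (A.act c) := by
      refine A.cx.hom_ext _ _ fun q a ha => ?_
      rw [LinearMap.comp_apply, A.cx.tperm_tprod σ q a ha, map_smul, PiTensorProduct.lift.tprod,
        PiTensorProduct.lift.tprod, A.act_relabel σ (fun l => q (σ.symm l)) c _ (fun l => ha _)]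
      simp only [Equiv.symm_apply_apply]
      rw [smul_smul, koszul_mul_self, one_smul]
    exact LinearMap.congr_fun h x.1
  θ_mem := fun _ _ _ _ _ _ _ => trivial
  θ_comp {k} j p c x z w hx hw := by
    change PiTensorProduct.lift (A.act (O.comp j c x)) z.1 = PiTensorProduct.lift (A.act c) _
    rw [A.lift_comp j p c x hx, hw]
    congr 1
    exact LinearMap.congr_fun (PiTensorProduct.map_comp (R := R)
      (fun i => PiTensorProduct.lift (A.act (x i)) ∘ₗ
        A.cx.teps (j i) (∑ l, if i < l then p l else 0))
      (fun i => ((Domain.full A.cx).sub (j i)).subtype)).symm w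

/-- The inclusion of the category of algebras in the category of partial algebras. -/
noncomputable def toPartial (O : Operad R) : OperadAlgebra O ⥤ PartialAlgebra O where
  obj A := A.toPartialObj
  map {A B} g :=
    { f := g.f
      f_gr := g.f_gr
      f_d := g.f_d
      map_mem := fun _ _ => trivial
      map_θ := fun {j} c x => by
        have h : g.f ∘ₗ PiTensorProduct.lift (A.act c) =
            PiTensorProduct.lift (B.act c) ∘ₗ PiTensorProduct.map (fun _ => g.f) := by
          ext a
          simp [g.map_act]
        exact LinearMap.congr_fun h x.1 }
  map_id _ := rfl
  map_comp _ _ := rfl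

end OperadAlgebra

open PiTensorProduct renaming map → pmap, tprod → tp, map_tprod → map_tp, map_comp → pmap_comp,
  map_id → pmap_id, ext → pext
open PiTensorProduct (span_tprod_eq_top mapIncl)
open LinearMap renaming comp_apply → lcmp, congr_fun → lcongr, id → lid, ext → lext, smul_apply → l_smul,
  sum_apply → l_sum, add_apply → l_add, sub_apply → l_sub, zero_apply → l_zero, id_apply → l_id,
  comp_assoc → l_assoc, compMultilinearMap_apply → l_mult
open LinearMap (mem_eqLocus eqLocus range ker)
open Submodule (mem_comap subset_span span_le smul_mem mem_iSup_of_mem span_induction comap span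
  mem_iSup_of_directed)
open Finset (sum_congr mem_univ sum_add_distrib mul_sum single_le_sum)
open Function (update update_of_ne update_self Injective)
open Equiv (Perm symm_apply_apply apply_symm_apply)
open MultilinearMap renaming ext → mext
open MultilinearMap (map_smul_univ map_update_smul map_update_add)

noncomputable section

open DGModule

variable {R : Type u} [CommRing R] {k : ℕ}

local notation "fsf" => finSigmaFinEquiv

local notation "fsi" => Equiv.symm finSigmaFinEquiv

/-- The dependent function of one index with the values `c i m`, in lexicographic order. -/
local notation:max "♭(" c ")" => fun s => c (Sigma.fst (Equiv.symm finSigmaFinEquiv s)) (Sigma.snd (Equiv.symm finSigmaFinEquiv s))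

/-- The tensor power of a linear map. -/
local notation:max "pow(" f ")" => pmap fun _ => f

/-! ### Multilinear maps given on generators -/

section Generators

variable {R : Type*} [CommRing R]

lemma LinearMap.exists_extend_of_span {M N S : Type*} [AddCommGroup M] [Module R M]
    [AddCommGroup N] [Module R N] (e : S → M) (he : span R (Set.range e) = ⊤)
    (g : S → N) (h : ∀ r : S →₀ R, Finsupp.linearCombination R e r = 0 → Finsupp.linearCombination R g r = 0) :
    ∃ f : M →ₗ[R] N, ∀ s, f (e s) = g s := by
  have hsurj : Function.Surjective (Finsupp.linearCombination R e) := by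
    rw [← LinearMap.range_eq_top, Finsupp.range_linearCombination, he]
  have hk : ker (Finsupp.linearCombination R e) ≤
      ker (Finsupp.linearCombination R g) := fun r hr => h r hr
  refine ⟨(Submodule.liftQ _ _ hk) ∘ₗ
    ((Finsupp.linearCombination R e).quotKerEquivOfSurjective hsurj).symm.toLinearMap,
    fun s => ?_⟩
  have : ((Finsupp.linearCombination R e).quotKerEquivOfSurjective hsurj).symm (e s)
      = Submodule.Quotient.mk (Finsupp.single s 1) := by
    rw [LinearEquiv.symm_apply_eq]
    exact (by simp : e s = Finsupp.linearCombination R e (Finsupp.single s 1))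
  rw [lcmp, LinearEquiv.coe_coe, this, Submodule.liftQ_apply]
  simp

/-- A function on tuples of generators extends to a multilinear map if it extends linearly in each
variable, the other variables being fixed generators. -/
lemma MultilinearMap.exists_of_generators : ∀ {k : ℕ} {M : Fin k → Type*} {S : Fin k → Type*}
    [∀ i, AddCommGroup (M i)] [∀ i, Module R (M i)] {N : Type*} [AddCommGroup N] [Module R N]
    (e : ∀ i, S i → M i) (_ : ∀ i, span R (Set.range (e i)) = ⊤)
    (g : (∀ i, S i) → N)
    (_ : ∀ (s : ∀ i, S i) (i : Fin k), ∃ L : M i →ₗ[R] N, ∀ t, L (e i t) = g (update s i t)),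
    ∃ F : MultilinearMap R M N, ∀ s : ∀ i, S i, F (fun i => e i (s i)) = g s := by
  intro k
  induction k with
  | zero =>
    intro M S _ _ N _ _ e he g h
    refine ⟨MultilinearMap.constOfIsEmpty R M (g finZeroElim), fun s => ?_⟩
    rw [MultilinearMap.constOfIsEmpty_apply]
    exact congrArg g (funext fun i => i.elim0)
  | succ k ih =>
    intro M S _ _ N _ _ e he g h
    have h1 : ∀ t : S 0, ∃ F : MultilinearMap R (fun i : Fin k => M i.succ) N,
        ∀ s : ∀ i : Fin k, S i.succ, F (fun i => e i.succ (s i)) = g (Fin.cons t s) := by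
      intro t
      refine ih (fun i => e i.succ) (fun i => he i.succ) (fun s => g (Fin.cons t s)) ?_
      intro s i
      obtain ⟨L, hL⟩ := h (Fin.cons t s) i.succ
      refine ⟨L, fun t' => ?_⟩
      rw [hL, Fin.cons_update]
    choose F hF using h1
    obtain ⟨G, hG⟩ := LinearMap.exists_extend_of_span (e 0) (he 0) F (by
      intro r hr
      refine MultilinearMap.ext_of_span_eq_top (γ := fun i : Fin k => S i.succ)
        (g := fun {i : Fin k} => e i.succ) (fun i => he i.succ) ?_
      intro s
      rcases em (Nonempty (S 0)) with ⟨⟨t0⟩⟩ | hemp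
      · obtain ⟨L, hL⟩ := h (Fin.cons t0 s) 0
        have : ∀ r : S 0 →₀ R, (Finsupp.linearCombination R F r) (fun i => e i.succ (s i))
            = L (Finsupp.linearCombination R (e 0) r) := by
          intro r
          induction r using Finsupp.induction_linear with
          | zero => simp
          | add r r' h h' => simp [h, h']
          | single t c => simp [hF, hL]
        rw [this, hr, L.map_zero]; rfl
      · have : r = 0 := by ext t; exact (hemp ⟨t⟩).elim
        rw [this]; simp)
    refine ⟨LinearMap.uncurryLeft G, fun s => ?_⟩
    rw [LinearMap.uncurryLeft_apply, hG]
    have := hF (s 0) (fun i => s i.succ)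
    rw [show Fin.tail (fun i => e i (s i)) = fun i : Fin k => e i.succ (s i.succ) from rfl, this]
    congr 1
    exact Fin.cons_self_tail s

end Generators

/-! ### Signs -/

section Signs

variable (R : Type*) [CommRing R]

lemma sgn_one : sgn R 1 = -1 := by simp [sgn]

lemma sgn_of_cast {m n : ℤ} (h : (m : ZMod 2) = n) : sgn R m = sgn R n := by
  refine sgn_congr R ?_
  rw [even_iff_two_dvd]
  have := (ZMod.intCast_zmod_eq_zero_iff_dvd (m - n) 2).1 (by push_cast; rw [h, sub_self])
  exact_mod_cast this

lemma sgn_smul_inj {M : Type*} [AddCommGroup M] [Module R M] (n : ℤ) {x y : M}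
    (h : sgn R n • x = sgn R n • y) : x = y := by
  have := congrArg (sgn R n • ·) h
  simpa [smul_smul, sgn_mul_self] using this

lemma sgn_smul_smul {M : Type*} [AddCommGroup M] [Module R M] (n : ℤ) (x : M) : sgn R n • sgn R n • x = x := by
  rw [smul_smul, sgn_mul_self, one_smul]

/-- The exponent of the Koszul sign of a bijection `e : Fin m ≃ Fin n`. -/
def kexp {m n : ℕ} (e : Fin m ≃ Fin n) (q : Fin m → ℤ) : ℤ := ∑ l, ∑ l', if l < l' ∧ e l' < e l then q l * q l' else 0

lemma koszul_eq (σ : Perm (Fin k)) (q : Fin k → ℤ) : koszul R σ q = sgn R (kexp σ q) := by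
  rw [kexp, sgn_sum, koszul]
  refine Finset.prod_congr rfl fun l _ => ?_
  rw [sgn_sum]
  refine Finset.prod_congr rfl fun m _ => ?_
  split_ifs <;> simp [sgn_zero]

lemma Finset.sum_sum_eq_of_symm {Z : Type*} [AddCommMonoid Z] (A B : Fin k → Fin k → Z)
    (hd : ∀ l, A l l = B l l) (h : ∀ l m, l < m → A l m + A m l = B l m + B m l) :
    ∑ l, ∑ m, A l m = ∑ l, ∑ m, B l m := by
  have key : ∀ A : Fin k → Fin k → Z, ∑ l, ∑ m, A l m =
      ∑ l, ∑ m, if l < m then A l m + A m l else if l = m then A l l else 0 := by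
    intro A
    have h1 : ∑ l, ∑ m, A l m = (∑ l, ∑ m, if l < m then A l m else if l = m then A l l else 0) +
        ∑ l, ∑ m, if m < l then A l m else 0 := by
      rw [← sum_add_distrib]
      refine sum_congr rfl fun l _ => ?_
      rw [← sum_add_distrib]
      refine sum_congr rfl fun m _ => ?_
      rcases lt_trichotomy l m with h | h | h
      · simp [h, h.not_gt]
      · simp [h]
      · simp [h, h.not_gt, h.ne']
    rw [h1, Finset.sum_comm (f := fun l m => if m < l then A l m else 0), ← sum_add_distrib]
    refine sum_congr rfl fun l _ => ?_
    rw [← sum_add_distrib]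
    refine sum_congr rfl fun m _ => ?_
    split_ifs <;> simp
  rw [key A, key B]
  refine sum_congr rfl fun l _ => sum_congr rfl fun m _ => ?_
  split_ifs with h1
  · exact h l m h1
  · exact hd l
  · rfl

lemma zmod_two_add_self (x : ZMod 2) : x + x = 0 := CharTwo.add_self_eq_zero x

lemma kexp_trans {m n p : ℕ} (e : Fin m ≃ Fin n) (f : Fin n ≃ Fin p) (q : Fin m → ℤ) :
    ((kexp (e.trans f) q : ℤ) : ZMod 2) = (kexp e q + kexp f (fun l => q (e.symm l)) : ℤ) := by
  have h : kexp f (fun l => q (e.symm l)) = ∑ l, ∑ l', if e l < e l' ∧ f (e l') < f (e l) then q l * q l' else 0 := by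
    rw [kexp, ← e.sum_comp]
    refine sum_congr rfl fun l _ => ?_
    rw [← e.sum_comp]
    simp
  rw [h, kexp, kexp]
  push_cast
  rw [← sum_add_distrib]
  simp_rw [← sum_add_distrib]
  refine Finset.sum_sum_eq_of_symm _ _ (fun l => by simp) fun l l' hl => ?_
  have h1 : e l < e l' ∨ e l' < e l := lt_or_gt_of_ne (fun h => hl.ne (e.injective h))
  have h2 : f (e l) < f (e l') ∨ f (e l') < f (e l) := lt_or_gt_of_ne (fun h => hl.ne (e.injective (f.injective h)))
  rcases h1 with h1 | h1 <;> rcases h2 with h2 | h2 <;>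
    simp [hl, hl.not_gt, h1, h1.not_gt, h2, h2.not_gt, zmod_two_add_self, mul_comm]

lemma kexp_of_monotone {m n : ℕ} (e : Fin m ≃ Fin n) (he : ∀ l l', l < l' → e l < e l')
    (q : Fin m → ℤ) : kexp e q = 0 := by
  rw [kexp]
  refine Finset.sum_eq_zero fun l _ => Finset.sum_eq_zero fun l' _ => if_neg ?_
  rintro ⟨h1, h2⟩
  exact (he _ _ h1).not_gt h2

/-- Raising the degree of one factor by one changes the sign of a permutation by the number of
the odd factors that are passed. -/
lemma kexp_update {m n : ℕ} (e : Fin m ≃ Fin n) (q q' : Fin m → ℤ) (i : Fin m)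
    (h : ∀ l, (q' l : ZMod 2) = q l + if l = i then 1 else 0) :
    ((kexp e q' : ℤ) : ZMod 2) = ((kexp e q + (∑ l, if l < i then q l else 0) +
      ∑ l, if e l < e i then q l else 0 : ℤ) : ZMod 2) := by
  have h1 : ((kexp e q' : ℤ) : ZMod 2) = (kexp e q : ℤ) +
      ∑ l, ∑ l', ((if l = i then (if l < l' ∧ e l' < e l then (q l' : ZMod 2) else 0) else 0) +
        (if l' = i then (if l < l' ∧ e l' < e l then (q l : ZMod 2) else 0) else 0)) := by
    rw [kexp, kexp]
    push_cast
    rw [← sum_add_distrib]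
    refine sum_congr rfl fun l _ => ?_
    rw [← sum_add_distrib]
    refine sum_congr rfl fun l' _ => ?_
    split_ifs with h0 h1 h2 h2
    · exact absurd h0.1 (by rw [h1, h2]; exact lt_irrefl _)
    · rw [h, h, if_pos h1, if_neg h2]; ring
    · rw [h, h, if_neg h1, if_pos h2]; ring
    · rw [h, h, if_neg h1, if_neg h2]; ring
    all_goals simp
  rw [h1]
  push_cast
  rw [add_assoc]
  congr 1
  simp_rw [sum_add_distrib]
  rw [Finset.sum_comm (f := fun l l' => if l' = i then _ else _)]
  simp only [Finset.sum_ite_irrel, Finset.sum_const_zero, Finset.sum_ite_eq', mem_univ, if_true]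
  rw [← sum_add_distrib, ← sum_add_distrib]
  refine sum_congr rfl fun l _ => ?_
  rcases eq_or_ne l i with rfl | hl
  · simp
  have h2 : l < i ∨ i < l := lt_or_gt_of_ne hl
  have h3 : e l < e i ∨ e i < e l := lt_or_gt_of_ne (fun h => hl (e.injective h))
  rcases h2 with h2 | h2 <;> rcases h3 with h3 | h3 <;> simp [h2, h2.not_gt, h3, h3.not_gt, zmod_two_add_self]

end Signs

/-! ### Tensor powers of graded modules -/

namespace DGModule

lemma gr_ext (A : DGModule R) {N : Type*} [AddCommGroup N] [Module R N] (f g : A →ₗ[R] N)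
    (h : ∀ n, ∀ x ∈ A.gr n, f x = g x) : f = g := by
  refine lext fun x => ?_
  have hx : x ∈ ⨆ n, A.gr n := by rw [A.internal.submodule_iSup_eq_top]; trivial
  induction hx using Submodule.iSup_induction' with
  | mem n x hx => exact h n x hx
  | zero => simp
  | add x y _ _ hx hy => rw [map_add, map_add, hx, hy]

lemma eps_mem (A : DGModule R) (n : ℤ) {m : ℤ} {x : A} (hx : x ∈ A.gr m) : A.eps n x ∈ A.gr m := by
  rw [A.eps_of_mem n hx]; exact smul_mem _ _ hx

lemma eps_add (A : DGModule R) (m n : ℤ) : A.eps (m + n) = A.eps m ∘ₗ A.eps n := by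
  refine A.gr_ext _ _ fun l x hx => ?_
  rw [lcmp, A.eps_of_mem _ (A.eps_mem n hx), A.eps_of_mem _ hx, A.eps_of_mem _ hx, smul_smul, add_mul, sgn_add]

lemma eps_congr (A : DGModule R) {m n : ℤ} (h : (m : ZMod 2) = n) : A.eps m = A.eps n := by
  refine A.gr_ext _ _ fun l x hx => ?_
  rw [A.eps_of_mem _ hx, A.eps_of_mem _ hx, sgn_of_cast R (m := m * l) (n := n * l) (by push_cast; rw [h])]

@[simp] lemma eps_zero (A : DGModule R) : A.eps 0 = lid := by
  refine A.gr_ext _ _ fun l x hx => ?_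
  rw [A.eps_of_mem _ hx, zero_mul, sgn_zero, one_smul]; rfl

@[simp] lemma eps_eps (A : DGModule R) (n : ℤ) (x : A) : A.eps n (A.eps n x) = x := by
  rw [← lcmp, ← eps_add, A.eps_congr (n := 0), eps_zero]; rfl
  push_cast; exact zmod_two_add_self _

lemma eps_comp_eps (A : DGModule R) (n : ℤ) : A.eps n ∘ₗ A.eps n = lid := lext fun x => A.eps_eps n x

/-- The linear map `f` commutes with signs as a map of degree `p` does. -/
def HasPar (A B : DGModule R) (f : A →ₗ[R] B) (p : ℤ) : Prop := ∀ n, B.eps n ∘ₗ f = sgn R (n * p) • (f ∘ₗ A.eps n)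

lemma hasPar_of_gr {A B : DGModule R} {f : A →ₗ[R] B} {p : ℤ}
    (h : ∀ n, ∀ x ∈ A.gr n, f x ∈ B.gr (p + n)) : HasPar A B f p := by
  intro m
  refine A.gr_ext _ _ fun n x hx => ?_
  rw [lcmp, B.eps_of_mem _ (h n x hx), l_smul, lcmp, A.eps_of_mem _ hx, map_smul, smul_smul, ← sgn_add, mul_add]

lemma hasPar_d (A : DGModule R) : HasPar A A A.d (-1) :=
  hasPar_of_gr fun n x hx => by have := A.d_gr n x hx; rwa [sub_eq_neg_add] at this

/-! #### Parts of the tensor power -/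

lemma tprod_mem_tgr (A : DGModule R) {j : ℕ} (q : Fin j → ℤ) (a : Fin j → A)
    (ha : ∀ l, a l ∈ A.gr (q l)) : tp R a ∈ A.tgr j (∑ l, q l) :=
  subset_span ⟨q, a, ha, rfl, rfl⟩

lemma tgr_induction {A : DGModule R} {j : ℕ} {n : ℤ} (P : Submodule R ((⨂[R]^j) A))
    (h : ∀ (q : Fin j → ℤ) (a : Fin j → A), (∀ l, a l ∈ A.gr (q l)) → ∑ l, q l = n →
      tp R a ∈ P) : A.tgr j n ≤ P := by
  refine span_le.2 ?_
  rintro _ ⟨q, a, ha, hn, rfl⟩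
  exact h q a ha hn

lemma iSup_tgr (A : DGModule R) (j : ℕ) : ⨆ n, A.tgr j n = ⊤ := by
  rw [eq_top_iff, ← span_tprod_eq_top, span_le]
  rintro _ ⟨a, rfl⟩
  refine A.multilinear_mem (tp R) _ (fun q a ha => ?_) a
  exact mem_iSup_of_mem (∑ l, q l) (A.tprod_mem_tgr q a ha)

lemma tgr_ext (A : DGModule R) {j : ℕ} {N : Type*} [AddCommGroup N] [Module R N]
    (f g : (⨂[R]^j) A →ₗ[R] N) (h : ∀ n, ∀ x ∈ A.tgr j n, f x = g x) : f = g :=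
  A.hom_ext f g fun q a ha => h _ _ (A.tprod_mem_tgr q a ha)

lemma teps_add (A : DGModule R) (j : ℕ) (m n : ℤ) : A.teps j (m + n) = A.teps j m ∘ₗ A.teps j n := by
  rw [teps, eps_add, pmap_comp]; rfl

lemma teps_congr (A : DGModule R) (j : ℕ) {m n : ℤ} (h : (m : ZMod 2) = n) : A.teps j m = A.teps j n := by
  rw [teps, eps_congr A h]; rfl

@[simp] lemma teps_zero (A : DGModule R) (j : ℕ) : A.teps j 0 = lid := by rw [teps, eps_zero, pmap_id]

/-- The linear map `f` out of a tensor power commutes with signs as a map of degree `p` does. -/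
def TPar (A B : DGModule R) {j : ℕ} (f : (⨂[R]^j) A →ₗ[R] B) (p : ℤ) : Prop :=
  ∀ n, B.eps n ∘ₗ f = sgn R (n * p) • (f ∘ₗ A.teps j n)

lemma tpar_of_gr {A B : DGModule R} {j : ℕ} {f : (⨂[R]^j) A →ₗ[R] B} {p : ℤ}
    (h : ∀ n, ∀ x ∈ A.tgr j n, f x ∈ B.gr (p + n)) : TPar A B f p := by
  intro m
  refine A.tgr_ext _ _ fun n x hx => ?_
  rw [lcmp, B.eps_of_mem _ (h n x hx), l_smul, lcmp, A.teps_of_mem _ hx, map_smul, smul_smul, ← sgn_add, mul_add]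

/-! #### Bijections of the factors -/

/-- The action of a bijection `e` on tensor powers: the `l`-th factor moves to the place `e l`,
with the Koszul sign. -/
def tmv (A : DGModule R) {m n : ℕ} (e : Fin m ≃ Fin n) : (⨂[R]^m) A →ₗ[R] (⨂[R]^n) A :=
  ∑ s : Fin m → Fin 2, sgn R (kexp e (fun l => ((s l : ℕ) : ℤ))) •
    ((PiTensorProduct.reindex R (fun _ => (A : Type u)) e).toLinearMap ∘ₗ pmap (fun l => A.par (s l)))

lemma tmv_perm (A : DGModule R) {j : ℕ} (σ : Perm (Fin j)) : A.tmv σ = A.tperm σ := by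
  rw [tmv, tperm]
  simp_rw [koszul_eq]

lemma tmv_tprod (A : DGModule R) {m n : ℕ} (e : Fin m ≃ Fin n) (q : Fin m → ℤ)
    (a : Fin m → A) (ha : ∀ l, a l ∈ A.gr (q l)) :
    A.tmv e (tp R a) = sgn R (kexp e q) • tp R (fun l => a (e.symm l)) := by
  obtain rfl : m = n := by simpa using Fintype.card_congr e
  rw [tmv_perm, A.tperm_tprod e q a ha, koszul_eq]

lemma tmv_of_monotone (A : DGModule R) {m n : ℕ} (e : Fin m ≃ Fin n)
    (he : ∀ l l', l < l' → e l < e l') (a : Fin m → A) :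
    A.tmv e (tp R a) = tp R (fun l => a (e.symm l)) := by
  have : A.tmv e = (PiTensorProduct.reindex R (fun _ => (A : Type u)) e).toLinearMap := by
    refine A.hom_ext _ _ fun q a ha => ?_
    rw [A.tmv_tprod e q a ha, kexp_of_monotone e he, sgn_zero, one_smul, LinearEquiv.coe_coe,
      PiTensorProduct.reindex_tprod]
  rw [this, LinearEquiv.coe_coe, PiTensorProduct.reindex_tprod]

@[simp] lemma tmv_finCongr (A : DGModule R) {m n : ℕ} (h : m = n) (a : Fin m → A) :
    A.tmv (finCongr h) (tp R a) = tp R (fun l => a (Fin.cast h.symm l)) :=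
  A.tmv_of_monotone _ (fun _ _ hl => hl) a

@[simp] lemma tmv_refl (A : DGModule R) (m : ℕ) : A.tmv (Equiv.refl (Fin m)) = lid := by
  ext a
  exact A.tmv_of_monotone (Equiv.refl _) (fun _ _ hl => hl) a

lemma tmv_trans (A : DGModule R) {m n p : ℕ} (e : Fin m ≃ Fin n) (f : Fin n ≃ Fin p) :
    A.tmv (e.trans f) = A.tmv f ∘ₗ A.tmv e := by
  refine A.hom_ext _ _ fun q a ha => ?_
  rw [A.tmv_tprod _ q a ha, lcmp, A.tmv_tprod e q a ha, map_smul,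
    A.tmv_tprod f (fun l => q (e.symm l)) _ (fun l => ha _), smul_smul, ← sgn_add,
    sgn_of_cast R (kexp_trans e f q)]
  rfl

lemma tmv_symm_tmv (A : DGModule R) {m n : ℕ} (e : Fin m ≃ Fin n) (x : (⨂[R]^m) A) :
    A.tmv e.symm (A.tmv e x) = x := by
  rw [← lcmp, ← tmv_trans, Equiv.self_trans_symm, tmv_refl]; rfl

lemma tmv_tmv_symm (A : DGModule R) {m n : ℕ} (e : Fin m ≃ Fin n) (x : (⨂[R]^n) A) :
    A.tmv e (A.tmv e.symm x) = x := by
  rw [← lcmp, ← tmv_trans, Equiv.symm_trans_self, tmv_refl]; rfl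

lemma tmv_mem_tgr (A : DGModule R) {m n : ℕ} (e : Fin m ≃ Fin n) {p : ℤ} {x : (⨂[R]^m) A}
    (hx : x ∈ A.tgr m p) : A.tmv e x ∈ A.tgr n p := by
  refine tgr_induction ((A.tgr n p).comap (A.tmv e)) (fun q a ha hq => ?_) hx
  rw [mem_comap, A.tmv_tprod e q a ha]
  refine smul_mem _ _ ?_
  rw [← hq, ← e.symm.sum_comp]
  exact A.tprod_mem_tgr (fun l => q (e.symm l)) _ fun l => ha _

lemma tmv_teps (A : DGModule R) {m n : ℕ} (e : Fin m ≃ Fin n) (r : ℤ) :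
    A.tmv e ∘ₗ A.teps m r = A.teps n r ∘ₗ A.tmv e := by
  refine A.tgr_ext _ _ fun p x hx => ?_
  rw [lcmp, lcmp, A.teps_of_mem r hx, A.teps_of_mem r (A.tmv_mem_tgr e hx), map_smul]

/-- A family of even maps commutes with bijections of the factors. -/
lemma tmv_map {A B : DGModule R} {m n : ℕ} (e : Fin m ≃ Fin n) (f : Fin m → (A →ₗ[R] B))
    (hf : ∀ l (p : ℤ), ∀ x ∈ A.gr p, f l x ∈ B.gr p) :
    B.tmv e ∘ₗ pmap f = pmap (fun l => f (e.symm l)) ∘ₗ A.tmv e := by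
  refine A.hom_ext _ _ fun q a ha => ?_
  rw [lcmp, lcmp, A.tmv_tprod e q a ha, map_tp,
    B.tmv_tprod e q _ (fun l => hf l _ _ (ha l)), map_smul, map_tp]

lemma map_mem_tgr {A B : DGModule R} {m : ℕ} (f : Fin m → (A →ₗ[R] B))
    (hf : ∀ l (p : ℤ), ∀ x ∈ A.gr p, f l x ∈ B.gr p) {n : ℤ} {x : (⨂[R]^m) A}
    (hx : x ∈ A.tgr m n) : pmap f x ∈ B.tgr m n := by
  refine tgr_induction ((B.tgr m n).comap (pmap f)) (fun q a ha hq => ?_) hx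
  rw [mem_comap, map_tp, ← hq]
  exact B.tprod_mem_tgr q _ fun l => hf l _ _ (ha l)

/-! #### Derivations of tensor powers -/

/-- The map `a₁ ⊗ ⋯ ⊗ a_j ↦ ∑ᵢ (-1)^(|a₁| + ⋯ + |a_{i-1}|) f a₁ ⊗ ⋯ ⊗ δ aᵢ ⊗ ⋯ ⊗ f a_j`. -/
def tDer (A : DGModule R) {N : Type*} [AddCommGroup N] [Module R N] (f δ : A →ₗ[R] N) (j : ℕ) :
    (⨂[R]^j) A →ₗ[R] (⨂[R]^j) N :=
  ∑ i : Fin j, pmap (fun l => if l < i then f ∘ₗ A.eps 1 else if l = i then δ else f)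

lemma tD_eq_tDer (A : DGModule R) (j : ℕ) : A.tD j = A.tDer lid A.d j := rfl

/-- A map that lowers or raises degrees by an odd number. -/
def GrMap (A B : DGModule R) (f : A →ₗ[R] B) (r : ℤ) : Prop := ∀ n, ∀ x ∈ A.gr n, f x ∈ B.gr (r + n)

lemma tmv_tDer {A B : DGModule R} {f δ : A →ₗ[R] B} (hf : GrMap A B f 0)
    {r : ℤ} (hr : (r : ZMod 2) = 1) (hδ : GrMap A B δ r) {m n : ℕ} (e : Fin m ≃ Fin n) :
    B.tmv e ∘ₗ A.tDer f δ m = A.tDer f δ n ∘ₗ A.tmv e := by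
  have hf0 : ∀ n, ∀ x ∈ A.gr n, f x ∈ B.gr n := fun n x hx => by simpa using hf n x hx
  refine A.hom_ext _ _ fun q a ha => ?_
  have key : ∀ i : Fin m, B.tmv e (pmap (fun l => if l < i then f ∘ₗ A.eps 1 else if l = i then δ else f)
        (tp R a)) = sgn R (kexp e q) • pmap
      (fun l => if l < e i then f ∘ₗ A.eps 1 else if l = e i then δ else f) (tp R (fun l => a (e.symm l))) := by
    intro i
    have h1 : ∀ (k : ℕ) (q : Fin k → ℤ) (a : Fin k → A), (∀ l, a l ∈ A.gr (q l)) → ∀ i : Fin k,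
        pmap (fun l => if l < i then f ∘ₗ A.eps 1 else if l = i then δ else f)
        (tp R a) = sgn R (∑ l, if l < i then q l else 0) •
          tp R (fun l => if l = i then δ (a l) else f (a l)) := by
      intro k q a ha i
      rw [map_tp, sgn_sum, ← map_smul_univ]
      congr 1
      funext l
      split_ifs with h1 h2 h2
      · exact absurd h1 (by rw [h2]; exact lt_irrefl _)
      · rw [lcmp, A.eps_of_mem 1 (ha l), map_smul, one_mul]
      · rw [sgn_zero, one_smul]
      · rw [sgn_zero, one_smul]
    rw [h1 m q a ha i, h1 n (fun l => q (e.symm l)) _ (fun l => ha _) (e i), map_smul,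
      B.tmv_tprod e (fun l => if l = i then r + q l else q l)]
    · rw [smul_smul, smul_smul, ← sgn_add, ← sgn_add]
      congr 1
      · refine sgn_of_cast R ?_
        have h2 := kexp_update e q (fun l => if l = i then r + q l else q l) i (fun l => by
          split_ifs <;> push_cast <;> simp [hr, add_comm])
        push_cast at h2 ⊢
        rw [h2, ← e.sum_comp (fun l => if l < e i then ((q (e.symm l) : ℤ) : ZMod 2) else 0)]
        simp only [symm_apply_apply]
        linear_combination (zmod_two_add_self (∑ l, if l < i then ((q l : ℤ) : ZMod 2) else 0))
      · congr 1
        funext l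
        simp only [Equiv.symm_apply_eq]
    · intro l
      split_ifs
      · exact hδ _ _ (ha l)
      · exact hf0 _ _ (ha l)
  rw [lcmp, lcmp, tDer, l_sum, map_sum, A.tmv_tprod e q a ha, map_smul, tDer, l_sum, Finset.smul_sum, ← e.sum_comp]
  exact sum_congr rfl fun i _ => key i

end DGModule

/-! ### Blocks of indices -/

section Blocks

lemma fsf_val (j : Fin k → ℕ) (i : Fin k) (m : Fin (j i)) :
    ((fsf ⟨i, m⟩ : Fin (∑ i, j i)) : ℕ) = (∑ l, if l < i then j l else 0) + m := by
  rw [finSigmaFinEquiv_apply]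
  congr 1
  rw [← Finset.sum_filter]
  have : (Finset.univ.filter (· < i) : Finset (Fin k)) = Finset.univ.map (Fin.castLEEmb i.2.le) := by
    ext l
    simp only [Finset.mem_filter, mem_univ, true_and, Finset.mem_map]
    constructor
    · intro h
      exact ⟨⟨l, h⟩, rfl⟩
    · rintro ⟨a, rfl⟩
      exact a.2
  rw [this, Finset.sum_map]
  rfl

lemma fsf_lt_of_lt {j : Fin k → ℕ} {i i' : Fin k} (h : i < i') (m : Fin (j i)) (m' : Fin (j i')) :
    (fsf ⟨i, m⟩ : Fin (∑ i, j i)) < fsf ⟨i', m'⟩ := by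
  rw [Fin.lt_def, fsf_val, fsf_val]
  have h1 : (∑ l, if l < i then j l else 0) + j i ≤ ∑ l, if l < i' then j l else 0 := by
    have : j i = ∑ l, if l = i then j l else 0 := by simp
    rw [this, ← sum_add_distrib]
    refine Finset.sum_le_sum fun l _ => ?_
    rcases lt_trichotomy l i with hl | hl | hl
    · simp [hl, hl.ne, hl.trans h]
    · simp [hl, h]
    · simp [hl.not_gt, hl.ne']
  have := m.2
  omega

lemma fsf_lt_iff {j : Fin k → ℕ} {i : Fin k} (m m' : Fin (j i)) :
    (fsf ⟨i, m⟩ : Fin (∑ i, j i)) < fsf ⟨i, m'⟩ ↔ m < m' := by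
  rw [Fin.lt_def, fsf_val, fsf_val, Fin.lt_def]
  omega

lemma sum_fsf {Z : Type*} [AddCommMonoid Z] (j : Fin k → ℕ) (g : Fin (∑ i, j i) → Z) :
    ∑ s, g s = ∑ i, ∑ m, g (fsf ⟨i, m⟩) := by
  rw [← (fsf).sum_comp, Fintype.sum_sigma]

/-- The function of `∑ i, j i` variables that is made of `k` functions of `j i` variables. -/
def flat {α : Type*} {j : Fin k → ℕ} (b : ∀ i, Fin (j i) → α) (s : Fin (∑ i, j i)) : α :=
  b (fsi s).1 (fsi s).2

lemma flat_fsf {α : Type*} {j : Fin k → ℕ} (b : ∀ i, Fin (j i) → α) (i : Fin k) (m : Fin (j i)) :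
    flat b (fsf ⟨i, m⟩) = b i m := by
  rw [flat, symm_apply_apply]

lemma sum_fsf_lt {Z : Type*} [AddCommMonoid Z] (j : Fin k → ℕ) (g : ∀ i, Fin (j i) → Z)
    (i : Fin k) (m : Fin (j i)) :
    (∑ s : Fin (∑ i, j i), if s < fsf ⟨i, m⟩ then flat g s else 0) =
      (∑ i', if i' < i then ∑ m', g i' m' else 0) + ∑ m', if m' < m then g i m' else 0 := by
  rw [sum_fsf]
  simp only [flat_fsf]
  have h : (∑ m', if m' < m then g i m' else 0) = ∑ i', if i' = i then
      (∑ m', if (fsf ⟨i', m'⟩ : Fin (∑ i, j i)) < fsf ⟨i, m⟩ then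
        g i' m' else 0) else 0 := by
    rw [Finset.sum_ite_eq' , if_pos (mem_univ _)]
    simp only [fsf_lt_iff]
  rw [h, ← sum_add_distrib]
  refine sum_congr rfl fun i' _ => ?_
  rcases lt_trichotomy i' i with hl | hl | hl
  · simp [hl, hl.ne, fsf_lt_of_lt hl]
  · simp [hl]
  · simp [hl.not_gt, hl.ne', (fsf_lt_of_lt hl _ _).not_gt]

lemma sum_fsf_gt {Z : Type*} [AddCommMonoid Z] (j : Fin k → ℕ) (g : ∀ i, Fin (j i) → Z)
    (i : Fin k) (m : Fin (j i)) :
    (∑ s : Fin (∑ i, j i), if fsf ⟨i, m⟩ < s then flat g s else 0) =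
      (∑ i', if i < i' then ∑ m', g i' m' else 0) + ∑ m', if m < m' then g i m' else 0 := by
  rw [sum_fsf]
  simp only [flat_fsf]
  have h : (∑ m', if m < m' then g i m' else 0) = ∑ i', if i' = i then
      (∑ m', if (fsf ⟨i, m⟩ : Fin (∑ i, j i)) < fsf ⟨i', m'⟩ then
        g i' m' else 0) else 0 := by
    rw [Finset.sum_ite_eq' , if_pos (mem_univ _)]
    simp only [fsf_lt_iff]
  rw [h, ← sum_add_distrib]
  refine sum_congr rfl fun i' _ => ?_
  rcases lt_trichotomy i' i with hl | hl | hl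
  · simp [hl.not_gt, hl.ne, (fsf_lt_of_lt hl _ _).not_gt]
  · simp [hl]
  · simp [hl, hl.ne', fsf_lt_of_lt hl]

lemma exists_flat {α : Type*} {j : Fin k → ℕ} (a : Fin (∑ i, j i) → α) : ∃ b : ∀ i, Fin (j i) → α, a = flat b :=
  ⟨fun i m => a (fsf ⟨i, m⟩), funext fun s => by simp [flat]⟩

lemma exists_comp_perm {T : Fin k → Type*} (σ : Perm (Fin k)) (b : ∀ i, T (σ i)) :
    ∃ b' : ∀ i, T i, b = fun i => b' (σ i) :=
  ⟨Equiv.piCongrLeft T σ b, funext fun i => (Equiv.piCongrLeft_apply_apply T σ b i).symm⟩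

lemma blockPerm_fsf (σ : Perm (Fin k)) (j : Fin k → ℕ) (i : Fin k) (m : Fin (j (σ i))) :
    blockPerm σ j (fsf ⟨i, m⟩) = fsf ⟨σ i, m⟩ := by
  rw [blockPerm, Equiv.trans_apply, symm_apply_apply]
  rfl

lemma blockSum_fsf {j j' : Fin k → ℕ} (τ : ∀ i, Fin (j i) ≃ Fin (j' i)) (i : Fin k) (m : Fin (j i)) :
    blockSum τ (fsf ⟨i, m⟩) = fsf ⟨i, τ i m⟩ := by
  rw [blockSum, Equiv.trans_apply, symm_apply_apply]
  rfl

lemma kexp_blockPerm (σ : Perm (Fin k)) (j : Fin k → ℕ) (q : ∀ i, Fin (j (σ i)) → ℤ) :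
    kexp (blockPerm σ j) (flat q) = kexp σ fun i => ∑ m, q i m := by
  rw [kexp, sum_fsf, kexp]
  simp_rw [sum_fsf (fun i => j (σ i)), flat_fsf, blockPerm_fsf]
  refine sum_congr rfl fun i _ => ?_
  rw [Finset.sum_comm]
  refine sum_congr rfl fun i' _ => ?_
  rcases lt_trichotomy i i' with hl | rfl | hl
  · have h1 : ∀ m m', (fsf ⟨i, m⟩ : Fin (∑ i, j (σ i))) < fsf ⟨i', m'⟩ :=
      fun m m' => fsf_lt_of_lt (j := fun i => j (σ i)) hl m m'
    have h2 : ∀ m m', ((fsf ⟨σ i', m'⟩ : Fin (∑ i, j i)) < fsf ⟨σ i, m⟩) ↔ σ i' < σ i := by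
      intro m m'
      rcases lt_or_gt_of_ne (fun h => hl.ne (σ.injective h) : σ i ≠ σ i') with h | h
      · simp [h.not_gt, (fsf_lt_of_lt (j := j) h m m').not_gt]
      · simp [h, fsf_lt_of_lt (j := j) h m' m]
    simp only [h1, h2, hl, true_and]
    split_ifs
    · rw [Finset.sum_mul_sum]
    · simp
  · simp only [fsf_lt_iff, lt_self_iff_false, false_and, if_false]
    refine Finset.sum_eq_zero fun m _ => Finset.sum_eq_zero fun m' _ => if_neg ?_
    rintro ⟨h1, h2⟩
    exact lt_asymm h1 h2
  · have h1 : ∀ m m', ¬ (fsf ⟨i, m⟩ : Fin (∑ i, j (σ i))) <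
        fsf ⟨i', m'⟩ := fun m m' => (fsf_lt_of_lt (j := fun i => j (σ i)) hl _ _).not_gt
    simp [h1, hl.not_gt]

lemma kexp_blockSum {j j' : Fin k → ℕ} (τ : ∀ i, Fin (j i) ≃ Fin (j' i))
    (q : ∀ i, Fin (j i) → ℤ) : kexp (blockSum τ) (flat q) = ∑ i, kexp (τ i) (q i) := by
  rw [kexp, sum_fsf]
  simp_rw [sum_fsf j, flat_fsf, blockSum_fsf]
  refine sum_congr rfl fun i _ => ?_
  rw [Finset.sum_comm, Finset.sum_eq_single i]
  · rw [kexp]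
    refine sum_congr rfl fun m _ => sum_congr rfl fun m' _ => ?_
    simp only [fsf_lt_iff]
  · intro i' _ hi
    refine Finset.sum_eq_zero fun m _ => Finset.sum_eq_zero fun m' _ => if_neg ?_
    rintro ⟨h1, h2⟩
    rcases lt_or_gt_of_ne hi with h | h
    · exact (fsf_lt_of_lt h m' m).not_gt h1
    · exact (fsf_lt_of_lt h (τ i m) (τ i' m')).not_gt h2
  · simp

end Blocks

/-! ### Tensor products of maps out of tensor powers -/

namespace DGModule

lemma split_flat (A : DGModule R) (j : Fin k → ℕ) (b : ∀ i, Fin (j i) → A) : A.split j (tp R (flat b)) =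
      tp R (fun i => tp R (b i)) := by
  rw [split_tprod]
  simp only [flat_fsf]

lemma flat_update {α : Type*} {j : Fin k → ℕ} (b : ∀ i, Fin (j i) → α) (i : Fin k)
    (a : Fin (j i) → α) (m : Fin (j i)) (x : α) :
    flat (update b i (update a m x)) = update (flat (update b i a)) (fsf ⟨i, m⟩) x := by
  funext s
  obtain ⟨⟨i', m'⟩, rfl⟩ := (fsf).surjective s
  rw [flat_fsf]
  rcases eq_or_ne i' i with rfl | hi
  · rw [update_self]
    rcases eq_or_ne m' m with rfl | hm
    · rw [update_self, update_self]
    · rw [update_of_ne hm, update_of_ne, flat_fsf, update_self]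
      intro h
      apply hm
      simpa using h
  · rw [update_of_ne hi, update_of_ne, flat_fsf, update_of_ne hi]
    intro h
    apply hi
    exact congrArg Sigma.fst ((fsf).injective h)

lemma exists_join (A : DGModule R) (j : Fin k → ℕ) :
    ∃ F : (⨂[R] i, (⨂[R]^(j i)) A) →ₗ[R] (⨂[R]^(∑ i, j i)) A, ∀ b : ∀ i, Fin (j i) → A,
      F (tp R fun i => tp R (b i)) = tp R (flat b) := by
  obtain ⟨F, hF⟩ := MultilinearMap.exists_of_generators (R := R)
    (M := fun i => (⨂[R]^(j i)) A) (S := fun i => Fin (j i) → A)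
    (fun _ => tp R) (fun _ => span_tprod_eq_top)
    (fun b => tp R (flat b)) (by
      intro b i
      refine ⟨PiTensorProduct.lift
        { toFun := fun a => tp R (flat (update b i a))
          map_update_add' := ?_
          map_update_smul' := ?_ }, fun t => ?_⟩
      · intro inst a m x y
        rw [Subsingleton.elim inst (instDecidableEqFin _), flat_update, flat_update, flat_update,
          map_update_add]
      · intro inst a m c x
        rw [Subsingleton.elim inst (instDecidableEqFin _), flat_update, flat_update, map_update_smul]
      · rw [PiTensorProduct.lift.tprod]; rfl)
  exact ⟨PiTensorProduct.lift F, fun b => by rw [PiTensorProduct.lift.tprod, hF]⟩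

/-- The inverse of `split`. -/
def join (A : DGModule R) (j : Fin k → ℕ) :
    (⨂[R] i, (⨂[R]^(j i)) A) →ₗ[R] (⨂[R]^(∑ i, j i)) A := (A.exists_join j).choose

lemma join_tprod (A : DGModule R) (j : Fin k → ℕ) (b : ∀ i, Fin (j i) → A) :
    A.join j (tp R fun i => tp R (b i)) = tp R (flat b) := (A.exists_join j).choose_spec b

lemma ptp_ext₂ (A : DGModule R) (j : Fin k → ℕ) {N : Type*} [AddCommGroup N] [Module R N]
    {f g : (⨂[R] i, (⨂[R]^(j i)) A) →ₗ[R] N} (h : ∀ b : ∀ i, Fin (j i) → A,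
      f (tp R fun i => tp R (b i)) =
      g (tp R fun i => tp R (b i))) : f = g :=
  PiTensorProduct.ext_of_span_eq_top (γ := fun i => Fin (j i) → A) (g := fun {i} => tp R)
    (fun i => span_tprod_eq_top) h

lemma tprod_flat_ext (A : DGModule R) (j : Fin k → ℕ) {N : Type*} [AddCommGroup N]
    [Module R N] {f g : (⨂[R]^(∑ i, j i)) A →ₗ[R] N} (h : ∀ b : ∀ i, Fin (j i) → A,
      f (tp R (flat b)) = g (tp R (flat b))) : f = g := by
  ext a
  obtain ⟨b, rfl⟩ := exists_flat a
  exact h b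

lemma hom_flat_ext (A : DGModule R) (j : Fin k → ℕ) {N : Type*} [AddCommGroup N]
    [Module R N] {f g : (⨂[R]^(∑ i, j i)) A →ₗ[R] N}
    (h : ∀ (q : ∀ i, Fin (j i) → ℤ) (b : ∀ i, Fin (j i) → A), (∀ i m, b i m ∈ A.gr (q i m)) →
      f (tp R (flat b)) = g (tp R (flat b))) : f = g := by
  refine A.hom_ext _ _ fun q a ha => ?_
  obtain ⟨b, rfl⟩ := exists_flat a
  obtain ⟨q, rfl⟩ := exists_flat q
  refine h q b fun i m => ?_
  have := ha (fsf ⟨i, m⟩)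
  rwa [flat_fsf, flat_fsf] at this

@[simp] lemma split_join (A : DGModule R) (j : Fin k → ℕ)
    (x : ⨂[R] i, (⨂[R]^(j i)) A) : A.split j (A.join j x) = x := by
  rw [← lcmp]
  refine lcongr (f := A.split j ∘ₗ A.join j) (g := lid) ?_ x
  refine A.ptp_ext₂ j fun b => ?_
  rw [lcmp, join_tprod, split_flat]; rfl

@[simp] lemma join_split (A : DGModule R) (j : Fin k → ℕ)
    (x : (⨂[R]^(∑ i, j i)) A) : A.join j (A.split j x) = x := by
  rw [← lcmp]
  refine lcongr (f := A.join j ∘ₗ A.split j) (g := lid) ?_ x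
  refine A.tprod_flat_ext j fun b => ?_
  rw [lcmp, split_flat, join_tprod]; rfl

lemma split_map {A B : DGModule R} (j : Fin k → ℕ) (F : Fin (∑ i, j i) → (A →ₗ[R] B)) :
    B.split j ∘ₗ pmap F = pmap (fun i => pmap fun m => F (fsf ⟨i, m⟩)) ∘ₗ A.split j := by
  refine A.tprod_flat_ext j fun b => ?_
  rw [lcmp, lcmp, split_flat, map_tp, map_tp, split_tprod]
  simp only [map_tp, flat_fsf]

lemma comp_sum_lin {M N P : Type*} [AddCommGroup M] [Module R M] [AddCommGroup N] [Module R N]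
    [AddCommGroup P] [Module R P] (f : N →ₗ[R] P) {ι : Type*} (t : Finset ι) (g : ι → (M →ₗ[R] N)) :
    f ∘ₗ (∑ i ∈ t, g i) = ∑ i ∈ t, f ∘ₗ g i := by
  ext x; simp

lemma sum_comp_lin {M N P : Type*} [AddCommGroup M] [Module R M] [AddCommGroup N] [Module R N]
    [AddCommGroup P] [Module R P] (f : M →ₗ[R] N) {ι : Type*} (t : Finset ι) (g : ι → (N →ₗ[R] P)) :
    (∑ i ∈ t, g i) ∘ₗ f = ∑ i ∈ t, g i ∘ₗ f := by
  ext x; simp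

lemma map_sum_slot {M N : Fin k → Type*} [∀ i, AddCommGroup (M i)]
    [∀ i, Module R (M i)] [∀ i, AddCommGroup (N i)] [∀ i, Module R (N i)]
    (f : ∀ i, M i →ₗ[R] N i) (i : Fin k) {ι : Type*} (t : Finset ι) (g : ι → (M i →ₗ[R] N i)) :
    pmap (update f i (∑ s ∈ t, g s)) = ∑ s ∈ t, pmap (update f i (g s)) := by
  classical
  exact (PiTensorProduct.mapMultilinear R M N).map_update_sum t i g f

lemma split_tDer {A B : DGModule R} (f δ : A →ₗ[R] B) (j : Fin k → ℕ) :
    B.split j ∘ₗ A.tDer f δ (∑ i, j i) = (∑ i, pmap (fun l =>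
      if l < i then pow(f) ∘ₗ A.teps (j l) 1 else
        if l = i then A.tDer f δ (j l) else pow(f))) ∘ₗ A.split j := by
  rw [tDer, comp_sum_lin, sum_fsf, sum_comp_lin]
  refine sum_congr rfl fun i _ => ?_
  have h : (fun l => if l < i then pow(f) ∘ₗ A.teps (j l) 1 else
      if l = i then A.tDer f δ (j l) else pow(f)) =
      update (fun l => if l < i then pow(f) ∘ₗ A.teps (j l) 1
        else pow(f)) i (∑ m : Fin (j i), pmap
        (fun l => if l < m then f ∘ₗ A.eps 1 else if l = m then δ else f)) := by
    funext l
    rcases eq_or_ne l i with rfl | hl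
    · rw [update_self]; simp [tDer]
    · rw [update_of_ne hl]; simp [hl]
  rw [h, map_sum_slot, sum_comp_lin]
  refine sum_congr rfl fun m _ => ?_
  rw [split_map]
  congr 2
  funext l
  rcases lt_trichotomy l i with hl | rfl | hl
  · rw [update_of_ne hl.ne]
    simp only [hl, fsf_lt_of_lt hl, if_true]
    rw [teps, ← pmap_comp]
  · simp [fsf_lt_iff]
  · rw [update_of_ne hl.ne']
    have h1 : ∀ m', (fsf ⟨l, m'⟩ : Fin (∑ i, j i)) ≠ fsf ⟨i, m⟩ :=
      fun m' => (fsf_lt_of_lt hl m m').ne'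
    simp only [hl.not_gt, (fsf_lt_of_lt hl _ _).not_gt, h1, if_false]

end DGModule

section MoreBlocks

/-- The sum of the entries of `p` to the right of `i`. -/
def suf (p : Fin k → ℤ) (i : Fin k) : ℤ := ∑ l, if i < l then p l else 0

lemma unshuffleExp_eq (p q : Fin k → ℤ) : unshuffleExp p q = ∑ i, suf p i * q i := rfl

lemma suf_flat {j : Fin k → ℕ} (P : ∀ i, Fin (j i) → ℤ) (i : Fin k) (m : Fin (j i)) :
    suf (flat P) (fsf ⟨i, m⟩) = suf (fun i => ∑ m, P i m) i + suf (P i) m := by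
  rw [suf, sum_fsf_gt]; rfl

lemma sum_flat {Z : Type*} [AddCommMonoid Z] {j : Fin k → ℕ} (P : ∀ i, Fin (j i) → Z) :
    ∑ s, flat P s = ∑ i, ∑ m, P i m := by
  rw [sum_fsf]; simp only [flat_fsf]

lemma exists_flat_dep {j : Fin k → ℕ} {T : ∀ i, Fin (j i) → Type*}
    (C : ∀ s : Fin (∑ i, j i), T (fsi s).1 (fsi s).2) :
    ∃ c : ∀ i m, T i m, C = ♭(c) := by
  refine ⟨fun i m => Equiv.piCongrLeft (fun t : Σ i, Fin (j i) => T t.1 t.2) fsi C ⟨i, m⟩, ?_⟩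
  funext s
  exact (Equiv.piCongrLeft_apply_apply (fun t : Σ i, Fin (j i) => T t.1 t.2) fsi C s).symm

lemma flat_flat {α : Type*} {j : Fin k → ℕ} {l : ∀ i, Fin (j i) → ℕ}
    (c : ∀ i m, Fin (l i m) → α) (t : Fin (∑ i, ∑ m, l i m)) :
    flat (j := ♭(l)) ♭(c)
      (Fin.cast (sum_arity j l).symm t) = flat (fun i => flat (c i)) t := by
  obtain ⟨⟨i, t⟩, rfl⟩ := (fsf).surjective t
  obtain ⟨⟨m, r⟩, rfl⟩ := (fsf).surjective t
  rw [flat_fsf, flat_fsf]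
  have hl : l i m = l (fsi (fsf ⟨i, m⟩)).1
      (fsi (fsf ⟨i, m⟩)).2 := (flat_fsf l i m).symm
  have h1 : Fin.cast (sum_arity j l).symm (fsf ⟨i, fsf ⟨m, r⟩⟩) =
      finSigmaFinEquiv (n := ♭(l)) ⟨fsf ⟨i, m⟩, Fin.cast hl r⟩ := by
    apply Fin.ext
    have := sum_fsf_lt j l i m
    simp only [flat] at this
    rw [Fin.val_cast, fsf_val, fsf_val, fsf_val, this]
    simp [add_assoc]
  rw [h1, flat_fsf]
  have key : ∀ (t : Σ i, Fin (j i)) (r' : Fin (l t.1 t.2)), t = ⟨i, m⟩ → (r' : ℕ) = r → c t.1 t.2 r' = c i m r := by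
    rintro t r' rfl h
    congr 1
    exact Fin.ext h
  exact key _ _ ((fsf).symm_apply_apply _) rfl

lemma unshuffle_perm (σ : Perm (Fin k)) (p q : Fin k → ℤ) :
    ((unshuffleExp (fun i => p (σ i)) (fun i => q (σ i)) + kexp σ (fun i => p (σ i) + q (σ i)) : ℤ)
      : ZMod 2) = ((kexp σ (fun i => p (σ i)) + kexp σ (fun i => q (σ i)) + unshuffleExp p q : ℤ) : ZMod 2) := by
  have h : unshuffleExp p q = ∑ i, ∑ l, if σ i < σ l then p (σ l) * q (σ i) else 0 := by
    rw [unshuffleExp, ← Equiv.sum_comp σ]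
    refine sum_congr rfl fun i _ => ?_
    rw [← Equiv.sum_comp σ (fun l => if σ i < l then p l else 0), Finset.sum_mul]
    refine sum_congr rfl fun l _ => ?_
    split_ifs <;> simp
  rw [h, unshuffleExp, kexp, kexp, kexp]
  simp only [Finset.sum_mul]
  push_cast
  simp_rw [← sum_add_distrib]
  refine Finset.sum_sum_eq_of_symm _ _ (fun i => by simp) fun i l hl => ?_
  have h2 : σ i < σ l ∨ σ l < σ i := lt_or_gt_of_ne (fun h => hl.ne (σ.injective h))
  rcases h2 with h2 | h2
  · simp [hl, hl.not_gt, h2, h2.not_gt]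
  · simp [hl, hl.not_gt, h2, h2.not_gt]
    linear_combination zmod_two_add_self ((p (σ l) : ZMod 2) * q (σ i))

end MoreBlocks

namespace DGModule

/-- The linear map `f` out of a tensor power is homogeneous of degree `p`. -/
def GrT (A B : DGModule R) {j : ℕ} (f : (⨂[R]^j) A →ₗ[R] B) (p : ℤ) : Prop := ∀ n, ∀ x ∈ A.tgr j n, f x ∈ B.gr (p + n)

lemma GrT.tpar {A B : DGModule R} {j : ℕ} {f : (⨂[R]^j) A →ₗ[R] B} {p : ℤ} (h : GrT A B f p) :
    TPar A B f p := tpar_of_gr h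

/-- The tensor product of maps `φ i` of degrees `p i` out of tensor powers:
`x₁ ⊗ ⋯ ⊗ x_k ↦ ± φ₁ x₁ ⊗ ⋯ ⊗ φ_k x_k`. -/
def bop (A B : DGModule R) (j : Fin k → ℕ) (p : Fin k → ℤ)
    (φ : ∀ i, (⨂[R]^(j i)) A →ₗ[R] B) : (⨂[R]^(∑ i, j i)) A →ₗ[R] (⨂[R]^k) B :=
  pmap (fun i => φ i ∘ₗ A.teps (j i) (suf p i)) ∘ₗ A.split j

lemma bop_flat (A B : DGModule R) (j : Fin k → ℕ) (p : Fin k → ℤ)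
    (φ : ∀ i, (⨂[R]^(j i)) A →ₗ[R] B) (b : ∀ i, Fin (j i) → A) :
    bop A B j p φ (tp R (flat b)) = tp R (fun i => φ i (A.teps (j i) (suf p i) (tp R (b i)))) := by
  rw [bop, lcmp, split_flat, map_tp]; rfl

lemma bop_flat_homog (A B : DGModule R) (j : Fin k → ℕ) (p : Fin k → ℤ)
    (φ : ∀ i, (⨂[R]^(j i)) A →ₗ[R] B) (q : ∀ i, Fin (j i) → ℤ) (b : ∀ i, Fin (j i) → A)
    (hb : ∀ i m, b i m ∈ A.gr (q i m)) :
    bop A B j p φ (tp R (flat b)) = sgn R (unshuffleExp p fun i => ∑ m, q i m) • tp R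
        (fun i => φ i (tp R (b i))) := by
  rw [bop_flat, unshuffleExp_eq, sgn_sum, ← map_smul_univ]
  congr 1
  funext i
  rw [A.teps_tprod _ (q i) _ (hb i), map_smul]

lemma bop_mem_tgr {A B : DGModule R} {j : Fin k → ℕ} {p : Fin k → ℤ}
    {φ : ∀ i, (⨂[R]^(j i)) A →ₗ[R] B} (hφ : ∀ i, GrT A B (φ i) (p i)) {n : ℤ}
    {x : (⨂[R]^(∑ i, j i)) A} (hx : x ∈ A.tgr _ n) :
    bop A B j p φ x ∈ B.tgr k ((∑ i, p i) + n) := by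
  refine tgr_induction ((B.tgr k ((∑ i, p i) + n)).comap (bop A B j p φ)) (fun q a ha hq => ?_) hx
  obtain ⟨b, rfl⟩ := exists_flat a
  obtain ⟨q, rfl⟩ := exists_flat q
  have hb : ∀ i m, b i m ∈ A.gr (q i m) := fun i m => by simpa only [flat_fsf] using ha (fsf ⟨i, m⟩)
  rw [mem_comap, bop_flat_homog A B j p φ q b hb]
  refine smul_mem _ _ ?_
  rw [← hq, sum_flat, ← sum_add_distrib]
  exact B.tprod_mem_tgr _ _ fun i => hφ i _ _ (A.tprod_mem_tgr (q i) (b i) (hb i))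

/-- Tensor products of maps out of tensor powers are associative. -/
lemma bop_bop (A B C : DGModule R) (j : Fin k → ℕ) (l : ∀ i, Fin (j i) → ℕ)
    (p : Fin k → ℤ) (P : ∀ i, Fin (j i) → ℤ) (φ : ∀ i, (⨂[R]^(j i)) B →ₗ[R] C)
    (ψ : ∀ i m, (⨂[R]^(l i m)) A →ₗ[R] B) (hψ : ∀ i m, TPar A B (ψ i m) (P i m)) :
    bop B C j p φ ∘ₗ bop A B ♭(l) (flat P)
        ♭(ψ) =
      sgn R (unshuffleExp p fun i => ∑ m, P i m) • (bop A C (fun i => ∑ m, l i m) (fun i => p i + ∑ m, P i m)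
          (fun i => φ i ∘ₗ bop A B (l i) (P i) (ψ i)) ∘ₗ A.tmv (finCongr (sum_arity j l))) := by
  refine A.tprod_flat_ext ♭(l) fun b => ?_
  obtain ⟨c, rfl⟩ := exists_flat_dep (T := fun i m => Fin (l i m) → A) b
  set D : ∀ i, Fin (j i) → B := fun i m => ψ i m
    (A.teps (l i m) (suf (flat P) (fsf ⟨i, m⟩)) (tp R (c i m)))
    with hD
  have h1 : bop A B ♭(l) (flat P)
        ♭(ψ)
        (tp R (flat (j := ♭(l)) ♭(c))) =
      tp R (flat D) := by
    rw [bop_flat]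
    congr 1
    funext s
    rw [flat, hD]
    dsimp only
    rw [show (fsf ⟨(fsi s).1, (fsi s).2⟩) = s from
      (fsf).apply_symm_apply s]
  rw [lcmp, h1, bop_flat, l_smul, lcmp]
  have h2 : A.tmv (finCongr (sum_arity j l)) (tp R
      (flat (j := ♭(l)) ♭(c))) =
      tp R (flat fun i => flat (c i)) := by
    refine (A.tmv_finCongr (sum_arity j l) _).trans ?_
    congr 1
    funext t
    exact flat_flat c t
  rw [h2, bop_flat, unshuffleExp_eq, sgn_sum, ← map_smul_univ]
  congr 1
  funext i
  rw [lcmp, ← map_smul]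
  congr 1
  set n := suf p i
  set n' := suf (fun i => p i + ∑ m, P i m) i with hn'
  have hnn : n' = n + suf (fun i => ∑ m, P i m) i := by
    rw [hn', suf, suf, show n = ∑ l, if i < l then p l else 0 from rfl, ← sum_add_distrib]
    refine sum_congr rfl fun l _ => ?_
    split_ifs <;> simp
  have h3 : A.teps (∑ m, l i m) n' (tp R (flat (c i))) = tp R (flat fun m r => A.eps n' (c i m r)) := by
    rw [teps, map_tp]; rfl
  rw [h3, bop_flat, mul_sum, sgn_sum, ← map_smul_univ, teps, map_tp]
  congr 1
  funext m
  have h4 := lcongr (hψ i m n) (A.teps (l i m) (suf (flat P) (fsf ⟨i, m⟩)) (tp R (c i m)))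
  rw [lcmp, l_smul, lcmp] at h4
  rw [hD]
  dsimp only
  rw [h4]
  congr 2
  have h5 : tp R (fun r => A.eps n' (c i m r)) = A.teps (l i m) n' (tp R (c i m)) := by rw [teps, map_tp]
  rw [h5, ← lcmp, ← lcmp, ← teps_add, ← teps_add, suf_flat, hnn]
  congr 2
  ring

/-- Tensor products of maps out of tensor powers commute with permutations of the factors. -/
lemma tmv_bop {A B : DGModule R} (σ : Perm (Fin k)) (j : Fin k → ℕ)
    (p : Fin k → ℤ) (φ : ∀ i, (⨂[R]^(j i)) A →ₗ[R] B) (hφ : ∀ i, GrT A B (φ i) (p i)) :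
    B.tmv σ ∘ₗ bop A B (fun i => j (σ i)) (fun i => p (σ i)) (fun i => φ (σ i)) =
      koszul R σ (fun i => p (σ i)) • (bop A B j p φ ∘ₗ A.tmv (blockPerm σ j)) := by
  refine A.hom_flat_ext (fun i => j (σ i)) fun q b hb => ?_
  obtain ⟨b, rfl⟩ := exists_comp_perm (T := fun i => Fin (j i) → A) σ b
  obtain ⟨q, rfl⟩ := exists_comp_perm (T := fun i => Fin (j i) → ℤ) σ q
  dsimp only at hb ⊢
  have hb' : ∀ i m, b i m ∈ A.gr (q i m) := by
    intro i
    obtain ⟨i, rfl⟩ := σ.surjective i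
    exact hb i
  set X : Fin k → B := fun i => φ i (tp R (b i)) with hX
  have hXm : ∀ i, X i ∈ B.gr (p i + ∑ m, q i m) := fun i => hφ i _ _ (A.tprod_mem_tgr (q i) (b i) (hb' i))
  have hfl : (fun t => flat (fun i => b (σ i)) ((blockPerm σ j).symm t)) = flat b := by
    funext t
    obtain ⟨s, rfl⟩ := (blockPerm σ j).surjective t
    rw [symm_apply_apply]
    obtain ⟨⟨i, m⟩, rfl⟩ := (fsf).surjective s
    rw [blockPerm_fsf, flat_fsf, flat_fsf]
  rw [lcmp, bop_flat_homog A B _ _ _ (fun i => q (σ i)) _ hb, map_smul, l_smul, lcmp,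
    A.tmv_tprod (blockPerm σ j) (flat fun i => q (σ i)) _ (fun s => by
      obtain ⟨⟨i, m⟩, rfl⟩ := (fsf).surjective s
      rw [flat_fsf, flat_fsf]; exact hb i m), hfl, map_smul, bop_flat_homog A B _ _ _ q b hb',
    B.tmv_tprod σ (fun i => p (σ i) + ∑ m, q (σ i) m) (fun i => X (σ i)) (fun i => hXm (σ i)),
    kexp_blockPerm, koszul_eq, smul_smul, smul_smul, smul_smul, ← sgn_add, ← sgn_add, ← sgn_add]
  congr 1
  · exact sgn_of_cast R (unshuffle_perm σ p fun i => ∑ m, q i m)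
  · exact congrArg _ (funext fun i => congrArg X (σ.apply_symm_apply i))

/-- The decomposition into blocks and permutations inside the blocks. -/
lemma split_blockSum (A : DGModule R) {j j' : Fin k → ℕ} (τ : ∀ i, Fin (j i) ≃ Fin (j' i)) :
    A.split j' ∘ₗ A.tmv (blockSum τ) = pmap (fun i => A.tmv (τ i)) ∘ₗ A.split j := by
  refine A.hom_flat_ext j fun q b hb => ?_
  have hfl : (fun t => flat b ((blockSum τ).symm t)) = flat fun i m => b i ((τ i).symm m) := by
    funext t
    obtain ⟨s, rfl⟩ := (blockSum τ).surjective t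
    rw [symm_apply_apply]
    obtain ⟨⟨i, m⟩, rfl⟩ := (fsf).surjective s
    rw [blockSum_fsf, flat_fsf, flat_fsf, symm_apply_apply]
  rw [lcmp, lcmp, A.tmv_tprod (blockSum τ) (flat q) _ (fun s => by
      obtain ⟨⟨i, m⟩, rfl⟩ := (fsf).surjective s
      rw [flat_fsf, flat_fsf]; exact hb i m), hfl, map_smul, kexp_blockSum, split_flat, split_flat,
    map_tp, sgn_sum, ← map_smul_univ]
  congr 1
  funext i
  rw [A.tmv_tprod (τ i) (q i) _ (hb i)]

lemma join_blockSum (A : DGModule R) {j j' : Fin k → ℕ}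
    (τ : ∀ i, Fin (j i) ≃ Fin (j' i)) (x : ⨂[R] i, (⨂[R]^(j i)) A) :
    A.join j' (pmap (fun i => A.tmv (τ i)) x) = A.tmv (blockSum τ) (A.join j x) := by
  have h := lcongr (A.split_blockSum τ) (A.join j x)
  rw [lcmp, lcmp, split_join] at h
  rw [← h, join_split]

/-- Tensor products of maps out of tensor powers and permutations inside the blocks. -/
lemma bop_blockSum {A B : DGModule R} {j j' : Fin k → ℕ}
    (τ : ∀ i, Fin (j i) ≃ Fin (j' i)) (p : Fin k → ℤ) (φ : ∀ i, (⨂[R]^(j' i)) A →ₗ[R] B) :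
    bop A B j' p φ ∘ₗ A.tmv (blockSum τ) = bop A B j p (fun i => φ i ∘ₗ A.tmv (τ i)) := by
  rw [bop, l_assoc, split_blockSum, ← l_assoc, ← pmap_comp, bop]
  congr 2
  funext i
  rw [l_assoc, l_assoc, tmv_teps]

/-- Naturality of the tensor product of maps out of tensor powers. -/
lemma map_bop {A B A' B' : DGModule R} (j : Fin k → ℕ) (p : Fin k → ℤ)
    (φ : ∀ i, (⨂[R]^(j i)) A →ₗ[R] B) (φ' : ∀ i, (⨂[R]^(j i)) A' →ₗ[R] B')
    (f : A →ₗ[R] A') (hf : HasPar A A' f 0) (F : B →ₗ[R] B')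
    (h : ∀ i x, F (φ i x) = φ' i (pow(f) x)) :
    pow(F) ∘ₗ bop A B j p φ = bop A' B' j p φ' ∘ₗ pow(f) := by
  refine A.tprod_flat_ext j fun b => ?_
  have h1 : pow(f) (tp R (flat b)) = tp R (flat fun i m => f (b i m)) := by rw [map_tp]; rfl
  rw [lcmp, lcmp, bop_flat, h1, bop_flat, map_tp]
  congr 1
  funext i
  rw [h]
  congr 1
  simp only [teps, map_tp]
  congr 1
  funext m
  have := lcongr (hf (suf p i)) (b i m)
  simpa [sgn_zero] using this.symm

lemma tDer_teps {A B : DGModule R} {f δ : A →ₗ[R] B} (hf : HasPar A B f 0)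
    {r : ℤ} (hδ : HasPar A B δ r) (j : ℕ) (n : ℤ) :
    B.teps j n ∘ₗ A.tDer f δ j = sgn R (n * r) • (A.tDer f δ j ∘ₗ A.teps j n) := by
  rw [tDer, comp_sum_lin, sum_comp_lin, Finset.smul_sum]
  refine sum_congr rfl fun i _ => ?_
  have hf' : ∀ x, B.eps n (f x) = f (A.eps n x) := fun x => by
    have := lcongr (hf n) x
    simpa [sgn_zero] using this
  have hδ' : ∀ x, B.eps n (δ x) = sgn R (n * r) • δ (A.eps n x) := fun x => lcongr (hδ n) x
  ext a
  simp only [l_mult, lcmp, l_smul, teps, map_tp]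
  have : sgn R (n * r) = ∏ l, if l = i then sgn R (n * r) else 1 := by simp
  rw [this, ← map_smul_univ]
  congr 1
  funext l
  split_ifs with h1 h2 h2
  · exact absurd h1 (by rw [h2]; exact lt_irrefl _)
  · rw [lcmp, lcmp, hf', one_smul, ← lcmp (A.eps n), ← lcmp (A.eps 1), ← eps_add, ← eps_add, add_comm]
  · rw [hδ']
  · rw [hf', one_smul]

/-- The Leibniz rule for a tensor product of maps out of tensor powers. -/
lemma tDer_bop {A B : DGModule R} {A' : DGModule R} {f δ : A →ₗ[R] A'} (hf : HasPar A A' f 0)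
    {r : ℤ} (hr : (r : ZMod 2) = 1) (hδ : HasPar A A' δ r) (D : B →ₗ[R] B)
    (j : Fin k → ℕ) (p : Fin k → ℤ)
    (φ : ∀ i, (⨂[R]^(j i)) A' →ₗ[R] B) (g ψ : ∀ i, (⨂[R]^(j i)) A →ₗ[R] B)
    (hg : ∀ i, g i = φ i ∘ₗ pmap fun _ => f) (hgp : ∀ i, TPar A B (g i) (p i))
    (hD : ∀ i, D ∘ₗ g i = ψ i + sgn R (p i) • (φ i ∘ₗ A.tDer f δ (j i))) :
    B.tDer lid D k ∘ₗ bop A B j p g = (∑ i, sgn R (∑ l, if l < i then p l else 0) •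
        bop A B j (update p i (p i - 1)) (update g i (ψ i))) +
      sgn R (∑ i, p i) • (bop A' B j p φ ∘ₗ A.tDer f δ (∑ i, j i)) := by
  have h1 : ∀ i, pmap (fun l => if l < i then lid ∘ₗ B.eps 1 else if l = i then D else lid) ∘ₗ bop A B j p g =
      sgn R (∑ l, if l < i then p l else 0) • bop A B j (update p i (p i - 1)) (update g i (ψ i)) +
      sgn R (∑ i, p i) • (pmap (fun i => φ i ∘ₗ A'.teps (j i) (suf p i)) ∘ₗ pmap (fun l =>
          if l < i then pow(f) ∘ₗ A.teps (j l) 1 else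
          if l = i then A.tDer f δ (j l) else pow(f)) ∘ₗ A.split j) := by
    intro i
    have hfe : ∀ (m : ℕ) (n : ℤ) (x), A'.teps m n (pow(f) x) =
        pow(f) (A.teps m n x) := fun m n x => by
      rw [← lcmp, ← lcmp]
      congr 1
      rw [teps, teps, ← pmap_comp, ← pmap_comp]
      congr 1; funext _
      have := hf n
      rwa [mul_zero, sgn_zero, one_smul] at this
    have hde : ∀ (m : ℕ) (n : ℤ) (x), A'.teps m n (A.tDer f δ m x) =
        sgn R n • A.tDer f δ m (A.teps m n x) := fun m n x => by
      have := lcongr (tDer_teps hf hδ m n) x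
      rw [l_smul, sgn_of_cast R (m := n * r) (n := n) (by push_cast; rw [hr, mul_one])] at this
      exact this
    have hge : ∀ l x, B.eps 1 (g l x) = sgn R (p l) • g l (A.teps (j l) 1 x) := fun l x => by
      have := lcongr (hgp l 1) x
      rwa [one_mul] at this
    have hDe : ∀ x, D (g i x) = ψ i x + sgn R (p i) • φ i (A.tDer f δ (j i) x) := fun x => lcongr (hD i) x
    refine A.tprod_flat_ext j fun b => ?_
    set t : ∀ i, (⨂[R]^(j i)) A := fun i => tp R (b i) with ht
    rw [lcmp, l_add, l_smul, l_smul, lcmp, lcmp, bop_flat, bop_flat, split_flat, map_tp, map_tp, map_tp]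
    set c : ∀ l : Fin k, R := fun l => if l < i then sgn R (p l) else 1 with hc
    set Y : Fin k → B := fun l => if l < i then g l (A.teps (j l) (suf p l + 1) (t l)) else
      g l (A.teps (j l) (suf p l) (t l)) with hY
    have hcp : ∏ l, c l = sgn R (∑ l, if l < i then p l else 0) := by
      rw [sgn_sum]
      refine Finset.prod_congr rfl fun l _ => ?_
      simp only [hc]
      split_ifs <;> simp [sgn_zero]
    have hsuf : ∀ l, suf (update p i (p i - 1)) l = suf p l - if l < i then 1 else 0 := by
      intro l
      rw [suf, suf, sub_eq_add_neg, ← sub_eq_add_neg, eq_sub_iff_add_eq]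
      have : (if l < i then (1 : ℤ) else 0) = ∑ l', if l' = i then (if l < l' then 1 else 0) else 0 := by simp
      rw [this, ← sum_add_distrib]
      refine sum_congr rfl fun l' _ => ?_
      rcases eq_or_ne l' i with rfl | h
      · rw [update_self, if_pos rfl]; split_ifs <;> ring
      · rw [update_of_ne h, if_neg h, add_zero]
    have e1 : (fun l => (if l < i then lid ∘ₗ B.eps 1 else
        if l = i then D else lid) (g l (A.teps (j l) (suf p l) (t l)))) =
        fun l => c l • update Y i (ψ i (A.teps (j i) (suf p i) (t i)) +
          sgn R (p i) • φ i (A.tDer f δ (j i) (A.teps (j i) (suf p i) (t i)))) l := by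
      funext l
      rcases lt_trichotomy l i with hl | rfl | hl
      · rw [update_of_ne hl.ne]
        simp only [hc, hY, hl, if_true]
        rw [lcmp, l_id, hge, add_comm, teps_add, lcmp]
      · rw [update_self]
        simp [hc, hDe]
      · rw [update_of_ne hl.ne']
        simp [hc, hY, hl.not_gt, hl.ne']
    have e2 : (fun l => update g i (ψ i) l (A.teps (j l) (suf (update p i (p i - 1)) l) (t l))) =
        update Y i (ψ i (A.teps (j i) (suf p i) (t i))) := by
      funext l
      rcases lt_trichotomy l i with hl | rfl | hl
      · rw [update_of_ne hl.ne, update_of_ne hl.ne, hsuf]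
        simp only [hY, hl, if_true]
        rw [A.teps_congr (j l) (m := suf p l - 1) (n := suf p l + 1)]
        push_cast
        linear_combination -(zmod_two_add_self 1)
      · rw [update_self, update_self, hsuf]
        simp
      · rw [update_of_ne hl.ne', update_of_ne hl.ne', hsuf]
        simp [hY, hl.not_gt]
    have e3 : (fun l => (φ l ∘ₗ A'.teps (j l) (suf p l)) ((if l < i then pow(f) ∘ₗ A.teps (j l) 1 else
          if l = i then A.tDer f δ (j l) else pow(f)) (t l))) =
        update Y i (sgn R (suf p i) • φ i (A.tDer f δ (j i) (A.teps (j i) (suf p i) (t i)))) := by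
      funext l
      rcases lt_trichotomy l i with hl | rfl | hl
      · rw [update_of_ne hl.ne]
        simp only [hY, hl, if_true]
        rw [lcmp, lcmp, hfe, hg, teps_add]; rfl
      · rw [update_self]
        simp only [lt_self_iff_false, if_false, if_true]
        rw [lcmp, hde, map_smul]
      · rw [update_of_ne hl.ne']
        simp only [hY, hl.not_gt, hl.ne', if_false]
        rw [lcmp, hfe, hg]; rfl
    rw [e1, e2, e3, map_smul_univ, hcp, map_update_add, smul_add,
      map_update_smul, map_update_smul, smul_smul, smul_smul,
      ← sgn_add, ← sgn_add]
    congr 2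
    refine sgn_of_cast R ?_
    have hs : (∑ l, p l) = (∑ l, if l < i then p l else 0) + p i + suf p i := by
      have : p i = ∑ l, if l = i then p l else 0 := by simp
      rw [this, suf, ← sum_add_distrib, ← sum_add_distrib]
      refine sum_congr rfl fun l _ => ?_
      rcases lt_trichotomy l i with hl | rfl | hl
      · simp [hl, hl.ne, hl.not_gt]
      · simp
      · simp [hl, hl.ne', hl.not_gt]
    rw [hs]
    push_cast
    linear_combination -(zmod_two_add_self (suf p i : ZMod 2))
  rw [tDer, sum_comp_lin, sum_congr rfl fun i _ => h1 i, sum_add_distrib, bop]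
  congr 1
  rw [← Finset.smul_sum, l_assoc, split_tDer, sum_comp_lin, comp_sum_lin]

end DGModule

/-! ### Gradings and coactions -/

section Coaction

variable {R : Type*} [CommRing R] {M : Type*} [AddCommGroup M] [Module R M]

/-- A linear map that records the degrees of the elements of the subsets `G n`. -/
def IsCoaction (G : ℤ → Submodule R M) (κ : M →ₗ[R] (ℤ →₀ M)) : Prop := ∀ n, ∀ x ∈ G n, κ x = Finsupp.single n x

lemma isInternal_of_coaction {G : ℤ → Submodule R M} (hG : ⨆ n, G n = ⊤)
    {κ : M →ₗ[R] (ℤ →₀ M)} (hκ : IsCoaction G κ) : DirectSum.IsInternal G := by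
  constructor
  · rw [injective_iff_map_eq_zero]
    intro x hx
    have h : ∀ x : DirectSum ℤ (fun n => G n), ∀ n, κ (DirectSum.coeAddMonoidHom G x) n = (x n : M) := by
      intro x n
      induction x using DirectSum.induction_on with
      | zero => simp
      | of m x =>
        rw [DirectSum.coeAddMonoidHom_of, hκ m x x.2]
        rcases eq_or_ne m n with rfl | h
        · simp
        · rw [Finsupp.single_eq_of_ne h.symm, DirectSum.of_eq_of_ne _ _ _ h.symm]; rfl
      | add x y hx hy => rw [map_add, map_add, Finsupp.add_apply, hx, hy]; rfl
    ext n
    rw [← h x n, hx]; simp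
  · intro x
    have hx : x ∈ ⨆ n, G n := by rw [hG]; trivial
    induction hx using Submodule.iSup_induction' with
    | mem n x hx => exact ⟨DirectSum.of _ n ⟨x, hx⟩, by rw [DirectSum.coeAddMonoidHom_of]⟩
    | zero => exact ⟨0, map_zero _⟩
    | add x y _ _ hx hy =>
      obtain ⟨a, rfl⟩ := hx
      obtain ⟨b, rfl⟩ := hy
      exact ⟨a + b, map_add _ _ _⟩

end Coaction

namespace DGModule

lemma exists_coaction (A : DGModule R) : ∃ κ, IsCoaction A.gr κ := by
  refine ⟨DirectSum.toModule R ℤ _ (fun n => Finsupp.lsingle n ∘ₗ (A.gr n).subtype) ∘ₗ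
    (LinearEquiv.ofBijective (DirectSum.coeLinearMap A.gr) A.internal).symm.toLinearMap, ?_⟩
  intro n x hx
  have h : (LinearEquiv.ofBijective (DirectSum.coeLinearMap A.gr) A.internal).symm x
      = DirectSum.lof R ℤ (fun n => A.gr n) n ⟨x, hx⟩ := by
    rw [LinearEquiv.symm_apply_eq]
    exact (DirectSum.coeLinearMap_lof A.gr n ⟨x, hx⟩).symm
  rw [lcmp, LinearEquiv.coe_coe, h]
  simp [DirectSum.toModule_lof]

/-- The homogeneous elements of a graded module, with their degrees. -/
structure Homog (A : DGModule R) : Type u where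
  deg : ℤ
  val : A
  mem : val ∈ A.gr deg

lemma span_homog (A : DGModule R) : span R (Set.range fun s : A.Homog => s.val) = ⊤ := by
  rw [eq_top_iff, ← A.internal.submodule_iSup_eq_top]
  exact iSup_le fun n x hx => subset_span ⟨⟨n, x, hx⟩, rfl⟩

lemma tgr_exists_coaction (A : DGModule R) (k : ℕ) : ∃ κ, IsCoaction (A.tgr k) κ := by
  obtain ⟨κ, hκ⟩ := A.exists_coaction
  obtain ⟨F, hF⟩ := MultilinearMap.exists_of_generators (R := R) (M := fun _ : Fin k => (A : Type u))
    (S := fun _ => A.Homog) (fun _ s => s.val) (fun _ => A.span_homog)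
    (fun s => Finsupp.single (∑ i, (s i).deg) (tp R fun i => (s i).val)) (by
      intro s i
      refine ⟨Finsupp.lsum R (fun n => Finsupp.lsingle (n + ∑ l, if l = i then 0 else (s l).deg) ∘ₗ
        (tp R).toLinearMap (fun l => (s l).val) i) ∘ₗ κ, fun t => ?_⟩
      rw [lcmp, hκ _ _ t.mem, Finsupp.lsum_single, lcmp, Finsupp.lsingle_apply]
      congr 1
      · rw [Finset.sum_eq_add_sum_sdiff_singleton_of_mem (mem_univ i) (fun l => (update s i t l).deg), update_self]
        congr 1
        rw [Finset.sum_ite, Finset.sum_const_zero, zero_add]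
        refine sum_congr (by ext; simp) fun l hl => ?_
        have : l ≠ i := by simpa using hl
        rw [update_of_ne this]
      · rw [MultilinearMap.toLinearMap_apply]
        congr 1
        funext l
        rcases eq_or_ne l i with rfl | h
        · rw [update_self, update_self]
        · rw [update_of_ne h, update_of_ne h])
  refine ⟨PiTensorProduct.lift F, fun n x hx => ?_⟩
  refine tgr_induction (eqLocus (PiTensorProduct.lift F) (Finsupp.lsingle n)) (fun q a ha hq => ?_) hx
  rw [mem_eqLocus, PiTensorProduct.lift.tprod]
  have := hF (fun i => ⟨q i, a i, ha i⟩)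
  subst hq
  exact this

/-- The composite of a derivation of odd degree with a derivation along `f`. -/
lemma tDer_comp_tDer {A B : DGModule R} {f δ : A →ₗ[R] B} {D : B →ₗ[R] B} (hf : HasPar A B f 0)
    {r : ℤ} (hr : (r : ZMod 2) = 1) (hδ : HasPar A B δ r) (hDf : D ∘ₗ f = δ) (k : ℕ) :
    B.tDer lid D k ∘ₗ A.tDer f δ k = ∑ i : Fin k, pmap (fun l => if l = i then D ∘ₗ δ else f) := by
  have hfe : ∀ x, B.eps 1 (f x) = f (A.eps 1 x) := fun x => by
    have := lcongr (hf 1) x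
    simpa [sgn_zero] using this
  have hδe : ∀ x, B.eps 1 (δ x) = - δ (A.eps 1 x) := fun x => by
    have := lcongr (hδ 1) x
    rw [l_smul, sgn_of_cast R (m := 1 * r) (n := 1) (by push_cast; rw [hr, mul_one]), sgn_one, neg_one_smul] at this
    exact this
  have hDf' : ∀ x, D (f x) = δ x := fun x => lcongr hDf x
  set T : Fin k → Fin k → ((⨂[R]^k) A →ₗ[R] (⨂[R]^k) B) := fun i i' => pmap
    (fun l => if l < i then lid ∘ₗ B.eps 1 else if l = i then D else lid) ∘ₗ
    pmap (fun l => if l < i' then f ∘ₗ A.eps 1 else if l = i' then δ else f) with hT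
  have h0 : B.tDer lid D k ∘ₗ A.tDer f δ k = ∑ i, ∑ i', T i i' := by
    rw [tDer, tDer, sum_comp_lin]
    exact sum_congr rfl fun i _ => comp_sum_lin _ _ _
  have h1 : ∀ i, T i i = pmap (fun l => if l = i then D ∘ₗ δ else f) := by
    intro i
    rw [hT]
    dsimp only
    rw [← pmap_comp]
    congr 1
    funext l
    ext x
    rcases lt_trichotomy l i with h | rfl | h
    · simp [h, h.ne, hfe]
    · simp
    · simp [h.not_gt, h.ne']
  rw [h0, ← sum_congr rfl fun i _ => h1 i]
  have h2 := Finset.sum_sum_eq_of_symm T (fun i i' => if i' = i then T i i else 0)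
    (fun i => by simp) (fun i i' hii => ?_)
  · rw [h2]; simp
  · rw [if_neg hii.ne', if_neg hii.ne, add_zero, hT]
    dsimp only
    rw [← pmap_comp, ← pmap_comp, ← eq_neg_iff_add_eq_zero]
    ext a
    rw [l_mult, l_mult, map_tp, LinearMap.neg_apply, map_tp]
    have : (-1 : R) = ∏ l, if l = i then (-1 : R) else 1 := by simp
    rw [← neg_one_smul R, this, ← map_smul_univ]
    congr 1
    funext l
    rcases lt_trichotomy l i with h | rfl | h
    · simp [h, h.ne, h.trans hii]
    · simp [hii, hDf', hδe]
    · rcases lt_trichotomy l i' with h' | rfl | h'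
      · simp [h.not_gt, h.ne', h', hfe]
      · simp [h.not_gt, h.ne', hDf']
      · simp [h.not_gt, h.ne', h'.not_gt, h'.ne']

lemma hasPar_id (A : DGModule R) : HasPar A A lid 0 := fun n => by rw [mul_zero, sgn_zero, one_smul]; rfl

lemma tD_tD (A : DGModule R) (k : ℕ) : A.tD k ∘ₗ A.tD k = 0 := by
  rw [tD_eq_tDer, tDer_comp_tDer A.hasPar_id (r := -1) (by decide) A.hasPar_d rfl]
  refine Finset.sum_eq_zero fun i _ => ?_
  ext a
  rw [l_mult, map_tp]
  refine (tp R).map_coord_zero i ?_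
  simp [A.d_d]

lemma tDer_mem_tgr {A B : DGModule R} {f δ : A →ₗ[R] B} (hf : GrMap A B f 0) {r : ℤ}
    (hδ : GrMap A B δ r) {n : ℤ} {x : (⨂[R]^k) A} (hx : x ∈ A.tgr k n) :
    A.tDer f δ k x ∈ B.tgr k (r + n) := by
  refine tgr_induction ((B.tgr k (r + n)).comap (A.tDer f δ k)) (fun q a ha hq => ?_) hx
  rw [mem_comap, tDer, l_sum]
  refine Submodule.sum_mem _ fun i _ => ?_
  have : r + n = ∑ l, if l = i then r + q l else q l := by
    have h : ∀ l, (if l = i then r + q l else q l) = (if l = i then r else 0) + q l := fun l => by split_ifs <;> simp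
    simp_rw [h, sum_add_distrib]
    simp [hq]
  rw [map_tp, this]
  refine B.tprod_mem_tgr _ _ fun l => ?_
  have hf0 : ∀ n, ∀ x ∈ A.gr n, f x ∈ B.gr n := fun n x hx => by simpa using hf n x hx
  rcases lt_trichotomy l i with h | rfl | h
  · simpa [h, h.ne] using hf0 _ _ (A.eps_mem 1 (ha l))
  · simpa using hδ _ _ (ha l)
  · simpa [h.not_gt, h.ne'] using hf0 _ _ (ha l)

lemma grMap_d (A : DGModule R) : GrMap A A A.d (-1) := fun n x hx => by
  have := A.d_gr n x hx; rwa [sub_eq_neg_add] at this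

lemma GrMap.hasPar {A B : DGModule R} {f : A →ₗ[R] B} {p : ℤ} (h : GrMap A B f p) :
    HasPar A B f p := hasPar_of_gr h

lemma grMap_id (A : DGModule R) : GrMap A A lid 0 := fun n x hx => by simpa using hx

lemma tmv_tD {A : DGModule R} {m n : ℕ} (e : Fin m ≃ Fin n) (t : (⨂[R]^m) A) : A.tD n (A.tmv e t) = A.tmv e (A.tD m t) :=
  (lcongr (tmv_tDer A.grMap_id (r := -1) (by decide) A.grMap_d e) t).symm

/-- The representation of the symmetric group on a tensor power. -/
def trep (A : DGModule R) (k : ℕ) : Representation R (Perm (Fin k)) ((⨂[R]^k) A) where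
  toFun σ := A.tmv σ
  map_one' := A.tmv_refl k
  map_mul' σ τ := A.tmv_trans τ σ

@[simp] lemma trep_apply (A : DGModule R) (k : ℕ) (σ : Perm (Fin k)) : A.trep k σ = A.tmv σ := rfl

end DGModule

/-! ### Coinvariants -/

namespace Operad

variable (O : Operad R)

/-- The relations `c σ ⊗ x = c ⊗ σ x`. -/
def coinvRel (k : ℕ) {M : Type u} [AddCommGroup M] [Module R M]
    (ρ : Representation R (Perm (Fin k)) M) : Submodule R (O.obj k ⊗[R] M) :=
  span R {t | ∃ (σ : Perm (Fin k)) (c : O.obj k) (x : M), t = O.relabel σ c ⊗ₜ[R] ρ σ x - c ⊗ₜ[R] x}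

/-- The module `O(k) ⊗ M` over the group ring of `Σ_k`. -/
abbrev Coinv (k : ℕ) {M : Type u} [AddCommGroup M] [Module R M]
    (ρ : Representation R (Perm (Fin k)) M) : Type u := (O.obj k ⊗[R] M) ⧸ O.coinvRel k ρ

variable {M N P : Type u} [AddCommGroup M] [Module R M] [AddCommGroup N] [Module R N]
  [AddCommGroup P] [Module R P] (ρ : Representation R (Perm (Fin k)) M)
  (ρ' : Representation R (Perm (Fin k)) N) (ρ'' : Representation R (Perm (Fin k)) P)

/-- The class of `c ⊗ x`. -/
def cmk : O.obj k →ₗ[R] M →ₗ[R] O.Coinv k ρ := (TensorProduct.mk R (O.obj k) M).compr₂ (O.coinvRel k ρ).mkQ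

lemma cmk_relabel (σ : Perm (Fin k)) (c : O.obj k) (x : M) : O.cmk ρ (O.relabel σ c) (ρ σ x) = O.cmk ρ c x := by
  rw [← sub_eq_zero]
  simp only [cmk, LinearMap.compr₂_apply, ← map_sub]
  exact (Submodule.Quotient.mk_eq_zero _).2 (subset_span ⟨σ, c, x, rfl⟩)

variable {ρ} in
lemma coinv_ext {f g : O.Coinv k ρ →ₗ[R] P} (h : ∀ c x, f (O.cmk ρ c x) = g (O.cmk ρ c x)) : f = g := by
  refine Submodule.linearMap_qext _ (TensorProduct.ext' fun c x => h c x)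

/-- The linear map out of the coinvariants given by an invariant bilinear map. -/
def coinvLift (f : O.obj k →ₗ[R] M →ₗ[R] P) (h : ∀ σ c x, f (O.relabel σ c) (ρ σ x) = f c x) : O.Coinv k ρ →ₗ[R] P :=
  Submodule.liftQ _ (TensorProduct.lift f) (span_le.2 (by
    rintro _ ⟨σ, c, x, rfl⟩
    simp [h]))

@[simp] lemma coinvLift_mk (f : O.obj k →ₗ[R] M →ₗ[R] P) (h) (c : O.obj k) (x : M) :
    O.coinvLift ρ f h (O.cmk ρ c x) = f c x := rfl

lemma coinv_induction {ρ : Representation R (Perm (Fin k)) M} (S : Submodule R (O.Coinv k ρ))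
    (h : ∀ c x, O.cmk ρ c x ∈ S) (z : O.Coinv k ρ) : z ∈ S := by
  have : S.mkQ = 0 := O.coinv_ext fun c x => by simpa using h c x
  have h2 := lcongr this z
  simpa using h2

/-- The map of coinvariants induced by equivariant maps. -/
def coinvMap (g : O.obj k →ₗ[R] O.obj k) (hg : ∀ (σ : Perm (Fin k)) c, g (O.relabel σ c) = O.relabel σ (g c))
    (T : M →ₗ[R] N) (hT : ∀ σ x, T (ρ σ x) = ρ' σ (T x)) : O.Coinv k ρ →ₗ[R] O.Coinv k ρ' :=
  O.coinvLift ρ (((O.cmk ρ').compl₂ T) ∘ₗ g) (fun σ c x => by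
    simp only [lcmp, LinearMap.compl₂_apply, hg, hT, cmk_relabel])

@[simp] lemma coinvMap_mk (g : O.obj k →ₗ[R] O.obj k) (hg) (T : M →ₗ[R] N) (hT) (c : O.obj k)
    (x : M) : O.coinvMap ρ ρ' g hg T hT (O.cmk ρ c x) = O.cmk ρ' (g c) (T x) := rfl

/-- The linear functionals on `O(k)` that express that `O(k)` is a direct summand of a free module
over the group ring. -/
lemma exists_dual_basis (h : Module.Projective (MonoidAlgebra R (Perm (Fin k))) (O.rep k).asModule) :
    ∃ (ι : Type u) (b : ι → O.obj k) (S : O.obj k →ₗ[R] (ι →₀ (Perm (Fin k) → R))),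
      (∀ (τ : Perm (Fin k)) c i σ, S (O.relabel τ c) i σ = S c i (τ⁻¹ * σ)) ∧
      ∀ c, ((S c).sum fun i f => ∑ σ, f σ • O.relabel σ (b i)) = c := by
  obtain ⟨s, hs⟩ := Module.projective_def'.1 h
  let G := Perm (Fin k)
  have hco : ∀ (r : R) (f : MonoidAlgebra R G) (σ : G),
      (algebraMap R (MonoidAlgebra R G) r * f).coeff σ = r * f.coeff σ := by
    intro r f σ
    rw [← Algebra.smul_def]; simp
  let co : (O.obj k) → ((O.rep k).asModule →₀ (G → R)) := fun c =>
    Finsupp.mapRange (fun f : MonoidAlgebra R G => (fun σ => f.coeff σ)) (by ext; simp)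
      (s ((O.rep k).asModuleEquiv.symm c))
  refine ⟨(O.rep k).asModule, fun x => (O.rep k).asModuleEquiv x,
    { toFun := co
      map_add' := fun c c' => ?_
      map_smul' := fun r c => ?_ }, ?_, ?_⟩
  · ext i σ; simp [co]
  · ext i σ
    have h1 := Representation.asModuleEquiv_symm_map_smul (O.rep k) r c
    simp only [co, Finsupp.mapRange_apply, Finsupp.smul_apply, smul_eq_mul, RingHom.id_apply, Pi.smul_apply]
    rw [h1, map_smul]
    exact hco _ _ _
  · intro τ c i σ
    have h1 : (O.rep k).asModuleEquiv.symm (O.relabel τ c) =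
        MonoidAlgebra.of R G τ • (O.rep k).asModuleEquiv.symm c :=
      Representation.asModuleEquiv_symm_map_rho (O.rep k) τ c
    simp only [co, LinearMap.coe_mk, AddHom.coe_mk, h1, map_smul, Finsupp.mapRange_apply,
      Finsupp.smul_apply, smul_eq_mul, MonoidAlgebra.of_apply]
    rw [MonoidAlgebra.coeff_single_mul_eq_mul_coeff (m₂ := τ⁻¹ * σ), one_mul]
    intro m' _
    exact eq_inv_mul_iff_mul_eq.symm
  · intro c
    have h1 := lcongr hs ((O.rep k).asModuleEquiv.symm c)
    have h2 := congrArg (O.rep k).asModuleEquiv h1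
    rw [lcmp, Finsupp.linearCombination_apply, Finsupp.sum, map_sum] at h2
    simp only [Representation.asModuleEquiv_map_smul, id] at h2
    rw [l_id, LinearEquiv.apply_symm_apply] at h2
    rw [LinearMap.coe_mk, AddHom.coe_mk, Finsupp.sum_mapRange_index (by simp)]
    refine Eq.trans (sum_congr rfl fun x _ => ?_) h2
    rw [Representation.asAlgebraHom_def, MonoidAlgebra.lift_apply, Finsupp.sum_fintype _ _ (by simp)]
    rw [l_sum]
    rfl

end Operad

namespace Operad

variable (O : Operad R)

/-- A family of vectors and equivariant functionals that exhibits `O(k)` as a direct summand of a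
free module over the group ring of `Σ_k`. -/
structure DualBasis (k : ℕ) where
  ι : Type u
  b : ι → O.obj k
  S : O.obj k →ₗ[R] (ι →₀ (Perm (Fin k) → R))
  S_relabel : ∀ (τ : Perm (Fin k)) c i σ, S (O.relabel τ c) i σ = S c i (τ⁻¹ * σ)
  sum_eq : ∀ c, ((S c).sum fun i f => ∑ σ, f σ • O.relabel σ (b i)) = c

variable {O} {M N : Type u} [AddCommGroup M] [Module R M] [AddCommGroup N] [Module R N]

/-- Each module of operations has a dual basis. -/
abbrev HasDualBases (O : Operad R) : Prop := ∀ k, Nonempty (O.DualBasis k)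

namespace DualBasis

variable (B : O.DualBasis k) (ρ : Representation R (Perm (Fin k)) M) (ρ' : Representation R (Perm (Fin k)) N)

/-- The linear map `f ↦ ∑ f(σ) σ⁻¹ x`. -/
def orb (x : M) : (Perm (Fin k) → R) →ₗ[R] M := ∑ σ, (LinearMap.toSpanSingleton R M (ρ σ⁻¹ x)) ∘ₗ LinearMap.proj σ

lemma orb_apply (x : M) (f : Perm (Fin k) → R) : orb ρ x f = ∑ σ, f σ • ρ σ⁻¹ x := by simp [orb]

/-- The coordinates of an element of the coinvariants with respect to the dual basis. -/
def phi : O.Coinv k ρ →ₗ[R] (B.ι →₀ M) :=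
  O.coinvLift ρ (LinearMap.mk₂ R (fun c x => Finsupp.mapRange.linearMap (orb ρ x) (B.S c))
    (fun c c' x => by ext i; simp) (fun r c x => by ext i; simp)
    (fun c x x' => by
      ext i
      simp [orb_apply, sum_add_distrib])
    (fun r c x => by
      ext i
      simp only [Finsupp.mapRange.linearMap_apply, Finsupp.mapRange_apply, orb_apply, map_smul,
        Finsupp.smul_apply, Finset.smul_sum]
      exact sum_congr rfl fun σ _ => smul_comm _ _ _)) (by
    intro τ c x
    ext i
    simp only [LinearMap.mk₂_apply, Finsupp.mapRange.linearMap_apply, Finsupp.mapRange_apply, orb_apply, B.S_relabel]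
    rw [← Equiv.sum_comp (Equiv.mulLeft τ)]
    refine sum_congr rfl fun σ _ => ?_
    simp only [Equiv.coe_mulLeft, inv_mul_cancel_left, mul_inv_rev]
    rw [← Module.End.mul_apply, ← map_mul, inv_mul_cancel_right])

lemma phi_mk (c : O.obj k) (x : M) (i : B.ι) : B.phi ρ (O.cmk ρ c x) i = ∑ σ, B.S c i σ • ρ σ⁻¹ x := by
  simp [phi, orb_apply]

/-- The element of the coinvariants with given coordinates. -/
def psi : (B.ι →₀ M) →ₗ[R] O.Coinv k ρ := Finsupp.lsum R fun i => O.cmk ρ (B.b i)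

lemma psi_phi (z : O.Coinv k ρ) : B.psi ρ (B.phi ρ z) = z := by
  have : B.psi ρ ∘ₗ B.phi ρ = lid := by
    refine O.coinv_ext fun c x => ?_
    have h : B.phi ρ (O.cmk ρ c x) = Finsupp.mapRange.linearMap (orb ρ x) (B.S c) := by
      ext i; rw [phi_mk]; simp [orb_apply]
    rw [lcmp, h, psi, Finsupp.lsum_apply, Finsupp.mapRange.linearMap_apply, Finsupp.sum_mapRange_index (by simp)]
    conv_rhs => rw [l_id, ← B.sum_eq c]
    rw [Finsupp.sum, Finsupp.sum, map_sum, l_sum]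
    refine sum_congr rfl fun i _ => ?_
    rw [orb_apply, map_sum, map_sum, l_sum]
    refine sum_congr rfl fun σ _ => ?_
    rw [map_smul, map_smul, l_smul, ← O.cmk_relabel ρ σ, ← Module.End.mul_apply,
      ← map_mul, mul_inv_cancel, map_one, Module.End.one_apply]
  exact lcongr this z

lemma phi_injective : Injective (B.phi ρ) := Function.LeftInverse.injective (B.psi_phi ρ)

lemma phi_map (T : M →ₗ[R] N) (hT : ∀ σ x, T (ρ σ x) = ρ' σ (T x)) (z : O.Coinv k ρ) (i : B.ι) :
    B.phi ρ' (O.coinvMap ρ ρ' lid (fun _ _ => rfl) T hT z) i = T (B.phi ρ z i) := by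
  have : (Finsupp.lapply i ∘ₗ B.phi ρ') ∘ₗ O.coinvMap ρ ρ' lid (fun _ _ => rfl) T hT =
      T ∘ₗ Finsupp.lapply i ∘ₗ B.phi ρ := by
    refine O.coinv_ext fun c x => ?_
    simp [phi_mk, hT, map_sum]
  exact lcongr this z

lemma coinvMap_injective (B : O.DualBasis k) (T : M →ₗ[R] N) (hT : ∀ σ x, T (ρ σ x) = ρ' σ (T x))
    (hinj : Injective T) :
    Injective (O.coinvMap ρ ρ' lid (fun _ _ => rfl) T hT) := by
  rw [injective_iff_map_eq_zero]
  intro z hz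
  apply B.phi_injective ρ
  ext i
  apply hinj
  rw [← B.phi_map ρ ρ' T hT, hz]
  simp

end DualBasis

/-- The elements `∑ c ⊗ x` of the coinvariants with `x` in a given submodule. -/
def cspan (k : ℕ) (ρ : Representation R (Perm (Fin k)) M) (Z : Submodule R M) : Submodule R (O.Coinv k ρ) :=
  span R {t | ∃ c, ∃ x ∈ Z, t = O.cmk ρ c x}

lemma mem_cspan_iff (B : O.DualBasis k) (ρ : Representation R (Perm (Fin k)) M)
    (Z : Submodule R M) (hZ : ∀ σ, ∀ x ∈ Z, ρ σ x ∈ Z) (z : O.Coinv k ρ) :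
    z ∈ cspan k ρ Z ↔ ∀ i, B.phi ρ z i ∈ Z := by
  constructor
  · intro hz i
    have : cspan k ρ Z ≤ Z.comap (Finsupp.lapply i ∘ₗ B.phi ρ) := by
      refine span_le.2 ?_
      rintro _ ⟨c, x, hx, rfl⟩
      simp only [Submodule.comap_coe, Set.mem_preimage, lcmp, Finsupp.lapply_apply, B.phi_mk]
      exact Submodule.sum_mem _ fun σ _ => smul_mem _ _ (hZ _ _ hx)
    exact this hz
  · intro h
    rw [← B.psi_phi ρ z, DualBasis.psi, Finsupp.lsum_apply]
    exact Submodule.sum_mem _ fun i _ => subset_span ⟨_, _, h i, rfl⟩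

end Operad

/-! ### The free algebra on a graded module -/

namespace Operad

variable (O : Operad R) (X Y : DGModule R)

/-- The underlying module `⨁ₖ O(k) ⊗ X^{⊗ k}` (over the group rings of the symmetric groups) of the
free algebra on `X`. -/
def FreeMod : Type u := DirectSum ℕ fun k => O.Coinv k (X.trep k)

instance : AddCommGroup (O.FreeMod X) := inferInstanceAs (AddCommGroup (DirectSum ℕ fun k => O.Coinv k (X.trep k)))

instance : Module R (O.FreeMod X) := inferInstanceAs (Module R (DirectSum ℕ fun k => O.Coinv k (X.trep k)))

/-- The inclusion of the part of arity `k`. -/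
def fin (k : ℕ) : O.Coinv k (X.trep k) →ₗ[R] O.FreeMod X := DirectSum.lof R ℕ (fun k => O.Coinv k (X.trep k)) k

/-- The projection onto the part of arity `k`. -/
def fpr (k : ℕ) : O.FreeMod X →ₗ[R] O.Coinv k (X.trep k) := DirectSum.component R ℕ (fun k => O.Coinv k (X.trep k)) k

lemma fpr_fin (k : ℕ) (z : O.Coinv k (X.trep k)) : O.fpr X k (O.fin X k z) = z :=
  DirectSum.component.lof_self R (M := fun k => O.Coinv k (X.trep k)) k z

lemma fpr_fin_of_ne {k l : ℕ} (h : k ≠ l) (z : O.Coinv k (X.trep k)) : O.fpr X l (O.fin X k z) = 0 := by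
  have := DirectSum.component.of R (M := fun k => O.Coinv k (X.trep k)) l k z
  rw [dif_neg h] at this
  exact this

/-- The element `c ⊗ x` of the free algebra. -/
def br : O.obj k →ₗ[R] (⨂[R]^k) X →ₗ[R] O.FreeMod X := (O.cmk (X.trep k)).compr₂ (O.fin X k)

variable {X Y}

lemma br_eq (c : O.obj k) (x : (⨂[R]^k) X) : O.br X c x = O.fin X k (O.cmk (X.trep k) c x) := rfl

lemma br_relabel {m n : ℕ} (e : Fin m ≃ Fin n) (c : O.obj m) (x : (⨂[R]^m) X) :
    O.br X (O.relabel e c) (X.tmv e x) = O.br X c x := by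
  obtain rfl : m = n := by simpa using Fintype.card_congr e
  rw [br_eq, br_eq]
  congr 1
  exact O.cmk_relabel (X.trep m) e c x

lemma free_fin_ext {P : Type*} [AddCommGroup P] [Module R P] {f g : O.FreeMod X →ₗ[R] P}
    (h : ∀ (k : ℕ) z, f (O.fin X k z) = g (O.fin X k z)) : f = g :=
  DirectSum.linearMap_ext R fun k => lext fun z => h k z

lemma free_ext {P : Type u} [AddCommGroup P] [Module R P] {f g : O.FreeMod X →ₗ[R] P}
    (h : ∀ (k : ℕ) (c : O.obj k) x, f (O.br X c x) = g (O.br X c x)) : f = g :=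
  O.free_fin_ext fun k z => lcongr (O.coinv_ext (f := f ∘ₗ O.fin X k) (g := g ∘ₗ O.fin X k) fun c x => h k c x) z

lemma free_ext_homog {P : Type u} [AddCommGroup P] [Module R P] {f g : O.FreeMod X →ₗ[R] P}
    (h : ∀ (k : ℕ) (p q : ℤ) (c : O.obj k) x, c ∈ (O.obj k).gr p → x ∈ X.tgr k q →
      f (O.br X c x) = g (O.br X c x)) : f = g := by
  refine O.free_ext fun k c x => ?_
  refine lcongr (f := f ∘ₗ (O.br X).flip x) (g := g ∘ₗ (O.br X).flip x) ((O.obj k).gr_ext _ _ fun p c hc => ?_) c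
  exact lcongr (f := f ∘ₗ O.br X c) (g := g ∘ₗ O.br X c) (X.tgr_ext _ _ fun q x hx => h k p q c x hc hx) x

/-- The linear map out of the free algebra given by invariant bilinear maps. -/
def freeLift {P : Type u} [AddCommGroup P] [Module R P] (f : ∀ k, O.obj k →ₗ[R] (⨂[R]^k) X →ₗ[R] P)
    (h : ∀ k (σ : Perm (Fin k)) c x, f k (O.relabel σ c) (X.tmv σ x) = f k c x) :
    O.FreeMod X →ₗ[R] P :=
  DirectSum.toModule R ℕ P fun k => O.coinvLift (X.trep k) (f k) (fun σ c x => by rw [X.trep_apply]; exact h k σ c x)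

@[simp] lemma freeLift_br {P : Type u} [AddCommGroup P] [Module R P]
    (f : ∀ k, O.obj k →ₗ[R] (⨂[R]^k) X →ₗ[R] P) (h) (c : O.obj k) (x : (⨂[R]^k) X) :
    O.freeLift f h (O.br X c x) = f k c x :=
  (DirectSum.toModule_lof R (M := fun k => O.Coinv k (X.trep k)) k _).trans rfl

/-- The map of free algebras given by equivariant maps of tensor powers. -/
def freeMap (T : ∀ k, (⨂[R]^k) X →ₗ[R] (⨂[R]^k) Y)
    (hT : ∀ k (σ : Perm (Fin k)) x, T k (X.tmv σ x) = Y.tmv σ (T k x)) :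
    O.FreeMod X →ₗ[R] O.FreeMod Y :=
  O.freeLift (fun k => (O.br Y).compl₂ (T k)) (fun k σ c x => by simp only [LinearMap.compl₂_apply, hT, br_relabel])

@[simp] lemma freeMap_br (T : ∀ k, (⨂[R]^k) X →ₗ[R] (⨂[R]^k) Y) (hT) (c : O.obj k)
    (x : (⨂[R]^k) X) : O.freeMap T hT (O.br X c x) = O.br Y c (T k x) := by
  exact O.freeLift_br _ _ c x

/-- The part of degree `n` of the free algebra. -/
def frGr (X : DGModule R) (n : ℤ) : Submodule R (O.FreeMod X) :=
  span R {t | ∃ (k : ℕ) (p q : ℤ) (c : O.obj k) (x : (⨂[R]^k) X),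
    c ∈ (O.obj k).gr p ∧ x ∈ X.tgr k q ∧ p + q = n ∧ t = O.br X c x}

lemma br_mem_gr {p q : ℤ} {c : O.obj k} {x : (⨂[R]^k) X} (hc : c ∈ (O.obj k).gr p)
    (hx : x ∈ X.tgr k q) : O.br X c x ∈ O.frGr X (p + q) :=
  subset_span ⟨k, p, q, c, x, hc, hx, rfl, rfl⟩

lemma iSup_frGr : ⨆ n, O.frGr X n = ⊤ := by
  have : (⨆ n, O.frGr X n).mkQ = 0 := O.free_ext_homog fun k p q c x hc hx => by
    simpa using mem_iSup_of_mem (p + q) (O.br_mem_gr hc hx)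
  simpa using congrArg ker this

lemma frGr_coaction : ∃ κ, IsCoaction (O.frGr X) κ := by
  choose κ hκ using fun k => (O.obj k).exists_coaction
  choose κ' hκ' using fun k => X.tgr_exists_coaction k
  let K : ∀ k, ℤ → (O.obj k →ₗ[R] (⨂[R]^k) X →ₗ[R] (ℤ →₀ O.FreeMod X)) := fun k p =>
    { toFun := fun c => Finsupp.lsum R (fun q => Finsupp.lsingle (p + q) ∘ₗ O.br X c) ∘ₗ κ' k
      map_add' := fun c c' => by
        refine lext fun x => ?_
        simp only [lcmp, Finsupp.lsum_apply, l_add, Finsupp.sum, map_add, ← sum_add_distrib]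
      map_smul' := fun r c => by
        refine lext fun x => ?_
        simp only [lcmp, Finsupp.lsum_apply, l_smul, Finsupp.sum, map_smul, Finset.smul_sum, RingHom.id_apply] }
  let f : ∀ k, O.obj k →ₗ[R] (⨂[R]^k) X →ₗ[R] (ℤ →₀ O.FreeMod X) := fun k => Finsupp.lsum R (K k) ∘ₗ κ k
  have hf : ∀ k p q c x, c ∈ (O.obj k).gr p → x ∈ X.tgr k q → f k c x = Finsupp.single (p + q) (O.br X c x) := by
    intro k p q c x hc hx
    simp only [f, lcmp, hκ k p c hc, Finsupp.lsum_single, K, LinearMap.coe_mk,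
      AddHom.coe_mk, hκ' k q x hx, Finsupp.lsingle_apply]
  have hinv : ∀ k (σ : Perm (Fin k)) c x, f k (O.relabel σ c) (X.tmv σ x) = f k c x := by
    intro k σ c x
    refine lcongr (f := (f k).flip (X.tmv σ x) ∘ₗ O.relabel σ) (g := (f k).flip x)
      ((O.obj k).gr_ext _ _ fun p c hc => ?_) c
    refine lcongr (f := f k (O.relabel σ c) ∘ₗ X.tmv σ) (g := f k c) (X.tgr_ext _ _ fun q x hx => ?_) x
    rw [lcmp, hf k p q _ _ (O.relabel_gr σ p c hc) (X.tmv_mem_tgr σ hx), hf k p q c x hc hx, br_relabel]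
  refine ⟨O.freeLift f hinv, fun n x hx => ?_⟩
  have : O.frGr X n ≤ eqLocus (O.freeLift f hinv) (Finsupp.lsingle n) := by
    refine span_le.2 ?_
    rintro _ ⟨k, p, q, c, y, hc, hy, rfl, rfl⟩
    rw [SetLike.mem_coe, mem_eqLocus, freeLift_br, hf k p q c y hc hy]
    rfl
  exact this hx

lemma relabel_eps {m n : ℕ} (e : Fin m ≃ Fin n) (r : ℤ) (c : O.obj m) :
    O.relabel e ((O.obj m).eps r c) = (O.obj n).eps r (O.relabel e c) := by
  refine lcongr (f := O.relabel e ∘ₗ (O.obj m).eps r)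
    (g := (O.obj n).eps r ∘ₗ O.relabel e) ((O.obj m).gr_ext _ _ fun p c hc => ?_) c
  rw [lcmp, lcmp, (O.obj m).eps_of_mem r hc, (O.obj n).eps_of_mem r (O.relabel_gr e p c hc), map_smul]

lemma eps_d {A : DGModule R} (x : A) : A.eps 1 (A.d x) = - A.d (A.eps 1 x) := by
  have := lcongr (A.hasPar_d 1) x
  rw [l_smul, one_mul, sgn_of_cast R (m := -1) (n := 1) (by decide), sgn_one, neg_one_smul] at this
  exact this

/-- The differential of the free algebra on the complex `X`. -/
def frD (X : DGModule R) : O.FreeMod X →ₗ[R] O.FreeMod X :=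
  O.freeLift (fun k => O.br X ∘ₗ (O.obj k).d + ((O.br X).compl₂ (X.tD k)) ∘ₗ (O.obj k).eps 1) (fun k σ c x => by
      simp only [l_add, lcmp, LinearMap.compl₂_apply, ← O.relabel_d, ← O.relabel_eps, tmv_tD, br_relabel])

lemma frD_br (c : O.obj k) (x : (⨂[R]^k) X) :
    O.frD X (O.br X c x) = O.br X ((O.obj k).d c) x + O.br X ((O.obj k).eps 1 c) (X.tD k x) := by
  exact O.freeLift_br _ _ c x

/-- The free algebra on the complex `X`, as a complex. -/
abbrev free (X : DGModule R) : DGModule R where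
  carrier := O.FreeMod X
  gr := O.frGr X
  internal := by
    obtain ⟨κ, hκ⟩ := O.frGr_coaction (X := X)
    exact isInternal_of_coaction O.iSup_frGr hκ
  d := O.frD X
  d_gr n x hx := by
    have : O.frGr X n ≤ (O.frGr X (n - 1)).comap (O.frD X) := by
      refine span_le.2 ?_
      rintro _ ⟨k, p, q, c, y, hc, hy, rfl, rfl⟩
      rw [SetLike.mem_coe, mem_comap, frD_br]
      refine Submodule.add_mem _ ?_ ?_
      · rw [show p + q - 1 = (p - 1) + q by ring]
        exact O.br_mem_gr ((O.obj k).d_gr p c hc) hy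
      · rw [show p + q - 1 = p + (-1 + q) by ring]
        exact O.br_mem_gr ((O.obj k).eps_mem 1 hc) (tDer_mem_tgr X.grMap_id X.grMap_d hy)
    exact this hx
  d_d x := by
    have : O.frD X ∘ₗ O.frD X = 0 := O.free_ext fun k c x => by
      have h := lcongr (X.tD_tD k) x
      rw [lcmp] at h
      rw [lcmp, frD_br, map_add, frD_br, frD_br, (O.obj k).d_d, eps_d, h]
      simp
    exact lcongr this x

end Operad

/-! ### The free algebra over an operad -/

/-- A multilinear map takes tuples of elements of spans to the span of the values. -/
lemma MultilinearMap.mem_of_forall_span {R : Type*} [CommRing R] {ι : Type*} [Fintype ι]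
    {M : ι → Type*} [∀ i, AddCommGroup (M i)] [∀ i, Module R (M i)] {N : Type*} [AddCommGroup N]
    [Module R N] (f : MultilinearMap R M N) (S : ∀ i, Set (M i)) (P : Submodule R N)
    (h : ∀ s, (∀ i, s i ∈ S i) → f s ∈ P) (a : ∀ i, M i)
    (ha : ∀ i, a i ∈ span R (S i)) : f a ∈ P := by
  classical
  have key : ∀ (t : Finset ι) (a : ∀ i, M i), (∀ i, a i ∈ span R (S i)) →
      (∀ i, i ∉ t → a i ∈ S i) → f a ∈ P := by
    intro t
    induction t using Finset.induction_on with
    | empty => intro a _ h2; exact h a fun i => h2 i (by simp)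
    | insert i t hi ih =>
      intro a h1 h2
      have hx : ∀ x ∈ span R (S i), f (update a i x) ∈ P := by
        intro x hx
        induction hx using span_induction with
        | mem x hx =>
          refine ih _ (fun l => ?_) (fun l hl => ?_)
          · rcases eq_or_ne l i with rfl | hli
            · rw [update_self]; exact subset_span hx
            · rw [update_of_ne hli]; exact h1 l
          · rcases eq_or_ne l i with rfl | hli
            · rw [update_self]; exact hx
            · rw [update_of_ne hli]; exact h2 l (by simp [hli, hl])
        | zero => rw [MultilinearMap.map_update_zero]; exact P.zero_mem
        | add x y _ _ hx hy => rw [map_update_add]; exact P.add_mem hx hy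
        | smul r x _ hx => rw [map_update_smul]; exact P.smul_mem r hx
      simpa using hx (a i) (h1 i)
  exact key Finset.univ a ha (by simp)

lemma unshuffleExp_update (p q : Fin k → ℤ) (i : Fin k) (x y : ℤ) :
    unshuffleExp (update p i x) (update q i y) = unshuffleExp (update p i 0) (update q i 0) +
        ((∑ l, if l < i then q l else 0) * x + suf p i * y) := by
  have hsuf : ∀ l, suf (update p i x) l = suf (update p i 0) l + if l < i then x else 0 := by
    intro l
    have : (if l < i then x else 0) = ∑ l', if l' = i then (if l < l' then x else 0) else 0 := by simp
    rw [suf, suf, this, ← sum_add_distrib]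
    refine sum_congr rfl fun l' _ => ?_
    rcases eq_or_ne l' i with rfl | h
    · simp
    · simp [h]
  have hs2 : ∀ x, suf (update p i x) i = suf p i := by
    intro x
    rw [suf, suf]
    refine sum_congr rfl fun l _ => ?_
    split_ifs with h
    · rw [update_of_ne h.ne']
    · rfl
  have h3 : suf p i * y = ∑ l, if l = i then suf p l * y else 0 := by simp
  rw [unshuffleExp_eq, unshuffleExp_eq, h3, Finset.sum_mul, ← sum_add_distrib, ← sum_add_distrib]
  refine sum_congr rfl fun l _ => ?_
  rcases eq_or_ne l i with rfl | h
  · rw [hs2, hs2]; simp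
  · rw [update_of_ne h, update_of_ne h, hsuf, if_neg h]
    split_ifs <;> ring

namespace DGModule

/-- The isomorphism of `A` with its first tensor power. -/
def tone (A : DGModule R) : A →ₗ[R] (⨂[R]^1) A := (tp R (s := fun _ : Fin 1 => (A : Type u))).toLinearMap 0 0

lemma tone_apply (A : DGModule R) (a : A) : A.tone a = tp R fun _ : Fin 1 => a := by
  rw [tone, MultilinearMap.toLinearMap_apply]
  congr 1
  funext i
  rw [Subsingleton.elim i 0, update_self]

lemma tone_mem_tgr (A : DGModule R) {n : ℤ} {a : A} (ha : a ∈ A.gr n) : A.tone a ∈ A.tgr 1 n := by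
  rw [tone_apply]
  simpa using A.tprod_mem_tgr (fun _ : Fin 1 => n) (fun _ => a) (fun _ => ha)

lemma tone_map {A B : DGModule R} (f : A →ₗ[R] B) (a : A) : pow(f) (A.tone a) = B.tone (f a) := by
  rw [tone_apply, map_tp, tone_apply]

end DGModule

namespace Operad

variable (O : Operad R) (X Y : DGModule R)

lemma br_grT {p : ℤ} {c : O.obj k} (hc : c ∈ (O.obj k).gr p) :
    DGModule.GrT X (O.free X) (O.br X c) p := fun _ _ hx => O.br_mem_gr hc hx

/-- Generators of the part of arity `n` of the free algebra. -/
structure Gen (n : ℕ) : Type u where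
  p : ℤ
  q : ℤ
  c : O.obj n
  x : (⨂[R]^n) X
  hc : c ∈ (O.obj n).gr p
  hx : x ∈ X.tgr n q

variable {O X} in
/-- The element of the coinvariants given by a generator. -/
def Gen.mk' {n : ℕ} (s : O.Gen X n) : O.Coinv n (X.trep n) := O.cmk (X.trep n) s.c s.x

lemma span_gen (n : ℕ) : span R (Set.range (Gen.mk' (O := O) (X := X) (n := n))) = ⊤ := by
  rw [eq_top_iff]
  intro z _
  refine O.coinv_induction _ (fun c x => ?_) z
  set S := span R (Set.range (Gen.mk' (O := O) (X := X) (n := n)))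
  have h : ∀ c x, S.mkQ (O.cmk (X.trep n) c x) = 0 := by
    intro c x
    refine lcongr (f := S.mkQ ∘ₗ (O.cmk (X.trep n)).flip x) (g := 0) ((O.obj n).gr_ext _ _ fun p c hc => ?_) c
    refine lcongr (f := S.mkQ ∘ₗ (O.cmk (X.trep n)) c) (g := 0) (X.tgr_ext _ _ fun q x hx => ?_) x
    rw [lcmp, Submodule.mkQ_apply, l_zero, Submodule.Quotient.mk_eq_zero]
    exact subset_span ⟨⟨p, q, c, x, hc, hx⟩, rfl⟩
  simpa using h c x

/-- The linear map `c ↦ c(c₁, …, c_k) ⊗ (x₁ ⊗ ⋯ ⊗ x_k)`. -/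
def preAct (J : Fin k → ℕ) (cs : ∀ i, O.obj (J i)) (xs : ∀ i, (⨂[R]^(J i)) X) :
    O.obj k →ₗ[R] O.FreeMod X where
  toFun c := O.br X (O.comp J c cs) (X.join J (tp R xs))
  map_add' c c' := by simp
  map_smul' r c := by simp

lemma preAct_relabel {J J' : Fin k → ℕ} (τ : ∀ i, Fin (J i) ≃ Fin (J' i))
    (cs : ∀ i, O.obj (J i)) (xs : ∀ i, (⨂[R]^(J i)) X) :
    O.preAct X J' (fun i => O.relabel (τ i) (cs i)) (fun i => X.tmv (τ i) (xs i)) = O.preAct X J cs xs := by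
  ext c
  change O.br X _ _ = O.br X _ _
  rw [O.comp_relabel_inner, ← map_tp, X.join_blockSum, br_relabel]

lemma exists_frAct (J : Fin k → ℕ) :
    ∃ F : MultilinearMap R (fun i => O.Coinv (J i) (X.trep (J i))) (O.obj k →ₗ[R] O.FreeMod X),
      ∀ s : ∀ i, O.Gen X (J i), F (fun i => (s i).mk') = sgn R (unshuffleExp (fun i => (s i).p) (fun i => (s i).q)) •
          O.preAct X J (fun i => (s i).c) (fun i => (s i).x) := by
  refine MultilinearMap.exists_of_generators (R := R)
    (M := fun i => O.Coinv (J i) (X.trep (J i))) (S := fun i => O.Gen X (J i))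
    (fun i => Gen.mk') (fun i => O.span_gen X (J i)) _ ?_
  intro s i
  set p : Fin k → ℤ := fun i => (s i).p
  set q : Fin k → ℤ := fun i => (s i).q
  set cs : ∀ i, O.obj (J i) := fun i => (s i).c
  set xs : ∀ i, (⨂[R]^(J i)) X := fun i => (s i).x
  set a : ℤ := ∑ l, if l < i then q l else 0
  set b : ℤ := suf p i
  set r : R := sgn R (unshuffleExp (update p i 0) (update q i 0))
  let f : O.obj (J i) →ₗ[R] (⨂[R]^(J i)) X →ₗ[R] (O.obj k →ₗ[R] O.FreeMod X) :=
    LinearMap.mk₂ R (fun c x => r • O.preAct X J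
      (update cs i ((O.obj (J i)).eps a c)) (update xs i (X.teps (J i) b x)))
      (fun c c' x => by
        ext e
        simp [preAct, map_update_add])
      (fun t c x => by
        ext e
        simp [preAct, map_update_smul, smul_comm r t])
      (fun c x x' => by
        ext e
        simp [preAct, map_update_add])
      (fun t c x => by
        ext e
        simp [preAct, map_update_smul, smul_comm r t])
  refine ⟨O.coinvLift (X.trep (J i)) f (fun σ c x => ?_), fun t => ?_⟩
  · rw [LinearMap.mk₂_apply, LinearMap.mk₂_apply]
    congr 1
    have h1 : X.teps (J i) b (X.trep (J i) σ x) = X.tmv σ (X.teps (J i) b x) := lcongr (X.tmv_teps σ b).symm x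
    rw [h1, ← relabel_eps]
    refine Eq.trans ?_ (O.preAct_relabel X (update (fun l => Equiv.refl (Fin (J l))) i σ) _ _)
    congr 1
    · funext l
      rcases eq_or_ne l i with rfl | h
      · simp
      · simp [h, O.relabel_refl]
    · funext l
      rcases eq_or_ne l i with rfl | h
      · simp
      · simp [h]
  · refine (O.coinvLift_mk _ f _ t.c t.x).trans ?_
    rw [LinearMap.mk₂_apply, (O.obj _).eps_of_mem _ t.hc, X.teps_of_mem _ t.hx]
    have e1 : (fun l => (update s i t l).p) = update p i t.p := by
      funext l; rcases eq_or_ne l i with rfl | h <;> simp [*, p]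
    have e2 : (fun l => (update s i t l).q) = update q i t.q := by
      funext l; rcases eq_or_ne l i with rfl | h <;> simp [*, q]
    have e3 : (fun l => (update s i t l).c) = update cs i t.c := by
      funext l; rcases eq_or_ne l i with rfl | h <;> simp [*, cs]
    have e4 : (fun l => (update s i t l).x) = update xs i t.x := by
      funext l; rcases eq_or_ne l i with rfl | h <;> simp [*, xs]
    rw [e1, e2, e3, e4, unshuffleExp_update, sgn_add, sgn_add]
    ext e
    simp [preAct, map_update_smul, smul_smul]
    congr 1
    ring

/-- The structure maps of the free algebra. -/
def frAct : O.obj k →ₗ[R] (⨂[R]^k) (O.FreeMod X) →ₗ[R] O.FreeMod X :=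
  (PiTensorProduct.lift (MultilinearMap.fromDirectSumEquiv (R := R)
    (M := fun (_ : Fin k) (n : ℕ) => O.Coinv n (X.trep n))
    (fun J => (O.exists_frAct X J).choose))).flip

lemma frAct_fin (c : O.obj k) (J : Fin k → ℕ) (s : ∀ i, O.Gen X (J i)) :
    O.frAct X c (tp R fun i => O.br X (s i).c (s i).x) =
      sgn R (unshuffleExp (fun i => (s i).p) (fun i => (s i).q)) • O.br X (O.comp J c fun i => (s i).c)
          (X.join J (tp R fun i => (s i).x)) := by
  have h := MultilinearMap.fromDirectSumEquiv_lof (R := R) (M := fun (_ : Fin k) (n : ℕ) => O.Coinv n (X.trep n))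
    (fun J => (O.exists_frAct X J).choose) J (fun i => (s i).mk')
  rw [(O.exists_frAct X J).choose_spec s] at h
  exact lcongr ((PiTensorProduct.lift.tprod _).trans h) c

lemma frAct_bop (J : Fin k → ℕ) (p : Fin k → ℤ) (c : O.obj k) (cs : ∀ i, O.obj (J i))
    (hc : ∀ i, cs i ∈ (O.obj (J i)).gr (p i)) :
    O.frAct X c ∘ₗ bop X (O.free X) J p (fun i => O.br X (cs i)) = O.br X (O.comp J c cs) := by
  refine X.hom_flat_ext J fun q b hb => ?_
  rw [lcmp, bop_flat_homog X (O.free X) J p _ q b hb, map_smul,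
    O.frAct_fin X c J (fun i => ⟨p i, ∑ m, q i m, cs i, tp R (b i), hc i,
      X.tprod_mem_tgr _ _ (hb i)⟩), sgn_smul_smul, X.join_tprod]

variable {X Y}

lemma free_bop_ext {P : Type u} [AddCommGroup P] [Module R P]
    {f g : (⨂[R]^k) (O.free X) →ₗ[R] P}
    (h : ∀ (J : Fin k → ℕ) (p : Fin k → ℤ) (cs : ∀ i, O.obj (J i)), (∀ i, cs i ∈ (O.obj (J i)).gr (p i)) →
      f ∘ₗ bop X (O.free X) J p (fun i => O.br X (cs i)) =
      g ∘ₗ bop X (O.free X) J p (fun i => O.br X (cs i))) : f = g := by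
  have hsp : ⊤ ≤ span R {t | ∃ (n : ℕ) (p : ℤ) (c : O.obj n) (q : Fin n → ℤ)
      (a : Fin n → X), c ∈ (O.obj n).gr p ∧ (∀ m, a m ∈ X.gr (q m)) ∧ t = O.br X c (tp R a)} := by
    intro z _
    set S := span R {t | ∃ (n : ℕ) (p : ℤ) (c : O.obj n) (q : Fin n → ℤ)
      (a : Fin n → X), c ∈ (O.obj n).gr p ∧ (∀ m, a m ∈ X.gr (q m)) ∧ t = O.br X c (tp R a)} with hS
    have : S.mkQ = 0 := by
      refine O.free_ext_homog fun n p q c x hc hx => ?_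
      refine lcongr (f := S.mkQ ∘ₗ O.br X c) (g := 0) (X.hom_ext _ _ fun q a ha => ?_) x
      rw [lcmp, Submodule.mkQ_apply, l_zero, Submodule.Quotient.mk_eq_zero]
      exact subset_span ⟨n, p, c, q, a, hc, ha, rfl⟩
    simpa using lcongr this z
  rw [← sub_eq_zero]
  refine pext (mext fun z => ?_)
  have := MultilinearMap.mem_of_forall_span (R := R) ((f - g).compMultilinearMap (tp R)) _ ⊥ (fun s hs => ?_) z
    (fun i => hsp Submodule.mem_top)
  · simpa using this
  · choose J p c q a hc ha hs using hs
    obtain rfl : s = fun i => O.br X (c i) (tp R (a i)) := funext hs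
    have h1 := lcongr (h J p c hc) (tp R (flat a))
    rw [lcmp, lcmp, bop_flat_homog X (O.free X) J p _ q a ha, map_smul, map_smul] at h1
    have h2 := sgn_smul_inj R _ h1
    rw [Submodule.mem_bot, l_mult, l_sub, sub_eq_zero]
    exact h2

lemma frAct_relabel (σ : Perm (Fin k)) (c : O.obj k) (w : (⨂[R]^k) (O.free X)) :
    O.frAct X (O.relabel σ c) ((O.free X).tmv σ w) = O.frAct X c w := by
  refine lcongr (f := O.frAct X (O.relabel σ c) ∘ₗ (O.free X).tmv σ)
    (g := O.frAct X c) (O.free_bop_ext fun J p cs hc => ?_) w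
  obtain ⟨J, rfl⟩ := exists_comp_perm (T := fun _ => ℕ) σ J
  obtain ⟨p, rfl⟩ := exists_comp_perm (T := fun _ => ℤ) σ p
  obtain ⟨cs, rfl⟩ := exists_comp_perm (T := fun i => O.obj (J i)) σ cs
  have hc' : ∀ i, cs i ∈ (O.obj (J i)).gr (p i) := by
    intro i
    obtain ⟨i, rfl⟩ := σ.surjective i
    exact hc i
  dsimp only
  have h := tmv_bop (B := O.free X) σ J p (fun i => O.br X (cs i)) (fun i => O.br_grT X (hc' i))
  rw [l_assoc]
  refine (congrArg (fun f => O.frAct X (O.relabel σ c) ∘ₗ f) h).trans ?_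
  rw [LinearMap.comp_smul, ← l_assoc,
    O.frAct_bop X J p _ cs hc', O.frAct_bop X (fun i => J (σ i)) (fun i => p (σ i)) c _ hc,
    O.comp_relabel_outer σ J p c cs hc']
  ext x
  simp only [l_mult, l_smul, lcmp, map_smul, br_relabel, smul_smul, koszul_mul_self, one_smul]

/-- The structure maps of the free algebra are associative. -/
lemma frAct_comp (j : Fin k → ℕ) (p : Fin k → ℤ) (c : O.obj k) (cs : ∀ i, O.obj (j i))
    (hc : ∀ i, cs i ∈ (O.obj (j i)).gr (p i)) :
    O.frAct X (O.comp j c cs) = O.frAct X c ∘ₗ bop (O.free X) (O.free X) j p (fun i => O.frAct X (cs i)) := by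
  refine O.free_bop_ext fun L P ys hy => ?_
  obtain ⟨l, rfl⟩ := exists_flat_dep (T := fun _ _ => ℕ) L
  obtain ⟨P, rfl⟩ := exists_flat P
  obtain ⟨ys, rfl⟩ := exists_flat_dep (T := fun i m => O.obj (l i m)) ys
  have hy' : ∀ i m, ys i m ∈ (O.obj (l i m)).gr (P i m) := by
    intro i m
    have key : ∀ t : Σ i, Fin (j i), t = ⟨i, m⟩ → ys t.1 t.2 ∈ (O.obj (l t.1 t.2)).gr (P t.1 t.2) →
      ys i m ∈ (O.obj (l i m)).gr (P i m) := by rintro t rfl h; exact h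
    exact key _ ((fsf).symm_apply_apply _) (hy (fsf ⟨i, m⟩))
  have e1 := O.frAct_bop X ♭(l)
    (flat P) (O.comp j c cs)
    ♭(ys) hy
  have e2 := bop_bop X (O.free X) (O.free X) j l p P (fun i => O.frAct X (cs i))
    (fun i m => O.br X (ys i m)) (fun i m => (O.br_grT X (hy' i m)).tpar)
  refine e1.trans ?_
  rw [l_assoc]
  refine Eq.trans ?_ (congrArg (fun f => O.frAct X c ∘ₗ f) e2.symm)
  rw [LinearMap.comp_smul, ← l_assoc]
  have e3 : (fun i => O.frAct X (cs i) ∘ₗ bop X (O.free X) (l i) (P i)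
      (fun m => O.br X (ys i m))) = fun i => O.br X (O.comp (l i) (cs i) (ys i)) :=
    funext fun i => O.frAct_bop X (l i) (P i) (cs i) (ys i) (hy' i)
  rw [e3, O.frAct_bop X _ _ c _ fun i => O.comp_gr (l i) _ _ _ _ (hc i) (hy' i)]
  ext x
  rw [l_mult, l_mult, ← O.br_relabel (finCongr (sum_arity j l)), O.comp_assoc j l p P c cs ys hc hy']
  simp

lemma frAct_mem_gr {p q : ℤ} {c : O.obj k} (hc : c ∈ (O.obj k).gr p)
    {w : (⨂[R]^k) (O.free X)} (hw : w ∈ (O.free X).tgr k q) :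
    O.frAct X c w ∈ (O.free X).gr (p + q) := by
  refine tgr_induction (((O.free X).gr (p + q)).comap (O.frAct X c)) (fun Q a ha hQ => ?_) hw
  refine MultilinearMap.mem_of_forall_span (R := R) ((O.frAct X c).compMultilinearMap (tp R)) _
    ((O.free X).gr (p + q)) (fun s hs => ?_) a ha
  choose J P Q' cs xs hcs hxs hPQ hs using hs
  obtain rfl : s = fun i => O.br X (cs i) (xs i) := funext hs
  rw [l_mult, O.frAct_fin X c J (fun i => ⟨P i, Q' i, cs i, xs i, hcs i, hxs i⟩)]
  refine smul_mem _ _ ?_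
  have : p + q = (p + ∑ i, P i) + ∑ i, Q' i := by
    rw [← hQ, add_assoc, ← sum_add_distrib]
    simp only [hPQ]
  rw [this]
  refine O.br_mem_gr (O.comp_gr J _ _ _ _ hc hcs) ?_
  have hx : ∀ i, xs i ∈ span R {t | ∃ (q : Fin (J i) → ℤ) (a : Fin (J i) → X),
    (∀ l, a l ∈ X.gr (q l)) ∧ ∑ l, q l = Q' i ∧ t = tp R a} := hxs
  refine MultilinearMap.mem_of_forall_span (R := R) ((X.join J).compMultilinearMap (tp R)) _
    (X.tgr _ (∑ i, Q' i)) (fun s hs => ?_) xs hx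
  choose q a ha hq hs using hs
  obtain rfl : s = fun i => tp R (a i) := funext hs
  rw [l_mult, X.join_tprod]
  have : ∑ i, Q' i = ∑ s, flat q s := by rw [sum_flat]; simp only [hq]
  rw [this]
  refine X.tprod_mem_tgr _ _ fun s => ?_
  obtain ⟨⟨i, m⟩, rfl⟩ := (fsf).surjective s
  rw [flat_fsf, flat_fsf]
  exact ha i m

variable (X) in
/-- The inclusion of `X` in the free algebra on `X`. -/
def frEta : X →ₗ[R] O.FreeMod X := O.br X O.one ∘ₗ X.tone

lemma frEta_apply (x : X) : O.frEta X x = O.br X O.one (X.tone x) := rfl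

lemma frEta_mem_gr {n : ℤ} {x : X} (hx : x ∈ X.gr n) : O.frEta X x ∈ (O.free X).gr n := by
  have := O.br_mem_gr O.one_gr (X.tone_mem_tgr hx)
  rwa [zero_add] at this

lemma frEta_gr : DGModule.GrMap X (O.free X) (O.frEta X) 0 := fun n x hx => by
  rw [zero_add]; exact O.frEta_mem_gr hx

lemma frAct_eta (c : O.obj k) (x : (⨂[R]^k) X) :
    O.frAct X c (pow(O.frEta X) x) = O.br X c x := by
  refine lcongr (f := O.frAct X c ∘ₗ pow(O.frEta X)) (g := O.br X c) (X.hom_ext _ _ fun q a ha => ?_) x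
  rw [lcmp, map_tp]
  have h := O.frAct_fin X c (fun _ => 1) (fun i => ⟨0, q i, O.one, X.tone (a i), O.one_gr, X.tone_mem_tgr (ha i)⟩)
  have h0 : unshuffleExp (fun _ : Fin k => 0) q = 0 := by simp [unshuffleExp]
  rw [h0, sgn_zero, one_smul] at h
  refine h.trans ?_
  simp only [X.tone_apply]
  rw [X.join_tprod (fun _ : Fin k => 1) (fun i _ => a i)]
  have h1 := O.comp_one c
  conv_rhs => rw [← h1]
  have h2 : X.tmv (finCongr (by simp : ∑ _ : Fin k, 1 = k)) (tp R
      (flat (j := fun _ : Fin k => 1) (fun i _ => a i))) = tp R a := by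
    rw [X.tmv_finCongr]
    congr 1
    funext l
    have : Fin.cast (by simp) l = (finSigmaFinEquiv (n := fun _ : Fin k => 1) ⟨l, 0⟩) := by
      apply Fin.ext
      rw [fsf_val]
      simp only [Fin.val_cast, Fin.val_zero, add_zero]
      rw [← Finset.sum_filter, Finset.sum_const, smul_eq_mul, mul_one]
      have : (Finset.univ.filter (· < l)).card = (l : ℕ) := by rw [Finset.filter_gt_eq_Iio, Fin.card_Iio]
      rw [this]
    rw [this, flat_fsf]
  rw [← h2, br_relabel]

lemma frAct_one (z : O.free X) : O.frAct X O.one ((O.free X).tone z) = z := by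
  refine lcongr (f := O.frAct X O.one ∘ₗ (O.free X).tone) (g := lid) (O.free_ext_homog fun k p q c x hc hx => ?_) z
  rw [lcmp, l_id]
  refine lcongr (f := (O.frAct X O.one ∘ₗ (O.free X).tone) ∘ₗ O.br X c)
    (g := O.br X c) (X.hom_ext _ _ fun q a ha => ?_) x
  rw [lcmp, lcmp, tone_apply]
  refine (O.frAct_fin X O.one (fun _ => k) (fun i => ⟨p, ∑ l, q l, c, tp R a, hc,
    X.tprod_mem_tgr q a ha⟩)).trans ?_
  have h0 : ∀ x y : ℤ, unshuffleExp (fun _ : Fin 1 => x) (fun _ : Fin 1 => y) = 0 := by intro x y; simp [unshuffleExp]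
  dsimp only
  rw [h0, sgn_zero, one_smul, X.join_tprod (fun _ : Fin 1 => k) (fun i => a)]
  have h1 := O.one_comp c
  conv_rhs => rw [← h1]
  have h2 : X.tmv (finCongr (by simp : ∑ _ : Fin 1, k = k)) (tp R
      (flat (j := fun _ : Fin 1 => k) (fun i => a))) = tp R a := by
    rw [X.tmv_finCongr]
    congr 1
    funext l
    have : Fin.cast (by simp) l = (finSigmaFinEquiv (n := fun _ : Fin 1 => k) ⟨0, l⟩) := by
      apply Fin.ext
      rw [fsf_val]
      simp
    rw [this, flat_fsf]
  rw [← h2, br_relabel]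

/-- The map of free algebras induced by a map of graded modules. -/
def freeFun (f : X →ₗ[R] Y) (hf : ∀ n, ∀ x ∈ X.gr n, f x ∈ Y.gr n) : O.FreeMod X →ₗ[R] O.FreeMod Y :=
  O.freeMap (fun _ => pmap fun _ => f) (fun _ σ x => (lcongr (tmv_map σ (fun _ => f) (fun _ => hf)) x).symm)

@[simp] lemma freeFun_br (f : X →ₗ[R] Y) (hf) (c : O.obj k) (x : (⨂[R]^k) X) :
    O.freeFun f hf (O.br X c x) = O.br Y c (pow(f) x) := by
  exact O.freeMap_br _ _ c x

lemma freeFun_eta (f : X →ₗ[R] Y) (hf) (x : X) : O.freeFun f hf (O.frEta X x) = O.frEta Y (f x) := by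
  rw [frEta_apply, freeFun_br, tone_map, frEta_apply]

lemma freeFun_mem_gr (f : X →ₗ[R] Y) (hf : ∀ n, ∀ x ∈ X.gr n, f x ∈ Y.gr n) (n : ℤ)
    (z : O.free X) (hz : z ∈ (O.free X).gr n) : O.freeFun f hf z ∈ (O.free Y).gr n := by
  have : O.frGr X n ≤ (O.frGr Y n).comap (O.freeFun f hf) := by
    refine span_le.2 ?_
    rintro _ ⟨k, p, q, c, x, hc, hx, rfl, rfl⟩
    rw [SetLike.mem_coe, mem_comap, freeFun_br]
    exact O.br_mem_gr hc (map_mem_tgr _ (fun _ => hf) hx)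
  exact this hz

lemma freeFun_act (f : X →ₗ[R] Y) (hf : ∀ n, ∀ x ∈ X.gr n, f x ∈ Y.gr n) (c : O.obj k)
    (w : (⨂[R]^k) (O.free X)) : O.freeFun f hf (O.frAct X c w) = O.frAct Y c (pow(O.freeFun f hf) w) := by
  refine lcongr (f := O.freeFun f hf ∘ₗ O.frAct X c) (g := O.frAct Y c ∘ₗ pow(O.freeFun f hf))
    (O.free_bop_ext fun J p cs hc => ?_) w
  rw [l_assoc, l_assoc, O.frAct_bop X J p c cs hc]
  have h := map_bop (B := O.free X) (B' := O.free Y) J p (fun i => O.br X (cs i))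
    (fun i => O.br Y (cs i)) f (hasPar_of_gr fun n x hx => by
      rw [zero_add]; exact hf n x hx) (O.freeFun f hf) (fun i x => O.freeFun_br f hf (cs i) x)
  refine Eq.trans ?_ (congrArg (fun g => O.frAct Y c ∘ₗ g) h.symm)
  rw [← l_assoc, O.frAct_bop Y J p c cs hc]
  ext x
  simp [-map_tp]

end Operad

/-! ### Derivations of the free algebra -/

namespace DGModule

lemma tDer_tone {A B : DGModule R} (f δ : A →ₗ[R] B) (a : A) : A.tDer f δ 1 (A.tone a) = B.tone (δ a) := by
  simp only [tDer, tone_apply, map_tp, Finset.univ_unique, Finset.sum_singleton]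
  congr 1
  funext i
  rw [Subsingleton.elim i default]
  simp

lemma map_tDer {A B A' B' : DGModule R} {f δ : A →ₗ[R] B} {f' δ' : A' →ₗ[R] B'} {g : A →ₗ[R] A'}
    {F : B →ₗ[R] B'} (hg : HasPar A A' g 0) (h1 : ∀ x, F (f x) = f' (g x))
    (h2 : ∀ x, F (δ x) = δ' (g x)) (k : ℕ) (x : (⨂[R]^k) A) :
    pow(F) (A.tDer f δ k x) = A'.tDer f' δ' k (pow(g) x) := by
  have hge : ∀ x, A'.eps 1 (g x) = g (A.eps 1 x) := fun x => by
    have := lcongr (hg 1) x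
    simpa [sgn_zero] using this
  rw [tDer, tDer, l_sum, l_sum, map_sum]
  refine sum_congr rfl fun i _ => ?_
  rw [← lcmp, ← lcmp, ← pmap_comp, ← pmap_comp]
  congr 2
  funext l
  ext y
  split_ifs <;> simp [h1, h2, hge]

end DGModule

namespace Operad

variable (O : Operad R) {X Y : DGModule R}

lemma eps_comp (J : Fin k → ℕ) (p : Fin k → ℤ) (c : O.obj k) (cs : ∀ i, O.obj (J i))
    (hc : ∀ i, cs i ∈ (O.obj (J i)).gr (p i)) :
    (O.obj _).eps 1 (O.comp J c cs) = sgn R (∑ i, p i) • O.comp J ((O.obj k).eps 1 c) cs := by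
  let L : O.obj k →ₗ[R] O.obj (∑ i, J i) :=
    { toFun := fun c => O.comp J c cs
      map_add' := fun c c' => by simp
      map_smul' := fun r c => by simp }
  refine lcongr (f := (O.obj _).eps 1 ∘ₗ L)
    (g := sgn R (∑ i, p i) • L ∘ₗ (O.obj k).eps 1) ((O.obj k).gr_ext _ _ fun q c hq => ?_) c
  have h : L c ∈ _ := O.comp_gr J q p c cs hq hc
  rw [lcmp, (O.obj _).eps_of_mem 1 h, l_smul, lcmp, (O.obj k).eps_of_mem 1 hq, map_smul, smul_smul, ← sgn_add]
  congr 2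
  ring

lemma d_comp' (J : Fin k → ℕ) (p : Fin k → ℤ) (c : O.obj k) (cs : ∀ i, O.obj (J i))
    (hc : ∀ i, cs i ∈ (O.obj (J i)).gr (p i)) :
    (O.obj _).d (O.comp J c cs) = O.comp J ((O.obj k).d c) cs +
      ∑ i, sgn R (∑ l, if l < i then p l else 0) • O.comp J ((O.obj k).eps 1 c)
        (update cs i ((O.obj (J i)).d (cs i))) := by
  rw [O.d_comp]
  congr 1
  refine sum_congr rfl fun i _ => ?_
  rw [sgn_sum, ← map_smul_univ]
  congr 1
  funext l
  rcases lt_trichotomy l i with h | rfl | h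
  · simp [h, h.ne, (O.obj (J l)).eps_of_mem 1 (hc l)]
  · simp [sgn_zero]
  · simp [h.not_gt, h.ne', sgn_zero]

/-- The derivation of the free algebra that extends `δ`, where the differential of the operad is
taken into account. -/
def frDer (δ : X →ₗ[R] O.free X) (hδ : DGModule.GrMap X (O.free X) δ (-1)) : O.FreeMod X →ₗ[R] O.FreeMod X :=
  O.freeLift (fun k => O.br X ∘ₗ (O.obj k).d + ((O.frAct X).compl₂ (X.tDer (O.frEta X) δ k)) ∘ₗ (O.obj k).eps 1)
    (fun k σ c x => by
      have h := lcongr (tmv_tDer (B := O.free X) O.frEta_gr (r := -1) (by decide) hδ σ) x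
      simp only [lcmp] at h
      simp only [l_add, lcmp, LinearMap.compl₂_apply, ← O.relabel_d, ← O.relabel_eps, br_relabel]
      congr 1
      exact (congrArg _ h.symm).trans (O.frAct_relabel σ _ _))

variable {δ : X →ₗ[R] O.free X} (hδ : DGModule.GrMap X (O.free X) δ (-1))

lemma frDer_br (c : O.obj k) (x : (⨂[R]^k) X) : O.frDer δ hδ (O.br X c x) = O.br X ((O.obj k).d c) x +
      O.frAct X ((O.obj k).eps 1 c) (X.tDer (O.frEta X) δ k x) := by
  exact O.freeLift_br _ _ c x

lemma frDer_eta (x : X) : O.frDer δ hδ (O.frEta X x) = δ x := by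
  rw [frEta_apply, frDer_br, O.d_one, (O.obj 1).eps_of_mem 1 O.one_gr, mul_zero, sgn_zero, one_smul]
  have h := tDer_tone (B := O.free X) (O.frEta X) δ x
  refine (congrArg (fun z => O.br X 0 (X.tone x) + O.frAct X O.one z) h).trans ?_
  dsimp only
  rw [map_zero, l_zero, zero_add]
  exact O.frAct_one (δ x)

lemma frDer_mem_gr {n : ℤ} {z : O.free X} (hz : z ∈ (O.free X).gr n) : O.frDer δ hδ z ∈ (O.free X).gr (n - 1) := by
  have : O.frGr X n ≤ (O.frGr X (n - 1)).comap (O.frDer δ hδ) := by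
    refine span_le.2 ?_
    rintro _ ⟨k, p, q, c, y, hc, hy, rfl, rfl⟩
    rw [SetLike.mem_coe, mem_comap, frDer_br]
    refine Submodule.add_mem _ ?_ ?_
    · rw [show p + q - 1 = (p - 1) + q by ring]
      exact O.br_mem_gr ((O.obj k).d_gr p c hc) hy
    · rw [show p + q - 1 = p + (-1 + q) by ring]
      exact O.frAct_mem_gr ((O.obj k).eps_mem 1 hc) (tDer_mem_tgr (B := O.free X) O.frEta_gr hδ hy)
  exact this hz

/-- The Leibniz rule. -/
lemma frDer_act (c : O.obj k) (w : (⨂[R]^k) (O.free X)) :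
    O.frDer δ hδ (O.frAct X c w) = O.frAct X ((O.obj k).d c) w + O.frAct X ((O.obj k).eps 1 c)
        ((O.free X).tDer lid (O.frDer δ hδ) k w) := by
  refine lcongr (f := O.frDer δ hδ ∘ₗ O.frAct X c) (g := O.frAct X ((O.obj k).d c) + O.frAct X ((O.obj k).eps 1 c) ∘ₗ
      (O.free X).tDer lid (O.frDer δ hδ) k)
    (O.free_bop_ext fun J p cs hc => ?_) w
  set bp := bop X (O.free X) J p (fun i => O.br X (cs i)) with hbp
  have hB : ∀ c, O.frAct X c ∘ₗ bp = O.br X (O.comp J c cs) := fun c => O.frAct_bop X J p c cs hc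
  have key := tDer_bop (A := X) (B := O.free X) (A' := O.free X) (f := O.frEta X) (δ := δ)
    (DGModule.GrMap.hasPar O.frEta_gr) (r := -1) (by decide) hδ.hasPar (O.frDer δ hδ) J p
    (fun i => O.frAct X (cs i)) (fun i => O.br X (cs i)) (fun i => O.br X ((O.obj (J i)).d (cs i)))
    (fun i => lext fun x => (O.frAct_eta (cs i) x).symm)
    (fun i => (O.br_grT X (hc i)).tpar)
    (fun i => lext fun x => by
      rw [lcmp, frDer_br, (O.obj (J i)).eps_of_mem 1 (hc i), one_mul, map_smul]
      rfl)
  refine lext fun x => ?_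
  have key2 := lcongr key x
  have hBx : ∀ c, O.frAct X c (bp x) = O.br X (O.comp J c cs) x := fun c => lcongr (hB c) x
  have lhs : (O.frDer δ hδ ∘ₗ O.frAct X c) (bp x) = _ := (congrArg (O.frDer δ hδ) (hBx c)).trans (O.frDer_br hδ _ x)
  refine lhs.trans ?_
  have rhs : (O.frAct X ((O.obj k).d c) + O.frAct X ((O.obj k).eps 1 c) ∘ₗ
      (O.free X).tDer lid (O.frDer δ hδ) k) (bp x) =
      O.br X (O.comp J ((O.obj k).d c) cs) x + O.frAct X ((O.obj k).eps 1 c)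
      ((O.free X).tDer lid (O.frDer δ hδ) k (bp x)) :=
    congrArg (· + _) (hBx _)
  refine Eq.trans ?_ rhs.symm
  have key3 := congrArg (O.frAct X ((O.obj k).eps 1 c)) key2
  refine Eq.trans ?_ (congrArg (O.br X (O.comp J ((O.obj k).d c) cs) x + ·) key3.symm)
  rw [O.d_comp' J p c cs hc, O.eps_comp J p c cs hc, l_add, map_add, map_add, l_add, add_assoc]
  congr 1
  have h4 : O.frAct X (O.comp J ((O.obj k).eps 1 c) cs) = _ := O.frAct_comp J p _ cs hc
  rw [map_smul, h4]
  congr 1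
  · rw [map_sum, l_sum, l_sum, map_sum]
    refine sum_congr rfl fun i _ => ?_
    rw [map_smul, l_smul, l_smul, map_smul]
    congr 1
    have h5 : (update (fun i => O.br X (cs i)) i (O.br X ((O.obj (J i)).d (cs i)))) =
        fun l => O.br X (update cs i ((O.obj (J i)).d (cs i)) l) := by
      funext l
      rcases eq_or_ne l i with rfl | h
      · simp
      · simp [h]
    rw [h5]
    refine (lcongr (O.frAct_bop X J (update p i (p i - 1)) ((O.obj k).eps 1 c) _ (fun l => ?_)) x).symm
    rcases eq_or_ne l i with rfl | h
    · simpa using (O.obj (J l)).d_gr _ _ (hc l)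
    · simpa [h] using hc l
  · rw [l_smul, l_smul, map_smul]
    rfl

end Operad

/-! ### The graded module of trees -/

namespace DGModule

lemma isInternal_of_separating {M : Type*} [AddCommGroup M] [Module R M] {G : ℤ → Submodule R M}
    (hG : ⨆ n, G n = ⊤) {ι : Type*} {A : ι → DGModule R} (p : ∀ k, M →ₗ[R] A k)
    (hp : ∀ k n, ∀ x ∈ G n, p k x ∈ (A k).gr n) (hinj : ∀ x, (∀ k, p k x = 0) → x = 0) :
    DirectSum.IsInternal G := by
  constructor
  · rw [injective_iff_map_eq_zero]
    intro x hx
    have h : ∀ k κ (_ : IsCoaction (A k).gr κ), ∀ x : DirectSum ℤ (fun n => G n), ∀ n,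
        κ (p k (DirectSum.coeAddMonoidHom G x)) n = p k (x n) := by
      intro k κ hκ x n
      induction x using DirectSum.induction_on with
      | zero => simp
      | of m x =>
        rw [DirectSum.coeAddMonoidHom_of, hκ m _ (hp k m x x.2)]
        rcases eq_or_ne m n with rfl | h
        · simp
        · rw [Finsupp.single_eq_of_ne h.symm, DirectSum.of_eq_of_ne _ _ _ h.symm]; simp
      | add x y hx hy => rw [map_add, map_add, map_add, Finsupp.add_apply, hx, hy]; simp
    ext n
    refine hinj _ fun k => ?_
    obtain ⟨κ, hκ⟩ := (A k).exists_coaction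
    rw [← h k κ hκ x n, hx]
    simp
  · intro x
    have hx : x ∈ ⨆ n, G n := by rw [hG]; trivial
    induction hx using Submodule.iSup_induction' with
    | mem n x hx => exact ⟨DirectSum.of _ n ⟨x, hx⟩, by rw [DirectSum.coeAddMonoidHom_of]⟩
    | zero => exact ⟨0, map_zero _⟩
    | add x y _ _ hx hy =>
      obtain ⟨a, rfl⟩ := hx
      obtain ⟨b, rfl⟩ := hy
      exact ⟨a + b, map_add _ _ _⟩

/-- Maps of complexes. -/
@[ext]
structure Mor (A B : DGModule R) where
  f : A →ₗ[R] B
  f_gr : ∀ n, ∀ x ∈ A.gr n, f x ∈ B.gr n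
  f_d : ∀ x, f (A.d x) = B.d (f x)

namespace Mor

variable {A B C : DGModule R}

/-- The identity. -/
def id (A : DGModule R) : Mor A A := ⟨lid, fun _ _ h => h, fun _ => rfl⟩

/-- The composite. -/
def comp (g : Mor B C) (f : Mor A B) : Mor A C :=
  ⟨g.f ∘ₗ f.f, fun n x h => g.f_gr n _ (f.f_gr n x h), fun x => by simp [f.f_d, g.f_d]⟩

lemma hasPar (f : Mor A B) : HasPar A B f.f 0 := hasPar_of_gr fun n x hx => by rw [zero_add]; exact f.f_gr n x hx

end Mor

/-- The complex `E ⊕ Y[1]`. -/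
abbrev cosum (E Y : DGModule R) : DGModule R where
  carrier := E × Y
  gr n := (E.gr n).prod (Y.gr (n - 1))
  internal := by
    obtain ⟨κ, hκ⟩ := E.exists_coaction
    obtain ⟨κ', hκ'⟩ := Y.exists_coaction
    refine isInternal_of_coaction (κ :=
      Finsupp.lsum R (fun n => Finsupp.lsingle n ∘ₗ LinearMap.inl R E Y) ∘ₗ κ ∘ₗ LinearMap.fst R E Y +
      Finsupp.lsum R (fun n => Finsupp.lsingle (n + 1) ∘ₗ LinearMap.inr R E Y) ∘ₗ κ' ∘ₗ LinearMap.snd R E Y) ?_ ?_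
    · rw [eq_top_iff]
      rintro ⟨a, y⟩ -
      have h1 : ∀ a, (LinearMap.inl R E Y a) ∈ ⨆ n, (E.gr n).prod (Y.gr (n - 1)) := by
        intro a
        have ha : a ∈ ⨆ n, E.gr n := by rw [E.internal.submodule_iSup_eq_top]; trivial
        refine (iSup_le (a := comap (LinearMap.inl R E Y) (⨆ n, (E.gr n).prod (Y.gr (n - 1)))) fun n x hx => ?_) ha
        exact mem_iSup_of_mem n ⟨hx, zero_mem _⟩
      have h2 : ∀ y, (LinearMap.inr R E Y y) ∈ ⨆ n, (E.gr n).prod (Y.gr (n - 1)) := by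
        intro y
        have hy : y ∈ ⨆ n, Y.gr n := by rw [Y.internal.submodule_iSup_eq_top]; trivial
        refine (iSup_le (a := comap (LinearMap.inr R E Y) (⨆ n, (E.gr n).prod (Y.gr (n - 1)))) fun n x hx => ?_) hy
        refine mem_iSup_of_mem (n + 1) ⟨zero_mem _, ?_⟩
        rw [add_sub_cancel_right]; exact hx
      have := add_mem (h1 a) (h2 y)
      simpa using this
    · rintro n ⟨a, y⟩ ⟨ha, hy⟩
      dsimp only at ha hy
      simp only [l_add, lcmp, LinearMap.fst_apply,
        LinearMap.snd_apply, hκ n a ha, hκ' _ y hy, Finsupp.lsum_single, Finsupp.lsingle_apply,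
        sub_add_cancel, LinearMap.inl_apply, LinearMap.inr_apply, ← Finsupp.single_add,
        Prod.mk_add_mk, add_zero, zero_add]
  d := E.d.prodMap (-Y.d)
  d_gr n x hx := ⟨E.d_gr n _ hx.1, neg_mem (Y.d_gr _ _ hx.2)⟩
  d_d x := by
    refine Prod.ext ?_ ?_
    · exact E.d_d _
    · change -Y.d (-Y.d x.2) = 0
      rw [map_neg, Y.d_d, neg_zero, neg_zero]

/-- The inclusion of the first summand. -/
def cosumInl (E Y : DGModule R) : Mor E (E.cosum Y) :=
  ⟨LinearMap.inl R E Y, fun _ _ h => ⟨h, zero_mem _⟩, fun x => by simp⟩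

/-- The projection to the first summand. -/
def cosumFst (E Y : DGModule R) : Mor (E.cosum Y) E := ⟨LinearMap.fst R E Y, fun _ _ h => h.1, fun x => by simp⟩

/-- The map of sums induced by maps of the summands. -/
def cosumMap {E E' Y Y' : DGModule R} (f : Mor E E') (g : Mor Y Y') : Mor (E.cosum Y) (E'.cosum Y') :=
  ⟨f.f.prodMap g.f, fun _ _ h => ⟨f.f_gr _ _ h.1, g.f_gr _ _ h.2⟩, fun x => by
    refine Prod.ext ?_ ?_
    · exact f.f_d _
    · change g.f (-Y.d x.2) = - Y'.d (g.f x.2)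
      rw [map_neg, g.f_d]⟩

end DGModule

namespace Operad

variable (O : Operad R)

lemma free_ext_tprod {X : DGModule R} {P : Type u} [AddCommGroup P] [Module R P]
    {f g : O.FreeMod X →ₗ[R] P} (h : ∀ (k : ℕ) (c : O.obj k) (x : Fin k → X),
      f (O.br X c (tp R x)) = g (O.br X c (tp R x))) : f = g :=
  O.free_ext fun k c => lcongr (f := f ∘ₗ O.br X c) (g := g ∘ₗ O.br X c) (pext (mext fun x => h k c x))

lemma free_induction_tprod {X : DGModule R} (S : Submodule R (O.FreeMod X))
    (h : ∀ (k : ℕ) (c : O.obj k) (x : Fin k → X), O.br X c (tp R x) ∈ S)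
    (z : O.FreeMod X) : z ∈ S := by
  have : S.mkQ = 0 := O.free_ext_tprod fun k c x => by simpa using h k c x
  have h2 := lcongr this z
  simpa using h2

lemma freeFun_frD {X Y : DGModule R} (f : Mor X Y) (x : O.FreeMod X) :
    O.freeFun f.f f.f_gr (O.frD X x) = O.frD Y (O.freeFun f.f f.f_gr x) := by
  refine lcongr (f := O.freeFun f.f f.f_gr ∘ₗ O.frD X)
    (g := O.frD Y ∘ₗ O.freeFun f.f f.f_gr) (O.free_ext fun k c x => ?_) x
  have h := map_tDer (f := lid) (δ := X.d) (f' := lid) (δ' := Y.d) (g := f.f)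
    (F := f.f) f.hasPar (fun _ => rfl) f.f_d k x
  rw [← tD_eq_tDer, ← tD_eq_tDer] at h
  rw [lcmp, lcmp, frD_br, map_add, freeFun_br, freeFun_br, freeFun_br, frD_br, h]

/-- The functor that takes `X` to the free algebra on `X`. -/
def freeMor {X Y : DGModule R} (f : Mor X Y) : Mor (O.free X) (O.free Y) :=
  ⟨O.freeFun f.f f.f_gr, O.freeFun_mem_gr f.f f.f_gr, O.freeFun_frD f⟩

lemma freeMor_br {X Y : DGModule R} (f : Mor X Y) (c : O.obj k) (x : (⨂[R]^k) X) :
    (O.freeMor f).f (O.br X c x) = O.br Y c (pow(f.f) x) :=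
  O.freeFun_br f.f f.f_gr c x

lemma freeFun_id {X : DGModule R} {f : X →ₗ[R] X} (e : f = lid) (h) : O.freeFun f h = lid := by
  subst e
  exact O.free_ext fun k c x => (O.freeFun_br _ _ c x).trans (by rw [pmap_id]; rfl)

lemma freeFun_comp {X Y Z : DGModule R} {g : Y →ₗ[R] Z} {f : X →ₗ[R] Y} {φ : X →ₗ[R] Z} (e : φ = g ∘ₗ f) (hg hf h) :
    O.freeFun φ h = O.freeFun g hg ∘ₗ O.freeFun f hf := by
  subst e
  refine O.free_ext fun k c x => ?_
  rw [lcmp, freeFun_br, freeFun_br, freeFun_br]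
  exact congrArg _ (lcongr (pmap_comp (fun _ : Fin k => g) fun _ => f) x)

lemma freeMor_id (X : DGModule R) : O.freeMor (Mor.id X) = Mor.id (O.free X) := Mor.ext (O.freeFun_id rfl (Mor.id X).f_gr)

lemma freeMor_comp {X Y Z : DGModule R} (g : Mor Y Z) (f : Mor X Y) :
    O.freeMor (g.comp f) = (O.freeMor g).comp (O.freeMor f) := Mor.ext (O.freeFun_comp rfl g.f_gr f.f_gr (g.comp f).f_gr)

variable (E : DGModule R)

/-- The complex of trees of height at most `h`, with leaves labelled by `E`: a tree is a leaf or
is obtained by grafting an element of the free algebra on the trees of smaller height. -/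
def tower : ℕ → DGModule R
  | 0 => E
  | h + 1 => E.cosum (O.free (tower h))

/-- The inclusions of towers and the retractions that cut off higher trees. -/
def tr : ∀ m n, Mor (O.tower E m) (O.tower E n)
  | 0, 0 => Mor.id E
  | 0, n + 1 => cosumInl E (O.free (O.tower E n))
  | m + 1, 0 => cosumFst E (O.free (O.tower E m))
  | m + 1, n + 1 => cosumMap (Mor.id E) (O.freeMor (tr m n))

lemma tr_self : ∀ m, O.tr E m m = Mor.id _
  | 0 => rfl
  | m + 1 => by
    change cosumMap (Mor.id E) (O.freeMor (O.tr E m m)) = Mor.id (E.cosum (O.free (O.tower E m)))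
    rw [tr_self m, freeMor_id]
    rfl

lemma tr_comp : ∀ a b n, a ≤ b → (O.tr E b n).comp (O.tr E a b) = O.tr E a n
  | 0, 0, 0, _ => rfl
  | 0, 0, _ + 1, _ => rfl
  | 0, _ + 1, 0, _ => rfl
  | 0, b + 1, n + 1, _ => by
    change (cosumMap (Mor.id E) (O.freeMor (O.tr E b n))).comp (cosumInl E _) = cosumInl E _
    refine Mor.ext (lext fun x => Prod.ext rfl ?_)
    exact map_zero (O.freeMor (O.tr E b n)).f
  | a + 1, b + 1, 0, _ => rfl
  | a + 1, b + 1, n + 1, h => by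
    change (cosumMap (Mor.id E) (O.freeMor (O.tr E b n))).comp
      (cosumMap (Mor.id E) (O.freeMor (O.tr E a b))) = cosumMap (Mor.id E) (O.freeMor (O.tr E a n))
    rw [← tr_comp a b n (by omega), freeMor_comp]
    rfl

/-- The inclusion of the `m`-th tower in the product of all towers. -/
def trPi (m : ℕ) : O.tower E m →ₗ[R] ∀ n, O.tower E n := LinearMap.pi fun n => (O.tr E m n).f

lemma trPi_tr {a b : ℕ} (h : a ≤ b) (y : O.tower E a) : O.trPi E b ((O.tr E a b).f y) = O.trPi E a y := by
  funext n
  exact congrArg (fun f => f.f y) (O.tr_comp E a b n h)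

/-- The union of the towers. -/
def treeSub : Submodule R (∀ n, O.tower E n) := ⨆ m, range (O.trPi E m)

lemma mem_treeSub {x : ∀ n, O.tower E n} : x ∈ O.treeSub E ↔ ∃ m y, O.trPi E m y = x := by
  rw [treeSub, mem_iSup_of_directed]
  · rfl
  · refine Monotone.directed_le fun a b h => ?_
    rintro _ ⟨y, rfl⟩
    exact ⟨_, O.trPi_tr E h y⟩

lemma trPi_mem (m : ℕ) (y : O.tower E m) : O.trPi E m y ∈ O.treeSub E := (O.mem_treeSub E).2 ⟨m, y, rfl⟩

/-- The part of degree `n` of the module of trees. -/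
def treeGr (n : ℤ) : Submodule R (O.treeSub E) :=
  ⨅ k, ((O.tower E k).gr n).comap (LinearMap.proj k ∘ₗ (O.treeSub E).subtype)

lemma mem_treeGr {n : ℤ} {x : O.treeSub E} : x ∈ O.treeGr E n ↔ ∀ k, x.1 k ∈ (O.tower E k).gr n := by simp [treeGr]

lemma treeGr_internal : DirectSum.IsInternal (O.treeGr E) := by
  refine isInternal_of_separating (A := O.tower E) ?_ (fun k => LinearMap.proj k ∘ₗ (O.treeSub E).subtype)
    (fun k n x hx => (O.mem_treeGr E).1 hx k) (fun x hx => Subtype.ext (funext hx))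
  rw [eq_top_iff]
  rintro ⟨x, hx⟩ -
  obtain ⟨m, y, rfl⟩ := (O.mem_treeSub E).1 hx
  have hy : y ∈ ⨆ n, (O.tower E m).gr n := by rw [(O.tower E m).internal.submodule_iSup_eq_top]; trivial
  have : ⨆ n, (O.tower E m).gr n ≤ comap
      ((O.trPi E m).codRestrict _ (O.trPi_mem E m)) (⨆ n, O.treeGr E n) := iSup_le fun n y hy =>
    mem_iSup_of_mem n ((O.mem_treeGr E).2 fun k => (O.tr E m k).f_gr n y hy)
  exact this hy

/-- The complex of all trees, with leaves labelled by `E`. -/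
abbrev tree : DGModule R where
  carrier := O.treeSub E
  gr := O.treeGr E
  internal := O.treeGr_internal E
  d := ((LinearMap.pi fun n => (O.tower E n).d ∘ₗ LinearMap.proj n) ∘ₗ (O.treeSub E).subtype).codRestrict _ (by
      rintro ⟨x, hx⟩
      obtain ⟨m, y, rfl⟩ := (O.mem_treeSub E).1 hx
      refine (O.mem_treeSub E).2 ⟨m, (O.tower E m).d y, ?_⟩
      funext n
      exact (O.tr E m n).f_d y)
  d_gr n x hx := (O.mem_treeGr E).2 fun k => (O.tower E k).d_gr n _ ((O.mem_treeGr E).1 hx k)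
  d_d x := Subtype.ext (funext fun n => (O.tower E n).d_d _)

/-- The inclusion of the trees of bounded height. -/
def tin (m : ℕ) : Mor (O.tower E m) (O.tree E) where
  f := (O.trPi E m).codRestrict _ (O.trPi_mem E m)
  f_gr n y hy := (O.mem_treeGr E).2 fun k => (O.tr E m k).f_gr n y hy
  f_d y := Subtype.ext (funext fun n => (O.tr E m n).f_d y)

/-- The map that cuts off trees above a given height. -/
def tpr (n : ℕ) : Mor (O.tree E) (O.tower E n) where
  f := LinearMap.proj n ∘ₗ (O.treeSub E).subtype
  f_gr _ _ hx := (O.mem_treeGr E).1 hx n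
  f_d _ := rfl

lemma tpr_tin (m n : ℕ) : (O.tpr E n).comp (O.tin E m) = O.tr E m n := rfl

lemma tree_hext {x y : O.tree E} (h : ∀ n, (O.tpr E n).f x = (O.tpr E n).f y) : x = y := Subtype.ext (funext h)

lemma tin_tr {a b : ℕ} (h : a ≤ b) (y : O.tower E a) :
    (O.tin E b).f ((O.tr E a b).f y) = (O.tin E a).f y := Subtype.ext (O.trPi_tr E h y)

lemma exists_tin (x : O.tree E) : ∃ m y, (O.tin E m).f y = x := by
  obtain ⟨m, y, h⟩ := (O.mem_treeSub E).1 x.2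
  exact ⟨m, y, Subtype.ext h⟩

lemma exists_tin_le (x : O.tree E) : ∃ m, ∀ n, m ≤ n → ∃ y, (O.tin E n).f y = x := by
  obtain ⟨m, y, h⟩ := O.exists_tin E x
  exact ⟨m, fun n hn => ⟨(O.tr E m n).f y, by rw [tin_tr _ _ hn, h]⟩⟩

lemma free_exists_tin (w : O.free (O.tree E)) : ∃ m w', (O.freeMor (O.tin E m)).f w' = w := by
  have hdir : Monotone fun m => range (O.freeMor (O.tin E m)).f := by
    intro a b h
    rintro _ ⟨y, rfl⟩
    refine ⟨(O.freeMor (O.tr E a b)).f y, ?_⟩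
    have : (O.tin E b).comp (O.tr E a b) = O.tin E a := Mor.ext (lext fun y => O.tin_tr E h y)
    rw [← this, freeMor_comp]
    rfl
  have : w ∈ ⨆ m, range (O.freeMor (O.tin E m)).f := by
    refine O.free_induction_tprod _ (fun k c x => ?_) w
    choose m hm using fun l => O.exists_tin_le E (x l)
    choose y hy using fun l => hm l (∑ l, m l) (single_le_sum (by simp) (mem_univ l))
    refine mem_iSup_of_mem (∑ l, m l) ⟨O.br _ c (tp R y), ?_⟩
    rw [freeMor_br, map_tp]
    simp only [hy]
  rwa [mem_iSup_of_directed _ hdir.directed_le] at this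

end Operad

/-! ### Leaves and grafting -/

namespace Operad

variable (O : Operad R) (E : DGModule R)

/-- The inclusion of the trees that consist of a leaf. -/
def leaf : Mor E (O.tree E) := O.tin E 0

/-- The projection onto the trees that consist of a leaf. -/
def root : Mor (O.tree E) E := O.tpr E 0

@[simp] lemma root_leaf (a : E) : (O.root E).f ((O.leaf E).f a) = a := rfl

/-- The decomposition of a tower into leaves and trees with a root. -/
def tcons (m : ℕ) : (E × O.FreeMod (O.tower E m)) →ₗ[R] O.tower E (m + 1) := lid

/-- The values of `graft` in the towers. -/
def graftPi : O.FreeMod (O.tree E) →ₗ[R] ∀ n, O.tower E n :=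
  LinearMap.pi fun n => match n with
    | 0 => (0 : O.FreeMod (O.tree E) →ₗ[R] E)
    | n + 1 => LinearMap.inr R E (O.FreeMod (O.tower E n)) ∘ₗ (O.freeMor (O.tpr E n)).f

lemma graftPi_tin (m : ℕ) (w : O.FreeMod (O.tower E m)) : O.graftPi E ((O.freeMor (O.tin E m)).f w) =
      O.trPi E (m + 1) (O.tcons E m (0, w)) := by
  funext n
  cases n with
  | zero => rfl
  | succ n =>
    have h : (O.freeMor (O.tpr E n)).f ((O.freeMor (O.tin E m)).f w) = (O.freeMor (O.tr E m n)).f w := by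
      rw [← tpr_tin, freeMor_comp]; rfl
    exact Prod.ext rfl h

/-- The map that grafts an element of the free algebra on trees to a tree. -/
def graft : O.FreeMod (O.tree E) →ₗ[R] O.tree E :=
  (O.graftPi E).codRestrict _ fun w => by
    obtain ⟨m, w, rfl⟩ := O.free_exists_tin E w
    rw [graftPi_tin]
    exact O.trPi_mem E _ _

lemma graft_tin (m : ℕ) (w : O.FreeMod (O.tower E m)) : O.graft E ((O.freeMor (O.tin E m)).f w) =
      (O.tin E (m + 1)).f (O.tcons E m (0, w)) :=
  Subtype.ext (O.graftPi_tin E m w)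

lemma tin_succ (m : ℕ) (a : E) (w : O.FreeMod (O.tower E m)) : (O.tin E (m + 1)).f (O.tcons E m (a, w)) =
      (O.leaf E).f a + O.graft E ((O.freeMor (O.tin E m)).f w) := by
  have h : (O.leaf E).f a = (O.tin E (m + 1)).f (O.tcons E m (a, 0)) := (O.tin_tr E (Nat.zero_le (m + 1)) a).symm
  rw [graft_tin, h, ← map_add, ← map_add, Prod.mk_add_mk, add_zero, zero_add]

@[simp] lemma root_graft (w : O.FreeMod (O.tree E)) : (O.root E).f (O.graft E w) = 0 := rfl

lemma graft_gr (n : ℤ) (w : O.FreeMod (O.tree E)) (hw : w ∈ (O.free (O.tree E)).gr n) :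
    O.graft E w ∈ (O.tree E).gr (n + 1) := by
  refine (O.mem_treeGr E).2 fun k => ?_
  cases k with
  | zero => exact zero_mem _
  | succ k =>
    refine ⟨zero_mem _, ?_⟩
    rw [add_sub_cancel_right]
    exact (O.freeMor (O.tpr E k)).f_gr n w hw

lemma d_graft (w : O.FreeMod (O.tree E)) : (O.tree E).d (O.graft E w) = - O.graft E (O.frD (O.tree E) w) := by
  refine O.tree_hext E fun n => ?_
  cases n with
  | zero =>
    change E.d 0 = - 0
    simp
  | succ n =>
    refine Prod.ext ?_ ?_
    · change E.d 0 = - 0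
      simp
    · change - O.frD _ ((O.freeMor (O.tpr E n)).f w) = - (O.freeMor (O.tpr E n)).f (O.frD _ w)
      rw [show O.frD (O.tree E) w = (O.free (O.tree E)).d w from rfl, (O.freeMor (O.tpr E n)).f_d]

lemma graft_gr_iff {n : ℤ} {w : O.FreeMod (O.tree E)} (hw : O.graft E w ∈ (O.tree E).gr (n + 1)) :
    w ∈ (O.free (O.tree E)).gr n := by
  obtain ⟨m, w, rfl⟩ := O.free_exists_tin E w
  have h1 := ((O.mem_treeGr E).1 hw (m + 1)).2
  rw [add_sub_cancel_right] at h1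
  have h2 : (O.freeMor (O.tpr E m)).f ((O.freeMor (O.tin E m)).f w) = w := by
    have : (O.freeMor (O.tpr E m)).comp (O.freeMor (O.tin E m)) = Mor.id _ := by
      rw [← freeMor_comp, tpr_tin, tr_self, freeMor_id]
    exact congrArg (fun f => f.f w) this
  have h3 : (O.freeMor (O.tpr E m)).f ((O.freeMor (O.tin E m)).f w) ∈ (O.free (O.tower E m)).gr n := h1
  rw [h2] at h3
  exact (O.freeMor (O.tin E m)).f_gr n w h3

lemma leaf_add_graft_injective : Injective
    ((O.leaf E).f.coprod (O.graft E) : E × O.FreeMod (O.tree E) →ₗ[R] O.tree E) := by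
  rw [injective_iff_map_eq_zero]
  rintro ⟨a, w⟩ h
  rw [LinearMap.coprod_apply] at h
  have ha : a = 0 := by
    have := congrArg (O.root E).f h
    rwa [map_add, root_leaf, root_graft, add_zero, map_zero] at this
  subst ha
  rw [map_zero, zero_add] at h
  refine Prod.ext rfl ?_
  obtain ⟨m, w, rfl⟩ := O.free_exists_tin E w
  have h2 : (O.freeMor (O.tpr E m)).f ((O.freeMor (O.tin E m)).f w) = w := by
    have : (O.freeMor (O.tpr E m)).comp (O.freeMor (O.tin E m)) = Mor.id _ := by
      rw [← freeMor_comp, tpr_tin, tr_self, freeMor_id]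
    exact congrArg (fun f => f.f w) this
  have h3 : (O.freeMor (O.tpr E m)).f ((O.freeMor (O.tin E m)).f w) = 0 :=
    congrArg (fun x : O.tree E => (x.1 (m + 1) : E × O.FreeMod (O.tower E m)).2) h
  rw [h2] at h3
  dsimp only
  rw [h3, map_zero]
  rfl

lemma leaf_add_graft_surjective : Function.Surjective
    ((O.leaf E).f.coprod (O.graft E) : E × O.FreeMod (O.tree E) →ₗ[R] O.tree E) := by
  intro x
  obtain ⟨m, y, rfl⟩ := O.exists_tin E x
  cases m with
  | zero => exact ⟨(y, 0), by simp; rfl⟩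
  | succ m =>
    obtain ⟨a, w⟩ := (show E × O.FreeMod (O.tower E m) from y)
    exact ⟨(a, (O.freeMor (O.tin E m)).f w), (O.tin_succ E m a w).symm⟩

/-- The inverse of `graft` on the trees that are not leaves. -/
def ungraft : O.tree E →ₗ[R] O.FreeMod (O.tree E) :=
  LinearMap.snd R E _ ∘ₗ (LinearEquiv.ofBijective _
    ⟨O.leaf_add_graft_injective E, O.leaf_add_graft_surjective E⟩).symm.toLinearMap

lemma ungraft_add (a : E) (w : O.FreeMod (O.tree E)) : O.ungraft E ((O.leaf E).f a + O.graft E w) = w := by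
  have : (LinearEquiv.ofBijective _ ⟨O.leaf_add_graft_injective E, O.leaf_add_graft_surjective E⟩).symm
      ((O.leaf E).f a + O.graft E w) = (a, w) := by
    rw [LinearEquiv.symm_apply_eq]; rfl
  rw [ungraft, lcmp, LinearEquiv.coe_coe, this]; rfl

@[simp] lemma ungraft_leaf (a : E) : O.ungraft E ((O.leaf E).f a) = 0 := by
  have := O.ungraft_add E a 0
  rwa [map_zero, add_zero] at this

@[simp] lemma ungraft_graft (w : O.FreeMod (O.tree E)) : O.ungraft E (O.graft E w) = w := by
  have := O.ungraft_add E 0 w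
  rwa [map_zero, zero_add] at this

lemma leaf_root_add (x : O.tree E) : (O.leaf E).f ((O.root E).f x) + O.graft E (O.ungraft E x) = x := by
  obtain ⟨⟨a, w⟩, rfl⟩ := O.leaf_add_graft_surjective E x
  rw [LinearMap.coprod_apply, ungraft_add, map_add, root_leaf, root_graft, add_zero]

lemma ungraft_gr (n : ℤ) (x : O.tree E) (hx : x ∈ (O.tree E).gr n) :
    O.ungraft E x ∈ (O.free (O.tree E)).gr (n - 1) := by
  apply O.graft_gr_iff E
  rw [sub_add_cancel, ← sub_eq_iff_eq_add'.2 (O.leaf_root_add E x).symm]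
  exact sub_mem hx ((O.leaf E).f_gr n _ ((O.root E).f_gr n x hx))

/-- Induction on trees. -/
lemma tree_induction (S : Submodule R (O.tree E)) (h0 : ∀ a, (O.leaf E).f a ∈ S)
    (h1 : ∀ (k : ℕ) (c : O.obj k) (x : Fin k → O.tree E), (∀ i, x i ∈ S) →
      O.graft E (O.br _ c (tp R x)) ∈ S) (x : O.tree E) : x ∈ S := by
  have h : ∀ m y, (O.tin E m).f y ∈ S := by
    intro m
    induction m with
    | zero => exact h0
    | succ m ih =>
      intro y
      obtain ⟨a, w⟩ := (show E × O.FreeMod (O.tower E m) from y)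
      refine (O.tin_succ E m a w).symm ▸ add_mem (h0 a) ?_
      refine O.free_induction_tprod (comap (O.graft E ∘ₗ (O.freeMor (O.tin E m)).f) S) (fun k c x => ?_) w
      rw [mem_comap, lcmp, freeMor_br, map_tp]
      exact h1 k c _ fun i => ih (x i)
  obtain ⟨m, y, rfl⟩ := O.exists_tin E x
  exact h m y

lemma tree_ext {P : Type*} [AddCommGroup P] [Module R P] {f g : O.tree E →ₗ[R] P}
    (h0 : ∀ a, f ((O.leaf E).f a) = g ((O.leaf E).f a))
    (h1 : ∀ (k : ℕ) (c : O.obj k) (x : Fin k → O.tree E), (∀ i, f (x i) = g (x i)) →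
      f (O.graft E (O.br _ c (tp R x))) = g (O.graft E (O.br _ c (tp R x)))) : f = g :=
  lext fun x => O.tree_induction E (eqLocus f g) h0 h1 x

/-- Recursion on trees: an operator on homogeneous maps out of the trees has a fixed point if the
value at a tree only depends on the values at the branches. -/
lemma tree_rec {Y : DGModule R} {r : ℤ} (G : {φ : O.tree E →ₗ[R] Y // GrMap (O.tree E) Y φ r} →
      {φ : O.tree E →ₗ[R] Y // GrMap (O.tree E) Y φ r})
    (h0 : ∀ φ ψ a, (G φ).1 ((O.leaf E).f a) = (G ψ).1 ((O.leaf E).f a))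
    (h1 : ∀ φ ψ (k : ℕ) (c : O.obj k) (x : Fin k → O.tree E), (∀ i, φ.1 (x i) = ψ.1 (x i)) →
      (G φ).1 (O.graft E (O.br _ c (tp R x))) = (G ψ).1 (O.graft E (O.br _ c (tp R x)))) :
    ∃ φ, G φ = φ := by
  let Φ : ℕ → {φ : O.tree E →ₗ[R] Y // GrMap (O.tree E) Y φ r} := fun n => G^[n] ⟨0, fun _ _ _ => zero_mem _⟩
  have hΦ : ∀ n, Φ (n + 1) = G (Φ n) := fun n => Function.iterate_succ_apply' G n _
  have hstep : ∀ m φ ψ, (∀ y, φ.1 ((O.tin E m).f y) = ψ.1 ((O.tin E m).f y)) →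
      ∀ y, (G φ).1 ((O.tin E (m + 1)).f y) = (G ψ).1 ((O.tin E (m + 1)).f y) := by
    intro m φ ψ h y
    obtain ⟨a, w⟩ := (show E × O.FreeMod (O.tower E m) from y)
    have e := O.tin_succ E m a w
    refine (congrArg (G φ).1 e).trans (Eq.trans ?_ (congrArg (G ψ).1 e).symm)
    rw [map_add, map_add, h0 φ ψ]
    congr 1
    refine O.free_induction_tprod (eqLocus ((G φ).1 ∘ₗ O.graft E ∘ₗ (O.freeMor (O.tin E m)).f)
      ((G ψ).1 ∘ₗ O.graft E ∘ₗ (O.freeMor (O.tin E m)).f)) (fun k c x => ?_) w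
    rw [mem_eqLocus, lcmp, lcmp, lcmp, lcmp, freeMor_br, map_tp]
    exact h1 φ ψ k c _ fun i => h (x i)
  have hn : ∀ m n, m < n → ∀ y, (Φ n).1 ((O.tin E m).f y) = (Φ (m + 1)).1 ((O.tin E m).f y) := by
    have aux : ∀ m n, m < n → ∀ y, (Φ (n + 1)).1 ((O.tin E m).f y) = (Φ n).1 ((O.tin E m).f y) := by
      intro m
      induction m with
      | zero =>
        intro n hn y
        obtain ⟨n, rfl⟩ : ∃ l, n = l + 1 := ⟨n - 1, by omega⟩
        rw [hΦ (n + 1), hΦ n]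
        exact h0 _ _ _
      | succ m ih =>
        intro n hn y
        obtain ⟨n, rfl⟩ : ∃ l, n = l + 1 := ⟨n - 1, by omega⟩
        have e := hstep m _ _ (ih n (by omega)) y
        rwa [← hΦ (n + 1), ← hΦ n] at e
    intro m n hmn y
    induction n, hmn using Nat.le_induction with
    | base => rfl
    | succ n hmn ih => rw [aux m n hmn, ih]
  have hloc : ∀ x : O.tree E, ∃ m, ∀ n, m ≤ n → (Φ n).1 x = (Φ m).1 x := by
    intro x
    obtain ⟨m, y, rfl⟩ := O.exists_tin E x
    exact ⟨m + 1, fun n hmn => hn m n hmn y⟩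
  choose M hM using hloc
  let φ : O.tree E →ₗ[R] Y :=
    { toFun := fun x => (Φ (M x)).1 x
      map_add' := fun x y => by
        set N := M x + M y + M (x + y)
        rw [← hM x N (by omega), ← hM y N (by omega), ← hM (x + y) N (by omega), map_add]
      map_smul' := fun t x => by
        set N := M x + M (t • x)
        rw [← hM x N (by omega), ← hM (t • x) N (by omega), map_smul, RingHom.id_apply] }
  have hφ : ∀ x n, M x ≤ n → φ x = (Φ n).1 x := fun x n h => (hM x n h).symm
  refine ⟨⟨φ, fun n x hx => (Φ (M x)).2 n x hx⟩, ?_⟩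
  refine Subtype.ext (O.tree_ext E (fun a => ?_) fun k c x _ => ?_)
  · rw [hφ _ (M ((O.leaf E).f a) + 1) (by omega), hΦ]
    exact h0 _ _ _
  · set t := O.graft E (O.br _ c (tp R x))
    set N := M t + ∑ i, M (x i)
    have h2 : ∀ i, M (x i) ≤ N := fun i =>
      (single_le_sum (f := fun i => M (x i)) (by simp) (mem_univ i)).trans (by omega)
    rw [hφ t (N + 1) (by omega), hΦ]
    exact h1 _ _ k c x fun i => hφ _ _ (h2 i)

end Operad

/-! ### Flatness -/

section Flatness

lemma flat_tensorPower (M : Type u) [AddCommGroup M] [Module R M] [Module.Flat R M] :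
    ∀ k : ℕ, Module.Flat R ((⨂[R]^k) M)
  | 0 => Module.Flat.of_linearEquiv (PiTensorProduct.isEmptyEquiv (Fin 0))
  | k + 1 => by
    have := flat_tensorPower M k
    have : Module.Flat R ((⨂[R]^1) M) := Module.Flat.of_linearEquiv (PiTensorProduct.subsingletonEquiv (0 : Fin 1))
    exact Module.Flat.of_linearEquiv (TensorPower.mulEquiv (R := R) (M := M) (n := k) (m := 1)).symm

lemma mulEquiv_map {M N : Type u} [AddCommGroup M] [Module R M] [AddCommGroup N] [Module R N]
    (f : M →ₗ[R] N) (a b : ℕ) :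
    (TensorPower.mulEquiv (R := R) (M := N) (n := a) (m := b)).toLinearMap ∘ₗ
        TensorProduct.map pow(f) pow(f) =
      pow(f) ∘ₗ (TensorPower.mulEquiv (R := R) (M := M) (n := a) (m := b)).toLinearMap := by
  refine TensorProduct.ext ?_
  refine pext (mext fun x => ?_)
  refine pext (mext fun y => ?_)
  have h : ∀ {L : Type u} [AddCommGroup L] [Module R L] (x : Fin a → L) (y : Fin b → L),
      TensorPower.mulEquiv (tp R x ⊗ₜ[R] tp R y) =
        tp R (Fin.append x y) := fun x y => TensorPower.tprod_mul_tprod R x y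
  change TensorPower.mulEquiv (pow(f) (tp R x) ⊗ₜ[R] pow(f) (tp R y)) =
    pow(f) (TensorPower.mulEquiv (tp R x ⊗ₜ[R] tp R y))
  rw [h, map_tp, map_tp, h, map_tp]
  congr 1
  funext s
  refine Fin.addCases (fun i => ?_) (fun i => ?_) s <;> simp

lemma tensorPower_map_injective {M N : Type u} [AddCommGroup M] [Module R M] [AddCommGroup N]
    [Module R N] [Module.Flat R M] [Module.Flat R N] (f : M →ₗ[R] N) (hf : Injective f) :
    ∀ k : ℕ, Injective (pmap fun _ : Fin k => f)
  | 0 => by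
    have : pmap (fun _ : Fin 0 => f) =
        (PiTensorProduct.isEmptyEquiv (R := R) (s := fun _ => N) (Fin 0)).symm.toLinearMap ∘ₗ
          (PiTensorProduct.isEmptyEquiv (R := R) (s := fun _ => M) (Fin 0)).toLinearMap := by
      refine pext (mext fun x => ?_)
      simp only [l_mult, map_tp, lcmp, LinearEquiv.coe_coe, PiTensorProduct.isEmptyEquiv_apply_tprod,
        PiTensorProduct.isEmptyEquiv_symm_apply, one_smul]
      congr 1
      funext i
      exact i.elim0
    rw [this, LinearMap.coe_comp, LinearEquiv.coe_coe, LinearEquiv.coe_coe]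
    exact (LinearEquiv.injective _).comp (LinearEquiv.injective _)
  | k + 1 => by
    have h1 : Injective (pmap fun _ : Fin 1 => f) := by
      have : pmap (fun _ : Fin 1 => f) =
          (PiTensorProduct.subsingletonEquiv (R := R) (s := fun _ => N) (0 : Fin 1)).symm.toLinearMap ∘ₗ
            f ∘ₗ (PiTensorProduct.subsingletonEquiv (R := R) (s := fun _ => M) (0 : Fin 1)).toLinearMap := by
        refine pext (mext fun x => ?_)
        simp only [l_mult, map_tp, lcmp, LinearEquiv.coe_coe, PiTensorProduct.subsingletonEquiv_apply_tprod]
        rw [LinearEquiv.eq_symm_apply, PiTensorProduct.subsingletonEquiv_apply_tprod]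
      rw [this, LinearMap.coe_comp, LinearMap.coe_comp, LinearEquiv.coe_coe, LinearEquiv.coe_coe]
      exact (LinearEquiv.injective _).comp (hf.comp (LinearEquiv.injective _))
    have h2 := tensorPower_map_injective f hf k
    have := flat_tensorPower (R := R) M 1
    have := flat_tensorPower (R := R) N k
    have h3 := TensorProduct.map_injective_of_flat_flat _ _ h2 h1
    have h4 := (LinearEquiv.injective (TensorPower.mulEquiv (R := R) (M := N) (n := k) (m := 1))).comp h3
    have h5 := congrArg (fun g : _ →ₗ[R] _ => (g : _ → _)) (mulEquiv_map f k 1)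
    have h6 : Injective ((pmap (fun _ : Fin (k + 1) => f)) ∘
        (TensorPower.mulEquiv (R := R) (M := M) (n := k) (m := 1))) := by
      refine Eq.mp (congrArg Injective h5) h4
    exact (Function.Injective.of_comp_iff' _ (LinearEquiv.bijective _)).1 h6

lemma isTorsionFree_of_flat [IsDedekindDomain R] (M : Type u) [AddCommGroup M] [Module R M]
    [Module.Flat R M] : Module.IsTorsionFree R M :=
  Submodule.isTorsionFree_iff_torsion_eq_bot.2 (IsDedekindDomain.flat_iff_torsion_eq_bot.1 ‹_›)

end Flatness

namespace Operad

variable (O : Operad R)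

lemma flat_free (hB : O.HasDualBases) (X : DGModule R) [Module.Flat R X] : Module.Flat R (O.FreeMod X) := by
  have h : ∀ k, Module.Flat R (O.Coinv k (X.trep k)) := fun k => by
    obtain ⟨B⟩ := hB k
    have := flat_tensorPower (R := R) X k
    have : Module.Flat R (B.ι →₀ (⨂[R]^k) X) := by
      classical exact Module.Flat.of_linearEquiv (finsuppLEquivDirectSum R _ _)
    exact Module.Flat.of_retract (B.phi _) (B.psi _) (lext (B.psi_phi _))
  exact inferInstanceAs (Module.Flat R (DirectSum ℕ fun k => O.Coinv k (X.trep k)))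

lemma flat_tower [IsDedekindDomain R] (hB : O.HasDualBases) (E : DGModule R)
    [Module.Flat R E] : ∀ n, Module.Flat R (O.tower E n)
  | 0 => inferInstanceAs (Module.Flat R E)
  | n + 1 => by
    have := flat_tower hB E n
    have := O.flat_free hB (O.tower E n)
    have := isTorsionFree_of_flat (R := R) E
    have := isTorsionFree_of_flat (R := R) (O.FreeMod (O.tower E n))
    exact inferInstanceAs (Module.Flat R (E × O.FreeMod (O.tower E n)))

lemma flat_tree [IsDedekindDomain R] (hB : O.HasDualBases) (E : DGModule R)
    [Module.Flat R E] : Module.Flat R (O.tree E) := by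
  have h : ∀ n, Module.IsTorsionFree R (O.tower E n) := fun n => by
    have := O.flat_tower hB E n
    exact isTorsionFree_of_flat _
  have : Module.IsTorsionFree R (∀ n, O.tower E n) := inferInstance
  have : Module.IsTorsionFree R (O.treeSub E) := inferInstance
  exact inferInstanceAs (Module.Flat R (O.treeSub E))

end Operad

/-! ### The divisible hull of a complex -/

namespace DGModule

/-- The complex `K ⊗ A`, where `K` is the fraction field of `R`. -/
abbrev frac (A : DGModule R) : DGModule R where
  carrier := FractionRing R ⊗[R] A
  gr n := range ((A.gr n).subtype.lTensor (FractionRing R))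
  internal := by
    obtain ⟨κ, hκ⟩ := A.exists_coaction
    refine isInternal_of_coaction (κ := (TensorProduct.finsuppRight R R (FractionRing R) A ℤ).toLinearMap
      ∘ₗ κ.lTensor (FractionRing R)) ?_ ?_
    · rw [eq_top_iff]
      rintro x -
      induction x using TensorProduct.induction_on with
      | zero => exact zero_mem _
      | tmul t a =>
        have ha : a ∈ ⨆ n, A.gr n := by rw [A.internal.submodule_iSup_eq_top]; trivial
        refine (iSup_le (a := comap (TensorProduct.mk R (FractionRing R) A t)
          (⨆ n, range ((A.gr n).subtype.lTensor (FractionRing R)))) fun n x hx => ?_) ha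
        exact mem_iSup_of_mem n ⟨t ⊗ₜ ⟨x, hx⟩, rfl⟩
      | add x y hx hy => exact add_mem hx hy
    · rintro n _ ⟨x, rfl⟩
      induction x using TensorProduct.induction_on with
      | zero => simp
      | tmul t a =>
        simp only [LinearMap.lTensor_tmul, lcmp, LinearEquiv.coe_coe,
          Submodule.subtype_apply, hκ n a a.2, TensorProduct.finsuppRight_apply_tmul]
        rw [Finsupp.sum_single_index (by simp)]
      | add x y hx hy => rw [map_add, map_add, hx, hy, Finsupp.single_add]
  d := A.d.lTensor (FractionRing R)
  d_gr n := by
    rintro _ ⟨x, rfl⟩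
    induction x using TensorProduct.induction_on with
    | zero => simp
    | tmul t a => exact ⟨t ⊗ₜ ⟨A.d a, A.d_gr n a a.2⟩, rfl⟩
    | add x y hx hy => rw [map_add, map_add]; exact add_mem hx hy
  d_d x := by
    rw [← lcmp, ← LinearMap.lTensor_comp, show A.d ∘ₗ A.d = 0 from lext A.d_d, LinearMap.lTensor_zero, l_zero]

/-- The map of hulls induced by a map of complexes. -/
def fracMap {A B : DGModule R} (f : Mor A B) : Mor A.frac B.frac where
  f := f.f.lTensor (FractionRing R)
  f_gr n := by
    rintro _ ⟨x, rfl⟩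
    induction x using TensorProduct.induction_on with
    | zero => rw [map_zero, map_zero]; exact zero_mem _
    | tmul t a => exact ⟨t ⊗ₜ ⟨f.f a, f.f_gr n a a.2⟩, rfl⟩
    | add x y hx hy => rw [map_add, map_add]; exact add_mem hx hy
  f_d x := by
    rw [← lcmp, ← lcmp]
    change ((f.f.lTensor (FractionRing R)) ∘ₗ (A.d.lTensor (FractionRing R))) x =
      ((B.d.lTensor (FractionRing R)) ∘ₗ (f.f.lTensor (FractionRing R))) x
    rw [← LinearMap.lTensor_comp, ← LinearMap.lTensor_comp, show f.f ∘ₗ A.d = B.d ∘ₗ f.f from lext f.f_d]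

lemma fracMap_id (A : DGModule R) : fracMap (Mor.id A) = Mor.id A.frac := Mor.ext (LinearMap.lTensor_id _ _)

lemma fracMap_comp {A B C : DGModule R} (g : Mor B C) (f : Mor A B) :
    fracMap (g.comp f) = (fracMap g).comp (fracMap f) :=
  Mor.ext (LinearMap.lTensor_comp _ _ _)

/-- The map `A → K ⊗ A`. -/
def toFrac (A : DGModule R) : Mor A A.frac where
  f := TensorProduct.mk R (FractionRing R) A 1
  f_gr _ x hx := ⟨1 ⊗ₜ ⟨x, hx⟩, rfl⟩
  f_d _ := rfl

lemma toFrac_injective (A : DGModule R) [Module.Flat R A] : Injective A.toFrac.f :=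
  Module.Flat.tensorProduct_mk_injective R A (FractionRing R)

lemma flat_frac (A : DGModule R) [Module.Flat R A] : Module.Flat R A.frac := by
  have : Module.Flat R (FractionRing R) := IsLocalization.flat (FractionRing R) (nonZeroDivisors R)
  exact inferInstanceAs (Module.Flat R (FractionRing R ⊗[R] A))

lemma baer_frac [IsDomain R] (A : DGModule R) : Module.Baer R A.frac := by
  intro I g
  change I →ₗ[R] FractionRing R ⊗[R] A at g
  by_cases hI : I = ⊥
  · subst hI
    refine ⟨0, fun x hx => ?_⟩
    have : (⟨x, hx⟩ : (⊥ : Ideal R)) = 0 := Subsingleton.elim _ _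
    rw [this, map_zero, l_zero]
  · obtain ⟨a, ha, ha0⟩ := Submodule.exists_mem_ne_zero_of_ne_bot hI
    have ha1 : algebraMap R (FractionRing R) a ≠ 0 := by rw [Ne, FaithfulSMul.algebraMap_eq_zero_iff]; exact ha0
    refine ⟨LinearMap.toSpanSingleton R _ ((algebraMap R (FractionRing R) a)⁻¹ • g ⟨a, ha⟩), fun x hx => ?_⟩
    rw [LinearMap.toSpanSingleton_apply, smul_comm, ← map_smul]
    have : x • (⟨a, ha⟩ : I) = a • ⟨x, hx⟩ := Subtype.ext (mul_comm x a)
    rw [this, map_smul, ← algebraMap_smul (FractionRing R) a, smul_smul, inv_mul_cancel₀ ha1, one_smul]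

end DGModule

namespace Operad

variable {O : Operad R}

/-- The part of degree `0` of a linear map between graded modules. -/
lemma exists_degree_zero_part {A B : DGModule R} (φ : A →ₗ[R] B) :
    ∃ ψ : A →ₗ[R] B, (∀ n, ∀ x ∈ A.gr n, ψ x ∈ B.gr n) ∧ ∀ n, ∀ x ∈ A.gr n, φ x ∈ B.gr n → ψ x = φ x := by
  obtain ⟨κ, hκ⟩ := A.exists_coaction
  have hd : ∀ n y, B.diag (fun m => if m = n then 1 else 0) y ∈ B.gr n := by
    intro n y
    have hy : y ∈ ⨆ n, B.gr n := by rw [B.internal.submodule_iSup_eq_top]; trivial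
    refine (iSup_le (a := comap (B.diag fun m => if m = n then 1 else 0) (B.gr n)) fun m y hy => ?_) hy
    rw [mem_comap, B.diag_of_mem _ hy]
    split_ifs with h
    · subst h; rwa [one_smul]
    · rw [zero_smul]; exact zero_mem _
  have hψ : ∀ n, ∀ x ∈ A.gr n, (Finsupp.lsum R (fun n => B.diag (fun m => if m = n then 1 else 0) ∘ₗ φ) ∘ₗ κ) x =
        B.diag (fun m => if m = n then 1 else 0) (φ x) := fun n x hx => by
    rw [lcmp, hκ n x hx, Finsupp.lsum_single]; rfl
  refine ⟨_, fun n x hx => (hψ n x hx).symm ▸ hd _ _, fun n x hx h => ?_⟩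
  rw [hψ n x hx, B.diag_of_mem _ h, if_pos rfl, one_smul]

variable [IsDomain R]

/-- The structure maps of a partial algebra extend to a map out of the free algebra on the hull of
the underlying complex. -/
lemma exists_hull_action (hB : O.HasDualBases) (A : PartialAlgebra O) : ∃ T : O.FreeMod A.cx.frac →ₗ[R] A.cx.frac,
      (∀ n, ∀ w ∈ (O.free A.cx.frac).gr n, T w ∈ A.cx.frac.gr n) ∧
      ∀ (k : ℕ) (c : O.obj k) (x : A.dom.sub k), T (O.br A.cx.frac c (pow(A.cx.toFrac.f) x.1)) =
          A.cx.toFrac.f (A.θ c x) := by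
  have := A.flat
  have := A.cx.flat_frac
  have hk : ∀ k : ℕ, ∃ F : O.Coinv k (A.cx.frac.trep k) →ₗ[R] A.cx.frac, ∀ (c : O.obj k) (x : A.dom.sub k),
        F (O.cmk _ c (pow(A.cx.toFrac.f) x.1)) = A.cx.toFrac.f (A.θ c x) := by
    intro k
    obtain ⟨B⟩ := hB k
    let ρ : Representation R (Perm (Fin k)) (A.dom.sub k) :=
      { toFun := fun σ => (A.cx.tperm σ).restrict (A.dom.perm_mem σ)
        map_one' := lext fun x => Subtype.ext (by
          change A.cx.tperm (Equiv.refl _) x.1 = x.1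
          rw [← A.cx.tmv_perm, tmv_refl]; rfl)
        map_mul' := fun σ τ => lext fun x => Subtype.ext (by
          change A.cx.tperm (τ.trans σ) x.1 = A.cx.tperm σ (A.cx.tperm τ x.1)
          rw [← A.cx.tmv_perm, ← A.cx.tmv_perm, ← A.cx.tmv_perm, tmv_trans]; rfl) }
    let T : A.dom.sub k →ₗ[R] (⨂[R]^k) A.cx.frac := pow(A.cx.toFrac.f) ∘ₗ (A.dom.sub k).subtype
    have hT : ∀ σ x, T (ρ σ x) = A.cx.frac.trep k σ (T x) := fun σ x => by
      have h := lcongr (tmv_map (A := A.cx) (B := A.cx.frac) σ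
        (fun _ => A.cx.toFrac.f) (fun _ => A.cx.toFrac.f_gr)) x.1
      rw [lcmp, lcmp] at h
      rw [trep_apply]
      refine Eq.trans ?_ h.symm
      rw [A.cx.tmv_perm]
      rfl
    have hinj := B.coinvMap_injective ρ (A.cx.frac.trep k) T hT
      ((tensorPower_map_injective _ A.cx.toFrac_injective k).comp Subtype.val_injective)
    obtain ⟨F, hF⟩ := A.cx.baer_frac.extension_property _ hinj
      (A.cx.toFrac.f ∘ₗ O.coinvLift ρ A.θ (fun σ c x => A.θ_relabel σ c x))
    exact ⟨F, fun c x => lcongr hF (O.cmk ρ c x)⟩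
  choose F hF using hk
  obtain ⟨T, hT1, hT2⟩ := exists_degree_zero_part (A := O.free A.cx.frac) (B := A.cx.frac)
    (DirectSum.toModule R ℕ _ F : O.FreeMod A.cx.frac →ₗ[R] A.cx.frac)
  have hFbr : ∀ (k : ℕ) (c : O.obj k) (x : A.dom.sub k),
      (DirectSum.toModule R ℕ _ F : O.FreeMod A.cx.frac →ₗ[R] A.cx.frac)
        (O.br A.cx.frac c (pow(A.cx.toFrac.f) x.1)) = A.cx.toFrac.f (A.θ c x) := fun k c x =>
    (DirectSum.toModule_lof R (M := fun k => O.Coinv k (A.cx.frac.trep k)) k _).trans (hF k c x)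
  refine ⟨T, hT1, fun k c x => ?_⟩
  have hhom : ∀ (p q : ℤ) (c : O.obj k) (x : A.dom.sub k), c ∈ (O.obj k).gr p → x.1 ∈ A.cx.tgr k q →
      T (O.br A.cx.frac c (pow(A.cx.toFrac.f) x.1)) = A.cx.toFrac.f (A.θ c x) := by
    intro p q c x hc hx
    refine (hT2 (p + q) _ (O.br_mem_gr hc (map_mem_tgr _ (fun _ => A.cx.toFrac.f_gr) hx)) ?_).trans (hFbr k c x)
    refine (hFbr k c x).symm ▸ ?_
    exact A.cx.toFrac.f_gr _ _ (A.θ_gr p q c x hc hx)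
  have hx := A.dom.graded k x.2
  refine lcongr (f := T ∘ₗ (O.br A.cx.frac).flip
      (pow(A.cx.toFrac.f) x.1)) (g := A.cx.toFrac.f ∘ₗ A.θ.flip x)
    ((O.obj k).gr_ext _ _ fun p c hc => ?_) c
  let G : A.dom.sub k →ₗ[R] A.cx.frac := T ∘ₗ O.br A.cx.frac c ∘ₗ
    pow(A.cx.toFrac.f) ∘ₗ (A.dom.sub k).subtype - A.cx.toFrac.f ∘ₗ A.θ c
  have key : ⨆ n, A.dom.sub k ⊓ A.cx.tgr k n ≤ (ker G).map (A.dom.sub k).subtype := by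
    refine iSup_le fun n y hy => ⟨⟨y, hy.1⟩, ?_, rfl⟩
    rw [SetLike.mem_coe, LinearMap.mem_ker, l_sub, sub_eq_zero]
    exact hhom p n c ⟨y, hy.1⟩ hc hy.2
  obtain ⟨y, hy, hyx⟩ := key hx
  obtain rfl : y = x := Subtype.ext hyx
  exact sub_eq_zero.1 hy

end Operad

/-! ### The twisted differential -/

namespace Operad

variable {O : Operad R}

/-- An extension of the structure maps of a partial algebra to the free algebra on the hull of its
underlying complex. No compatibility is required outside the domain. -/
structure Ext (A : PartialAlgebra O) where
  E : DGModule R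
  E_flat : Module.Flat R E
  j : Mor A.cx E
  j_injective : Injective j.f
  T : O.FreeMod E →ₗ[R] E
  T_gr : ∀ n, ∀ w ∈ (O.free E).gr n, T w ∈ E.gr n
  T_br : ∀ (k : ℕ) (c : O.obj k) (x : A.dom.sub k), T (O.br E c (pow(j.f) x.1)) = j.f (A.θ c x)

namespace Ext

variable {A : PartialAlgebra O}

/-- The trees with leaves labelled by the hull. -/
abbrev V (H : Ext A) : DGModule R := O.tree H.E

/-- The free algebra on trees. -/
abbrev C (H : Ext A) : DGModule R := O.free H.V

variable (H : Ext A)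

/-- The augmentation: trees with a node are mapped to `0`, and the product of leaves is evaluated
by the structure maps. -/
def aug : H.C →ₗ[R] H.E := H.T ∘ₗ O.freeFun (O.root H.E).f (O.root H.E).f_gr

/-- The inclusion of the leaves. -/
def inc : H.E →ₗ[R] H.C := O.frEta H.V ∘ₗ (O.leaf H.E).f

/-- The contraction: grafting to a tree. -/
def con : H.C →ₗ[R] H.C := O.frEta H.V ∘ₗ O.graft H.E

lemma aug_gr (n : ℤ) (x : H.C) (hx : x ∈ H.C.gr n) : H.aug x ∈ H.E.gr n :=
  H.T_gr n _ (O.freeFun_mem_gr _ (O.root H.E).f_gr n x hx)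

lemma inc_gr (n : ℤ) (x : H.E) (hx : x ∈ H.E.gr n) : H.inc x ∈ H.C.gr n := O.frEta_mem_gr ((O.leaf H.E).f_gr n x hx)

lemma con_gr (n : ℤ) (x : H.C) (hx : x ∈ H.C.gr n) : H.con x ∈ H.C.gr (n + 1) :=
  O.frEta_mem_gr (O.graft_gr H.E n x hx)

lemma con_grMap : GrMap H.C H.C H.con 1 := fun n x hx => by rw [add_comm]; exact H.con_gr n x hx

lemma aug_con (w : H.C) : H.aug (H.con w) = 0 := by
  refine (congrArg H.T (O.freeFun_eta _ _ _)).trans ?_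
  rw [root_graft, map_zero, map_zero]

lemma T_eta (a : A.cx) : H.T (O.frEta _ (H.j.f a)) = H.j.f a := by
  have hm : tp R (fun _ : Fin 1 => a) ∈ A.dom.sub 1 := by rw [A.dom.sub_one]; trivial
  have h := H.T_br 1 O.one ⟨_, hm⟩
  rw [A.θ_one, map_tp] at h
  rwa [frEta_apply, tone_apply]

lemma aug_inc (a : A.cx) : H.aug (H.inc (H.j.f a)) = H.j.f a := by
  refine (congrArg H.T (O.freeFun_eta _ _ _)).trans ?_
  rw [root_leaf, T_eta]

/-- The operator whose fixed point is the restriction of the twisted differential to trees. -/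
def twistStep (φ : {φ : H.V →ₗ[R] H.C // GrMap H.V H.C φ (-1)}) :
    {φ : H.V →ₗ[R] H.C // GrMap H.V H.C φ (-1)} :=
  ⟨H.inc ∘ₗ H.E.d ∘ₗ (O.root H.E).f + (lid - H.inc ∘ₗ H.aug - H.con ∘ₗ O.frDer φ.1 φ.2) ∘ₗ O.ungraft H.E, by
    intro n x hx
    have h1 := O.ungraft_gr H.E n x hx
    rw [neg_add_eq_sub]
    refine add_mem (H.inc_gr _ _ (H.E.d_gr n _ ((O.root H.E).f_gr n x hx)))
      (sub_mem (sub_mem h1 (H.inc_gr _ _ (H.aug_gr _ _ h1))) ?_)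
    have := H.con_gr _ _ (O.frDer_mem_gr φ.2 h1)
    rwa [sub_add_cancel] at this⟩

lemma twistStep_congr (φ ψ : {φ : H.V →ₗ[R] H.C // GrMap H.V H.C φ (-1)}) (y : H.V) (w : H.C)
    (h : O.ungraft H.E y = w) (hw : O.frDer φ.1 φ.2 w = O.frDer ψ.1 ψ.2 w) :
    (H.twistStep φ).1 y = (H.twistStep ψ).1 y := by
  subst h
  exact congrArg (fun t => H.inc (H.E.d ((O.root H.E).f y)) +
    (O.ungraft H.E y - H.inc (H.aug (O.ungraft H.E y)) - H.con t)) hw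

lemma exists_twist : ∃ φ, H.twistStep φ = φ := by
  refine O.tree_rec H.E H.twistStep (fun φ ψ a => ?_) (fun φ ψ k c x h => ?_)
  · exact H.twistStep_congr _ _ _ _ (O.ungraft_leaf H.E a) (by rw [map_zero, map_zero])
  · refine H.twistStep_congr _ _ _ _ (O.ungraft_graft H.E _) ?_
    rw [frDer_br, frDer_br]
    congr 2
    rw [tDer, tDer, l_sum, l_sum]
    refine sum_congr rfl fun i _ => ?_
    rw [map_tp, map_tp]
    congr 1
    funext l
    rcases lt_trichotomy l i with hl | rfl | hl
    · rw [if_pos hl, if_pos hl]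
    · rw [if_neg (lt_irrefl l), if_neg (lt_irrefl l), if_pos rfl, if_pos rfl, h l]
    · rw [if_neg hl.not_gt, if_neg hl.not_gt, if_neg hl.ne', if_neg hl.ne']

/-- The restriction of the twisted differential to trees. -/
def twist : H.V →ₗ[R] H.C := H.exists_twist.choose.1

lemma twist_gr : GrMap H.V H.C H.twist (-1) := H.exists_twist.choose.2

lemma twist_eq (x : H.V) : H.twist x = H.inc (H.E.d ((O.root H.E).f x)) +
    (O.ungraft H.E x - H.inc (H.aug (O.ungraft H.E x)) - H.con (O.frDer H.twist H.twist_gr (O.ungraft H.E x))) :=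
  (lcongr (congrArg Subtype.val H.exists_twist.choose_spec) x).symm

/-- The twisted differential. It is a derivation for which the contraction is a contracting
homotopy; its square need not vanish, since the extended structure maps are not associative. -/
def D : H.C →ₗ[R] H.C := O.frDer H.twist H.twist_gr

lemma D_gr (n : ℤ) (x : H.C) (hx : x ∈ H.C.gr n) : H.D x ∈ H.C.gr (n - 1) := O.frDer_mem_gr _ hx

lemma D_grMap : GrMap H.C H.C H.D (-1) := fun n x hx => by rw [neg_add_eq_sub]; exact H.D_gr n x hx

lemma D_inc (a : H.E) : H.D (H.inc a) = H.inc (H.E.d a) := by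
  refine (O.frDer_eta _ _).trans ?_
  rw [twist_eq, root_leaf, ungraft_leaf]
  simp

lemma D_con (w : H.C) : H.D (H.con w) = w - H.inc (H.aug w) - H.con (H.D w) := by
  refine (O.frDer_eta _ _).trans ?_
  rw [twist_eq, root_graft, ungraft_graft]
  simp [D]

lemma D_act (c : O.obj k) (w : (⨂[R]^k) H.C) : H.D (O.frAct H.V c w) = O.frAct H.V ((O.obj k).d c) w +
      O.frAct H.V ((O.obj k).eps 1 c) (H.C.tDer lid H.D k w) :=
  O.frDer_act _ c w

end Ext

end Operad

/-! ### Block operations -/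

namespace DGModule

/-- The inverse of `tone`. -/
def unTone (A : DGModule R) : (⨂[R]^1) A →ₗ[R] A :=
  (PiTensorProduct.subsingletonEquiv (R := R) (s := fun _ : Fin 1 => (A : Type u)) 0).toLinearMap

@[simp] lemma unTone_tprod (A : DGModule R) (a : Fin 1 → A) : A.unTone (tp R a) = a 0 :=
  PiTensorProduct.subsingletonEquiv_apply_tprod 0 a

@[simp] lemma unTone_tone (A : DGModule R) (a : A) : A.unTone (A.tone a) = a := by rw [tone_apply, unTone_tprod]

@[simp] lemma tone_unTone (A : DGModule R) (x : (⨂[R]^1) A) : A.tone (A.unTone x) = x := by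
  refine lcongr (f := A.tone ∘ₗ A.unTone) (g := lid) (pext (mext fun a => ?_)) x
  simp only [l_mult, lcmp, unTone_tprod, tone_apply, l_id]
  congr 1
  funext i
  rw [Subsingleton.elim i 0]

lemma unTone_grT (A : DGModule R) : GrT A A A.unTone 0 := by
  intro n x hx
  refine tgr_induction ((A.gr (0 + n)).comap A.unTone) (fun q a ha hq => ?_) hx
  rw [mem_comap, unTone_tprod, zero_add, ← hq]
  simpa using ha 0

lemma bop_fin_one (A B : DGModule R) {J : ℕ} (p : ℤ) (χ : (⨂[R]^J) A →ₗ[R] B) :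
    bop A B (k := 1) (fun _ => J) (fun _ => p) (fun _ => χ) = B.tone ∘ₗ χ ∘ₗ A.tmv (finCongr (by simp)) := by
  refine A.tprod_flat_ext _ fun b => ?_
  rw [bop_flat, lcmp, lcmp, tmv_finCongr, tone_apply]
  congr 1
  funext i
  have hi : i = 0 := Subsingleton.elim _ _
  subst hi
  have h : suf (fun _ : Fin 1 => p) 0 = 0 := by simp [suf]
  rw [h, teps_zero, l_id]
  congr 2
  funext m
  have : (Fin.cast (by simp) m : Fin (∑ _ : Fin 1, J)) = fsf ⟨0, m⟩ := Fin.ext (by rw [fsf_val]; simp)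
  rw [this, flat_fsf]

lemma bop_unTone (A : DGModule R) (J : ℕ) : bop A A (fun _ : Fin J => 1) (fun _ => 0) (fun _ => A.unTone) =
      A.tmv (finCongr (by simp)) := by
  refine A.tprod_flat_ext _ fun b => ?_
  rw [bop_flat, tmv_finCongr]
  congr 1
  funext i
  have h : suf (fun _ : Fin J => (0 : ℤ)) i = 0 := by simp [suf]
  rw [h, teps_zero, l_id, unTone_tprod]
  have : (Fin.cast (by simp) i : Fin (∑ _ : Fin J, 1)) = fsf ⟨i, 0⟩ := by
    refine Fin.ext ?_
    rw [fsf_val]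
    have : (Finset.univ.filter fun x => x < i) = Finset.Iio i := by ext; simp
    simp [this]
  rw [this, flat_fsf]

/-- Composites of block operations of a special form are block operations of the same form. -/
lemma bop_comp_bop (A B C : DGModule R) {J : Fin k → ℕ} (a : Fin k → ℕ)
    (P : ∀ i, Fin (a i) → ℕ) (q : ∀ i, Fin (a i) → ℤ)
    (χ : ∀ i m, (⨂[R]^(P i m)) A →ₗ[R] B) (hχ : ∀ i m, TPar A B (χ i m) (q i m))
    (r : Fin k → ℤ) (φ : ∀ i, (⨂[R]^(a i)) B →ₗ[R] C) (e : ∀ i, Fin (J i) ≃ Fin (∑ m, P i m)) :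
    bop A C J (fun i => r i + ∑ m, q i m) (fun i => φ i ∘ₗ bop A B (P i) (q i) (χ i) ∘ₗ A.tmv (e i)) =
      sgn R (unshuffleExp r fun i => ∑ m, q i m) • (bop B C a r φ ∘ₗ
        bop A B ♭(P) (flat q)
          ♭(χ) ∘ₗ
        A.tmv ((blockSum e).trans (finCongr (sum_arity a P)).symm)) := by
  have h1 := bop_bop A B C a P r q φ χ hχ
  have h2 := bop_blockSum (A := A) (B := C) e (fun i => r i + ∑ m, q i m) (fun i => φ i ∘ₗ bop A B (P i) (q i) (χ i))
  rw [tmv_trans, ← l_assoc, ← l_assoc, h1, LinearMap.smul_comp,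
    LinearMap.smul_comp, smul_smul, sgn_mul_self, one_smul]
  refine h2.symm.trans ?_
  refine lext fun x => ?_
  simp only [lcmp]
  rw [tmv_tmv_symm]

/-- The dependence of a block operation on its entries. -/
def bopM (A B : DGModule R) (j : Fin k → ℕ) (p : Fin k → ℤ) :
    MultilinearMap R (fun i => (⨂[R]^(j i)) A →ₗ[R] B) ((⨂[R]^(∑ i, j i)) A →ₗ[R] (⨂[R]^k) B) :=
  ((LinearMap.lcomp R ((⨂[R]^k) B) (A.split j)).compMultilinearMap
    ((PiTensorProduct.mapMultilinear R (fun i => (⨂[R]^(j i)) A) (fun _ : Fin k => (B : Type u)))))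
      |>.compLinearMap fun i => LinearMap.lcomp R B (A.teps (j i) (suf p i))

lemma bopM_apply (A B : DGModule R) (j : Fin k → ℕ) (p : Fin k → ℤ)
    (φ : ∀ i, (⨂[R]^(j i)) A →ₗ[R] B) : bopM A B j p φ = bop A B j p φ := rfl

/-- A tensor product of linear maps, with the signs that belong to an odd map in the place `i`. -/
def slot (A B : DGModule R) (F : Fin k → (A →ₗ[R] B)) (i : Fin k) (T : A →ₗ[R] B) :
    (⨂[R]^k) A →ₗ[R] (⨂[R]^k) B :=
  pmap fun l => if l < i then F l ∘ₗ A.eps 1 else if l = i then T else F l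

lemma tDer_eq_sum_slot (A B : DGModule R) (f δ : A →ₗ[R] B) (k : ℕ) :
    A.tDer f δ k = ∑ i, slot A B (fun _ => f) i δ := rfl

lemma slot_bop {A B C : DGModule R} (F : Fin k → (B →ₗ[R] C)) (i : Fin k)
    (T : B →ₗ[R] C) (j : Fin k → ℕ) (p : Fin k → ℤ) (φ : ∀ i, (⨂[R]^(j i)) A →ₗ[R] B)
    (hφ : ∀ i, TPar A B (φ i) (p i)) {r : ℤ} (hr : (r : ZMod 2) = 1) :
    slot B C F i T ∘ₗ bop A B j p φ = sgn R (∑ l, if l < i then p l else 0) • bop A C j (update p i (p i + r))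
        (fun l => if l = i then T ∘ₗ φ l else F l ∘ₗ φ l) := by
  refine A.hom_flat_ext j fun q b hb => ?_
  rw [lcmp, l_smul, bop_flat_homog _ _ _ _ _ q b hb, bop_flat_homog _ _ _ _ _ q b hb, map_smul, slot, map_tp]
  have hge : ∀ l, B.eps 1 (φ l (tp R (b l))) = sgn R (p l + ∑ m, q l m) • φ l (tp R (b l)) := fun l => by
    have := lcongr (hφ l 1) (tp R (b l))
    rw [one_mul, l_smul, lcmp, lcmp, A.teps_tprod 1 (q l) _ (hb l), map_smul, smul_smul, one_mul, ← sgn_add] at this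
    exact this
  have e1 : (fun l => (if l < i then F l ∘ₗ B.eps 1 else if l = i then T else F l)
      (φ l (tp R (b l)))) = fun l => sgn R (if l < i then p l + ∑ m, q l m else 0) •
        (if l = i then T ∘ₗ φ l else F l ∘ₗ φ l) (tp R (b l)) := by
    funext l
    rcases lt_trichotomy l i with hl | rfl | hl
    · simp only [hl, hl.ne, if_true, if_false, lcmp, hge, map_smul]
    · simp [sgn_zero]
    · simp [hl.not_gt, hl.ne', sgn_zero]
  rw [e1, map_smul_univ, smul_smul, smul_smul, ← sgn_sum, ← sgn_add, ← sgn_add]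
  congr 1
  refine sgn_of_cast R ?_

  have hu2 := unshuffleExp_update p (fun i => ∑ m, q i m) i (p i) (∑ m, q i m)
  have hu3 := unshuffleExp_update p (fun i => ∑ m, q i m) i (p i + r) (∑ m, q i m)
  rw [Function.update_eq_self, Function.update_eq_self] at hu2
  rw [Function.update_eq_self] at hu3
  rw [hu2, hu3]
  have hs : (∑ l, if l < i then p l + ∑ m, q l m else 0) =
      (∑ l, if l < i then p l else 0) + ∑ l, if l < i then ∑ m, q l m else 0 := by
    rw [← sum_add_distrib]
    exact sum_congr rfl fun l _ => by split_ifs <;> simp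
  rw [hs]
  push_cast
  rw [hr]
  ring

end DGModule

/-- The image of the tensor product of submodules in the tensor product of the modules. -/
abbrev tspan {M : Fin k → Type*} [∀ i, AddCommGroup (M i)] [∀ i, Module R (M i)]
    (P : ∀ i, Submodule R (M i)) : Submodule R (⨂[R] i, M i) := range (mapIncl P)

section

variable {M N : Fin k → Type*} [∀ i, AddCommGroup (M i)] [∀ i, Module R (M i)] [∀ i, AddCommGroup (N i)]
  [∀ i, Module R (N i)] {P : ∀ i, Submodule R (M i)} {F G : ∀ i, M i →ₗ[R] N i}

lemma tp_mem_tspan {y : ∀ i, M i} (h : ∀ i, y i ∈ P i) : tp R y ∈ tspan P := ⟨tp R fun i => ⟨y i, h i⟩, map_tp _ _⟩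

lemma tspan_le {S : Submodule R (⨂[R] i, M i)} (h : ∀ y : ∀ i, M i, (∀ i, y i ∈ P i) → tp R y ∈ S) : tspan P ≤ S := by
  rw [tspan, mapIncl, PiTensorProduct.map_range_eq_span_tprod, span_le]
  rintro _ ⟨y, rfl⟩
  exact h _ fun i => (y i).2

lemma map_mem_tspan {Q : ∀ i, Submodule R (N i)} (h : ∀ i, ∀ x ∈ P i, F i x ∈ Q i) {w} (hw : w ∈ tspan P) :
    pmap F w ∈ tspan Q :=
  tspan_le (S := (tspan Q).comap (pmap F)) (fun y hy => by
    rw [mem_comap, map_tp]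
    exact tp_mem_tspan fun i => h i _ (hy i)) hw

lemma map_eq_of_mem_tspan (h : ∀ i, ∀ x ∈ P i, F i x = G i x) {w} (hw : w ∈ tspan P) : pmap F w = pmap G w :=
  tspan_le (S := eqLocus (pmap F) (pmap G)) (fun y hy => by
    rw [mem_eqLocus, map_tp, map_tp, funext fun i => h i _ (hy i)]) hw

end

/-! ### The operations on the domain -/

namespace Operad.Ext

variable {O : Operad R} {A : PartialAlgebra O} (H : Ext A)

/-- The image of `A_J` in the tensor power of the hull. -/
def L (J : ℕ) : Submodule R ((⨂[R]^J) H.E) := (A.dom.sub J).map pow(H.j.f)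

lemma map_j_tmv {m n : ℕ} (e : Fin m ≃ Fin n) (x : (⨂[R]^m) A.cx) : H.E.tmv e (pow(H.j.f) x) =
      pow(H.j.f) (A.cx.tmv e x) :=
  lcongr (tmv_map e (fun _ => H.j.f) (fun _ => H.j.f_gr)) x

lemma map_j_tD (x : (⨂[R]^k) A.cx) : H.E.tD k (pow(H.j.f) x) =
      pow(H.j.f) (A.cx.tD k x) := by
  have h := map_tDer (f := lid) (δ := A.cx.d) (f' := lid) (δ' := H.E.d)
    (g := H.j.f) (F := H.j.f) H.j.hasPar (fun _ => rfl) H.j.f_d k x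
  rw [← tD_eq_tDer, ← tD_eq_tDer] at h
  exact h.symm

lemma map_j_teps (n : ℤ) (x : (⨂[R]^k) A.cx) : H.E.teps k n (pow(H.j.f) x) =
      pow(H.j.f) (A.cx.teps k n x) := by
  refine lcongr (f := H.E.teps k n ∘ₗ pow(H.j.f)) (g := pow(H.j.f) ∘ₗ A.cx.teps k n)
    (A.cx.tgr_ext _ _ fun m x hx => ?_) x
  rw [lcmp, lcmp, A.cx.teps_of_mem n hx, map_smul, H.E.teps_of_mem n (map_mem_tgr _ (fun _ => H.j.f_gr) hx)]

lemma map_j_injective (k : ℕ) : Injective (pmap (R := R) fun _ : Fin k => H.j.f) := by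
  have := A.flat
  have := H.E_flat
  exact tensorPower_map_injective _ H.j_injective k

lemma L_tmv {m n : ℕ} (e : Fin m ≃ Fin n) {z : (⨂[R]^m) H.E} (hz : z ∈ H.L m) : H.E.tmv e z ∈ H.L n := by
  obtain ⟨x, hx, rfl⟩ := hz
  obtain rfl : m = n := by simpa using Fintype.card_congr e
  refine ⟨A.cx.tmv e x, ?_, (H.map_j_tmv e x).symm⟩
  have := A.dom.perm_mem e x hx
  rwa [← A.cx.tmv_perm e] at this

lemma L_tD {z : (⨂[R]^k) H.E} (hz : z ∈ H.L k) : H.E.tD k z ∈ H.L k := by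
  obtain ⟨x, hx, rfl⟩ := hz
  exact ⟨A.cx.tD k x, A.dom.d_mem k x hx, (H.map_j_tD x).symm⟩

lemma L_teps (n : ℤ) {z : (⨂[R]^k) H.E} (hz : z ∈ H.L k) : H.E.teps k n z ∈ H.L k := by
  obtain ⟨x, hx, rfl⟩ := hz
  exact ⟨A.cx.teps k n x, A.dom.teps_mem k n x hx, (H.map_j_teps n x).symm⟩

lemma L_graded (k : ℕ) : H.L k ≤ ⨆ n, H.L k ⊓ H.E.tgr k n := by
  rintro _ ⟨x, hx, rfl⟩
  refine (iSup_le (a := comap pow(H.j.f) (⨆ n, H.L k ⊓ H.E.tgr k n)) fun n y hy => ?_) (A.dom.graded k hx)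
  exact mem_iSup_of_mem n ⟨⟨y, hy.1, rfl⟩, map_mem_tgr _ (fun _ => H.j.f_gr) hy.2⟩

lemma L_one {z : (⨂[R]^1) H.E} (hz : z ∈ H.L 1) : ∃ a : A.cx, z = H.E.tone (H.j.f a) := by
  obtain ⟨x, -, rfl⟩ := hz
  refine ⟨A.cx.unTone x, ?_⟩
  rw [← tone_map, tone_unTone]

lemma tone_mem_L (a : A.cx) : H.E.tone (H.j.f a) ∈ H.L 1 :=
  ⟨A.cx.tone a, by rw [A.dom.sub_one]; trivial, tone_map _ _⟩

lemma split_mem_L (j : Fin k → ℕ) {z : (⨂[R]^(∑ i, j i)) H.E} (hz : z ∈ H.L _) :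
    H.E.split j z ∈ tspan fun i => H.L (j i) := by
  obtain ⟨x, hx, rfl⟩ := hz
  obtain ⟨w, hw⟩ := (A.dom.quasi_prod j).1 hx
  have h := lcongr (split_map j (fun _ => H.j.f)) x
  rw [lcmp, lcmp] at h
  rw [h]
  exact map_mem_tspan (Q := fun i => H.L (j i)) (fun i y hy => ⟨y, hy, rfl⟩) ⟨w, hw⟩

/-- The operations on tensors of elements of the hull that are obtained from the inclusion of the
leaves by grafting and by the action of the operad on the free algebra. -/
inductive COp : ∀ (J : ℕ) (_ : ℤ), ((⨂[R]^J) H.E →ₗ[R] H.C) → Prop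
  | inc : COp 1 0 (H.inc ∘ₗ H.E.unTone)
  | smul {J p g} (r : R) : COp J p g → COp J p (r • g)
  | con {J p g} : COp J p g → COp J (p + 1) (H.con ∘ₗ g)
  | act {k : ℕ} {J : Fin k → ℕ} {p : Fin k → ℤ} {g : ∀ i, (⨂[R]^(J i)) H.E →ₗ[R] H.C} {q : ℤ}
    (c : O.obj k) (hc : c ∈ (O.obj k).gr q) :
    (∀ i, COp (J i) (p i) (g i)) → COp (∑ i, J i) (q + ∑ i, p i) (O.frAct H.V c ∘ₗ bop H.E H.C J p g)

variable {H} {J : ℕ} {p : ℤ} {g : (⨂[R]^J) H.E →ₗ[R] H.C}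

lemma COp.grT (h : H.COp J p g) : GrT H.E H.C g p := by
  induction h with
  | inc =>
    intro n x hx
    have := H.inc_gr _ _ (H.E.unTone_grT n x hx)
    exact this
  | smul r _ ih => exact fun n x hx => smul_mem _ _ (ih n x hx)
  | con _ ih =>
    intro n x hx
    have := H.con_gr _ _ (ih n x hx)
    rwa [add_right_comm] at this
  | act c hc _ ih =>
    intro n x hx
    have := O.frAct_mem_gr hc (bop_mem_tgr ih hx)
    rwa [← add_assoc] at this

lemma COp.root (h : H.COp J p g) :
    ∃ c ∈ (O.obj J).gr p, O.freeFun (O.root H.E).f (O.root H.E).f_gr ∘ₗ g = O.br H.E c := by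
  induction h with
  | inc =>
    refine ⟨O.one, O.one_gr, lext fun x => ?_⟩
    refine (O.freeFun_eta (O.root H.E).f (O.root H.E).f_gr ((O.leaf H.E).f (H.E.unTone x))).trans ?_
    rw [root_leaf, frEta_apply, tone_unTone]
  | smul r _ ih =>
    obtain ⟨c, hc, h⟩ := ih
    exact ⟨r • c, smul_mem _ _ hc, by rw [LinearMap.comp_smul, h, map_smul]⟩
  | con _ ih =>
    refine ⟨0, zero_mem _, lext fun x => ?_⟩
    refine (O.freeFun_eta (O.root H.E).f (O.root H.E).f_gr (O.graft H.E _)).trans ?_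
    rw [root_graft, map_zero, map_zero, l_zero]
  | @act k J p g q c hc _ ih =>
    choose cs hcs h using ih
    refine ⟨O.comp J c cs, O.comp_gr J q p c cs hc hcs, ?_⟩
    rw [← O.frAct_bop H.E J p c cs hcs]
    have hm := map_bop (A := H.E) (B := H.C) (A' := H.E) (B' := O.free H.E) J p g
      (fun i => O.br H.E (cs i)) lid H.E.hasPar_id
      (O.freeFun (O.root H.E).f (O.root H.E).f_gr) (fun i x => by rw [pmap_id]; exact lcongr (h i) x)
    rw [pmap_id, LinearMap.comp_id] at hm
    rw [← hm]
    refine lext fun x => ?_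
    exact O.freeFun_act _ _ _ _

variable (H)

/-- The operations on tensors of elements of the hull that restrict to operations
`j θ(c, -)` on the domain. -/
def QOp (J : ℕ) (p : ℤ) (χ : (⨂[R]^J) H.E →ₗ[R] H.E) : Prop :=
  GrT H.E H.E χ p ∧ ∃ c ∈ (O.obj J).gr p, ∀ x : A.dom.sub J, χ (pow(H.j.f) x.1) = H.j.f (A.θ c x)

variable {H}

lemma QOp.unTone : H.QOp 1 0 H.E.unTone := by
  refine ⟨H.E.unTone_grT, O.one, O.one_gr, fun x => ?_⟩
  obtain ⟨x, hx⟩ := x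
  obtain ⟨a, rfl⟩ : ∃ a, x = tp R fun _ : Fin 1 => a := ⟨A.cx.unTone x, by rw [← tone_apply, tone_unTone]⟩
  rw [A.θ_one, map_tp, unTone_tprod]

lemma COp.aug_qop (h : H.COp J p g) : H.QOp J p (H.aug ∘ₗ g) := by
  refine ⟨fun n x hx => H.aug_gr _ _ (h.grT n x hx), ?_⟩
  obtain ⟨c, hc, hr⟩ := h.root
  refine ⟨c, hc, fun x => ?_⟩
  rw [← H.T_br]
  exact congrArg H.T (lcongr hr _)

/-- Block operations on the domain, with entries that restrict to operations `j θ(c, -)`. -/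
lemma bop_qop {J : Fin k → ℕ} {p : Fin k → ℤ} {χ : ∀ i, (⨂[R]^(J i)) H.E →ₗ[R] H.E}
    {cs : ∀ i, O.obj (J i)} (hcs : ∀ i, cs i ∈ (O.obj (J i)).gr (p i))
    (hχ : ∀ i, ∀ x : A.dom.sub (J i), χ i (pow(H.j.f) x.1) = H.j.f (A.θ (cs i) x))
    (z : A.dom.sub (∑ i, J i)) :
    ∃ y : A.dom.sub k, bop H.E H.E J p χ (pow(H.j.f) z.1) =
      pow(H.j.f) y.1 ∧ ∀ c, A.θ (O.comp J c cs) z = A.θ c y := by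
  obtain ⟨w, hw⟩ := (A.dom.quasi_prod J).1 z.2
  refine ⟨⟨_, A.θ_mem J p cs z w hcs hw.symm⟩, ?_, fun c => A.θ_comp J p c cs z w hcs hw.symm⟩
  have h := lcongr (split_map J (fun _ => H.j.f)) z.1
  rw [lcmp, lcmp] at h
  refine (congrArg (pmap fun i => χ i ∘ₗ H.E.teps (J i) (suf p i)) (h.trans (congrArg _ hw.symm))).trans ?_
  refine lcongr (f := pmap _ ∘ₗ pmap _ ∘ₗ mapIncl _) (g := pow(H.j.f) ∘ₗ pmap _) (pext (mext fun y => ?_)) w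
  simp only [l_mult, lcmp, mapIncl, map_tp]
  congr 1
  funext i
  rw [← hχ]
  congr 1
  exact H.map_j_teps _ _

lemma bop_qop_mem {J : Fin k → ℕ} {p : Fin k → ℤ}
    {χ : ∀ i, (⨂[R]^(J i)) H.E →ₗ[R] H.E} (hχ : ∀ i, H.QOp (J i) (p i) (χ i))
    {z : (⨂[R]^(∑ i, J i)) H.E} (hz : z ∈ H.L _) : bop H.E H.E J p χ z ∈ H.L k := by
  choose _ cs hcs h using hχ
  obtain ⟨x, hx, rfl⟩ := hz
  obtain ⟨y, hy, -⟩ := bop_qop hcs h ⟨x, hx⟩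
  exact ⟨y.1, y.2, hy.symm⟩

variable (H)

/-- The domain of the partial algebra: the values on the domain of `A` of tensor products of
operations. -/
def U (k : ℕ) : Submodule R ((⨂[R]^k) H.C) :=
  span R {w | ∃ (J : Fin k → ℕ) (p : Fin k → ℤ) (g : ∀ i, (⨂[R]^(J i)) H.E →ₗ[R] H.C)
    (z : (⨂[R]^(∑ i, J i)) H.E), (∀ i, H.COp (J i) (p i) (g i)) ∧ z ∈ H.L _ ∧ w = bop H.E H.C J p g z}

variable {H}

/-- The augmentation maps the domain to the domain of `A`, compatibly with the structure maps. -/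
lemma aug_mem {u : (⨂[R]^k) H.C} (hu : u ∈ H.U k) : ∃ x : A.dom.sub k, pow(H.aug) u =
      pow(H.j.f) x.1 ∧ ∀ c, H.aug (O.frAct H.V c u) = H.j.f (A.θ c x) := by
  induction hu using span_induction with
  | mem u hu =>
    obtain ⟨J, p, g, z, hg, ⟨z, hz, rfl⟩, rfl⟩ := hu
    choose cs hcs h using fun i => (hg i).root
    have hχ : ∀ i, ∀ x : A.dom.sub (J i), (H.aug ∘ₗ g i) (pow(H.j.f) x.1) = H.j.f (A.θ (cs i) x) := by
      intro i x
      rw [← H.T_br]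
      exact congrArg H.T (lcongr (h i) _)
    obtain ⟨y, hy, hy2⟩ := bop_qop hcs hχ ⟨z, hz⟩
    have hm := map_bop (A := H.E) (B := H.C) (A' := H.E) (B' := H.E) J p g
      (fun i => H.aug ∘ₗ g i) lid H.E.hasPar_id H.aug (fun i x => by rw [pmap_id]; rfl)
    rw [pmap_id, LinearMap.comp_id] at hm
    refine ⟨y, (lcongr hm _).trans hy, fun c => ?_⟩
    rw [← hy2, ← H.T_br]
    refine congrArg H.T ?_
    have hm := map_bop (A := H.E) (B := H.C) (A' := H.E) (B' := O.free H.E) J p g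
      (fun i => O.br H.E (cs i)) lid H.E.hasPar_id
      (O.freeFun (O.root H.E).f (O.root H.E).f_gr) (fun i x => by rw [pmap_id]; exact lcongr (h i) x)
    rw [pmap_id, LinearMap.comp_id] at hm
    rw [← O.frAct_bop H.E J p c cs hcs, ← hm]
    exact O.freeFun_act _ _ _ _
  | zero =>
    refine ⟨0, ?_, fun c => ?_⟩
    · rw [ZeroMemClass.coe_zero, map_zero, map_zero]
    · simp only [map_zero]
  | add x y _ _ hx hy =>
    obtain ⟨x', hx1, hx2⟩ := hx
    obtain ⟨y', hy1, hy2⟩ := hy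
    refine ⟨x' + y', ?_, fun c => ?_⟩
    · rw [map_add, hx1, hy1, Submodule.coe_add, map_add]
    · simp only [map_add, hx2, hy2]
  | smul r x _ hx =>
    obtain ⟨x', hx1, hx2⟩ := hx
    refine ⟨r • x', ?_, fun c => ?_⟩
    · rw [map_smul, hx1, Submodule.coe_smul, map_smul]
    · simp only [map_smul, hx2]

end Operad.Ext

namespace DGModule

lemma split_bop (A B : DGModule R) (j : Fin k → ℕ) (l : ∀ i, Fin (j i) → ℕ)
    (P : ∀ i, Fin (j i) → ℤ) (ψ : ∀ i m, (⨂[R]^(l i m)) A →ₗ[R] B) :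
    B.split j ∘ₗ bop A B ♭(l) (flat P)
        ♭(ψ) =
      pmap (fun i => bop A B (l i) (P i) (ψ i) ∘ₗ A.teps (∑ m, l i m) (suf (fun i => ∑ m, P i m) i)) ∘ₗ
        A.split (fun i => ∑ m, l i m) ∘ₗ A.tmv (finCongr (sum_arity j l)) := by
  refine A.tprod_flat_ext ♭(l) fun b => ?_
  obtain ⟨c, rfl⟩ := exists_flat_dep (T := fun i m => Fin (l i m) → A) b
  set D : ∀ i, Fin (j i) → B := fun i m => ψ i m
    (A.teps (l i m) (suf (flat P) (fsf ⟨i, m⟩)) (tp R (c i m)))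
    with hD
  have h1 : bop A B ♭(l) (flat P)
        ♭(ψ)
        (tp R (flat (j := ♭(l)) ♭(c))) =
      tp R (flat D) := by
    rw [bop_flat]
    congr 1
    funext s
    rw [flat, hD]
    dsimp only
    rw [show (fsf ⟨(fsi s).1, (fsi s).2⟩) = s from
      (fsf).apply_symm_apply s]
  rw [lcmp, h1, split_flat, lcmp, lcmp]
  have h2 : A.tmv (finCongr (sum_arity j l)) (tp R
      (flat (j := ♭(l)) ♭(c))) =
      tp R (flat fun i => flat (c i)) := by
    refine (A.tmv_finCongr (sum_arity j l) _).trans ?_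
    congr 1
    funext t
    exact flat_flat c t
  rw [h2, split_flat, map_tp]
  congr 1
  funext i
  rw [lcmp]
  have h3 : ∀ n', A.teps (∑ m, l i m) n' (tp R (flat (c i))) =
      tp R (flat fun m r => A.eps n' (c i m r)) := fun n' => by
    rw [teps, map_tp]; rfl
  rw [h3, bop_flat]
  congr 1
  funext m
  simp only [hD]
  rw [suf_flat, add_comm, teps_add, lcmp]
  congr 2
  rw [teps, map_tp]

section

variable {A B : DGModule R} {j : Fin k → ℕ} {p : Fin k → ℤ} {L : ∀ J, Submodule R ((⨂[R]^J) A)}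
  (hL : ∀ J n, ∀ y ∈ L J, A.teps J n y ∈ L J) {φ ψ : ∀ i, (⨂[R]^(j i)) A →ₗ[R] B} {z : (⨂[R]^(∑ i, j i)) A}
  (hz : A.split j z ∈ tspan fun i => L (j i))

include hL hz

lemma bop_mem_tspan : bop A B j p φ z ∈ tspan fun i => (L (j i)).map (φ i) :=
  map_mem_tspan (Q := fun i => (L (j i)).map (φ i)) (fun _ _ hy => ⟨_, hL _ _ _ hy, rfl⟩) hz

lemma bop_congr_of_mem (h : ∀ i, ∀ y ∈ L (j i), φ i y = ψ i y) : bop A B j p φ z = bop A B j p ψ z := by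
  refine map_eq_of_mem_tspan (P := fun i => L (j i)) (fun i y hy => ?_) hz
  exact h i _ (hL _ _ _ hy)

end

end DGModule

namespace Operad.Ext

variable {O : Operad R} {A : PartialAlgebra O} (H : Ext A)

/-- Operations preceded by tensor products of operations that restrict to the domain. -/
def NOp (J : ℕ) (p : ℤ) (g : (⨂[R]^J) H.E →ₗ[R] H.C) : Prop :=
  ∃ (a : ℕ) (r : ℤ) (Γ : (⨂[R]^a) H.E →ₗ[R] H.C) (P : Fin a → ℕ) (q : Fin a → ℤ)
    (χ : ∀ m, (⨂[R]^(P m)) H.E →ₗ[R] H.E) (e : Fin J ≃ Fin (∑ m, P m)),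
    H.COp a r Γ ∧ (∀ m, H.QOp (P m) (q m) (χ m)) ∧ p = r + ∑ m, q m ∧ g = Γ ∘ₗ bop H.E H.E P q χ ∘ₗ H.E.tmv e

variable {H} {J : ℕ} {p : ℤ} {g : (⨂[R]^J) H.E →ₗ[R] H.C}

lemma COp.nop (h : H.COp J p g) : H.NOp J p g := by
  refine ⟨J, p, g, fun _ => 1, fun _ => 0, fun _ => H.E.unTone, finCongr (by simp), h,
    fun _ => QOp.unTone, by simp, ?_⟩
  refine lext fun x => ?_
  rw [bop_unTone, lcmp, lcmp]
  congr 1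
  exact (H.E.tmv_tmv_symm (finCongr (by simp)) x).symm

lemma NOp.inc {J : ℕ} {p : ℤ} {χ : (⨂[R]^J) H.E →ₗ[R] H.E} (h : H.QOp J p χ) : H.NOp J p (H.inc ∘ₗ χ) := by
  refine ⟨1, 0, _, fun _ => J, fun _ => p, fun _ => χ, finCongr (by simp), COp.inc, fun _ => h, by simp, ?_⟩
  refine lext fun x => ?_
  rw [bop_fin_one]
  simp only [lcmp, unTone_tone]
  congr 2
  exact (H.E.tmv_tmv_symm (finCongr (by simp)) x).symm

lemma NOp.con (h : H.NOp J p g) : H.NOp J (p + 1) (H.con ∘ₗ g) := by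
  obtain ⟨a, r, Γ, P, q, χ, e, hΓ, hχ, rfl, rfl⟩ := h
  exact ⟨a, r + 1, _, P, q, χ, e, hΓ.con, hχ, by ring, rfl⟩

lemma nop_bop {J : Fin k → ℕ} {p : Fin k → ℤ}
    {g : ∀ i, (⨂[R]^(J i)) H.E →ₗ[R] H.C} (h : ∀ i, H.NOp (J i) (p i) (g i)) :
    ∃ (a : Fin k → ℕ) (r : Fin k → ℤ) (Γ : ∀ i, (⨂[R]^(a i)) H.E →ₗ[R] H.C)
      (P : Fin (∑ i, a i) → ℕ) (q : Fin (∑ i, a i) → ℤ)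
      (χ : ∀ m, (⨂[R]^(P m)) H.E →ₗ[R] H.E) (e : Fin (∑ i, J i) ≃ Fin (∑ m, P m)) (s : ℤ),
      (∀ i, H.COp (a i) (r i) (Γ i)) ∧ (∀ m, H.QOp (P m) (q m) (χ m)) ∧ ∑ i, p i = ∑ i, r i + ∑ m, q m ∧
        bop H.E H.C J p g = sgn R s • (bop H.E H.C a r Γ ∘ₗ bop H.E H.E P q χ ∘ₗ H.E.tmv e) := by
  choose a r Γ P q χ e hΓ hχ hp hg using h
  obtain rfl : p = fun i => r i + ∑ m, q i m := funext hp
  obtain rfl : g = fun i => Γ i ∘ₗ bop H.E H.E (P i) (q i) (χ i) ∘ₗ H.E.tmv (e i) := funext hg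
  refine ⟨a, r, Γ, ♭(P), flat q,
    ♭(χ), _,
    unshuffleExp r fun i => ∑ m, q i m, hΓ, fun m => hχ _ _, ?_,
    bop_comp_bop H.E H.E H.C a P q χ (fun i m => (hχ i m).1.tpar) r Γ e⟩
  rw [sum_add_distrib, sum_flat]

lemma NOp.act {J : Fin k → ℕ} {p : Fin k → ℤ}
    {g : ∀ i, (⨂[R]^(J i)) H.E →ₗ[R] H.C} (h : ∀ i, H.NOp (J i) (p i) (g i)) {q : ℤ}
    {c : O.obj k} (hc : c ∈ (O.obj k).gr q) :
    H.NOp (∑ i, J i) (q + ∑ i, p i) (O.frAct H.V c ∘ₗ bop H.E H.C J p g) := by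
  obtain ⟨a, r, Γ, P, q', χ, e, s, hΓ, hχ, hp, hg⟩ := nop_bop h
  refine ⟨_, _, sgn R s • (O.frAct H.V c ∘ₗ bop H.E H.C a r Γ), P, q', χ, e,
    COp.smul _ (COp.act c hc hΓ), hχ, by rw [hp, add_assoc], ?_⟩
  rw [hg, LinearMap.comp_smul, LinearMap.smul_comp]
  rfl

lemma NOp.bop_mem {J : Fin k → ℕ} {p : Fin k → ℤ}
    {g : ∀ i, (⨂[R]^(J i)) H.E →ₗ[R] H.C} (h : ∀ i, H.NOp (J i) (p i) (g i))
    {z : (⨂[R]^(∑ i, J i)) H.E} (hz : z ∈ H.L _) : bop H.E H.C J p g z ∈ H.U k := by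
  obtain ⟨a, r, Γ, P, q', χ, e, s, hΓ, hχ, hp, hg⟩ := nop_bop h
  rw [hg]
  exact smul_mem _ _ (subset_span ⟨a, r, Γ, _, hΓ, bop_qop_mem hχ (H.L_tmv e hz), rfl⟩)

variable (H) in
/-- The maps that agree on the domain with a linear combination of operations. -/
def SOp (J : ℕ) (p : ℤ) (g : (⨂[R]^J) H.E →ₗ[R] H.C) : Prop :=
  ∃ g' ∈ span R {g | H.NOp J p g}, ∀ z ∈ H.L J, g z = g' z

lemma NOp.sop (h : H.NOp J p g) : H.SOp J p g :=
  ⟨g, subset_span h, fun _ _ => rfl⟩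

lemma SOp.of_eq {g' : (⨂[R]^J) H.E →ₗ[R] H.C} (h : H.SOp J p g)
    (hg : ∀ z ∈ H.L J, g' z = g z) : H.SOp J p g' := by
  obtain ⟨g₀, h0, h1⟩ := h
  exact ⟨g₀, h0, fun z hz => (hg z hz).trans (h1 z hz)⟩

lemma SOp.add {g' : (⨂[R]^J) H.E →ₗ[R] H.C} (h : H.SOp J p g)
    (h' : H.SOp J p g') : H.SOp J p (g + g') := by
  obtain ⟨g₀, h0, h1⟩ := h
  obtain ⟨g₁, h0', h1'⟩ := h'
  refine ⟨g₀ + g₁, add_mem h0 h0', fun z hz => ?_⟩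
  rw [l_add, l_add, h1 z hz, h1' z hz]

lemma SOp.zero : H.SOp J p 0 := ⟨0, zero_mem _, fun _ _ => rfl⟩

lemma SOp.smul (h : H.SOp J p g) (r : R) : H.SOp J p (r • g) := by
  obtain ⟨g₀, h0, h1⟩ := h
  refine ⟨r • g₀, smul_mem _ _ h0, fun z hz => ?_⟩
  rw [l_smul, l_smul, h1 z hz]

lemma SOp.neg (h : H.SOp J p g) : H.SOp J p (-g) := by
  have := h.smul (-1)
  rwa [neg_one_smul] at this

lemma SOp.sum {J : ℕ} {p : ℤ} {ι : Type*} (s : Finset ι) {g : ι → ((⨂[R]^J) H.E →ₗ[R] H.C)}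
    (h : ∀ i, H.SOp J p (g i)) : H.SOp J p (∑ i ∈ s, g i) := by
  classical
  induction s using Finset.induction_on with
  | empty => rw [Finset.sum_empty]; exact SOp.zero
  | insert i s hi ih => rw [Finset.sum_insert hi]; exact (h i).add ih

lemma SOp.con (h : H.SOp J p g) : H.SOp J (p + 1) (H.con ∘ₗ g) := by
  obtain ⟨g₀, h0, h1⟩ := h
  refine ⟨H.con ∘ₗ g₀, ?_, fun z hz => congrArg H.con (h1 z hz)⟩
  have : span R {g | H.NOp J p g} ≤ (span R {g | H.NOp J (p + 1) g}).comap
      (LinearMap.llcomp R _ _ _ H.con) :=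
    span_le.2 fun g hg => subset_span (NOp.con hg)
  exact this h0

lemma SOp.bop_mem {J : Fin k → ℕ} {p : Fin k → ℤ}
    {g : ∀ i, (⨂[R]^(J i)) H.E →ₗ[R] H.C} (h : ∀ i, H.SOp (J i) (p i) (g i))
    {z : (⨂[R]^(∑ i, J i)) H.E} (hz : z ∈ H.L _) : bop H.E H.C J p g z ∈ H.U k := by
  choose g' h0 h1 using h
  rw [bop_congr_of_mem (fun J n y => H.L_teps n) (H.split_mem_L J hz) h1]
  exact MultilinearMap.mem_of_forall_span ((LinearMap.applyₗ z).compMultilinearMap (bopM H.E H.C J p)) _ (H.U k)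
    (fun s hs => NOp.bop_mem hs hz) g' h0

lemma SOp.act {J : Fin k → ℕ} {p : Fin k → ℤ}
    {g : ∀ i, (⨂[R]^(J i)) H.E →ₗ[R] H.C} (h : ∀ i, H.SOp (J i) (p i) (g i)) {q : ℤ}
    {c : O.obj k} (hc : c ∈ (O.obj k).gr q) :
    H.SOp (∑ i, J i) (q + ∑ i, p i) (O.frAct H.V c ∘ₗ bop H.E H.C J p g) := by
  choose g' h0 h1 using h
  refine ⟨O.frAct H.V c ∘ₗ bop H.E H.C J p g', ?_, fun z hz => congrArg (O.frAct H.V c)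
    (bop_congr_of_mem (fun J n y => H.L_teps n) (H.split_mem_L J hz) h1)⟩
  exact MultilinearMap.mem_of_forall_span
    ((LinearMap.llcomp R ((⨂[R]^(∑ i, J i)) H.E) ((⨂[R]^k) H.C) H.C (O.frAct H.V c)).compMultilinearMap
      (bopM H.E H.C J p)) _ _
    (fun s hs => subset_span (NOp.act hs hc)) g' h0

lemma bop_tD (J : Fin k → ℕ) (p : Fin k → ℤ) (g : ∀ i, (⨂[R]^(J i)) H.E →ₗ[R] H.C)
    (hg : ∀ i, TPar H.E H.C (g i) (p i)) :
    H.C.tDer lid H.D k ∘ₗ bop H.E H.C J p g = (∑ i, sgn R (∑ l, if l < i then p l else 0) •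
        bop H.E H.C J (update p i (p i - 1)) (update g i (H.D ∘ₗ g i - sgn R (p i) • (g i ∘ₗ H.E.tD (J i))))) +
      sgn R (∑ i, p i) • (bop H.E H.C J p g ∘ₗ H.E.tD (∑ i, J i)) := by
  have := tDer_bop (A := H.E) (A' := H.E) (B := H.C) H.E.hasPar_id (r := -1) (by decide)
    H.E.hasPar_d H.D J p g g (fun i => H.D ∘ₗ g i - sgn R (p i) • (g i ∘ₗ H.E.tD (J i)))
    (fun i => by rw [pmap_id, LinearMap.comp_id]) hg
    (fun i => by rw [tD_eq_tDer, sub_add_cancel])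
  rw [this, tD_eq_tDer]

/-- The commutator of an operation with the differential is a combination of operations. -/
lemma COp.boundary (h : H.COp J p g) :
    H.SOp J (p - 1) (H.D ∘ₗ g - sgn R p • (g ∘ₗ H.E.tD J)) := by
  induction h with
  | inc =>
    refine SOp.zero.of_eq fun z hz => ?_
    obtain ⟨a, rfl⟩ := H.L_one hz
    have h1 : H.E.tD 1 (H.E.tone (H.j.f a)) = H.E.tone (H.E.d (H.j.f a)) := tDer_tone lid H.E.d (H.j.f a)
    rw [l_sub, l_smul, lcmp, lcmp, lcmp, lcmp, h1, unTone_tone, unTone_tone, sgn_zero, one_smul, l_zero, sub_eq_zero]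
    exact H.D_inc _
  | @smul J p g r _ ih =>
    refine (ih.smul r).of_eq fun z _ => ?_
    simp only [l_sub, l_smul, lcmp, map_smul, smul_sub]
    rw [smul_comm]
  | @con J p g hg ih =>
    have h1 : H.SOp J (p + 1 - 1) g := by rw [add_sub_cancel_right]; exact hg.nop.sop
    have h2 : H.SOp J (p + 1 - 1) (H.inc ∘ₗ H.aug ∘ₗ g) := by
      rw [add_sub_cancel_right]; exact (NOp.inc hg.aug_qop).sop
    have h3 : H.SOp J (p + 1 - 1) (H.con ∘ₗ (H.D ∘ₗ g - sgn R p • (g ∘ₗ H.E.tD J))) := by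
      rw [show p + 1 - 1 = p - 1 + 1 by ring]
      exact ih.con
    refine ((h1.add h2.neg).add h3.neg).of_eq fun z _ => ?_
    rw [l_sub, lcmp, lcmp]
    refine (congrArg (fun t => t - _) (H.D_con (g z))).trans ?_
    simp only [l_sub, l_smul, lcmp, l_add, LinearMap.neg_apply, map_sub, map_smul, sgn_add, sgn_one]
    module
  | @act k J p g q c hc hg ih =>
    have h1 : H.SOp (∑ i, J i) (q + ∑ i, p i - 1) (O.frAct H.V ((O.obj k).d c) ∘ₗ bop H.E H.C J p g) := by
      have := SOp.act (fun i => (hg i).nop.sop) ((O.obj k).d_gr q c hc)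
      rwa [show q - 1 + ∑ i, p i = q + ∑ i, p i - 1 by ring] at this
    have h2 : ∀ i, H.SOp (∑ i, J i) (q + ∑ i, p i - 1) (O.frAct H.V ((O.obj k).eps 1 c) ∘ₗ
        bop H.E H.C J (update p i (p i - 1)) (update g i (H.D ∘ₗ g i - sgn R (p i) • (g i ∘ₗ H.E.tD (J i))))) := by
      intro i
      have := SOp.act (J := J) (p := update p i (p i - 1)) (g := update g i
          (H.D ∘ₗ g i - sgn R (p i) • (g i ∘ₗ H.E.tD (J i)))) (fun l => by
        rcases eq_or_ne l i with rfl | hl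
        · rw [update_self, update_self]; exact ih l
        · rw [update_of_ne hl, update_of_ne hl]; exact (hg l).nop.sop)
        ((O.obj k).eps_mem 1 hc)
      rwa [Finset.sum_update_of_mem (mem_univ i), ← Finset.erase_eq,
        show q + (p i - 1 + ∑ x ∈ Finset.univ.erase i, p x) = q + (p i + ∑ x ∈ Finset.univ.erase i, p x) - 1 by ring,
        Finset.add_sum_erase _ _ (mem_univ i)] at this
    refine (h1.add (SOp.sum Finset.univ fun i => (h2 i).smul
      (sgn R (∑ l, if l < i then p l else 0)))).of_eq fun z _ => ?_
    have hb := lcongr (bop_tD J p g fun i => (hg i).grT.tpar) z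
    rw [lcmp, l_add, l_smul, l_sum] at hb
    rw [l_sub, l_smul, lcmp, lcmp, lcmp, D_act, hb, map_add, map_smul, map_sum, l_add,
      l_sum, lcmp, (O.obj k).eps_of_mem 1 hc, lcmp]
    simp only [map_smul, l_smul, smul_smul, one_mul, lcmp]
    rw [← add_assoc, ← sgn_add, add_comm (∑ i, p i) q, add_sub_cancel_right]

end Operad.Ext

lemma forall_of_forall_fsf {j : Fin k → ℕ} {P : ∀ i, Fin (j i) → Prop}
    (h : ∀ s : Fin (∑ i, j i), P (fsi s).1 (fsi s).2) (i : Fin k)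
    (m : Fin (j i)) : P i m := by
  have := h (fsf ⟨i, m⟩)
  rwa [symm_apply_apply] at this

lemma DGModule.map_bop_id {A B C : DGModule R} (j : Fin k → ℕ)
    (p : Fin k → ℤ) (φ : ∀ i, (⨂[R]^(j i)) A →ₗ[R] B) (F : B →ₗ[R] C) :
    pow(F) ∘ₗ bop A B j p φ = bop A C j p (fun i => F ∘ₗ φ i) := by
  rw [bop, bop, ← l_assoc, ← pmap_comp]
  rfl

namespace Operad.Ext

variable {O : Operad R} {A : PartialAlgebra O} {H : Ext A}

lemma COp.bop_mem {J : Fin k → ℕ} {p : Fin k → ℤ}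
    {g : ∀ i, (⨂[R]^(J i)) H.E →ₗ[R] H.C} (h : ∀ i, H.COp (J i) (p i) (g i))
    {z : (⨂[R]^(∑ i, J i)) H.E} (hz : z ∈ H.L _) : bop H.E H.C J p g z ∈ H.U k :=
  subset_span ⟨J, p, g, z, h, hz, rfl⟩

lemma U_le {S : Submodule R ((⨂[R]^k) H.C)}
    (h : ∀ (J : Fin k → ℕ) (p : Fin k → ℤ) (g : ∀ i, (⨂[R]^(J i)) H.E →ₗ[R] H.C)
      (_ : ∀ i, H.COp (J i) (p i) (g i)), ∀ z ∈ H.L (∑ i, J i), bop H.E H.C J p g z ∈ S) :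
    H.U k ≤ S := by
  refine span_le.2 ?_
  rintro _ ⟨J, p, g, z, hg, hz, rfl⟩
  exact h J p g hg z hz

lemma U_tD (k : ℕ) : H.U k ≤ (H.U k).comap (H.C.tDer lid H.D k) := by
  refine U_le fun J p g hg z hz => ?_
  have hb := lcongr (bop_tD J p g fun i => (hg i).grT.tpar) z
  rw [lcmp] at hb
  rw [mem_comap, hb, l_add, l_smul, l_sum]
  refine add_mem (Submodule.sum_mem _ fun i _ => smul_mem _ _ ?_) (smul_mem _ _ (COp.bop_mem hg (H.L_tD hz)))
  refine SOp.bop_mem (fun l => ?_) hz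
  rcases eq_or_ne l i with rfl | hl
  · rw [update_self, update_self]; exact (hg l).boundary
  · rw [update_of_ne hl, update_of_ne hl]; exact (hg l).nop.sop

lemma U_slot {F : Fin k → (H.C →ₗ[R] H.C)} {T : H.C →ₗ[R] H.C} (i : Fin k)
    (hF : ∀ l {J p g}, H.COp J p g → H.NOp J p (F l ∘ₗ g))
    (hT : ∀ {J p g}, H.COp J p g → H.NOp J (p + 1) (T ∘ₗ g)) :
    H.U k ≤ (H.U k).comap (slot H.C H.C F i T) := by
  refine U_le fun J p g hg z hz => ?_
  have hb := lcongr (slot_bop F i T J p g (fun i => (hg i).grT.tpar) (r := 1) (by simp)) z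
  rw [lcmp] at hb
  rw [mem_comap, hb, l_smul]
  refine smul_mem _ _ (NOp.bop_mem (fun l => ?_) hz)
  rcases eq_or_ne l i with rfl | hl
  · rw [update_self, if_pos rfl]; exact hT (hg l)
  · rw [update_of_ne hl, if_neg hl]; exact hF l (hg l)

lemma map_inc_mem {z : (⨂[R]^k) H.E} (hz : z ∈ H.L k) : pow(H.inc) z ∈ H.U k := by
  have hb := map_bop_id (A := H.E) (B := H.E) (C := H.C) (fun _ : Fin k => 1) (fun _ => 0) (fun _ => H.E.unTone) H.inc
  rw [bop_unTone] at hb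
  have e : k = ∑ _i : Fin k, 1 := by simp
  have h2 := lcongr hb (H.E.tmv (finCongr e) z)
  have h3 := H.E.tmv_tmv_symm (finCongr e.symm) z
  rw [lcmp] at h2
  rw [← h3]
  refine Eq.mpr (congrArg (· ∈ H.U k) h2) ?_
  exact COp.bop_mem (fun _ => COp.inc) (H.L_tmv _ hz)

lemma U_zero : H.U 0 = ⊤ := by
  rw [eq_top_iff, ← span_tprod_eq_top, span_le]
  rintro _ ⟨a, rfl⟩
  have h : tp R (fun i : Fin 0 => i.elim0) ∈ H.L 0 :=
    ⟨tp R (fun i : Fin 0 => i.elim0), by rw [A.dom.sub_zero]; trivial, by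
      rw [map_tp]; congr 1; exact Subsingleton.elim _ _⟩
  have := map_inc_mem h
  rw [map_tp] at this
  rwa [Subsingleton.elim a]

lemma U_tmv (σ : Perm (Fin k)) : H.U k ≤ (H.U k).comap (H.C.tmv σ) := by
  refine U_le fun J p g hg z hz => ?_
  obtain ⟨J, rfl⟩ := exists_comp_perm (T := fun _ => ℕ) σ J
  obtain ⟨p, rfl⟩ := exists_comp_perm (T := fun _ => ℤ) σ p
  obtain ⟨g, rfl⟩ := exists_comp_perm (T := fun i => (⨂[R]^(J i)) H.E →ₗ[R] H.C) σ g
  have hg' : ∀ i, H.COp (J i) (p i) (g i) := fun i => by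
    obtain ⟨i, rfl⟩ := σ.surjective i
    exact hg i
  have hb := lcongr (tmv_bop (A := H.E) (B := H.C) σ J p g fun i => (hg' i).grT) z
  rw [lcmp] at hb
  rw [mem_comap, hb]
  exact smul_mem _ _ (COp.bop_mem hg' (H.L_tmv _ hz))

lemma U_graded (k : ℕ) : H.U k ≤ ⨆ n, H.U k ⊓ H.C.tgr k n := by
  refine U_le fun J p g hg z hz => ?_
  refine (iSup_le (a := comap (bop H.E H.C J p g) (⨆ n, H.U k ⊓ H.C.tgr k n)) fun n y hy => ?_) (H.L_graded _ hz)
  exact mem_iSup_of_mem _ ⟨COp.bop_mem hg hy.1, bop_mem_tgr (fun i => (hg i).grT) hy.2⟩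

lemma U_teps (k : ℕ) (n : ℤ) : H.U k ≤ (H.U k).comap (H.C.teps k n) := by
  refine (H.U_graded k).trans (iSup_le fun m x hx => ?_)
  rw [mem_comap, H.C.teps_of_mem n hx.2]
  exact smul_mem _ _ hx.1

lemma U_act (j : Fin k → ℕ) (q : Fin k → ℤ) (cs : ∀ i, O.obj (j i))
    (hc : ∀ i, cs i ∈ (O.obj (j i)).gr (q i)) :
    H.U (∑ i, j i) ≤ (H.U k).comap (bop H.C H.C j q fun i => O.frAct H.V (cs i)) := by
  refine U_le fun J p g hg z hz => ?_
  obtain ⟨J, rfl⟩ := exists_flat_dep (T := fun _ _ => ℕ) J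
  obtain ⟨p, rfl⟩ := exists_flat p
  obtain ⟨g, rfl⟩ := exists_flat_dep (T := fun i m => (⨂[R]^(J i m)) H.E →ₗ[R] H.C) g
  have hg' : ∀ i m, H.COp (J i m) (p i m) (g i m) :=
    forall_of_forall_fsf (P := fun i m => H.COp (J i m) (p i m) (g i m)) hg
  have hb := lcongr (bop_bop H.E H.C H.C j J q p (fun i => O.frAct H.V (cs i)) g fun i m => (hg' i m).grT.tpar) z
  rw [lcmp] at hb
  rw [mem_comap]
  refine Eq.mpr (congrArg (· ∈ H.U k) hb) ?_
  exact smul_mem _ _ (COp.bop_mem (fun i => COp.act (cs i) (hc i) (hg' i)) (H.L_tmv _ hz))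

lemma U_split (j : Fin k → ℕ) {u : (⨂[R]^(∑ i, j i)) H.C} (hu : u ∈ H.U _) :
    H.C.split j u ∈ tspan fun i => H.U (j i) := by
  refine U_le (S := comap (H.C.split j) (tspan fun i => H.U (j i))) (fun J p g hg z hz => ?_) hu
  obtain ⟨J, rfl⟩ := exists_flat_dep (T := fun _ _ => ℕ) J
  obtain ⟨p, rfl⟩ := exists_flat p
  obtain ⟨g, rfl⟩ := exists_flat_dep (T := fun i m => (⨂[R]^(J i m)) H.E →ₗ[R] H.C) g
  have hg' : ∀ i m, H.COp (J i m) (p i m) (g i m) :=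
    forall_of_forall_fsf (P := fun i m => H.COp (J i m) (p i m) (g i m)) hg
  have hb := lcongr (split_bop H.E H.C j J p g) z
  rw [lcmp] at hb
  rw [mem_comap]
  refine Eq.mpr (congrArg (· ∈ _) hb) ?_
  rw [lcmp, lcmp]
  refine map_mem_tspan (fun i x hx => ?_) (H.split_mem_L (fun i => ∑ m, J i m) (H.L_tmv (finCongr (sum_arity j J)) hz))
  exact COp.bop_mem (hg' i) (H.L_teps _ hx)

variable (H) in
/-- The module underlying the partial algebra: the values of operations on the domain of `A`. -/
def U₁ : Submodule R H.C := (H.U 1).comap H.C.tone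

lemma COp.mem_U₁ {J : ℕ} {p : ℤ} {g : (⨂[R]^J) H.E →ₗ[R] H.C} (hg : H.COp J p g)
    {z : (⨂[R]^J) H.E} (hz : z ∈ H.L J) : g z ∈ H.U₁ := by
  have e : J = ∑ _i : Fin 1, J := by simp
  have h := lcongr (bop_fin_one H.E H.C p g) (H.E.tmv (finCongr e) z)
  have h3 := H.E.tmv_tmv_symm (finCongr e.symm) z
  have := COp.bop_mem (fun _ : Fin 1 => hg) (H.L_tmv (finCongr e) hz)
  rw [h, lcmp, lcmp] at this
  rw [← h3]
  exact this

lemma U₁_le {S : Submodule R H.C} (h : ∀ (J : ℕ) (p : ℤ) (g : (⨂[R]^J) H.E →ₗ[R] H.C),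
    H.COp J p g → ∀ z ∈ H.L J, g z ∈ S) : H.U₁ ≤ S := by
  intro w hw
  have : H.U 1 ≤ S.comap H.C.unTone := by
    refine U_le fun J p g hg z hz => ?_
    obtain ⟨J, rfl⟩ : ∃ J₀, J = fun _ => J₀ := ⟨J 0, funext fun i => by rw [Subsingleton.elim i]⟩
    obtain ⟨p, rfl⟩ : ∃ J₀, p = fun _ => J₀ := ⟨p 0, funext fun i => by rw [Subsingleton.elim i]⟩
    obtain ⟨g, rfl⟩ : ∃ J₀, g = fun _ => J₀ := ⟨g 0, funext fun i => by rw [Subsingleton.elim i]⟩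
    rw [mem_comap, bop_fin_one, lcmp, lcmp, unTone_tone]
    exact h _ _ _ (hg 0) _ (H.L_tmv _ hz)
  have h2 := this hw
  rwa [mem_comap, unTone_tone] at h2

/-- The domain consists of tensors with factors in the underlying module. -/
lemma U_le_span (k : ℕ) : H.U k ≤ tspan fun _ : Fin k => H.U₁ := by
  refine U_le fun J p g hg z hz => ?_
  refine tspan_le (fun b hb => tp_mem_tspan fun i => ?_) (bop_mem_tspan (fun J n y => H.L_teps n) (H.split_mem_L J hz))
  obtain ⟨y, hy, h⟩ := hb i
  rw [← h]
  exact (hg i).mem_U₁ hy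

lemma act_mem_U₁ (c : O.obj k) {u : (⨂[R]^k) H.C} (hu : u ∈ H.U k) : O.frAct H.V c u ∈ H.U₁ := by
  have hc : c ∈ ⨆ n, (O.obj k).gr n := by rw [(O.obj k).internal.submodule_iSup_eq_top]; trivial
  induction hc using Submodule.iSup_induction' with
  | mem n c hc =>
    exact (U_le (S := H.U₁.comap (O.frAct H.V c)) fun J p g hg z hz => COp.mem_U₁ (COp.act c hc hg) hz) hu
  | zero => rw [map_zero]; exact zero_mem _
  | add x y _ _ hx hy => rw [map_add]; exact add_mem hx hy

end Operad.Ext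

/-! ### Relative acyclicity and homotopies -/

section RelAcyclic

variable {R M M' : Type*} [CommRing R] [AddCommGroup M] [Module R M] [AddCommGroup M'] [Module R M']

/-- The quotient `Q / P` is acyclic with respect to `D`, for submodules `P ⊆ Q`. This makes sense
even if `P` and `Q` are not stable under `D`. -/
def RelAcyclic (D : M →ₗ[R] M) (P Q : Submodule R M) : Prop := P ≤ Q ∧ ∀ z ∈ Q, D z ∈ P → ∃ y ∈ Q, z - D y ∈ P

lemma RelAcyclic.of_isQuasiIncl {D : M →ₗ[R] M} {P Q : Submodule R M} (h : IsQuasiIncl D P Q) : RelAcyclic D P Q := by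
  refine ⟨h.1, fun z hz hDz => ?_⟩
  obtain ⟨y, hy, e⟩ := h.2.1 _ hDz ⟨z, hz, rfl⟩
  obtain ⟨x, hx, -, y', hy', e'⟩ := h.2.2 (z - y) (sub_mem hz (h.1 hy)) (by rw [map_sub, e, sub_self])
  refine ⟨y', hy', ?_⟩
  rw [e', show z - (z - y - x) = y + x by abel]
  exact add_mem hy hx

lemma RelAcyclic.isQuasiIncl {D : M →ₗ[R] M} {P Q : Submodule R M}
    (hDD : ∀ x ∈ Q, D (D x) = 0) (h : RelAcyclic D P Q) : IsQuasiIncl D P Q := by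
  refine ⟨h.1, ?_, fun z hz hDz => ?_⟩
  · rintro _ hx ⟨y, hy, rfl⟩
    obtain ⟨y', hy', e⟩ := h.2 y hy hx
    exact ⟨_, e, by rw [map_sub, hDD y' hy', sub_zero]⟩
  · obtain ⟨y, hy, e⟩ := h.2 z hz (by rw [hDz]; exact zero_mem _)
    exact ⟨_, e, by rw [map_sub, hDD y hy, hDz, sub_zero], y, hy, by abel⟩

/-- Relative acyclicity is inherited along a deformation retraction up to homotopy. -/
lemma RelAcyclic.of_homotopy {D : M →ₗ[R] M} {D' : M' →ₗ[R] M'} {P Q : Submodule R M}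
    {P' Q' : Submodule R M'} (e : M →ₗ[R] M') (s : M' →ₗ[R] M) (h : M →ₗ[R] M)
    (heD : ∀ x, e (D x) = D' (e x)) (hsD : ∀ x, s (D' x) = D (s x))
    (hh : ∀ x, D (h x) + h (D x) = x - s (e x)) (hPQ : P ≤ Q) (heP : ∀ x ∈ P, e x ∈ P')
    (heQ : ∀ x ∈ Q, e x ∈ Q') (hsP : ∀ x ∈ P', s x ∈ P) (hsQ : ∀ x ∈ Q', s x ∈ Q)
    (hhP : ∀ x ∈ P, h x ∈ P) (hhQ : ∀ x ∈ Q, h x ∈ Q) (H : RelAcyclic D' P' Q') :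
    RelAcyclic D P Q := by
  refine ⟨hPQ, fun z hz hDz => ?_⟩
  obtain ⟨y, hy, hy2⟩ := H.2 (e z) (heQ z hz) (by rw [← heD]; exact heP _ hDz)
  refine ⟨s y + h z, add_mem (hsQ y hy) (hhQ z hz), ?_⟩
  have h1 := add_mem (hsP _ hy2) (hhP _ hDz)
  rw [map_sub, hsD] at h1
  convert h1 using 1
  rw [map_add, ← sub_eq_zero]
  have h2 := hh z
  rw [← sub_eq_zero] at h2
  rw [← neg_eq_zero, ← h2]
  abel

end RelAcyclic

namespace DGModule

section Homotopy

variable {A : DGModule R}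

lemma tprod_add_tprod_eq_zero {B : DGModule R} {a b : Fin k → B} (m : Fin k)
    (hm : a m = -b m) (h : ∀ l, l ≠ m → a l = b l) :
    tp R a + tp R b = 0 := by
  have : a = update b m (-b m) := by
    funext l
    rcases eq_or_ne l m with rfl | hl
    · rw [update_self, hm]
    · rw [update_of_ne hl, h l hl]
  rw [this, MultilinearMap.map_update_neg, Function.update_eq_self, neg_add_cancel]

lemma tD_slot_add {F : Fin k → (A →ₗ[R] A)} {s : A →ₗ[R] A} (hF : ∀ l, HasPar A A (F l) 0)
    (hFd : ∀ l x, A.d (F l x) = F l (A.d x)) (hs : HasPar A A s 1) (i : Fin k) :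
    A.tD k ∘ₗ slot A A F i s + slot A A F i s ∘ₗ A.tD k =
      pmap (fun l => if l = i then A.d ∘ₗ s + s ∘ₗ A.d else F l) := by
  have hFe : ∀ l x, A.eps 1 (F l x) = F l (A.eps 1 x) := fun l x => by
    have := lcongr (hF l 1) x
    simpa [sgn_zero] using this
  have hse : ∀ x, A.eps 1 (s x) = - s (A.eps 1 x) := fun x => by
    have := lcongr (hs 1) x
    simpa [sgn_one] using this
  have hde : ∀ x, A.d (A.eps 1 x) = - A.eps 1 (A.d x) := fun x => by rw [Operad.eps_d, neg_neg]
  refine pext (mext fun x => ?_)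
  rw [tD_eq_tDer, tDer_eq_sum_slot]
  simp only [l_mult, l_add, lcmp, l_sum, map_sum]
  rw [← sum_add_distrib, Finset.sum_eq_single i]
  · simp only [slot, map_tp]
    have h1 : ∀ y : A, (fun l => if l = i then y else F l (x l)) = update (fun l => F l (x l)) i y := fun y => by
      funext l
      rcases eq_or_ne l i with rfl | hl
      · rw [update_self, if_pos rfl]
      · rw [update_of_ne hl, if_neg hl]
    have h2 : (fun l => (if l = i then A.d ∘ₗ s + s ∘ₗ A.d else F l) (x l)) =
        update (fun l => F l (x l)) i (A.d (s (x i)) + s (A.d (x i))) := by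
      rw [← h1]
      funext l
      split_ifs with hl
      · subst hl; rfl
      · rfl
    rw [h2, map_update_add, ← h1, ← h1]
    congr 2 <;> funext l <;> rcases lt_trichotomy l i with hl | rfl | hl
    all_goals first | (simp [hl, hl.ne, hFe]; done) | (simp; done) | simp [hl.ne', hl.not_gt]
  · intro m _ hm
    simp only [slot, map_tp]
    rcases lt_or_gt_of_ne hm with hm | hm
    · refine tprod_add_tprod_eq_zero m ?_ fun l hl => ?_
      · simp [hm, hFd, hde]
      · rcases lt_or_gt_of_ne hl with hl | hl
        · simp [hl, hl.trans hm, hFe]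
        · simp [hl.ne', hl.not_gt]
    · refine tprod_add_tprod_eq_zero i ?_ fun l hl => ?_
      · simp [hm, hse]
      · rcases lt_or_gt_of_ne hl with hl | hl
        · simp [hl, hl.trans hm, hFe]
        · rcases lt_trichotomy l m with h | rfl | h
          · simp [hl.ne', hl.not_gt, h, hFe]
          · simp [hl.ne', hl.not_gt, hFd]
          · simp [hl.ne', hl.not_gt, h.ne', h.not_gt]
  · intro h; exact absurd (mem_univ i) h

/-- A homotopy from the identity to `e` induces one on the tensor powers. -/
lemma tD_homotopy {e s : A →ₗ[R] A} (he : HasPar A A e 0) (hs : HasPar A A s 1)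
    (hed : ∀ x, A.d (e x) = e (A.d x)) (h : ∀ x, A.d (s x) + s (A.d x) = x - e x) (k : ℕ) :
    A.tD k ∘ₗ (∑ i, slot A A (fun l => if l < i then e else lid) i s) +
      (∑ i, slot A A (fun l => if l < i then e else lid) i s) ∘ₗ A.tD k =
      lid - pmap (fun _ : Fin k => e) := by
  have h' : A.d ∘ₗ s + s ∘ₗ A.d = lid - e := lext h
  rw [comp_sum_lin, sum_comp_lin, ← sum_add_distrib]
  have h1 : ∀ i : Fin k, A.tD k ∘ₗ slot A A (fun l => if l < i then e else lid) i s +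
      slot A A (fun l => if l < i then e else lid) i s ∘ₗ A.tD k =
      pmap (fun l : Fin k => if (l : ℕ) < i then e else lid) -
      pmap (fun l : Fin k => if (l : ℕ) < i + 1 then e else lid) := by
    intro i
    rw [tD_slot_add (fun l => ?_) (fun l x => ?_) hs, h']
    · have e1 : ∀ y : A →ₗ[R] A, (fun l => if l = i then y else if l < i then e else lid) =
          update (fun l => if l < i then e else lid) i y := fun y => by
        funext l
        rcases eq_or_ne l i with rfl | hl
        · rw [update_self, if_pos rfl]
        · rw [update_of_ne hl, if_neg hl]
      have e2 := (PiTensorProduct.mapMultilinear R (fun _ : Fin k => (A : Type u)) fun _ => A).map_update_sub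
        (fun l => if l < i then e else lid) i lid e
      rw [PiTensorProduct.mapMultilinear_apply, PiTensorProduct.mapMultilinear_apply,
        PiTensorProduct.mapMultilinear_apply] at e2
      rw [e1, e2, ← e1, ← e1]
      congr 2 <;> funext l <;> rcases lt_trichotomy l i with hl | rfl | hl
      all_goals first
        | (simp [hl, hl.ne, hl.le]; done)
        | (simp; done)
        | simp [hl.ne', hl.not_gt, hl.not_ge]
    · split_ifs
      · exact he
      · exact A.hasPar_id
    · split_ifs
      · exact hed x
      · rfl
  rw [sum_congr rfl fun i _ => h1 i, Fin.sum_univ_eq_sum_range (fun m =>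
    pmap (R := R) (fun l : Fin k => if (l : ℕ) < m then e else lid) -
      pmap (fun l : Fin k => if (l : ℕ) < m + 1 then e else lid)),
    Finset.sum_range_sub' (fun m => pmap (R := R) (fun l : Fin k => if (l : ℕ) < m then e else lid))]
  simp [pmap_id]

end Homotopy

/-! ### Products of subcomplexes of tensor powers -/

lemma mem_prodSub_iff {A : DGModule R} {P : ∀ j, Submodule R ((⨂[R]^j) A)} {j : Fin k → ℕ}
    {z : (⨂[R]^(∑ i, j i)) A} : z ∈ A.prodSub P j ↔ A.split j z ∈ tspan fun i => P (j i) := Iff.rfl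

lemma map_mem_prodSub {A B : DGModule R} {P : ∀ j, Submodule R ((⨂[R]^j) A)}
    {Q : ∀ j, Submodule R ((⨂[R]^j) B)} {j : Fin k → ℕ} (G : Fin (∑ i, j i) → (A →ₗ[R] B))
    (hG : ∀ i, ∀ x ∈ P (j i), pmap (fun m => G (fsf ⟨i, m⟩)) x ∈ Q (j i))
    {z : (⨂[R]^(∑ i, j i)) A} (hz : z ∈ A.prodSub P j) : pmap G z ∈ B.prodSub Q j := by
  have h := lcongr (split_map j G) z
  rw [lcmp, lcmp] at h
  rw [mem_prodSub_iff, h]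
  exact map_mem_tspan hG hz

lemma prodSub_le_map {A B : DGModule R} {P : ∀ j, Submodule R ((⨂[R]^j) A)}
    {Q : ∀ j, Submodule R ((⨂[R]^j) B)} {j : Fin k → ℕ} (f : A →ₗ[R] B)
    (h : ∀ i, Q (j i) ≤ (P (j i)).map pow(f)) : B.prodSub Q j ≤ (A.prodSub P j).map pow(f) := by
  intro z hz
  have key : tspan (fun i => Q (j i)) ≤ (A.prodSub P j).map (B.split j ∘ₗ pow(f)) := tspan_le fun y hy => by
    choose x hx hxy using fun i => h i (hy i)
    refine ⟨A.join j (tp R x), ?_, ?_⟩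
    · rw [SetLike.mem_coe, mem_prodSub_iff, split_join]
      exact tp_mem_tspan hx
    · have h := lcongr (split_map j (fun _ => f)) (A.join j (tp R x))
      rw [lcmp, lcmp, split_join, map_tp] at h
      exact h.trans (congrArg _ (funext hxy))
  obtain ⟨x, hx, e⟩ := key hz
  refine ⟨x, hx, ?_⟩
  rw [← B.join_split j z, ← e, lcmp, join_split]

lemma mem_of_coaction {M N : Type*} [AddCommGroup M] [Module R M] [AddCommGroup N] [Module R N]
    {G : ℤ → Submodule R M} {G' : ℤ → Submodule R N} (hG : ⨆ n, G n = ⊤)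
    (hκ : ∃ κ, IsCoaction G κ) (hκ' : ∃ κ, IsCoaction G' κ) {f : M →ₗ[R] N}
    (hf : ∀ n, ∀ x ∈ G n, f x ∈ G' n) (hinj : Injective f) {n : ℤ} {x : M}
    (hx : f x ∈ G' n) : x ∈ G n := by
  obtain ⟨κ, hκ⟩ := hκ
  obtain ⟨κ', hκ'⟩ := hκ'
  have h1 : ∀ x m, κ x m ∈ G m ∧ κ' (f x) m = f (κ x m) := by
    intro x m
    have hx : x ∈ ⨆ n, G n := by rw [hG]; trivial
    induction hx using Submodule.iSup_induction' with
    | mem n y hy =>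
      rw [hκ n y hy, hκ' n _ (hf n y hy), Finsupp.single_apply, Finsupp.single_apply]
      split_ifs with h
      · exact ⟨h ▸ hy, rfl⟩
      · exact ⟨zero_mem _, (map_zero f).symm⟩
    | zero => simp only [map_zero, Finsupp.zero_apply]; exact ⟨zero_mem _, trivial⟩
    | add x y _ _ hx hy =>
      simp only [map_add, Finsupp.add_apply, hx.2, hy.2]
      exact ⟨add_mem hx.1 hy.1, trivial⟩
  have h2 : κ x n = x := hinj (by rw [← (h1 x n).2, hκ' n _ hx, Finsupp.single_eq_same])
  rw [← h2]
  exact (h1 x n).1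

/-- An element of a tensor power is homogeneous if its image under an injective map is. -/
lemma mem_tgr_of_map {A B : DGModule R} {f : A →ₗ[R] B} (hf : ∀ n, ∀ x ∈ A.gr n, f x ∈ B.gr n)
    (hinj : Injective (pmap (R := R) fun _ : Fin k => f)) {n : ℤ}
    {x : (⨂[R]^k) A} (hx : pow(f) x ∈ B.tgr k n) : x ∈ A.tgr k n :=
  mem_of_coaction (A.iSup_tgr k) (A.tgr_exists_coaction k) (B.tgr_exists_coaction k)
    (fun _ _ hx => map_mem_tgr _ (fun _ => hf) hx) hinj hx

lemma slot_mem_prodSub {A : DGModule R} {P : ∀ j, Submodule R ((⨂[R]^j) A)} {e h : A →ₗ[R] A}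
    (he : ∀ {k}, ∀ x ∈ P k, pow(e) x ∈ P k)
    (hε : ∀ {k}, ∀ x ∈ P k, A.teps k 1 x ∈ P k)
    (hs : ∀ {k} (i : Fin k), ∀ x ∈ P k, slot A A (fun l => if l < i then e else lid) i h x ∈ P k)
    {j : Fin k → ℕ} (s : Fin (∑ i, j i)) {x : (⨂[R]^(∑ i, j i)) A} (hx : x ∈ A.prodSub P j) :
    slot A A (fun l => if l < s then e else lid) s h x ∈ A.prodSub P j := by
  refine map_mem_prodSub _ (fun i' x hx => ?_) hx
  obtain ⟨⟨i, m⟩, rfl⟩ := (fsf).surjective s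
  dsimp only
  rcases lt_trichotomy i' i with hi | rfl | hi
  · have h := he _ (hε _ hx)
    rw [teps, ← lcmp, ← pmap_comp] at h
    convert h using 3
    funext m'
    rw [if_pos (fsf_lt_of_lt hi m' m), if_pos (fsf_lt_of_lt hi m' m)]
  · have h := hs m _ hx
    rw [slot] at h
    convert h using 3
    funext m'
    simp only [fsf_lt_iff, EmbeddingLike.apply_eq_iff_eq, Sigma.mk.injEq, heq_eq_eq, true_and]
  · convert hx
    refine lcongr (f := pmap _) (g := lid) ?_ x
    rw [← pmap_id]
    congr 1
    funext m'
    have h := fsf_lt_of_lt hi m m'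
    rw [if_neg h.not_gt, if_neg h.ne', if_neg h.not_gt]

lemma isQuasiIncl_of_retract {X A : DGModule R} {e : Mor X A} {s : Mor A X} {h : X →ₗ[R] X}
    (hgr : GrMap X X h 1) (hh : ∀ x, X.d (h x) + h (X.d x) = x - s.f (e.f x)) 
    {P Q : Submodule R ((⨂[R]^k) X)} {P' Q' : Submodule R ((⨂[R]^k) A)} (hPQ : P ≤ Q)
    (heP : ∀ x ∈ P, pow(e.f) x ∈ P')
    (heQ : ∀ x ∈ Q, pow(e.f) x ∈ Q')
    (hsP : ∀ x ∈ P', pow(s.f) x ∈ P)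
    (hsQ : ∀ x ∈ Q', pow(s.f) x ∈ Q)
    (hP : ∀ (i : Fin k), ∀ x ∈ P, slot X X (fun l => if l < i then s.f ∘ₗ e.f else lid) i h x ∈ P)
    (hQ : ∀ (i : Fin k), ∀ x ∈ Q, slot X X (fun l => if l < i then s.f ∘ₗ e.f else lid) i h x ∈ Q)
    (H : IsQuasiIncl (A.tD k) P' Q') : IsQuasiIncl (X.tD k) P Q := by
  have hse : HasPar X X (s.f ∘ₗ e.f) 0 := hasPar_of_gr fun n x hx => by
    rw [zero_add]; exact s.f_gr n _ (e.f_gr n x hx)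
  refine RelAcyclic.isQuasiIncl (fun x _ => lcongr (X.tD_tD k) x)
    (RelAcyclic.of_homotopy (D' := A.tD k) pow(e.f) pow(s.f)
      (∑ i, slot X X (fun l => if l < i then s.f ∘ₗ e.f else lid) i h)
      (map_tDer (f := lid) (δ := X.d) (f' := lid) (δ' := A.d) e.hasPar (fun _ => rfl) e.f_d k)
      (map_tDer (f := lid) (δ := A.d) (f' := lid) (δ' := X.d)
        s.hasPar (fun _ => rfl) s.f_d k) (fun x => ?_) hPQ heP heQ hsP hsQ
      (fun x hx => ?_) (fun x hx => ?_) (RelAcyclic.of_isQuasiIncl H))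
  · have h2 := lcongr (tD_homotopy hse hgr.hasPar (fun x => by rw [lcmp, lcmp, e.f_d, s.f_d]) hh k) x
    rw [pmap_comp] at h2
    exact h2
  · rw [l_sum]
    exact Submodule.sum_mem _ fun i _ => hP i x hx
  · rw [l_sum]
    exact Submodule.sum_mem _ fun i _ => hQ i x hx

/-- The quasi-isomorphisms of a domain in `A` are inherited by a complex that contracts onto `A`,
if the retraction, its section and the homotopies on tensor powers preserve the subcomplexes. -/
lemma isQuasiIncl_prodSub_of_retract {X A : DGModule R} {P : ∀ j, Submodule R ((⨂[R]^j) X)}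
    {Q : ∀ j, Submodule R ((⨂[R]^j) A)} {e : Mor X A} {s : Mor A X} {h : X →ₗ[R] X}
    (hgr : GrMap X X h 1) (hh : ∀ x, X.d (h x) + h (X.d x) = x - s.f (e.f x))
    (he : ∀ {k}, ∀ x ∈ P k, pow(e.f) x ∈ Q k)
    (hs : ∀ {k}, ∀ x ∈ Q k, pow(s.f) x ∈ P k)
    (hε : ∀ {k}, ∀ x ∈ P k, X.teps k 1 x ∈ P k)
    (hsl : ∀ {k} (i : Fin k), ∀ x ∈ P k, slot X X (fun l => if l < i then s.f ∘ₗ e.f else lid) i h x ∈ P k)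
    (j : Fin k → ℕ) (hPQ : P (∑ i, j i) ≤ X.prodSub P j)
    (H : IsQuasiIncl (A.tD (∑ i, j i)) (Q (∑ i, j i)) (A.prodSub Q j)) :
    IsQuasiIncl (X.tD (∑ i, j i)) (P (∑ i, j i)) (X.prodSub P j) := by
  have hes : ∀ {k}, ∀ x ∈ P k, pow(s.f ∘ₗ e.f) x ∈ P k := by
    intro k x hx
    rw [pmap_comp]
    exact hs _ (he x hx)
  refine isQuasiIncl_of_retract hgr hh hPQ ?_ ?_ ?_ ?_ ?_ ?_ H
  · exact he
  · exact fun x hx => map_mem_prodSub (fun _ => e.f) (fun i x hx => he x hx) hx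
  · exact hs
  · exact fun x hx => map_mem_prodSub (fun _ => s.f) (fun i x hx => hs x hx) hx
  · exact hsl
  · exact fun i x hx => slot_mem_prodSub hes hε hsl i hx

/-- The quasi-isomorphism `A_k ⊆ A^{⊗ k}` of a domain is a special case of the others. -/
lemma quasi_of_prod {A : DGModule R} {sub : ∀ j, Submodule R ((⨂[R]^j) A)} (h1 : sub 1 = ⊤)
    (h : ∀ {k} (j : Fin k → ℕ), IsQuasiIncl (A.tD (∑ i, j i)) (sub (∑ i, j i)) (A.prodSub sub j))
    (k : ℕ) : IsQuasiIncl (A.tD k) (sub k) ⊤ := by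
  have h2 := h (fun _ : Fin k => 1)
  have h3 : A.prodSub sub (fun _ : Fin k => 1) = ⊤ := by
    rw [eq_top_iff]
    intro z _
    rw [mem_prodSub_iff]
    refine (span_le (p := tspan fun _ : Fin k => sub 1)).2 ?_ (span_tprod_eq_top.ge trivial)
    rintro _ ⟨y, rfl⟩
    exact tp_mem_tspan fun i => by rw [h1]; trivial
  rw [h3] at h2
  have : ∀ n, n = k → IsQuasiIncl (A.tD n) (sub n) ⊤ → IsQuasiIncl (A.tD k) (sub k) ⊤ := by rintro n rfl h; exact h
  exact this _ (by simp) h2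

/-- The complex structure on a graded submodule, given by an operator of degree `-1` whose square
vanishes on that submodule. -/
def subcx (C : DGModule R) (P : Submodule R C) (D : C →ₗ[R] C) (hP : P ≤ ⨆ n, P ⊓ C.gr n)
    (hgr : ∀ n, ∀ x ∈ C.gr n, D x ∈ C.gr (n - 1)) (hD : ∀ x ∈ P, D x ∈ P)
    (hDD : ∀ x ∈ P, D (D x) = 0) : DGModule R where
  carrier := P
  gr n := (C.gr n).comap P.subtype
  internal := by
    refine isInternal_of_separating (ι := Unit) (A := fun _ => C) ?_ (fun _ => P.subtype)
      (fun _ n x hx => hx) fun x hx => Subtype.ext (hx ())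
    rw [eq_top_iff]
    rintro ⟨x, hx⟩ -
    have h : P ≤ (⨆ n, (C.gr n).comap P.subtype).map P.subtype :=
      hP.trans (iSup_le fun n y hy => ⟨⟨y, hy.1⟩, mem_iSup_of_mem n hy.2, rfl⟩)
    obtain ⟨y, hy, rfl⟩ := h hx
    exact hy
  d := D.restrict hD
  d_gr n x hx := hgr n x.1 hx
  d_d x := Subtype.ext (hDD x.1 x.2)

lemma map_eps {A B : DGModule R} {g : A →ₗ[R] B} (hg : ∀ n, ∀ x ∈ A.gr n, g x ∈ B.gr n) (n : ℤ) (x : A) :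
    g (A.eps n x) = B.eps n (g x) := by
  have := lcongr (hasPar_of_gr (f := g) (p := 0) (fun n x hx => by rw [zero_add]; exact hg n x hx) n) x
  rw [mul_zero, sgn_zero, one_smul] at this
  exact this.symm

lemma map_tDer_tprod {A B : DGModule R} {δ : A →ₗ[R] A} {δ' : B →ₗ[R] B} {g : A →ₗ[R] B}
    (hg : ∀ n, ∀ x ∈ A.gr n, g x ∈ B.gr n) {b : Fin k → A} (hb : ∀ i, g (δ (b i)) = δ' (g (b i))) :
    pow(g) (A.tDer lid δ k (tp R b)) = B.tDer lid δ' k (pow(g) (tp R b)) := by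
  rw [tDer, tDer, l_sum, l_sum, map_sum]
  refine sum_congr rfl fun i _ => ?_
  rw [map_tp, map_tp, map_tp, map_tp]
  congr 1
  funext l
  split_ifs with h1 h2
  · exact map_eps hg 1 _
  · exact hb l
  · rfl

end DGModule

/-! ### The partial algebra of operations -/

namespace Operad.Ext

variable {O : Operad R} {A : PartialAlgebra O} {H : Ext A}

lemma tDer_tDer_tprod {b : Fin k → H.C} (hb : ∀ i, H.D (H.D (b i)) = 0) :
    H.C.tDer lid H.D k (H.C.tDer lid H.D k (tp R b)) = 0 := by
  have h := tDer_comp_tDer (A := H.C) (B := H.C) (f := lid) (δ := H.D) (D := H.D)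
    H.C.hasPar_id (r := -1) (by decide) H.D_grMap.hasPar rfl k
  refine (lcongr h (tp R b)).trans ?_
  rw [l_sum]
  refine Finset.sum_eq_zero fun i _ => ?_
  rw [map_tp]
  refine (tp R).map_coord_zero i ?_
  rw [if_pos rfl]
  exact hb i

lemma D_D_act (c : O.obj k) (w : (⨂[R]^k) H.C) :
    H.D (H.D (O.frAct H.V c w)) = O.frAct H.V c (H.C.tDer lid H.D k
      (H.C.tDer lid H.D k w)) := by
  rw [D_act, map_add, D_act, D_act, d_d, eps_d, eps_eps]
  simp only [map_neg, map_zero, LinearMap.neg_apply, l_zero]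
  abel

/-- On values of operations on the domain, the augmentation commutes with the differential, and the
square of the differential vanishes. -/
lemma COp.good {J : ℕ} {p : ℤ} {g : (⨂[R]^J) H.E →ₗ[R] H.C} (hg : H.COp J p g) :
    ∀ z ∈ H.L J, H.aug (H.D (g z)) = H.E.d (H.aug (g z)) ∧ H.D (H.D (g z)) = 0 := by
  have hj : ∀ {J p g}, H.COp J p g → ∀ z ∈ H.L J, ∃ a, H.aug (g z) = H.j.f a := by
    rintro J p g hg _ ⟨x, hx, rfl⟩
    obtain ⟨-, c, -, h⟩ := hg.aug_qop
    exact ⟨_, h ⟨x, hx⟩⟩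
  induction hg with
  | inc =>
    intro z hz
    obtain ⟨a, rfl⟩ := H.L_one hz
    rw [lcmp, unTone_tone]
    have h1 : H.D (H.inc (H.j.f a)) = H.inc (H.j.f (A.cx.d a)) := by rw [H.j.f_d]; exact H.D_inc _
    have h2 : H.D (H.inc (H.j.f (A.cx.d a))) = H.inc (H.j.f (A.cx.d (A.cx.d a))) := by
      rw [H.j.f_d (A.cx.d a)]; exact H.D_inc _
    constructor
    · rw [h1, aug_inc, aug_inc, H.j.f_d]
    · rw [h1, h2, d_d, map_zero, map_zero]
  | smul r _ ih =>
    intro z hz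
    obtain ⟨h1, h2⟩ := ih z hz
    simp only [l_smul, map_smul, h1, h2, smul_zero, and_self]
  | @con J p g hg ih =>
    intro z hz
    obtain ⟨h1, h2⟩ := ih z hz
    obtain ⟨a, ha⟩ := hj hg z hz
    rw [lcmp]
    have h3 : H.D (H.con (g z)) = g z - H.inc (H.aug (g z)) - H.con (H.D (g z)) := H.D_con _
    have h4 : H.D (H.con (H.D (g z))) = H.D (g z) - H.inc (H.aug (H.D (g z))) - H.con (H.D (H.D (g z))) := H.D_con _
    have h5 : ∀ e, H.D (H.inc e) = H.inc (H.E.d e) := H.D_inc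
    constructor
    · rw [aug_con, map_zero, h3, map_sub, map_sub, aug_con, ha, aug_inc, sub_self, sub_zero]
    · rw [h3, map_sub, map_sub, h4, h5, h2, h1, map_zero]
      abel
  | @act k J p g q c hc hg ih =>
    intro z hz
    rw [lcmp]
    have hu := COp.bop_mem hg hz
    have hs := bop_mem_tspan (p := p) (φ := g) (fun J n y => H.L_teps n) (H.split_mem_L J hz)
    generalize bop H.E H.C J p g z = u at hu hs
    constructor
    · have h1 : pow(H.aug) (H.C.tDer lid H.D k u) = H.E.tD k (pow(H.aug) u) :=
        tspan_le (S := eqLocus (pow(H.aug) ∘ₗ H.C.tDer lid H.D k) (H.E.tD k ∘ₗ pow(H.aug))) (fun b hb => by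
          refine (map_tDer_tprod H.aug_gr fun i => ?_).trans (lcongr (H.E.tD_eq_tDer k).symm _)
          obtain ⟨y, hy, e⟩ := hb i
          rw [← e]
          exact (ih i y hy).1) hs
      obtain ⟨x, hx, hx2⟩ := aug_mem hu
      obtain ⟨x', hx', hx2'⟩ := aug_mem (U_tD k hu)
      have h2 : x' = ⟨A.cx.tD k x, A.dom.d_mem k x x.2⟩ := by
        refine Subtype.ext (H.map_j_injective k ?_)
        rw [← hx', h1, hx, map_j_tD]
      rw [D_act, map_add, hx2, hx2', hx2, h2, ← map_add, ← A.d_θ, H.j.f_d]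
    · rw [D_D_act]
      refine (congrArg _ (tspan_le (S := ker (H.C.tDer lid H.D k ∘ₗ H.C.tDer lid H.D k)) (fun b hb => ?_) hs)).trans
        (map_zero _)
      refine tDer_tDer_tprod fun i => ?_
      obtain ⟨y, hy, e⟩ := hb i
      rw [← e]
      exact (ih i y hy).2

lemma exists_aug_eq {w : H.C} (hw : w ∈ H.U₁) : ∃ a, H.j.f a = H.aug w :=
  U₁_le (S := (range H.j.f).comap H.aug) (by
    rintro J p g hg _ ⟨x, hx, rfl⟩
    obtain ⟨-, c, -, h⟩ := hg.aug_qop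
    exact ⟨_, (h ⟨x, hx⟩).symm⟩) hw

lemma D_mem_U₁ {w : H.C} (hw : w ∈ H.U₁) : H.D w ∈ H.U₁ := by
  have h := U_tD 1 hw
  have h2 : H.C.tDer lid H.D 1 (H.C.tone w) = H.C.tone (H.D w) := tDer_tone lid H.D w
  rwa [mem_comap, h2] at h

lemma con_mem_U₁ {w : H.C} (hw : w ∈ H.U₁) : H.con w ∈ H.U₁ :=
  U₁_le (S := H.U₁.comap H.con) (fun _ _ _ hg _ hz => hg.con.mem_U₁ hz) hw

lemma inc_mem_U₁ (a : A.cx) : H.inc (H.j.f a) ∈ H.U₁ := by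
  have := COp.inc.mem_U₁ (H.tone_mem_L a)
  rwa [lcmp, unTone_tone] at this

lemma U₁_graded : H.U₁ ≤ ⨆ n, H.U₁ ⊓ H.C.gr n := by
  refine U₁_le fun J p g hg z hz => ?_
  refine (iSup_le (a := comap g (⨆ n, H.U₁ ⊓ H.C.gr n)) fun n y hy => ?_) (H.L_graded _ hz)
  exact mem_iSup_of_mem _ ⟨hg.mem_U₁ hy.1, hg.grT n y hy.2⟩

lemma aug_D {w : H.C} (hw : w ∈ H.U₁) : H.aug (H.D w) = H.E.d (H.aug w) :=
  U₁_le (S := eqLocus (H.aug ∘ₗ H.D) (H.E.d ∘ₗ H.aug)) (fun _ _ _ hg z hz => (hg.good z hz).1) hw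

lemma D_D {w : H.C} (hw : w ∈ H.U₁) : H.D (H.D w) = 0 :=
  U₁_le (S := ker (H.D ∘ₗ H.D)) (fun _ _ _ hg z hz => (hg.good z hz).2) hw

variable (H)

/-- The complex of values of operations on the domain of `A`. -/
def Uc : DGModule R := subcx H.C H.U₁ H.D U₁_graded H.D_gr (fun _ => D_mem_U₁) fun _ => D_D

/-- The inclusion in the free algebra on trees. -/
def incl : H.Uc →ₗ[R] H.C := H.U₁.subtype

lemma incl_gr (n : ℤ) (x : H.Uc) (hx : x ∈ H.Uc.gr n) : H.incl x ∈ H.C.gr n := hx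

lemma incl_hasPar : HasPar H.Uc H.C H.incl 0 := hasPar_of_gr fun n x hx => by rw [zero_add]; exact hx

lemma incl_eps (n : ℤ) (x : H.Uc) : H.incl (H.Uc.eps n x) = H.C.eps n (H.incl x) := map_eps H.incl_gr n x

/-- The augmentation, as a map to `A`. -/
def augA : H.Uc →ₗ[R] A.cx :=
  (LinearEquiv.ofInjective H.j.f H.j_injective).symm.toLinearMap ∘ₗ
    (H.aug ∘ₗ H.incl).codRestrict (range H.j.f) fun w => exists_aug_eq w.2

lemma j_augA (w : H.Uc) : H.j.f (H.augA w) = H.aug (H.incl w) :=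
  congrArg Subtype.val ((LinearEquiv.ofInjective H.j.f H.j_injective).apply_symm_apply
    ⟨H.aug (H.incl w), exists_aug_eq w.2⟩)

/-- The section of the augmentation given by the inclusion of the leaves. -/
def sec : A.cx →ₗ[R] H.Uc := (H.inc ∘ₗ H.j.f).codRestrict H.U₁ inc_mem_U₁

/-- The contraction. -/
def conU : H.Uc →ₗ[R] H.Uc := H.con.restrict fun _ => con_mem_U₁

lemma augA_d (w : H.Uc) : H.augA (H.Uc.d w) = A.cx.d (H.augA w) := by
  apply H.j_injective
  rw [j_augA, H.j.f_d, j_augA]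
  exact aug_D w.2

lemma sec_d (a : A.cx) : H.sec (A.cx.d a) = H.Uc.d (H.sec a) := by
  refine Subtype.ext ((congrArg H.inc (H.j.f_d a)).trans ?_)
  exact (H.D_inc _).symm

lemma augA_sec (a : A.cx) : H.augA (H.sec a) = a := H.j_injective ((H.j_augA _).trans (H.aug_inc a))

lemma d_conU (w : H.Uc) : H.Uc.d (H.conU w) + H.conU (H.Uc.d w) = w - H.sec (H.augA w) := by
  refine Subtype.ext ?_
  have h : H.D (H.con (H.incl w)) = H.incl w - H.inc (H.aug (H.incl w)) - H.con (H.D (H.incl w)) := H.D_con _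
  rw [← j_augA] at h
  exact (congrArg (· + H.con (H.D (H.incl w))) h).trans (sub_add_cancel _ _)

lemma augA_gr (n : ℤ) (w : H.Uc) (hw : w ∈ H.Uc.gr n) : H.augA w ∈ A.cx.gr n := by
  refine mem_of_coaction A.cx.internal.submodule_iSup_eq_top A.cx.exists_coaction
    H.E.exists_coaction H.j.f_gr H.j_injective ?_
  rw [j_augA]
  exact H.aug_gr n _ hw

/-- The augmentation, as a map of complexes. -/
def augM : Mor H.Uc A.cx := ⟨H.augA, H.augA_gr, H.augA_d⟩

/-- The section of the augmentation, as a map of complexes. -/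
def secM : Mor A.cx H.Uc := ⟨H.sec, fun n x hx => H.inc_gr n _ (H.j.f_gr n x hx), H.sec_d⟩

/-- The tensors that lie in the domain. -/
def Usub (k : ℕ) : Submodule R ((⨂[R]^k) H.Uc) := (H.U k).comap pow(H.incl)

variable {H}

lemma map_incl_map {G : Fin k → (H.Uc →ₗ[R] H.Uc)} {G' : Fin k → (H.C →ₗ[R] H.C)}
    (h : ∀ l x, H.incl (G l x) = G' l (H.incl x)) (x : (⨂[R]^k) H.Uc) :
    pow(H.incl) (pmap G x) = pmap G' (pow(H.incl) x) := by
  refine lcongr (f := pow(H.incl) ∘ₗ pmap G) (g := pmap G' ∘ₗ pow(H.incl)) ?_ x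
  rw [← pmap_comp, ← pmap_comp]
  exact congrArg _ (funext fun l => lext (h l))

lemma Usub_teps (n : ℤ) {x : (⨂[R]^k) H.Uc} (hx : x ∈ H.Usub k) : H.Uc.teps k n x ∈ H.Usub k := by
  rw [Usub, mem_comap, teps, map_incl_map (G' := fun _ => H.C.eps n) fun _ => H.incl_eps n]
  exact U_teps k n hx

lemma incl_sec_augA (x : H.Uc) : H.incl (H.sec (H.augA x)) = H.inc (H.aug (H.incl x)) := congrArg H.inc (H.j_augA x)

lemma COp.nop_inc_aug {J : ℕ} {p : ℤ} {g : (⨂[R]^J) H.E →ₗ[R] H.C} (h : H.COp J p g) :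
    H.NOp J p ((H.inc ∘ₗ H.aug) ∘ₗ g) := by
  rw [l_assoc]; exact NOp.inc h.aug_qop

lemma Usub_slot (i : Fin k) {x : (⨂[R]^k) H.Uc} (hx : x ∈ H.Usub k) :
    slot H.Uc H.Uc (fun l => if l < i then H.sec ∘ₗ H.augA else lid) i H.conU x ∈ H.Usub k := by
  let F : Fin k → (H.C →ₗ[R] H.C) := fun l => if l < i then H.inc ∘ₗ H.aug else lid
  have h := U_slot (F := F) (T := H.con) i (fun l J p g hg => ?_) (fun hg => hg.nop.con) hx
  · rw [Usub, mem_comap, slot, map_incl_map (G' := fun l => if l < i then F l ∘ₗ H.C.eps 1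
      else if l = i then H.con else F l)]
    · exact h
    · intro l x
      dsimp only [F]
      split_ifs
      · exact (incl_sec_augA _).trans (congrArg (fun t => H.inc (H.aug t)) (H.incl_eps 1 x))
      · rfl
      · rfl
  · dsimp only [F]
    split_ifs
    · exact hg.nop_inc_aug
    · rw [LinearMap.id_comp]; exact hg.nop

lemma exists_map_augA_eq {x : (⨂[R]^k) H.Uc} (hx : x ∈ H.Usub k) :
    ∃ y : A.dom.sub k, pow(H.augA) x = y ∧ ∀ c, H.aug (O.frAct H.V c
      (pow(H.incl) x)) = H.j.f (A.θ c y) := by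
  obtain ⟨y, hy, h⟩ := aug_mem hx
  refine ⟨y, ?_, h⟩
  apply H.map_j_injective k
  rw [← hy]
  refine lcongr (f := pow(H.j.f) ∘ₗ pow(H.augA)) (g := pow(H.aug) ∘ₗ
    pow(H.incl)) ?_ x
  rw [← pmap_comp, ← pmap_comp]
  exact congrArg _ (funext fun l => lext H.j_augA)

lemma map_augA_mem {x : (⨂[R]^k) H.Uc} (hx : x ∈ H.Usub k) : pow(H.augA) x ∈ A.dom.sub k := by
  obtain ⟨y, hy, -⟩ := exists_map_augA_eq hx
  rw [hy]
  exact y.2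

lemma map_sec_mem {x : (⨂[R]^k) A.cx} (hx : x ∈ A.dom.sub k) : pow(H.sec) x ∈ H.Usub k := by
  have h : pow(H.incl) (pow(H.sec) x) = pow(H.inc) (pow(H.j.f) x) := by
    refine lcongr (f := pow(H.incl) ∘ₗ pow(H.sec)) (g := pow(H.inc) ∘ₗ
      pow(H.j.f)) ?_ x
    rw [← pmap_comp, ← pmap_comp]
    rfl
  rw [Usub, mem_comap, h]
  exact map_inc_mem ⟨x, hx, rfl⟩

lemma U_le_map (k : ℕ) : H.U k ≤ (H.Usub k).map pow(H.incl) := by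
  intro u hu
  obtain ⟨x, rfl⟩ := U_le_span k hu
  exact ⟨x, hu, rfl⟩

lemma map_incl_tD (x : (⨂[R]^k) H.Uc) : pow(H.incl) (H.Uc.tD k x) =
      H.C.tDer lid H.D k (pow(H.incl) x) :=
  map_tDer (f := lid) (δ := H.Uc.d) (f' := lid) (δ' := H.D)
    (g := H.incl) (F := H.incl) H.incl_hasPar (fun _ => rfl) (fun _ => rfl) k x

lemma map_incl_tmv (σ : Perm (Fin k)) (x : (⨂[R]^k) H.Uc) : pow(H.incl) (H.Uc.tperm σ x) =
      H.C.tmv σ (pow(H.incl) x) := by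
  rw [← tmv_perm]
  exact (lcongr (tmv_map σ (fun _ => H.incl) fun _ => H.incl_gr) x).symm

lemma Usub_one : H.Usub 1 = ⊤ := by
  rw [eq_top_iff]
  intro x _
  rw [Usub, mem_comap, ← H.Uc.tone_unTone x, tone_map]
  exact (H.Uc.unTone x).2

lemma map_incl_bop {j : Fin k → ℕ} {p : Fin k → ℤ} {cs : ∀ i, O.obj (j i)}
    {z : (⨂[R]^(∑ i, j i)) H.Uc} {w : ⨂[R] i, H.Usub (j i)}
    (hw : H.Uc.split j z = mapIncl _ w) 
    {f : ∀ i, H.Usub (j i) →ₗ[R] H.Uc}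
    (hf : ∀ i x, H.incl (f i x) = O.frAct H.V (cs i) (pow(H.incl) (H.Uc.teps (j i) (suf p i) x.1))) :
    pow(H.incl) (pmap f w) = bop H.C H.C j p (fun i => O.frAct H.V (cs i)) (pow(H.incl) z) := by
  have h := lcongr (split_map j fun _ => H.incl) z
  rw [lcmp, lcmp, hw] at h
  rw [bop, lcmp, h]
  clear h hw
  refine lcongr (f := pow(H.incl) ∘ₗ pmap f) (g := pmap _ ∘ₗ pmap _ ∘ₗ mapIncl _) (pext (mext fun y => ?_)) w
  simp only [l_mult, lcmp, mapIncl, map_tp]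
  congr 1
  funext i
  rw [hf]
  congr 1
  exact map_incl_map (G' := fun _ => H.C.eps (suf p i)) (fun _ => H.incl_eps _) _

variable (H) in
/-- The structure maps on the domain in the complex of values of operations. -/
def Uθ (k : ℕ) : O.obj k →ₗ[R] H.Usub k →ₗ[R] H.Uc :=
  LinearMap.mk₂ R (fun c x => ⟨O.frAct H.V c (pow(H.incl) x.1), act_mem_U₁ c x.2⟩)
    (fun c c' x => Subtype.ext (by exact lcongr (map_add (O.frAct H.V) c c') _))
    (fun r c x => Subtype.ext (by exact lcongr (map_smul (O.frAct H.V) r c) _))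
    (fun c x x' => Subtype.ext (by exact (congrArg (O.frAct H.V c) (map_add _ x.1 x'.1)).trans (map_add _ _ _)))
    (fun r c x => Subtype.ext (by exact (congrArg (O.frAct H.V c) (map_smul _ r x.1)).trans (map_smul _ _ _)))

variable [IsDedekindDomain R] (hB : O.HasDualBases)

include hB

lemma flat_sub (P : Submodule R H.C) : Module.Flat R P := by
  have := H.E_flat
  have := O.flat_tree hB H.E
  have := O.flat_free hB H.V
  have : Module.IsTorsionFree R H.C := isTorsionFree_of_flat (R := R) (O.FreeMod H.V)
  rw [IsDedekindDomain.flat_iff_torsion_eq_bot]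
  exact Submodule.isTorsionFree_iff_torsion_eq_bot.1 P.instIsTorsionFree

variable (H) in
lemma map_incl_injective (k : ℕ) :
    Injective (pmap (R := R) fun _ : Fin k => H.incl) := by
  have := H.E_flat
  have := O.flat_tree hB H.E
  have : Module.Flat R H.C := O.flat_free hB H.V
  have : Module.Flat R H.Uc := flat_sub hB H.U₁
  exact tensorPower_map_injective H.incl Subtype.val_injective k

lemma Usub_le_prodSub (j : Fin k → ℕ) :
    H.Usub (∑ i, j i) ≤ H.Uc.prodSub H.Usub j := by
  intro x hx
  have h1 : pow(H.incl) x ∈ H.C.prodSub H.U j := by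
    rw [mem_prodSub_iff]
    exact U_split j hx
  obtain ⟨y, hy, e⟩ := prodSub_le_map H.incl (fun i => U_le_map (j i)) h1
  rwa [← H.map_incl_injective hB _ e]

lemma Usub_quasi (j : Fin k → ℕ) :
    IsQuasiIncl (H.Uc.tD (∑ i, j i)) (H.Usub (∑ i, j i)) (H.Uc.prodSub H.Usub j) :=
  isQuasiIncl_prodSub_of_retract (e := H.augM) (s := H.secM) (fun n x hx => H.con_grMap n _ hx) H.d_conU
    (fun _ hx => map_augA_mem hx) (fun _ hx => map_sec_mem hx) (fun _ hx => Usub_teps 1 hx)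
    (fun i _ hx => Usub_slot i hx) j (Usub_le_prodSub hB j) (A.dom.quasi_prod j)

lemma Usub_graded (k : ℕ) : H.Usub k ≤ ⨆ n, H.Usub k ⊓ H.Uc.tgr k n := by
  intro x hx
  have h : (⨆ n, H.U k ⊓ H.C.tgr k n) ≤ (⨆ n, H.Usub k ⊓ H.Uc.tgr k n).map pow(H.incl) := by
    refine iSup_le fun n y hy => ?_
    obtain ⟨x, hx, rfl⟩ := U_le_map k hy.1
    exact ⟨x, mem_iSup_of_mem n ⟨hx, mem_tgr_of_map H.incl_gr (H.map_incl_injective hB k) hy.2⟩, rfl⟩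
  obtain ⟨y, hy, e⟩ := h (U_graded k hx)
  rwa [← H.map_incl_injective hB k e]

variable (H) in
/-- The domain in the complex of values of operations. -/
def Udom : Domain H.Uc where
  sub := H.Usub
  sub_zero := by rw [Usub, U_zero, Submodule.comap_top]
  sub_one := Usub_one
  graded := Usub_graded hB
  d_mem k x hx := by
    rw [Usub, mem_comap, map_incl_tD]
    exact U_tD k hx
  perm_mem σ x hx := by
    rw [Usub, mem_comap, map_incl_tmv]
    exact U_tmv σ hx
  quasi := quasi_of_prod Usub_one (Usub_quasi hB)
  quasi_prod := Usub_quasi hB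

variable (H) in
/-- The partial algebra of values of operations on the domain of `A`. -/
def Upa : PartialAlgebra O where
  cx := H.Uc
  flat := flat_sub hB H.U₁
  dom := H.Udom hB
  θ {k} := H.Uθ k
  θ_gr p q c x hc hx := O.frAct_mem_gr hc (map_mem_tgr _ (fun _ => H.incl_gr) hx)
  d_θ {k} c x := Subtype.ext (by
    refine (H.D_act c _).trans ?_
    rw [← map_incl_tD]
    rfl)
  θ_one a h := Subtype.ext (by
    refine Eq.trans ?_ (O.frAct_one (H.incl a))
    refine congrArg (O.frAct H.V O.one) ?_
    rw [map_tp, tone_apply])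
  θ_relabel σ c x := Subtype.ext (by
    refine Eq.trans ?_ (O.frAct_relabel σ c _)
    exact congrArg (O.frAct H.V _) (map_incl_tmv σ x.1))
  θ_mem j p cs z w hc hw := by
    refine Eq.mpr (congrArg (· ∈ H.U _) (map_incl_bop (cs := cs) (p := p) hw fun i x => rfl)) ?_
    exact U_act j p cs hc z.2
  θ_comp j p c cs z w hc hw := Subtype.ext (by
    refine Eq.trans ?_ (congrArg (O.frAct H.V c) (map_incl_bop (cs := cs) (p := p) hw fun i x => rfl)).symm
    exact lcongr (O.frAct_comp j p c cs hc) _)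

variable (H) in
/-- The augmentation, as a morphism of partial algebras. -/
def augHom : H.Upa hB ⟶ A where
  f := H.augA
  f_gr := H.augA_gr
  f_d := H.augA_d
  map_mem k x := map_augA_mem x.2
  map_θ {k} c x := by
    apply H.j_injective
    obtain ⟨y, hy, h⟩ := exists_map_augA_eq x.2
    refine (H.j_augA _).trans ((h c).trans ?_)
    exact congrArg (fun t => H.j.f (A.θ c t)) (Subtype.ext hy.symm)

lemma augHom_isQuasiIso : PartialAlgebra.IsQuasiIso (H.augHom hB) := by
  have hd : ∀ w : H.Uc, H.Uc.d w = 0 → H.Uc.d (H.conU w) = w - H.sec (H.augA w) := fun w hw => by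
    have := H.d_conU w
    rwa [hw, map_zero, add_zero] at this
  constructor
  · rintro (x : H.Uc) (hx : H.Uc.d x = 0) ⟨y, hy : A.cx.d y = H.augA x⟩
    refine ⟨H.conU x + H.sec y, ?_⟩
    refine (map_add _ _ _).trans ?_
    have h := H.sec_d y
    rw [hy] at h
    refine (congrArg₂ (· + ·) (hd x hx) h.symm).trans (sub_add_cancel _ _)
  · intro y hy
    refine ⟨H.sec y, (H.sec_d y).symm.trans (by rw [hy, map_zero]; rfl), 0, ?_⟩
    have h : PartialAlgebra.Hom.f (H.augHom hB) (H.sec y) = y := H.augA_sec y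
    rw [map_zero, h, sub_self]

end Operad.Ext

/-! ### Tensor products with relatively acyclic complexes -/

section Kunneth

variable [IsDedekindDomain R] {Y M : Type u} [AddCommGroup Y] [Module R Y] [AddCommGroup M] [Module R M]

/-- The differential `d ⊗ 1 + e ⊗ T` of a tensor product of complexes, where `e` is the sign
operator of the first factor. -/
def tensorDiff {R Y M : Type*} [CommRing R] [AddCommGroup Y] [Module R Y] [AddCommGroup M] [Module R M]
    (d e : Y →ₗ[R] Y) (T : M →ₗ[R] M) : Y ⊗[R] M →ₗ[R] Y ⊗[R] M :=
  TensorProduct.map d lid + TensorProduct.map e T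

/-- The tensor product of a flat complex over a Dedekind domain and an acyclic complex is acyclic:
tensor the exact sequence of the cycles and the boundaries of the flat complex with the other one. -/
lemma exists_tensor_boundary [Module.Flat R Y] (d e : Y →ₗ[R] Y) (hd : d ∘ₗ d = 0)
    (he : e ∘ₗ e = lid) (hed : e ∘ₗ d = - (d ∘ₗ e)) (T : M →ₗ[R] M)
    (hT : Function.Exact T T) (x : Y ⊗[R] M)
    (hx : (tensorDiff d e T) x = 0) :
    ∃ y, (tensorDiff d e T) y = x := by
  have htf := isTorsionFree_of_flat (R := R) Y
  have hTT : T ∘ₗ T = 0 := hT.linearMap_comp_eq_zero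
  have hee : ∀ y, e (e y) = y := lcongr he
  have hdd : ∀ y, d (d y) = 0 := lcongr hd
  have hde : ∀ y, d (e y) = - e (d y) := fun y => by
    rw [eq_neg_iff_add_eq_zero, ← neg_eq_iff_add_eq_zero]
    exact (lcongr hed y).symm
  set D := tensorDiff d e T with hD
  let p := d.rangeRestrict
  let i := (ker d).subtype
  have hpi : Function.Exact i p := by rw [LinearMap.exact_iff, LinearMap.ker_rangeRestrict, Submodule.range_subtype]
  let e' : range d →ₗ[R] range d := e.restrict (by
    rintro _ ⟨y, rfl⟩; exact ⟨-e y, by rw [map_neg, hde, neg_neg]⟩)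
  have h1 : ∀ z, p.rTensor M (D z) = - (TensorProduct.map e' T) (p.rTensor M z) := lcongr (f := p.rTensor M ∘ₗ D)
      (g := - (TensorProduct.map e' T ∘ₗ p.rTensor M)) (TensorProduct.ext' fun y m => by
    have h1 : p (d y) = 0 := Subtype.ext (hdd y)
    have h2 : p (e y) = - e' (p y) := Subtype.ext (hde y)
    simp [hD, tensorDiff, h1, h2, TensorProduct.neg_tmul])
  have h2 : ∀ z, TensorProduct.map e' (lid (R := R) (M := M)) (TensorProduct.map e' T z)
      = T.lTensor _ z := fun z => by
    rw [← lcmp, ← TensorProduct.map_comp, LinearMap.id_comp,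
      show e' ∘ₗ e' = lid from lext fun y => Subtype.ext (hee y)]
    rfl
  obtain ⟨w, hw⟩ := (Module.Flat.lTensor_exact (range d) hT (p.rTensor M x)).1 (by
    rw [← h2, ← neg_neg (TensorProduct.map e' T _), ← h1, hx, map_zero, neg_zero, map_zero])
  obtain ⟨w', rfl⟩ := LinearMap.rTensor_surjective M d.surjective_rangeRestrict w
  have h3 : ∀ z, D (e.rTensor M z) = - e.rTensor M (d.rTensor M z) + T.lTensor Y z := lcongr (f := D ∘ₗ e.rTensor M)
      (g := - (e.rTensor M ∘ₗ d.rTensor M) + T.lTensor Y) (TensorProduct.ext' fun y m => by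
    simp [hD, tensorDiff, hde, hee, TensorProduct.neg_tmul])
  have h4 : ∀ z, D (D z) = 0 := lcongr (f := D ∘ₗ D)
      (g := 0) (TensorProduct.ext' fun y m => by
    have := lcongr hTT m
    rw [lcmp] at this
    simp [hD, tensorDiff, hdd, hee, hde, this, TensorProduct.neg_tmul])
  obtain ⟨x', hx'⟩ := (rTensor_exact M hpi d.surjective_rangeRestrict (x - D (e.rTensor M w'))).1 (by
    have : p.rTensor M (D (e.rTensor M w')) = p.rTensor M x := by
      rw [h3, ← hw, map_add, map_neg]
      have h5 : ∀ z, p.rTensor M (e.rTensor M (d.rTensor M z)) = 0 := lcongr (f := p.rTensor M ∘ₗ e.rTensor M ∘ₗ d.rTensor M)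
          (g := 0) (TensorProduct.ext' fun y m => by
        have h1 : p (e (d y)) = 0 := Subtype.ext (by
          change d (e (d y)) = 0
          rw [hde, hdd, map_zero, neg_zero])
        simp [h1])
      rw [h5, neg_zero, zero_add]
      exact lcongr ((LinearMap.rTensor_comp_lTensor _ p T).trans (LinearMap.lTensor_comp_rTensor _ p T).symm) w'
    rw [map_sub, this]; exact sub_self _)
  have h6 : ∀ z, d.rTensor M (i.rTensor M z) = 0 := fun z => by
    rw [← LinearMap.rTensor_comp_apply, show d ∘ₗ i = 0 from lext fun y => y.2, LinearMap.rTensor_zero, l_zero]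
  have h7 : ∀ z, T.lTensor Y (i.rTensor M z) = i.rTensor M (T.lTensor _ z) := fun z => by
    rw [← lcmp, ← lcmp, LinearMap.lTensor_comp_rTensor, LinearMap.rTensor_comp_lTensor]
  have h8 : ∀ z, D z = d.rTensor M z + e.rTensor M (T.lTensor Y z) := fun z => by
    rw [← lcmp (f := e.rTensor M), LinearMap.rTensor_comp_lTensor]; rfl
  have hinj : Injective (i.rTensor M) := by
    have := LinearMap.lTensor_injective_of_exact_of_flat p d.surjective_rangeRestrict i
      (ker d).subtype_injective hpi M
    exact LinearMap.lTensor_inj_iff_rTensor_inj M i |>.1 this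
  obtain ⟨w, rfl⟩ := (Module.Flat.lTensor_exact (ker d) hT x').1 (hinj (by
    have h9 : e.rTensor M (i.rTensor M (T.lTensor _ x')) = 0 := by
      have := congrArg D hx'
      rw [map_sub, hx, h4, sub_zero, h8, h6, zero_add, h7] at this
      exact this
    have h10 := congrArg (e.rTensor M) h9
    rw [← LinearMap.rTensor_comp_apply, he, LinearMap.rTensor_id, l_id, map_zero] at h10
    rw [h10, map_zero]))
  refine ⟨e.rTensor M (i.rTensor M w) + e.rTensor M w', ?_⟩
  rw [map_add, h3, h6, map_zero, neg_zero, zero_add, h7, hx', sub_add_cancel]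

lemma RelAcyclic.lTensor [Module.Flat R Y] {d e : Y →ₗ[R] Y} (hd : d ∘ₗ d = 0)
    (he : e ∘ₗ e = lid) (hed : e ∘ₗ d = - (d ∘ₗ e)) {T : M →ₗ[R] M}
    (hTT : ∀ x, T (T x) = 0) {P Q : Submodule R M} (hP : ∀ x ∈ P, T x ∈ P) (hQ : ∀ x ∈ Q, T x ∈ Q)
    (h : RelAcyclic T P Q) :
    RelAcyclic (tensorDiff d e T)
      (range (P.subtype.lTensor Y)) (range (Q.subtype.lTensor Y)) := by
  let P' := P.comap Q.subtype
  let TQ : Q →ₗ[R] Q := T.restrict hQ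
  let TN : (Q ⧸ P') →ₗ[R] (Q ⧸ P') := P'.mapQ P' TQ (fun x hx => hP _ hx)
  have hTN : Function.Exact TN TN := by
    intro x
    obtain ⟨x, rfl⟩ := P'.mkQ_surjective x
    constructor
    · intro hx
      obtain ⟨y, hy, hy2⟩ := h.2 x x.2 ((Submodule.Quotient.mk_eq_zero P').1 hx)
      exact ⟨P'.mkQ ⟨y, hy⟩, ((Submodule.Quotient.eq P').2 hy2).symm⟩
    · rintro ⟨y, hy⟩
      obtain ⟨y, rfl⟩ := P'.mkQ_surjective y
      rw [← hy]
      refine (Submodule.Quotient.mk_eq_zero P').2 ?_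
      change T (T y) ∈ P
      rw [hTT]; exact zero_mem _
  have hinj := Module.Flat.lTensor_preserves_injective_linearMap (M := Y) Q.subtype Q.subtype_injective
  have h1 : ∀ z, (tensorDiff d e T) (Q.subtype.lTensor Y z) =
      Q.subtype.lTensor Y ((tensorDiff d e TQ) z) := fun z => by
    have : (tensorDiff d e T) ∘ₗ Q.subtype.lTensor Y = Q.subtype.lTensor Y ∘ₗ (tensorDiff d e TQ) := by
      refine TensorProduct.ext' fun y m => ?_
      simp [tensorDiff, TQ]
    exact lcongr this z
  have h2 : ∀ z, P'.mkQ.lTensor Y ((tensorDiff d e TQ) z) = (tensorDiff d e TN) (P'.mkQ.lTensor Y z) := lcongr (f := P'.mkQ.lTensor Y ∘ₗ (tensorDiff d e TQ))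
      (g := (tensorDiff d e TN) ∘ₗ P'.mkQ.lTensor Y) (TensorProduct.ext' fun y m => by
    simp only [tensorDiff, lcmp, l_add, map_add, TensorProduct.map_tmul, LinearMap.lTensor_tmul, l_id]
    rfl)
  have hex : Function.Exact (P'.subtype.lTensor Y) (P'.mkQ.lTensor Y) :=
    lTensor_exact Y (by rw [LinearMap.exact_iff, Submodule.ker_mkQ, Submodule.range_subtype]) P'.mkQ_surjective
  have h3 : ∀ z, Q.subtype.lTensor Y z ∈ range (P.subtype.lTensor Y) ↔ P'.mkQ.lTensor Y z = 0 := fun z => by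
    have hr : range (P.subtype.lTensor Y) =
        range (Q.subtype.lTensor Y ∘ₗ P'.subtype.lTensor Y) := by
      rw [← LinearMap.lTensor_comp]
      refine le_antisymm ?_ ?_
      · rw [show P.subtype = (Q.subtype ∘ₗ P'.subtype) ∘ₗ
            (LinearMap.codRestrict P' (Submodule.inclusion h.1) fun x => x.2) from rfl,
          LinearMap.lTensor_comp]
        exact LinearMap.range_comp_le_range _ _
      · rw [show Q.subtype ∘ₗ P'.subtype = P.subtype ∘ₗ
            (LinearMap.codRestrict P (Q.subtype ∘ₗ P'.subtype) fun x => x.2) from rfl,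
          LinearMap.lTensor_comp]
        exact LinearMap.range_comp_le_range _ _
    rw [hex z, hr]
    exact ⟨fun ⟨y, hy⟩ => ⟨y, hinj hy⟩, fun ⟨y, hy⟩ => ⟨y, congrArg _ hy⟩⟩
  refine ⟨?_, ?_⟩
  · rw [show P.subtype = Q.subtype ∘ₗ Submodule.inclusion h.1 from rfl, LinearMap.lTensor_comp]
    exact LinearMap.range_comp_le_range _ _
  · rintro _ ⟨z, rfl⟩ hDz
    rw [h1, h3, h2] at hDz
    obtain ⟨y, hy⟩ := exists_tensor_boundary d e hd he hed TN hTN _ hDz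
    obtain ⟨y, rfl⟩ := LinearMap.lTensor_surjective Y P'.mkQ_surjective y
    refine ⟨_, ⟨y, rfl⟩, ?_⟩
    rw [h1, ← map_sub, h3, map_sub, h2, hy, sub_self]

end Kunneth

lemma DGModule.gr_induction (A : DGModule R) {S : Submodule R A} (h : ∀ n, ∀ x ∈ A.gr n, x ∈ S) (x : A) : x ∈ S :=
  (iSup_le h : ⨆ n, A.gr n ≤ S) (by rw [A.internal.submodule_iSup_eq_top]; trivial)

/-- For each `k`, the group order of `Σ_k` is invertible or the complex of `k`-ary operations is bounded
below. -/
abbrev Operad.Bounded (O : Operad R) : Prop := ∀ k, IsUnit (k.factorial : R) ∨ ∃ N : ℤ, ∀ n < N, (O.obj k).gr n = ⊥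

namespace Operad

variable {O : Operad R} {M : Type u} [AddCommGroup M] [Module R M] (ρ : Representation R (Perm (Fin k)) M)

lemma relabel_diag {m n : ℕ} (e : Fin m ≃ Fin n) (g : ℤ → R) (c : O.obj m) :
    (O.obj n).diag g (O.relabel e c) = O.relabel e ((O.obj m).diag g c) := by
  refine lcongr (f := (O.obj n).diag g ∘ₗ O.relabel e)
    (g := O.relabel e ∘ₗ (O.obj m).diag g) ((O.obj m).gr_ext _ _ fun p c hc => ?_) c
  rw [lcmp, lcmp, (O.obj m).diag_of_mem g hc, (O.obj n).diag_of_mem g (O.relabel_gr e p c hc), map_smul]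

/-- The differential of `O(k) ⊗ M` over the group ring of `Σ_k`, for a differential `T` of `M`. -/
def coinvD (T : M →ₗ[R] M) (hT : ∀ σ x, T (ρ σ x) = ρ σ (T x)) : O.Coinv k ρ →ₗ[R] O.Coinv k ρ :=
  O.coinvMap ρ ρ (O.obj k).d (fun σ c => (O.relabel_d σ c).symm) lid (fun _ _ => rfl) +
    O.coinvMap ρ ρ ((O.obj k).eps 1) (fun σ c => (O.relabel_eps σ 1 c).symm) T hT

variable {ρ} {T : M →ₗ[R] M} (hT : ∀ σ x, T (ρ σ x) = ρ σ (T x))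

lemma coinvD_mk (c : O.obj k) (x : M) : O.coinvD ρ T hT (O.cmk ρ c x) =
    O.cmk ρ ((O.obj k).d c) x + O.cmk ρ ((O.obj k).eps 1 c) (T x) := rfl

lemma coinvD_coinvD (hTT : ∀ x, T (T x) = 0) (z : O.Coinv k ρ) : O.coinvD ρ T hT (O.coinvD ρ T hT z) = 0 := by
  have : O.coinvD ρ T hT ∘ₗ O.coinvD ρ T hT = 0 := by
    refine O.coinv_ext fun c x => ?_
    rw [lcmp, coinvD_mk, map_add, coinvD_mk, coinvD_mk, (O.obj k).d_d, eps_d, hTT]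
    simp
  exact lcongr this z

lemma coinvD_mem {Q : Submodule R M} (hQ : ∀ x ∈ Q, T x ∈ Q) {z : O.Coinv k ρ}
    (hz : z ∈ cspan k ρ Q) : O.coinvD ρ T hT z ∈ cspan k ρ Q := by
  refine (span_le (p := (cspan k ρ Q).comap (O.coinvD ρ T hT))).2 ?_ hz
  rintro _ ⟨c, x, hx, rfl⟩
  exact Submodule.add_mem (cspan k ρ Q) (subset_span ⟨_, x, hx, rfl⟩) (subset_span ⟨_, _, hQ x hx, rfl⟩)

lemma cspan_mono {P Q : Submodule R M} (h : P ≤ Q) : cspan (O := O) k ρ P ≤ cspan k ρ Q := by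
  refine Submodule.span_mono ?_
  rintro _ ⟨c, x, hx, rfl⟩
  exact ⟨c, x, h hx, rfl⟩

variable (B : O.DualBasis k) {P Q : Submodule R M}
  (hP : ∀ σ, ∀ x ∈ P, ρ σ x ∈ P) (hQ : ∀ σ, ∀ x ∈ Q, ρ σ x ∈ Q)

include B hP hQ

/-- `O(k)` is projective, so tensoring with it preserves relative acyclicity. -/
lemma exists_cspan_boundary (h : RelAcyclic T P Q)
    {z : O.Coinv k ρ} (hz : z ∈ cspan k ρ Q)
    (hTz : O.coinvMap ρ ρ lid (fun _ _ => rfl) T hT z ∈ cspan k ρ P) :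
    ∃ y ∈ cspan k ρ Q, z - O.coinvMap ρ ρ lid (fun _ _ => rfl) T hT y ∈ cspan k ρ P := by
  rw [mem_cspan_iff B ρ Q hQ] at hz
  rw [mem_cspan_iff B ρ P hP] at hTz
  choose y hy hy2 using fun i => h.2 (B.phi ρ z i) (hz i) (by rw [← B.phi_map ρ ρ T hT]; exact hTz i)
  refine ⟨∑ i ∈ (B.phi ρ z).support, O.cmk ρ (B.b i) (y i), Submodule.sum_mem _ fun i _ =>
    subset_span ⟨_, _, hy i, rfl⟩, ?_⟩
  have hz' := B.psi_phi ρ z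
  rw [DualBasis.psi, Finsupp.lsum_apply, Finsupp.sum] at hz'
  nth_rewrite 1 [← hz']
  rw [map_sum, ← Finset.sum_sub_distrib]
  refine Submodule.sum_mem _ fun i _ => ?_
  rw [coinvMap_mk, l_id, ← map_sub]
  exact subset_span ⟨_, _, hy2 i, rfl⟩

variable (hTT : ∀ x, T (T x) = 0) (hTP : ∀ x ∈ P, T x ∈ P)

include hTT hTP

/-- If `O(k)` is bounded below, the differential of `O(k)` may be disregarded: filter by the degree
in `O(k)`. -/
lemma relAcyclic_coinvD_of_bounded (h : RelAcyclic T P Q) {N : ℤ} (hN : ∀ n < N, (O.obj k).gr n = ⊥) :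
    RelAcyclic (O.coinvD ρ T hT) (cspan k ρ P) (cspan k ρ Q) := by
  let F : ℤ → Submodule R (O.Coinv k ρ) := fun a =>
    span R {t | ∃ n < a, ∃ c ∈ (O.obj k).gr n, ∃ x ∈ Q, t = O.cmk ρ c x}
  have hFle : ∀ a, F a ≤ cspan k ρ Q := fun a => Submodule.span_mono (by
    rintro _ ⟨n, -, c, -, x, hx, rfl⟩; exact ⟨c, x, hx, rfl⟩)
  have hFmono : ∀ {a b}, a ≤ b → F a ≤ F b := fun {a b} hab => Submodule.span_mono (by
    rintro _ ⟨n, hn, c, hc, x, hx, rfl⟩; exact ⟨n, by omega, c, hc, x, hx, rfl⟩)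
  refine ⟨cspan_mono h.1, ?_⟩
  have key : ∀ m : ℕ, ∀ z ∈ F (N + m), O.coinvD ρ T hT z ∈ cspan k ρ P →
      ∃ y ∈ cspan k ρ Q, z - O.coinvD ρ T hT y ∈ cspan k ρ P := by
    intro m
    induction m with
    | zero =>
      intro z hz _
      have : F (N + (0 : ℕ)) ≤ ⊥ := by
        refine span_le.2 ?_
        rintro _ ⟨n, hn, c, hc, x, -, rfl⟩
        rw [hN n (by simpa using hn)] at hc
        rw [(Submodule.mem_bot R).1 hc]; simp
      refine ⟨0, zero_mem _, ?_⟩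
      rw [(Submodule.mem_bot R).1 (this hz)]; simp
    | succ m ih =>
      intro z hz hDz
      obtain ⟨a, ha⟩ : ∃ a, a = N + (m : ℤ) := ⟨_, rfl⟩
      rw [show N + ((m + 1 : ℕ) : ℤ) = a + 1 by rw [ha]; push_cast; ring] at hz
      rw [← ha] at ih
      let pr : O.Coinv k ρ →ₗ[R] O.Coinv k ρ := O.coinvMap ρ ρ
        ((O.obj k).diag fun n => if n = a then 1 else 0) (fun σ c => relabel_diag σ _ c)
        lid (fun _ _ => rfl)
      let K : O.Coinv k ρ →ₗ[R] O.Coinv k ρ := O.coinvMap ρ ρ lid (fun _ _ => rfl) T hT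
      have hpr : ∀ {n c} x, c ∈ (O.obj k).gr n → pr (O.cmk ρ c x) = if n = a then O.cmk ρ c x else 0 := by
        intro n c x hc
        refine (O.coinvMap_mk _ _ _ _ _ _ _ _).trans ?_
        rw [(O.obj k).diag_of_mem _ hc]
        split_ifs <;> simp
      have hext : ∀ {f g : O.Coinv k ρ →ₗ[R] O.Coinv k ρ}, (∀ n, ∀ c ∈ (O.obj k).gr n, ∀ x,
          f (O.cmk ρ c x) = g (O.cmk ρ c x)) → f = g := fun {f g} h => O.coinv_ext fun c x =>
        lcongr (f := f ∘ₗ (O.cmk ρ).flip x) (g := g ∘ₗ (O.cmk ρ).flip x)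
          ((O.obj k).gr_ext _ _ fun n c hc => h n c hc x) c
      have hprD : F (a + 1) ≤ eqLocus (pr ∘ₗ O.coinvD ρ T hT) (sgn R a • (K ∘ₗ pr)) := by
        refine span_le.2 ?_
        rintro _ ⟨n, hn, c, hc, x, -, rfl⟩
        refine (mem_eqLocus).2 ?_
        rw [lcmp, l_smul, lcmp, coinvD_mk, map_add, hpr _ ((O.obj k).d_gr _ _ hc), if_neg (by omega), zero_add,
          hpr _ ((O.obj k).eps_mem 1 hc), hpr _ hc]
        split_ifs with hna
        · rw [(O.obj k).eps_of_mem _ hc, one_mul, map_smul, hna]; rfl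
        · simp
      have hprQ : ∀ (Z : Submodule R M), ∀ w ∈ cspan k ρ Z, pr w ∈ cspan k ρ Z := fun Z =>
        (span_le (p := (cspan k ρ Z).comap pr)).2 (by rintro _ ⟨c, x, hx, rfl⟩; exact subset_span ⟨_, x, hx, rfl⟩)
      have hsub : F (a + 1) ≤ (F a).comap (lid - pr) := by
        refine span_le.2 ?_
        rintro _ ⟨n, hn, c, hc, x, hx, rfl⟩
        change O.cmk ρ c x - pr _ ∈ F a
        rw [hpr _ hc]
        split_ifs with hna
        · rw [sub_self]; exact zero_mem _
        · rw [sub_zero]; exact subset_span ⟨n, by omega, c, hc, x, hx, rfl⟩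
      have hlow : cspan k ρ Q ≤ (F a).comap (O.coinvD ρ T hT ∘ₗ pr - sgn R a • (K ∘ₗ pr)) := by
        refine span_le.2 ?_
        rintro _ ⟨c, x, hx, rfl⟩
        refine mem_comap.2 ((O.obj k).gr_induction (S := (F a).comap
          ((O.coinvD ρ T hT ∘ₗ pr - sgn R a • (K ∘ₗ pr)) ∘ₗ (O.cmk ρ).flip x)) ?_ c)
        intro n c hc
        rw [mem_comap, lcmp, LinearMap.flip_apply, l_sub, l_smul, lcmp, lcmp, hpr _ hc]
        split_ifs with hna
        · have h1 : K (O.cmk ρ c x) = O.cmk ρ c (T x) := rfl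
          rw [coinvD_mk, (O.obj k).eps_of_mem _ hc, one_mul, map_smul, hna, h1, l_smul, add_sub_cancel_right]
          exact subset_span ⟨_, by omega, _, (O.obj k).d_gr _ _ hc, x, hx, rfl⟩
        · rw [map_zero, map_zero, smul_zero, sub_zero]; exact zero_mem _
      have hprK : ∀ w, pr (K w) = K (pr w) := lcongr (f := pr ∘ₗ K) (g := K ∘ₗ pr) (O.coinv_ext fun c x => rfl)
      have hprpr : ∀ w, pr (pr w) = pr w := lcongr (f := pr ∘ₗ pr) (g := pr) (hext fun n c hc x => by
          rw [lcmp, hpr _ hc]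
          split_ifs with hna
          · rw [hpr _ hc, if_pos hna]
          · rw [map_zero])
      have hzQ := hFle _ hz
      have h1 : K (pr z) ∈ cspan k ρ P := by
        have := smul_mem _ (sgn R a) (hprQ P _ hDz)
        rwa [show pr (O.coinvD ρ T hT z) = sgn R a • K (pr z) from hprD hz, smul_smul, sgn_mul_self, one_smul] at this
      obtain ⟨y, hy, hy2⟩ := exists_cspan_boundary hT B hP hQ h (hprQ Q z hzQ) h1
      have h2 : pr z - K (pr y) ∈ cspan k ρ P := by
        have := hprQ P _ hy2
        rwa [map_sub, hprpr, hprK] at this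
      have h3 : (z - pr z) - sgn R a • (O.coinvD ρ T hT (pr y) - sgn R a • K (pr y)) ∈ F a :=
        sub_mem (hsub hz) (smul_mem _ _ (hlow hy))
      have h4 : (z - pr z) - sgn R a • (O.coinvD ρ T hT (pr y) - sgn R a • K (pr y)) =
          z - sgn R a • O.coinvD ρ T hT (pr y) - (pr z - K (pr y)) := by
        rw [smul_sub, smul_smul, sgn_mul_self, one_smul]; abel
      rw [h4] at h3
      obtain ⟨y', hy', hy2'⟩ := ih _ h3 (by
        rw [map_sub, map_sub, map_smul, coinvD_coinvD hT hTT, smul_zero, sub_zero]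
        exact sub_mem hDz (coinvD_mem hT hTP h2))
      refine ⟨sgn R a • pr y + y', add_mem (smul_mem _ _ (hprQ Q y hy)) hy', ?_⟩
      have := add_mem hy2' h2
      rw [map_add, map_smul]
      convert this using 1
      abel
  intro z hz
  suffices hs : ∃ m : ℕ, z ∈ F (N + m) by
    obtain ⟨m, hm⟩ := hs
    exact key m z hm
  have hd : Directed (· ≤ ·) fun m : ℕ => F (N + m) :=
    (monotone_nat_of_le_succ fun m => hFmono (by push_cast; omega)).directed_le
  rw [← mem_iSup_of_directed _ hd]
  revert z
  refine span_le.2 ?_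
  rintro _ ⟨c, x, hx, rfl⟩
  refine (O.obj k).gr_induction (S := (⨆ m : ℕ, F (N + m)).comap ((O.cmk ρ).flip x)) ?_ c
  intro n c hc
  exact mem_iSup_of_mem (n + 1 - N).toNat (subset_span ⟨n, by omega, c, hc, x, hx, rfl⟩)

/-- If `k!` is invertible, averaging embeds the tensor product over the group ring in the tensor
product over `R`. -/
lemma relAcyclic_coinvD_of_isUnit [IsDedekindDomain R] (hTQ : ∀ x ∈ Q, T x ∈ Q) (h : RelAcyclic T P Q) (hk : IsUnit (k.factorial : R)) :
    RelAcyclic (O.coinvD ρ T hT) (cspan k ρ P) (cspan k ρ Q) := by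
  have hflat : Module.Flat R (O.obj k) := by
    have : Module.Flat R (B.ι →₀ (Perm (Fin k) → R)) := by
      classical exact Module.Flat.of_linearEquiv (finsuppLEquivDirectSum R _ _)
    refine Module.Flat.of_retract B.S
      (Finsupp.lsum R fun i => ∑ σ, (LinearMap.toSpanSingleton R _ (O.relabel σ (B.b i))) ∘ₗ
        LinearMap.proj σ) (lext fun c => ?_)
    rw [lcmp, Finsupp.lsum_apply]
    refine Eq.trans (sum_congr rfl fun i _ => ?_) (B.sum_eq c)
    exact l_sum _ _ _
  obtain ⟨v, hv⟩ := hk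
  let pr : O.obj k ⊗[R] M →ₗ[R] O.Coinv k ρ := (O.coinvRel k ρ).mkQ
  have hpr : ∀ c x, pr (c ⊗ₜ x) = O.cmk ρ c x := fun _ _ => rfl
  let D := tensorDiff (O.obj k).d ((O.obj k).eps 1) T
  let s : O.Coinv k ρ →ₗ[R] O.obj k ⊗[R] M := O.coinvLift ρ
    ((↑v⁻¹ : R) • ∑ σ : Perm (Fin k), (TensorProduct.mk R (O.obj k) M).compl₁₂ (O.relabel σ) (ρ σ))
    (fun τ c x => by
      simp only [l_smul, l_sum, LinearMap.compl₁₂_apply]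
      congr 1
      refine Fintype.sum_equiv (Equiv.mulRight τ) _ _ fun σ => ?_
      rw [← O.relabel_trans, ← Module.End.mul_apply, ← map_mul]
      rfl)
  have hs : ∀ c x, s (O.cmk ρ c x) = (↑v⁻¹ : R) • ∑ σ : Perm (Fin k), O.relabel σ c ⊗ₜ[R] ρ σ x :=
    fun c x => by
      refine (O.coinvLift_mk _ _ _ _ _).trans ?_
      simp only [l_smul, l_sum, LinearMap.compl₁₂_apply, TensorProduct.mk_apply]
  have hprs : ∀ z, pr (s z) = z := lcongr (f := pr ∘ₗ s) (g := lid) (O.coinv_ext fun c x => by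
      rw [lcmp, hs, map_smul, map_sum]
      simp only [hpr, O.cmk_relabel]
      rw [Finset.sum_const, Finset.card_univ, Fintype.card_perm, Fintype.card_fin, ← Nat.cast_smul_eq_nsmul R,
        smul_smul, ← hv, Units.inv_mul, one_smul]
      rfl)
  have hprD : ∀ z, pr (D z) = O.coinvD ρ T hT (pr z) := lcongr (f := pr ∘ₗ D)
    (g := O.coinvD ρ T hT ∘ₗ pr) (TensorProduct.ext' fun c x => rfl)
  have hsD : ∀ z, s (O.coinvD ρ T hT z) = D (s z) := lcongr (f := s ∘ₗ O.coinvD ρ T hT)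
    (g := D ∘ₗ s) (O.coinv_ext fun c x => by
      rw [lcmp, lcmp, coinvD_mk, map_add, hs, hs, hs, map_smul, map_sum, ← smul_add, ← sum_add_distrib]
      congr 1
      refine sum_congr rfl fun σ _ => ?_
      rw [O.relabel_d, O.relabel_eps, ← hT]
      rfl)
  have hran : ∀ (Z : Submodule R M) c, ∀ x ∈ Z, c ⊗ₜ[R] x ∈
      range (Z.subtype.lTensor (O.obj k)) := fun Z c x hx => ⟨c ⊗ₜ ⟨x, hx⟩, rfl⟩
  have hprZ : ∀ Z : Submodule R M, ∀ z ∈ range (Z.subtype.lTensor (O.obj k)), pr z ∈ cspan k ρ Z := by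
    rintro Z _ ⟨z, rfl⟩
    induction z using TensorProduct.induction_on with
    | zero => rw [map_zero, map_zero]; exact zero_mem _
    | tmul c x => exact subset_span ⟨c, x, x.2, rfl⟩
    | add a b ha hb => rw [map_add, map_add]; exact add_mem ha hb
  have hsZ : ∀ Z : Submodule R M, (∀ σ, ∀ x ∈ Z, ρ σ x ∈ Z) → ∀ z ∈ cspan k ρ Z,
      s z ∈ range (Z.subtype.lTensor (O.obj k)) := by
    refine fun Z hZ => (span_le (p := (range (Z.subtype.lTensor (O.obj k))).comap s)).2 ?_
    rintro _ ⟨c, x, hx, rfl⟩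
    refine mem_comap.2 ?_
    rw [hs]
    exact smul_mem _ _ (Submodule.sum_mem _ fun σ _ => hran Z _ _ (hZ σ x hx))
  refine ⟨cspan_mono h.1, fun z hz hDz => ?_⟩
  obtain ⟨y, hy, hy2⟩ := (h.lTensor (lext (O.obj k).d_d) ((O.obj k).eps_comp_eps 1)
    (lext fun c => eps_d c) hTT hTP hTQ).2 (s z) (hsZ Q hQ z hz) (by
      have := hsZ P hP _ hDz
      rwa [hsD] at this)
  refine ⟨pr y, hprZ Q y hy, ?_⟩
  have := hprZ P _ hy2
  rwa [map_sub, hprs, hprD] at this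

/-- Relative acyclicity is preserved by the functor `O(k) ⊗ -` over the group ring of `Σ_k`. -/
lemma relAcyclic_coinvD [IsDedekindDomain R] (hTQ : ∀ x ∈ Q, T x ∈ Q)
    (hbdd : IsUnit (k.factorial : R) ∨ ∃ N : ℤ, ∀ n < N, (O.obj k).gr n = ⊥) (h : RelAcyclic T P Q) : RelAcyclic (O.coinvD ρ T hT) (cspan k ρ P) (cspan k ρ Q) := by
  rcases hbdd with hk | ⟨N, hN⟩
  · exact relAcyclic_coinvD_of_isUnit hT B hP hQ hTT hTP hTQ h hk
  · exact relAcyclic_coinvD_of_bounded hT B hP hQ hTT hTP h hN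

end Operad

/-! ### Forests -/

lemma DGModule.tD_map {A : DGModule R} (F : Fin k → (A →ₗ[R] A))
    (hF : ∀ l n, ∀ x ∈ A.gr n, F l x ∈ A.gr n) (hFd : ∀ l x, A.d (F l x) = F l (A.d x)) (z : (⨂[R]^k) A) :
    A.tD k (pmap F z) = pmap F (A.tD k z) := by
  have hFe : ∀ l x, A.eps 1 (F l x) = F l (A.eps 1 x) := fun l x =>
    lcongr (A.gr_ext (A.eps 1 ∘ₗ F l) (F l ∘ₗ A.eps 1) fun n x hx => by
      rw [lcmp, lcmp, A.eps_of_mem _ hx, A.eps_of_mem _ (hF l n x hx), map_smul]) x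
  rw [tD, l_sum, l_sum, map_sum]
  refine sum_congr rfl fun i _ => ?_
  rw [← lcmp, ← lcmp, ← pmap_comp, ← pmap_comp]
  congr 2
  funext l
  refine lext fun x => ?_
  simp only [lcmp]
  split_ifs
  · exact hFe l x
  · exact hFd l x
  · rfl

lemma DGModule.comp_bop {A B C : DGModule R} (j : Fin k → ℕ)
    (p : Fin k → ℤ) (φ : ∀ i, (⨂[R]^(j i)) A →ₗ[R] B) (F : Fin k → (B →ₗ[R] C)) :
    pmap F ∘ₗ bop A B j p φ = bop A C j p (fun i => F i ∘ₗ φ i) := by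
  rw [bop, bop, ← l_assoc, ← pmap_comp]
  rfl

namespace Operad

variable {O : Operad R} {E V : DGModule R}

variable (O E V) in
/-- A decomposition of the complex `V` as the sum of `E` and a shift of the free algebra on `V`, as
for the complex of trees. -/
structure Rooted where
  leaf : E →ₗ[R] V
  root : V →ₗ[R] E
  graft : O.FreeMod V →ₗ[R] V
  ungraft : V →ₗ[R] O.FreeMod V
  root_leaf : ∀ a, root (leaf a) = a
  root_graft : ∀ w, root (graft w) = 0
  ungraft_leaf : ∀ a, ungraft (leaf a) = 0
  ungraft_graft : ∀ w, ungraft (graft w) = w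
  leaf_root_add : ∀ x, leaf (root x) + graft (ungraft x) = x
  leaf_gr : ∀ n, ∀ a ∈ E.gr n, leaf a ∈ V.gr n
  leaf_d : ∀ a, V.d (leaf a) = leaf (E.d a)
  root_gr : ∀ n, ∀ x ∈ V.gr n, root x ∈ E.gr n
  graft_gr : ∀ n, ∀ w ∈ O.frGr V n, graft w ∈ V.gr (n + 1)
  ungraft_gr : ∀ n, ∀ x ∈ V.gr n, ungraft x ∈ O.frGr V (n - 1)
  d_graft : ∀ w, V.d (graft w) = - graft (O.frD V w)

variable (O E) in
/-- The decomposition of the complex of trees. -/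
def treeRooted : Rooted O E (O.tree E) where
  leaf := (O.leaf E).f
  root := (O.root E).f
  graft := O.graft E
  ungraft := O.ungraft E
  root_leaf := O.root_leaf E
  root_graft := O.root_graft E
  ungraft_leaf := O.ungraft_leaf E
  ungraft_graft := O.ungraft_graft E
  leaf_root_add := O.leaf_root_add E
  leaf_gr := (O.leaf E).f_gr
  leaf_d a := ((O.leaf E).f_d a).symm
  root_gr := (O.root E).f_gr
  graft_gr := O.graft_gr E
  ungraft_gr := O.ungraft_gr E
  d_graft := O.d_graft E

variable (S : Rooted O E V)

namespace Rooted

/-- The operations `⨂^J E → V` given by trees with `N` vertices of given degrees. -/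
inductive TOp : ℕ → ∀ J : ℕ, ℤ → ((⨂[R]^J) E →ₗ[R] V) → Prop
  | leaf : TOp 0 1 0 (S.leaf ∘ₗ E.unTone)
  | node {k : ℕ} {N J : Fin k → ℕ} {p : Fin k → ℤ} {φ : ∀ i, (⨂[R]^(J i)) E →ₗ[R] V} {q : ℤ}
    (c : O.obj k) (hc : c ∈ (O.obj k).gr q) : (∀ i, TOp (N i) (J i) (p i) (φ i)) →
      TOp (∑ i, N i + 1) (∑ i, J i) (q + ∑ i, p i + 1) (S.graft ∘ₗ O.br V c ∘ₗ bop E V J p φ)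

variable {S}

lemma TOp.grT {N J : ℕ} {p : ℤ} {φ : (⨂[R]^J) E →ₗ[R] V} (h : S.TOp N J p φ) : GrT E V φ p := by
  induction h with
  | leaf => exact fun n x hx => S.leaf_gr _ _ (E.unTone_grT n x hx)
  | node c hc h ih =>
    intro n x hx
    have := S.graft_gr _ _ (O.br_mem_gr hc (bop_mem_tgr ih hx))
    convert this using 2 <;> first | rfl | ring

lemma TOp.cast {N N' J J' : ℕ} {p p' : ℤ} {φ : (⨂[R]^J) E →ₗ[R] V} (h : S.TOp N J p φ)
    (hN : N = N') (hJ : J' = J) (hp : p = p') : S.TOp N' J' p' (φ ∘ₗ E.tmv (finCongr hJ)) := by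
  subst hN hJ hp
  rw [finCongr_refl, tmv_refl]
  exact h

variable (S) in
/-- The projections onto the direct summands: the leaf, and the trees whose root has a given
arity. -/
def pj : Option ℕ → (V →ₗ[R] V)
  | none => S.leaf ∘ₗ S.root
  | some k => S.graft ∘ₗ O.fin V k ∘ₗ O.fpr V k ∘ₗ S.ungraft

lemma fin_fpr_br (k k' : ℕ) {X : DGModule R} (c : O.obj k') (x : (⨂[R]^k') X) :
    O.fin X k (O.fpr X k (O.br X c x)) = if k' = k then O.br X c x else 0 := by
  split_ifs with h
  · subst h
    rw [br_eq, fpr_fin]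
  · rw [br_eq, fpr_fin_of_ne O X h, map_zero]

lemma pj_leaf (x : Option ℕ) (a : E) : S.pj x (S.leaf a) = if none = x then S.leaf a else 0 := by
  cases x <;> simp [pj, S.root_leaf, S.ungraft_leaf]

lemma pj_graft (x : Option ℕ) (c : O.obj k) (t : (⨂[R]^k) V) :
    S.pj x (S.graft (O.br V c t)) = if some k = x then S.graft (O.br V c t) else 0 := by
  cases x with
  | none => simp [pj, S.root_graft]
  | some k' =>
    simp only [pj, lcmp, S.ungraft_graft, fin_fpr_br, Option.some_inj]
    split_ifs <;> simp

lemma ext_homog (S : Rooted O E V) {P : Type u} [AddCommGroup P] [Module R P] {f g : V →ₗ[R] P}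
    (h0 : ∀ a, f (S.leaf a) = g (S.leaf a)) (h1 : ∀ (k : ℕ) (c : O.obj k) (t : (⨂[R]^k) V),
      f (S.graft (O.br _ c t)) = g (S.graft (O.br _ c t))) : f = g := by
  have h : f ∘ₗ S.graft = g ∘ₗ S.graft := O.free_ext h1
  refine lext fun x => ?_
  rw [← S.leaf_root_add x, map_add, map_add, h0]
  exact congrArg _ (lcongr h _)

lemma pj_pj (x y : Option ℕ) (v : V) : S.pj x (S.pj y v) = if x = y then S.pj y v else 0 := by
  have : S.pj x ∘ₗ S.pj y = if x = y then S.pj y else 0 := by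
    refine S.ext_homog (fun a => ?_) fun k c t => ?_
    · by_cases h1 : none = y <;> by_cases h2 : x = y <;> by_cases h3 : none = x <;> simp_all [pj_leaf]
    · by_cases h1 : some k = y <;> by_cases h2 : x = y <;> by_cases h3 : some k = x <;> simp_all [pj_graft]
  rw [← lcmp, this]
  split_ifs <;> rfl

lemma pj_d (x : Option ℕ) (v : V) : V.d (S.pj x v) = S.pj x (V.d v) := by
  refine lcongr (f := V.d ∘ₗ S.pj x) (g := S.pj x ∘ₗ V.d) (S.ext_homog (fun a => ?_) fun k c t => ?_) v
  · simp only [lcmp, pj_leaf, S.leaf_d]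
    split_ifs <;> simp [S.leaf_d]
  · simp only [lcmp, pj_graft, S.d_graft, frD_br, map_neg, map_add]
    split_ifs <;> simp [S.d_graft, frD_br]

lemma pj_gr (x : Option ℕ) (n : ℤ) (v : V) (hv : v ∈ V.gr n) : S.pj x v ∈ V.gr n := by
  cases x with
  | none => exact S.leaf_gr n _ (S.root_gr n v hv)
  | some k =>
    have h1 : O.frGr V (n - 1) ≤ (V.gr n).comap (S.graft ∘ₗ O.fin V k ∘ₗ O.fpr V k) := by
      refine span_le.2 ?_
      rintro _ ⟨k', p, q, c, t, hc, ht, hpq, rfl⟩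
      refine mem_comap.2 ?_
      rw [lcmp, lcmp, fin_fpr_br]
      split_ifs
      · have := S.graft_gr _ _ (O.br_mem_gr hc ht)
        rwa [hpq, sub_add_cancel] at this
      · rw [map_zero]; exact zero_mem _
    exact h1 (S.ungraft_gr n v hv)

lemma TOp.exists_pj {N J : ℕ} {p : ℤ} {φ : (⨂[R]^J) E →ₗ[R] V} (h : S.TOp N J p φ) : ∃ x, S.pj x ∘ₗ φ = φ := by
  cases h with
  | leaf => exact ⟨none, lext fun x => by simp [pj_leaf]⟩
  | @node k _ _ _ _ _ c hc h => exact ⟨some k, lext fun x => by simp [pj_graft]⟩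

lemma TOp.leaf_or {N J : ℕ} {p : ℤ} {φ : (⨂[R]^J) E →ₗ[R] V} (h : S.TOp N J p φ) :
    S.pj none ∘ₗ φ = 0 ∨ ∃ hJ : J = 1, p = 0 ∧ φ = (S.leaf ∘ₗ E.unTone) ∘ₗ E.tmv (finCongr hJ) := by
  cases h with
  | leaf => exact Or.inr ⟨rfl, rfl, by rw [finCongr_refl, tmv_refl]; rfl⟩
  | node c hc h => exact Or.inl (lext fun x => by simp [pj_graft])

end Rooted

open Rooted

/-- A system of submodules of the tensor powers of a complex, whose factors have colours. -/
structure Family (E : DGModule R) (κ : Type) where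
  sub : ∀ {m : ℕ}, (Fin m → κ) → Submodule R ((⨂[R]^m) E)
  tmv_mem : ∀ {m n : ℕ} (e : Fin m ≃ Fin n) {γ : Fin m → κ} {z : (⨂[R]^m) E}, z ∈ sub γ → E.tmv e z ∈ sub (γ ∘ e.symm)
  tD_mem : ∀ {m : ℕ} {γ : Fin m → κ} {z : (⨂[R]^m) E}, z ∈ sub γ → E.tD m z ∈ sub γ

variable {κ : Type} (Λ : Family E κ)

namespace Rooted

/-- The span of the values of forests with less than `n` vertices at the given submodules. Each
input has the colour of the tree to which it belongs. -/
def forest {q : ℕ} (β : Fin q → κ) (n : ℕ) : Submodule R ((⨂[R]^q) V) :=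
  span R {t | ∃ (N J : Fin q → ℕ) (p : Fin q → ℤ)
    (φ : ∀ i, (⨂[R]^(J i)) E →ₗ[R] V) (z : (⨂[R]^(∑ i, J i)) E),
    (∀ i, S.TOp (N i) (J i) (p i) (φ i)) ∧ ∑ i, N i < n ∧ z ∈ Λ.sub (flat fun i _ => β i) ∧ t = bop E V J p φ z}

variable {S}

lemma mem_of_eq {Λ : Family E κ} {m : ℕ} {γ γ' : Fin m → κ} {z : (⨂[R]^m) E} (h : z ∈ Λ.sub γ)
    (e : γ = γ') : z ∈ Λ.sub γ' := e ▸ h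

lemma forest_mono {q : ℕ} (β : Fin q → κ) {n n' : ℕ} (h : n ≤ n') :
    S.forest Λ β n ≤ S.forest Λ β n' := Submodule.span_mono (by
  rintro _ ⟨N, J, p, φ, z, hφ, hN, hz, rfl⟩
  exact ⟨N, J, p, φ, z, hφ, hN.trans_le h, hz, rfl⟩)

lemma forest_zero {q : ℕ} (β : Fin q → κ) : S.forest Λ β 0 = ⊥ := by
  refine Submodule.span_eq_bot.2 ?_
  rintro _ ⟨N, J, p, φ, z, hφ, hN, hz, rfl⟩
  exact absurd hN (Nat.not_lt_zero _)

variable {Λ}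

lemma forest_tmv {q : ℕ} (σ : Perm (Fin q)) {β : Fin q → κ} {n : ℕ} {t : (⨂[R]^q) V}
    (ht : t ∈ S.forest Λ (β ∘ σ) n) : V.tmv σ t ∈ S.forest Λ β n := by
  have : S.forest Λ (β ∘ σ) n ≤ (S.forest Λ β n).comap (V.tmv σ) := by
    refine span_le.2 ?_
    rintro _ ⟨N, J, p, φ, z, hφ, hN, hz, rfl⟩
    obtain ⟨J, rfl⟩ := exists_comp_perm (T := fun _ => ℕ) σ J
    obtain ⟨N, rfl⟩ := exists_comp_perm (T := fun _ => ℕ) σ N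
    obtain ⟨p, rfl⟩ := exists_comp_perm (T := fun _ => ℤ) σ p
    obtain ⟨φ, rfl⟩ := exists_comp_perm (T := fun i => (⨂[R]^(J i)) E →ₗ[R] V) σ φ
    have hφ' : ∀ i, S.TOp (N i) (J i) (p i) (φ i) := fun i => by
      obtain ⟨i, rfl⟩ := σ.surjective i
      exact hφ i
    have hb := lcongr (tmv_bop (A := E) (B := V) σ J p φ fun i => (hφ' i).grT) z
    rw [lcmp] at hb
    refine mem_comap.2 (Eq.mpr (congrArg (· ∈ _) hb) ?_)
    refine smul_mem _ _ (subset_span ⟨N, J, p, φ, _, hφ', ?_, mem_of_eq (Λ.tmv_mem (blockPerm σ J) hz) ?_, rfl⟩)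
    · rwa [Equiv.sum_comp] at hN
    · funext s
      obtain ⟨s, rfl⟩ := (blockPerm σ J).surjective s
      obtain ⟨⟨i, m⟩, rfl⟩ := (fsf).surjective s
      rw [Function.comp_apply, symm_apply_apply, flat_fsf, blockPerm_fsf, flat_fsf]
      rfl
  exact this ht

lemma forest_map {q : ℕ} {β : Fin q → κ} {n : ℕ} {F : Fin q → (V →ₗ[R] V)}
    (hF : ∀ i, F i = lid ∨ ∃ x, F i = S.pj x) {t : (⨂[R]^q) V}
    (ht : t ∈ S.forest Λ β n) : pmap F t ∈ S.forest Λ β n := by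
  have : S.forest Λ β n ≤ (S.forest Λ β n).comap (pmap F) := by
    refine span_le.2 ?_
    rintro _ ⟨N, J, p, φ, z, hφ, hN, hz, rfl⟩
    rw [Submodule.comap_coe, Set.mem_preimage, ← lcmp, comp_bop]
    have h1 : ∀ i, F i ∘ₗ φ i = 0 ∨ F i ∘ₗ φ i = φ i := fun i => by
      rcases hF i with h | ⟨x, h⟩
      · exact Or.inr (by rw [h, LinearMap.id_comp])
      · obtain ⟨y, hy⟩ := (hφ i).exists_pj
        rw [h, ← hy]
        by_cases hxy : x = y
        · exact Or.inr (lext fun v => by simp [pj_pj, hxy])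
        · exact Or.inl (lext fun v => by simp [pj_pj, hxy])
    by_cases h2 : ∃ i, F i ∘ₗ φ i = 0
    · obtain ⟨i, hi⟩ := h2
      rw [← bopM_apply, (bopM E V J p).map_coord_zero i hi]
      exact zero_mem _
    · rw [show (fun i => F i ∘ₗ φ i) = φ from funext fun i => (h1 i).resolve_left fun h => h2 ⟨i, h⟩]
      exact subset_span ⟨N, J, p, φ, z, hφ, hN, hz, rfl⟩
  exact this ht

variable (S) in
/-- The projections of a tensor power onto the tensors of leaves, and onto those whose first factor
that is not a leaf has a given place and a given arity. -/
def qj {q : ℕ} : Option (Fin q × ℕ) → Fin q → (V →ₗ[R] V)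
  | none => fun _ => S.pj none
  | some x => fun l => if l < x.1 then S.pj none else if l = x.1 then S.pj (some x.2) else lid

lemma qj_cases {q : ℕ} (x : Option (Fin q × ℕ)) (l : Fin q) : S.qj x l = lid ∨ ∃ y, S.qj x l = S.pj y := by
  cases x with
  | none => exact Or.inr ⟨none, rfl⟩
  | some x =>
    simp only [qj]
    split_ifs
    exacts [Or.inr ⟨_, rfl⟩, Or.inr ⟨_, rfl⟩, Or.inl rfl]

lemma exists_qj {q : ℕ} {β : Fin q → κ} {n : ℕ} {t : (⨂[R]^q) V} (ht : t ∈ S.forest Λ β n) :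
    ∃ s : Finset (Option (Fin q × ℕ)), t = ∑ x ∈ s, pmap (S.qj x) t := by
  suffices h : ∃ s : Finset (Option (Fin q × ℕ)), ∀ s' ⊇ s, t = ∑ x ∈ s', pmap (S.qj x) t by
    obtain ⟨s, hs⟩ := h
    exact ⟨s, hs s le_rfl⟩
  classical
  induction ht using span_induction with
  | zero => exact ⟨∅, fun s' _ => by simp⟩
  | add a b _ _ ha hb =>
    obtain ⟨s1, h1⟩ := ha
    obtain ⟨s2, h2⟩ := hb
    refine ⟨s1 ∪ s2, fun s' hs' => ?_⟩
    simp only [map_add, sum_add_distrib]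
    rw [← h1 s' (Finset.union_subset_left hs'), ← h2 s' (Finset.union_subset_right hs')]
  | smul r a _ ha =>
    obtain ⟨s1, h1⟩ := ha
    refine ⟨s1, fun s' hs' => ?_⟩
    simp only [map_smul, ← Finset.smul_sum]
    rw [← h1 s' hs']
  | mem t ht =>
    obtain ⟨N, J, p, φ, z, hφ, -, -, rfl⟩ := ht
    choose y hy using fun i => (hφ i).exists_pj
    have hF : ∀ x, pmap (S.qj x) (bop E V J p φ z) = bop E V J p (fun i => S.qj x i ∘ₗ φ i) z := fun x => by
      rw [← comp_bop, lcmp]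
    have hne : ∀ (x : Option (Fin q × ℕ)) (l : Fin q) w, S.qj x l = S.pj w → w ≠ y l →
        pmap (S.qj x) (bop E V J p φ z) = 0 := fun x l w hw hwy => by
      rw [hF, ← bopM_apply, (bopM E V J p).map_coord_zero l, l_zero]
      rw [hw, ← hy l]
      exact lext fun v => by simp [pj_pj, hwy]
    obtain ⟨x₀, h1, h2⟩ : ∃ x₀, (∀ l, S.qj x₀ l ∘ₗ φ l = φ l) ∧ ∀ x ≠ x₀, ∃ l w, S.qj x l = S.pj w ∧ w ≠ y l := by
      by_cases hall : ∀ i, y i = none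
      · refine ⟨none, fun l => by have h := hy l; rw [hall l] at h; exact h, fun x hx => ?_⟩
        obtain ⟨⟨i, k⟩, rfl⟩ := Option.ne_none_iff_exists'.1 hx
        exact ⟨i, some k, by simp [qj], by rw [hall]; simp⟩
      · push Not at hall
        obtain ⟨i, hi, hmin⟩ := wellFounded_lt.has_min {i : Fin q | y i ≠ none} hall
        have hlt : ∀ l < i, y l = none := fun l hl => by
          by_contra h
          exact hmin l h hl
        obtain ⟨k, hk⟩ := Option.ne_none_iff_exists'.1 hi
        refine ⟨some (i, k), fun l => ?_, fun x hx => ?_⟩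
        · simp only [qj]
          split_ifs with h3 h4
          · rw [← hlt l h3]; exact hy l
          · rw [h4, ← hk]; exact hy i
          · exact LinearMap.id_comp _
        · cases x with
          | none => exact ⟨i, none, rfl, by rw [hk]; simp⟩
          | some x =>
            obtain ⟨i', k'⟩ := x
            rcases lt_trichotomy i' i with h | rfl | h
            · exact ⟨i', some k', by simp [qj], by rw [hlt _ h]; simp⟩
            · exact ⟨i', some k', by simp [qj], by rw [hk]; rintro h; exact hx (by rw [Option.some_inj.1 h])⟩
            · exact ⟨i, none, by simp [qj, h], by rw [hk]; simp⟩
    refine ⟨{x₀}, fun s' hs' => ?_⟩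
    rw [Finset.sum_eq_single x₀]
    · rw [hF, show (fun i => S.qj x₀ i ∘ₗ φ i) = φ from funext h1]
    · intro x _ hx
      obtain ⟨l, w, hw, hwy⟩ := h2 x hx
      exact hne x l w hw hwy
    · exact fun h => absurd (hs' (Finset.mem_singleton_self _)) h

end Rooted

end Operad

namespace DGModule

lemma unTone_bop (A B : DGModule R) (P : Fin 1 → ℕ) (q : Fin 1 → ℤ) (χ : ∀ i, (⨂[R]^(P i)) A →ₗ[R] B) :
    B.unTone ∘ₗ bop A B P q χ = χ 0 ∘ₗ A.tmv (finCongr (by simp)) := by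
  obtain ⟨J, rfl⟩ : ∃ J, P = fun _ => J := ⟨P 0, funext fun i => by rw [Subsingleton.elim i 0]⟩
  obtain ⟨r, rfl⟩ : ∃ r, q = fun _ => r := ⟨q 0, funext fun i => by rw [Subsingleton.elim i 0]⟩
  obtain ⟨f, rfl⟩ : ∃ f, χ = fun _ => f := ⟨χ 0, funext fun i => by rw [Subsingleton.elim i 0]⟩
  rw [bop_fin_one]
  exact lext fun x => B.unTone_tone _

lemma tD_one (A : DGModule R) (x : (⨂[R]^1) A) : A.unTone (A.tD 1 x) = A.d (A.unTone x) := by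
  conv_lhs => rw [← A.tone_unTone x, tone_apply, tD_eq_tDer, tDer]
  simp

end DGModule

lemma blockSum_trans {j j' j'' : Fin k → ℕ} (τ : ∀ i, Fin (j i) ≃ Fin (j' i))
    (τ' : ∀ i, Fin (j' i) ≃ Fin (j'' i)) :
    (blockSum τ).trans (blockSum τ') = blockSum fun i => (τ i).trans (τ' i) := by
  refine Equiv.ext fun s => ?_
  obtain ⟨⟨i, m⟩, rfl⟩ := (fsf).surjective s
  simp [blockSum_fsf]

lemma blockSum_refl (j : Fin k → ℕ) : blockSum (fun i => Equiv.refl (Fin (j i))) = Equiv.refl _ := by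
  refine Equiv.ext fun s => ?_
  obtain ⟨⟨i, m⟩, rfl⟩ := (fsf).surjective s
  simp [blockSum_fsf]

namespace Operad

variable {O : Operad R} {E V : DGModule R}

namespace Rooted

/-- The arities of a list of `q + 1` operations of which the first one has arity `k`, and the other
ones are unary. -/
abbrev fstArity (k q : ℕ) : Fin (q + 1) → ℕ := Fin.cases k fun _ => 1

/-- A list of operations of which all but the first one are identities. -/
abbrev fstOp {k q : ℕ} (f : (⨂[R]^k) V →ₗ[R] V) : ∀ i, (⨂[R]^(fstArity k q i)) V →ₗ[R] V :=
  Fin.cases f fun _ => V.unTone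

/-- The permutations of a block sum of which all but the first one are identities. -/
abbrev fstPerm {k q : ℕ} (σ : Perm (Fin k)) : ∀ i, Fin (fstArity k q i) ≃ Fin (fstArity k q i) :=
  Fin.cases σ fun _ => Equiv.refl _

variable (V) in
/-- The action of `Σ_k` on the first `k` of `k + q` factors. -/
def fstRep (k q : ℕ) : Representation R (Perm (Fin k)) ((⨂[R]^(∑ i, fstArity k q i)) V) where
  toFun σ := V.tmv (blockSum (fstPerm σ))
  map_one' := by
    refine (congrArg V.tmv (Eq.trans ?_ (blockSum_refl _))).trans (V.tmv_refl _)
    congr 1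
    funext i
    cases i using Fin.cases <;> rfl
  map_mul' σ τ := by
    rw [Module.End.mul_eq_comp, ← tmv_trans, blockSum_trans]
    congr 2
    funext i
    cases i using Fin.cases <;> rfl

lemma fstRep_apply (k q : ℕ) (σ : Perm (Fin k)) : fstRep V k q σ = V.tmv (blockSum (fstPerm σ)) := rfl

lemma bop_fst {k q : ℕ} (r : ℤ) (φ : ∀ i, (⨂[R]^(fstArity k q i)) V →ₗ[R] V) :
    bop V V (fstArity k q) (Fin.cases r fun _ => 0) φ = bop V V (fstArity k q) (fun _ => 0) φ := by
  have : ∀ i, suf (Fin.cases r fun _ => 0 : Fin (q + 1) → ℤ) i = suf (fun _ : Fin (q + 1) => 0) i := by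
    intro i
    refine sum_congr rfl fun l _ => ?_
    cases l using Fin.cases with
    | zero => simp
    | succ l => rfl
  rw [bop, bop]
  simp only [this]

variable (S : Rooted O E V)

/-- The insertion of a vertex, labelled by an element of `O(k)`, below the first `k` of `k + q`
trees. -/
def nu (k q : ℕ) : O.obj k →ₗ[R] (⨂[R]^(∑ i, fstArity k q i)) V →ₗ[R] (⨂[R]^(q + 1)) V :=
  (bopM V V (fstArity k q) fun _ => 0).toLinearMap (fstOp 0) 0 ∘ₗ (O.br V).compr₂ S.graft

lemma nu_apply {k q : ℕ} (c : O.obj k) : S.nu k q c =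
    bop V V (fstArity k q) (fun _ => 0) (fstOp (S.graft ∘ₗ O.br V c)) := by
  rw [← bopM_apply]
  refine congrArg (bopM V V (fstArity k q) fun _ => 0) (funext fun i => ?_)
  cases i using Fin.cases with
  | zero => exact update_self _ _ _
  | succ i => exact update_of_ne (Fin.succ_ne_zero i) _ _

lemma nu_flat {k q : ℕ} (c : O.obj k) (b : ∀ i, Fin (fstArity k q i) → V) :
    S.nu k q c (tp R (flat b)) = tp R fun i => fstOp (S.graft ∘ₗ O.br V c) i (tp R (b i)) := by
  rw [nu_apply, bop_flat]
  simp [suf]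

lemma nu_fstRep {k q : ℕ} (σ : Perm (Fin k)) (c : O.obj k) (t) :
    S.nu k q (O.relabel σ c) (fstRep V k q σ t) = S.nu k q c t := by
  rw [fstRep_apply, nu_apply, nu_apply, ← lcmp, bop_blockSum]
  congr 2
  funext i
  cases i using Fin.cases with
  | zero => exact lext fun x => congrArg S.graft (O.br_relabel σ c x)
  | succ i => exact (congrArg (V.unTone ∘ₗ ·) (V.tmv_refl 1)).trans (LinearMap.comp_id _)

/-- The linear map given by the insertion of vertices of arity `k`. -/
def nuHat (k q : ℕ) : O.Coinv k (fstRep V k q) →ₗ[R] (⨂[R]^(q + 1)) V := O.coinvLift _ (S.nu k q) S.nu_fstRep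

lemma fstRep_tD {k q : ℕ} (σ : Perm (Fin k)) (t) : V.tD _ (fstRep V k q σ t) = fstRep V k q σ (V.tD _ t) :=
  tmv_tD _ t

lemma tD_nu {k q : ℕ} (c : O.obj k) (t) : V.tD _ (S.nu k q c t) =
    - (S.nu k q ((O.obj k).d c) t + S.nu k q ((O.obj k).eps 1 c) (V.tD _ t)) := by
  refine lcongr (f := V.tD _ ∘ₗ (S.nu k q).flip t)
    (g := - ((S.nu k q).flip t ∘ₗ (O.obj k).d + (S.nu k q).flip (V.tD _ t) ∘ₗ (O.obj k).eps 1))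
    ((O.obj k).gr_ext _ _ fun n c hc => ?_) c
  have hd : GrT V V (S.graft ∘ₗ O.br V c) (n + 1) := fun m x hx => by
    have := S.graft_gr _ _ (O.br_mem_gr hc hx)
    convert this using 2 <;> first | rfl | ring
  have h0 : ∀ x, V.d (S.graft (O.br V c x)) = -S.graft (O.br V ((O.obj k).d c) x) +
      sgn R (n + 1) • S.graft (O.br V c (V.tD k x)) := fun x => by
    rw [S.d_graft, frD_br, (O.obj k).eps_of_mem 1 hc, sgn_add, sgn_one]
    simp [add_comm]
  have h1 : ∀ x, V.d (V.unTone x) = 0 + sgn R 0 • V.unTone (V.tD 1 x) := fun x => by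
    rw [tD_one, sgn_zero, one_smul, zero_add]
  have h := lcongr (tDer_bop (A := V) (A' := V) (B := V) (hasPar_id V) (r := -1)
    (by decide) V.hasPar_d V.d (fstArity k q) (Fin.cases (n + 1) fun _ => 0)
    (fstOp (S.graft ∘ₗ O.br V c)) (fstOp (S.graft ∘ₗ O.br V c))
    (Fin.cases (-(S.graft ∘ₗ O.br V ((O.obj k).d c))) fun _ => 0)
    (fun i => by rw [pmap_id, LinearMap.comp_id])
    (fun i => by
      cases i using Fin.cases with
      | zero => exact hd.tpar
      | succ i => exact V.unTone_grT.tpar)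
    (fun i => by
      cases i using Fin.cases with
      | zero => exact lext h0
      | succ i => exact lext h1)) t
  rw [lcmp, bop_fst, l_add, l_smul, lcmp, ← nu_apply, ← tD_eq_tDer] at h
  refine h.trans (Eq.trans (congrArg₂ (· + ·) (?_ : _ = -S.nu k q ((O.obj k).d c) t)
    (?_ : _ = -S.nu k q ((O.obj k).eps 1 c) (V.tD _ t))) (neg_add _ _).symm)
  · refine (lcongr (Finset.sum_eq_single (0 : Fin (q + 1)) ?_ ?_) t).trans ?_
    · intro i _ hi
      obtain ⟨i, rfl⟩ := Fin.exists_succ_eq.2 hi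
      refine (congrArg _ ?_).trans (smul_zero _)
      rw [← bopM_apply]
      exact (bopM V V _ _).map_coord_zero i.succ (update_self _ _ _)
    · exact fun h => absurd (mem_univ _) h
    · have h2 : (∑ l : Fin (q + 1), if l < 0 then (Fin.cases (n + 1) (fun _ => 0) l : ℤ) else 0) = 0 := by simp
      have h3 : ∀ x, -S.graft (O.br V ((O.obj k).d c) x) = S.graft (O.br V (-(O.obj k).d c) x) :=
        fun x => by rw [map_neg (O.br V), LinearMap.neg_apply, map_neg]
      rw [h2, sgn_zero, one_smul, ← LinearMap.neg_apply, ← map_neg, nu_apply, ← bop_fst (n + 1 - 1)]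
      refine lcongr (congrArg₂ (bop V V (fstArity k q)) (funext fun i => ?_) (funext fun i => ?_)) t
      · cases i using Fin.cases with
        | zero => exact update_self _ _ _
        | succ i => exact update_of_ne (Fin.succ_ne_zero i) _ _
      · cases i using Fin.cases with
        | zero => exact (update_self _ _ _).trans (lext h3)
        | succ i => exact update_of_ne (Fin.succ_ne_zero i) _ _
  · have : ∑ i : Fin (q + 1), (Fin.cases (n + 1) (fun _ => 0) i : ℤ) = n + 1 := by rw [Fin.sum_univ_succ]; simp
    rw [this, (O.obj k).eps_of_mem 1 hc, map_smul, l_smul, one_mul, sgn_add, sgn_one]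
    simp
    rfl

lemma tD_nuHat {k q : ℕ} (z : O.Coinv k (fstRep V k q)) :
    V.tD _ (S.nuHat k q z) = - S.nuHat k q (O.coinvD _ (V.tD _) fstRep_tD z) :=
  lcongr (f := V.tD _ ∘ₗ S.nuHat k q)
    (g := -(S.nuHat k q ∘ₗ O.coinvD _ (V.tD _) fstRep_tD)) (O.coinv_ext fun c t => S.tD_nu c t) z

lemma nuHat_injective (B : O.DualBasis k) (q : ℕ) : Injective (S.nuHat k q) := by
  let G : B.ι → ∀ i : Fin (q + 1), V →ₗ[R] (⨂[R]^(fstArity k q i)) V := fun i =>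
    Fin.cases (Finsupp.lapply i ∘ₗ B.phi (V.trep k) ∘ₗ O.fpr V k ∘ₗ S.ungraft) fun _ => V.tone
  let Φ : B.ι → ((⨂[R]^(q + 1)) V →ₗ[R] (⨂[R]^(∑ i, fstArity k q i)) V) := fun i =>
    V.join (fstArity k q) ∘ₗ pmap (G i)
  have key : ∀ i, Φ i ∘ₗ S.nuHat k q = Finsupp.lapply i ∘ₗ B.phi (fstRep V k q) := by
    refine fun i => O.coinv_ext fun c t => ?_
    refine lcongr (f := Φ i ∘ₗ S.nu k q c)
      (g := Finsupp.lapply i ∘ₗ B.phi _ ∘ₗ O.cmk (fstRep V k q) c) (V.tprod_flat_ext _ fun b => ?_) t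
    have h0 : ∀ x, B.phi (V.trep k) (O.fpr V k (S.ungraft (S.graft (O.br V c x)))) i =
        ∑ σ, B.S c i σ • V.tmv σ⁻¹ x := fun x => by
      rw [S.ungraft_graft, br_eq, fpr_fin, B.phi_mk]
      rfl
    let w : ∀ l : Fin (q + 1), (⨂[R]^(fstArity k q l)) V := fun l => tp R (b l)
    have h1 : pmap (G i) (tp R fun l =>
        fstOp (S.graft ∘ₗ O.br V c) l (w l)) = ∑ σ, B.S c i σ • tp R
          (update w 0 (V.tmv (fstPerm σ⁻¹ 0) (w 0))) := by
      rw [map_tp]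
      have : (fun l => G i l (fstOp (S.graft ∘ₗ O.br V c) l (w l))) =
          update w 0 (∑ σ, B.S c i σ • V.tmv (fstPerm σ⁻¹ 0) (w 0)) := by
        funext l
        cases l using Fin.cases with
        | zero => rw [update_self]; exact h0 _
        | succ l =>
          rw [update_of_ne (Fin.succ_ne_zero l)]
          exact V.tone_unTone _
      rw [this, MultilinearMap.map_update_sum]
      exact sum_congr rfl fun σ _ => map_update_smul _ _ _ _ _
    rw [lcmp, nu_flat]
    refine (congrArg (V.join _) h1).trans ?_
    refine Eq.trans ?_ (B.phi_mk _ _ _ _).symm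
    rw [map_sum]
    refine sum_congr rfl fun σ _ => ?_
    rw [map_smul, fstRep_apply, ← join_tprod, ← join_blockSum, map_tp]
    congr 3
    funext l
    cases l using Fin.cases with
    | zero => exact update_self _ _ _
    | succ l =>
      rw [update_of_ne (Fin.succ_ne_zero l)]
      exact (lcongr (V.tmv_refl 1) _).symm
  rw [injective_iff_map_eq_zero]
  intro z hz
  apply B.phi_injective
  ext i
  have := lcongr (key i) z
  rw [lcmp, hz, map_zero] at this
  rw [map_zero]
  exact this.symm

end Rooted

end Operad

namespace Operad

variable {O : Operad R} {E V : DGModule R}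

namespace Rooted

variable {S : Rooted O E V} {κ : Type} {Λ : Family E κ}

lemma TOp.node_or {N J : ℕ} {p : ℤ} {φ : (⨂[R]^J) E →ₗ[R] V} (h : S.TOp N J p φ) (k : ℕ) :
    S.pj (some k) ∘ₗ φ = 0 ∨ ∃ (N' J' : Fin k → ℕ) (p' : Fin k → ℤ)
      (φ' : ∀ i, (⨂[R]^(J' i)) E →ₗ[R] V) (q : ℤ) (c : O.obj k) (hJ : J = ∑ i, J' i),
      c ∈ (O.obj k).gr q ∧ (∀ i, S.TOp (N' i) (J' i) (p' i) (φ' i)) ∧ N = ∑ i, N' i + 1 ∧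
      p = (q + 1) + ∑ i, p' i ∧ φ = (S.graft ∘ₗ O.br V c) ∘ₗ bop E V J' p' φ' ∘ₗ E.tmv (finCongr hJ) := by
  cases h with
  | leaf => exact Or.inl (lext fun x => by simp [pj_leaf])
  | @node k' N' J' p' φ' q c hc h =>
    by_cases hk : k' = k
    · subst hk
      exact Or.inr ⟨N', J', p', φ', q, c, rfl, hc, h, rfl, by ring, by rw [finCongr_refl, tmv_refl]; rfl⟩
    · exact Or.inl (lext fun x => by simp [pj_graft, hk])

lemma flat_cast {q : ℕ} {a : Fin q → ℕ} (P : ∀ i, Fin (a i) → ℕ) (β : Fin q → κ) :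
    (flat (j := ♭(P))
      fun s _ => flat (fun i (_ : Fin (a i)) => β i) s) ∘ (finCongr (sum_arity a P)).symm =
    flat fun i (_ : Fin (∑ m, P i m)) => β i :=
  funext fun t => (flat_flat (fun i m (_ : Fin (P i m)) => β i) t).trans rfl

lemma flat_blockSum {q : ℕ} {j j' : Fin q → ℕ} (e : ∀ i, Fin (j i) ≃ Fin (j' i)) (β : Fin q → κ) :
    (flat fun i (_ : Fin (j i)) => β i) ∘ (blockSum e).symm = flat fun i (_ : Fin (j' i)) => β i := by
  funext s
  obtain ⟨s, rfl⟩ := (blockSum e).surjective s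
  obtain ⟨⟨i, m⟩, rfl⟩ := (fsf).surjective s
  rw [Function.comp_apply, symm_apply_apply, blockSum_fsf, flat_fsf, flat_fsf]

/-- The trees whose first factor has a root of arity `k` arise by the insertion of that root. -/
lemma forest_fst_le {k q : ℕ} {β : Fin (q + 1) → κ} {n : ℕ} {t : (⨂[R]^(q + 1)) V} (ht : t ∈ S.forest Λ β (n + 1))
    (hk : pmap (Fin.cases (S.pj (some k)) fun _ => lid) t = t) :
    ∃ z ∈ cspan k (fstRep V k q) (S.forest Λ (flat fun i (_ : Fin (fstArity k q i)) => β i) n),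
      S.nuHat k q z = t := by
  let P0 : Fin (q + 1) → (V →ₗ[R] V) := Fin.cases (S.pj (some k)) fun _ => lid
  suffices h : S.forest Λ β (n + 1) ≤ ((cspan k (fstRep V k q) (S.forest Λ
      (flat fun i (_ : Fin (fstArity k q i)) => β i) n)).map (S.nuHat k q)).comap (pmap P0) by
    have := h ht
    rw [mem_comap] at this
    rw [← hk]; exact this
  refine span_le.2 ?_
  rintro _ ⟨N, J, p, φ, z, hφ, hN, hz, rfl⟩
  rw [Submodule.comap_coe, Set.mem_preimage, ← lcmp, comp_bop]
  rcases (hφ 0).node_or k with h0 | ⟨N', J', p', φ', r, c, hJ, hc, h', hN', hp', hφ0⟩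
  · rw [← bopM_apply, (bopM E V J p).map_coord_zero 0 h0]
    exact zero_mem _
  let a := fstArity k q
  let P : ∀ i, Fin (a i) → ℕ := Fin.cases J' fun i _ => J i.succ
  let Q : ∀ i, Fin (a i) → ℤ := Fin.cases p' fun i _ => p i.succ
  let M : ∀ i, Fin (a i) → ℕ := Fin.cases N' fun i _ => N i.succ
  let χ : ∀ i m, (⨂[R]^(P i m)) E →ₗ[R] V := Fin.cases φ' fun i _ => φ i.succ
  have hχ : ∀ i m, S.TOp (M i m) (P i m) (Q i m) (χ i m) := by
    intro i
    cases i using Fin.cases with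
    | zero => exact h'
    | succ i => exact fun _ => hφ i.succ
  let e : ∀ i, Fin (J i) ≃ Fin (∑ m, P i m) := Fin.cases (finCongr hJ) fun i =>
    finCongr (Fin.sum_univ_one fun _ => J i.succ).symm
  have hp : p = fun i => (Fin.cases (r + 1) fun _ => 0 : Fin (q + 1) → ℤ) i + ∑ m, Q i m := by
    funext i
    cases i using Fin.cases with
    | zero => exact hp'
    | succ i => exact (zero_add _).symm.trans (congrArg _ (Fin.sum_univ_one fun _ => p i.succ).symm)
  have hψ : (fun i => P0 i ∘ₗ φ i) =
      fun i => fstOp (S.graft ∘ₗ O.br V c) i ∘ₗ bop E V (P i) (Q i) (χ i) ∘ₗ E.tmv (e i) := by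
    funext i
    cases i using Fin.cases with
    | zero =>
      refine Eq.trans ?_ hφ0
      change S.pj (some k) ∘ₗ φ 0 = φ 0
      rw [hφ0]
      exact lext fun x => by simp [pj_graft]
    | succ i =>
      refine lext fun x => ?_
      have h1 := lcongr (unTone_bop E V (fun _ => J i.succ) (fun _ => p i.succ)
        fun _ => φ i.succ) (E.tmv (finCongr (Fin.sum_univ_one fun _ => J i.succ).symm) x)
      refine Eq.trans ?_ h1.symm
      exact congrArg (φ i.succ) (E.tmv_symm_tmv (finCongr (Fin.sum_univ_one fun _ => J i.succ).symm) x).symm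
  rw [hψ, hp, bop_comp_bop E V V a P Q χ (fun i m => (hχ i m).grT.tpar), bop_fst, ← nu_apply]
  refine smul_mem _ _ ⟨O.cmk _ c _, subset_span ⟨c, _, subset_span
    ⟨_, _, _, _, _, fun s => hχ _ _, ?_, mem_of_eq (Λ.tmv_mem ((blockSum e).trans
      (finCongr (sum_arity a P)).symm) hz) ?_, rfl⟩, rfl⟩, rfl⟩
  · change ∑ s, flat M s < n
    rw [sum_flat, Fin.sum_univ_succ]
    rw [Fin.sum_univ_succ, hN'] at hN
    have h2 : ∑ i : Fin q, ∑ m, M i.succ m = ∑ i : Fin q, N i.succ :=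
      sum_congr rfl fun i _ => Fin.sum_univ_one fun _ => N i.succ
    have h3 : ∑ m, M 0 m = ∑ i, N' i := rfl
    omega
  · change ((flat fun i (_ : Fin (J i)) => β i) ∘ (blockSum e).symm) ∘ finCongr (sum_arity a P) = _
    rw [flat_blockSum, ← flat_cast]
    rfl

lemma nu_mem_forest {k q : ℕ} {β : Fin (q + 1) → κ} {n : ℕ} (c : O.obj k)
    {t : (⨂[R]^(∑ i, fstArity k q i)) V}
    (ht : t ∈ S.forest Λ (flat fun i (_ : Fin (fstArity k q i)) => β i) n) :
    S.nu k q c t ∈ S.forest Λ β (n + 1) := by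
  refine (O.obj k).gr_induction (S := (S.forest Λ β (n + 1)).comap ((S.nu k q).flip t)) (fun r c hc => ?_) c
  have : S.forest Λ (flat fun i (_ : Fin (fstArity k q i)) => β i) n ≤ (S.forest Λ β (n + 1)).comap (S.nu k q c) := by
    refine span_le.2 ?_
    rintro _ ⟨N, J, p, φ, z, hφ, hN, hz, rfl⟩
    let a := fstArity k q
    obtain ⟨P, rfl⟩ := exists_flat_dep (T := fun i (_ : Fin (a i)) => ℕ) J
    obtain ⟨Q, rfl⟩ := exists_flat p
    obtain ⟨M, rfl⟩ := exists_flat N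
    obtain ⟨χ, rfl⟩ := exists_flat_dep (T := fun i m => (⨂[R]^(P i m)) E →ₗ[R] V) φ
    have hχ := forall_of_forall_fsf (P := fun i m => S.TOp (M i m) (P i m) (Q i m) (χ i m)) hφ
    have hb := lcongr (bop_bop E V V a P (Fin.cases (r + 1) fun _ => 0) Q
      (fstOp (S.graft ∘ₗ O.br V c)) χ fun i m => (hχ i m).grT.tpar) z
    rw [lcmp, bop_fst, ← nu_apply] at hb
    rw [Submodule.comap_coe, Set.mem_preimage]
    refine Eq.mpr (congrArg (· ∈ S.forest Λ β (n + 1)) hb) ?_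
    let N' : Fin (q + 1) → ℕ := Fin.cases (∑ m, M 0 m + 1) fun i => ∑ m, M i.succ m
    refine smul_mem _ _ (subset_span ⟨N', _, _, _, _, fun i => ?_, ?_,
      mem_of_eq (Λ.tmv_mem _ hz) (flat_cast P β), rfl⟩)
    · cases i using Fin.cases with
      | zero =>
        have h1 := (TOp.node c hc (hχ 0)).cast rfl rfl (show r + ∑ m, Q 0 m + 1 = (r + 1) + ∑ m, Q 0 m by ring)
        rw [finCongr_refl, tmv_refl] at h1
        exact h1
      | succ i =>
        have h1 := (hχ i.succ (0 : Fin 1)).cast (show _ = ∑ m : Fin 1, M i.succ m from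
          (Fin.sum_univ_one fun m : Fin 1 => M i.succ m).symm) (Fin.sum_univ_one fun m : Fin 1 => P i.succ m)
          (show _ = 0 + ∑ m : Fin 1, Q i.succ m by
            rw [zero_add]; exact (Fin.sum_univ_one fun m : Fin 1 => Q i.succ m).symm)
        have h2 := unTone_bop E V (P i.succ) (Q i.succ) (χ i.succ)
        exact h2 ▸ h1
    · rw [sum_flat, Fin.sum_univ_succ] at hN
      rw [Fin.sum_univ_succ]
      change ∑ m, M 0 m + 1 + ∑ i : Fin q, ∑ m, M i.succ m < n + 1
      omega
  exact this ht

lemma nuHat_mem_forest {k q : ℕ} {β : Fin (q + 1) → κ} {n : ℕ} {z : O.Coinv k (fstRep V k q)}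
    (hz : z ∈ cspan k (fstRep V k q) (S.forest Λ (flat fun i (_ : Fin (fstArity k q i)) => β i) n)) :
    S.nuHat k q z ∈ S.forest Λ β (n + 1) := by
  have : cspan k (fstRep V k q) (S.forest Λ (flat fun i (_ : Fin (fstArity k q i)) => β i) n) ≤
      (S.forest Λ β (n + 1)).comap (S.nuHat k q) := by
    refine span_le.2 ?_
    rintro _ ⟨c, x, hx, rfl⟩
    exact nu_mem_forest c hx
  exact this hz

lemma flat_one {q : ℕ} (β : Fin q → κ) : (flat fun i (_ : Fin 1) => β i) = β ∘ finCongr (by simp) := by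
  funext s
  obtain ⟨⟨i, m⟩, rfl⟩ := (fsf).surjective s
  rw [flat_fsf, Function.comp_apply]
  refine congrArg β (Fin.ext ?_)
  simp only [finCongr_apply, Fin.val_cast, fsf_val]
  have : (Finset.univ.filter fun x => x < i) = Finset.Iio i := by ext; simp
  simp [this]

lemma map_leaf_mem_forest {q : ℕ} {β : Fin q → κ} {n : ℕ} {z : (⨂[R]^q) E} (hz : z ∈ Λ.sub β) :
    pow(S.leaf) z ∈ S.forest Λ β (n + 1) := by
  have hq : q = ∑ _i : Fin q, 1 := by simp
  have h := lcongr (comp_bop (fun _ : Fin q => 1) (fun _ => 0) (fun _ => E.unTone)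
    fun _ => S.leaf) (E.tmv (finCongr hq) z)
  rw [lcmp, bop_unTone] at h
  have h2 := E.tmv_tmv_symm (finCongr hq.symm) z
  rw [finCongr_symm] at h2
  rw [h2] at h
  rw [h]
  refine subset_span ⟨fun _ => 0, _, _, _, _, fun _ => TOp.leaf, by simp,
    mem_of_eq (Λ.tmv_mem (finCongr hq) hz) (flat_one β).symm, rfl⟩

lemma forest_leaf_le {q : ℕ} {β : Fin q → κ} {n : ℕ} {t : (⨂[R]^q) V}
    (ht : t ∈ S.forest Λ β n) (hk : pow(S.pj none) t = t) :
    ∃ z ∈ Λ.sub β, pow(S.leaf) z = t := by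
  suffices h : S.forest Λ β n ≤ ((Λ.sub β).map pow(S.leaf)).comap pow(S.pj none) by
    have := h ht
    rw [mem_comap, hk] at this
    exact this
  refine span_le.2 ?_
  rintro _ ⟨N, J, p, φ, z, hφ, hN, hz, rfl⟩
  rw [Submodule.comap_coe, Set.mem_preimage, ← lcmp, comp_bop]
  by_cases h : ∃ i, S.pj none ∘ₗ φ i = 0
  · obtain ⟨i, hi⟩ := h
    rw [← bopM_apply, (bopM E V J p).map_coord_zero i hi]
    exact zero_mem _
  choose hJ hp hφ' using fun i => ((hφ i).leaf_or).resolve_left fun h' => h ⟨i, h'⟩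
  obtain rfl : J = fun _ => 1 := funext hJ
  have h1 : (fun i => S.pj none ∘ₗ φ i) = fun i => S.leaf ∘ₗ E.unTone := funext fun i => by
    rw [hφ' i]
    exact lext fun x => by simp [pj_leaf]
  obtain rfl : p = fun _ => 0 := funext hp
  rw [h1, ← comp_bop, bop_unTone, lcmp]
  exact ⟨_, mem_of_eq (Λ.tmv_mem _ hz) (by rw [flat_one]; rfl), rfl⟩

/-- To prove an assertion about combinations of forests, one may assume that all trees are leaves,
or that the first tree has a root of a given arity. -/
lemma forest_rec {n : ℕ} (H : ∀ {q : ℕ}, (Fin q → κ) → (⨂[R]^q) V → Prop)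
    (hsum : ∀ {q : ℕ} {β : Fin q → κ} {t : (⨂[R]^q) V}, t ∈ S.forest Λ β n → (∀ x, H β (pmap (S.qj x) t)) → H β t)
    (hperm : ∀ {q : ℕ} (σ : Perm (Fin q)) {β : Fin q → κ} {t : (⨂[R]^q) V}, H (β ∘ σ) t → H β (V.tmv σ t))
    (hleaf : ∀ {q : ℕ} {β : Fin q → κ} {t : (⨂[R]^q) V}, t ∈ S.forest Λ β n → pow(S.pj none) t = t → H β t)
    (hnode : ∀ {q : ℕ} {β : Fin (q + 1) → κ} {t : (⨂[R]^(q + 1)) V} (k : ℕ), t ∈ S.forest Λ β n →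
      pmap (Fin.cases (S.pj (some k)) fun _ => lid) t = t → H β t)
    {q : ℕ} {β : Fin q → κ} {t : (⨂[R]^q) V} (ht : t ∈ S.forest Λ β n) : H β t := by
  refine hsum ht fun x => ?_
  have hx := forest_map (qj_cases (S := S) x) ht
  cases x with
  | none =>
    refine hleaf hx ?_
    rw [← lcmp, ← pmap_comp]
    congr 2
    funext l
    exact lext fun v => by simp [qj, pj_pj]
  | some x =>
    obtain ⟨i, k⟩ := x
    set w := pmap (S.qj (some (i, k))) t with hw
    clear_value w
    cases q with
    | zero => exact i.elim0
    | succ q =>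
      let σ : Perm (Fin (q + 1)) := Equiv.swap 0 i
      have h1 : V.tmv σ (V.tmv σ.symm w) = w := V.tmv_tmv_symm σ w
      rw [← h1]
      refine hperm σ (hnode k (forest_tmv σ.symm ?_) ?_)
      · convert hx using 2
        funext l
        simp
      · have h2 : pmap (fun l => if l = i then S.pj (some k) else lid) w = w := by
          rw [hw, ← lcmp, ← pmap_comp]
          congr 2
          funext l
          refine lext fun v => ?_
          by_cases hl : l = i <;> by_cases hl' : l < i <;> simp [qj, pj_pj, hl, hl']
        have h3 := lcongr (tmv_map σ.symm (fun l => if l = i then S.pj (some k) else lid) (fun l n x hx => by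
            by_cases h : l = i <;> simp only [h, if_true, if_false]
            exacts [pj_gr _ n x hx, hx])) w
        rw [lcmp, lcmp, h2] at h3
        refine Eq.trans ?_ h3.symm
        congr 2
        funext l
        cases l using Fin.cases with
        | zero => simp [σ]
        | succ l =>
          have : (Equiv.swap 0 i) l.succ ≠ i := fun h => Fin.succ_ne_zero l
            ((Equiv.swap 0 i).injective (h.trans (Equiv.swap_apply_left 0 i).symm))
          simp [σ, this]

lemma tD_qj {q : ℕ} (x : Option (Fin q × ℕ)) (t : (⨂[R]^q) V) :
    V.tD q (pmap (S.qj x) t) = pmap (S.qj x) (V.tD q t) := by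
  refine tD_map _ (fun l n v hv => ?_) (fun l v => ?_) t <;> rcases qj_cases (S := S) x l with h | ⟨y, h⟩ <;> rw [h]
  exacts [hv, pj_gr y n v hv, rfl, pj_d y v]

lemma tD_map_leaf {q : ℕ} (z : (⨂[R]^q) E) : V.tD q (pow(S.leaf) z) =
    pow(S.leaf) (E.tD q z) :=
  (map_tDer (A := E) (f := lid) (δ := E.d) (f' := lid) (δ' := V.d) (g := S.leaf) (F := S.leaf)
    (hasPar_of_gr fun n x hx => by rw [zero_add]; exact S.leaf_gr n x hx) (fun _ => rfl) (fun x => (S.leaf_d x).symm) q z).symm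

lemma forest_tD (n : ℕ) : ∀ {q : ℕ} {β : Fin q → κ} {t : (⨂[R]^q) V}, t ∈ S.forest Λ β n →
    V.tD q t ∈ S.forest Λ β n := by
  induction n with
  | zero =>
    intro q β t ht
    rw [forest_zero] at ht
    rw [(Submodule.mem_bot R).1 ht, map_zero]
    exact zero_mem _
  | succ n ih =>
    refine forest_rec (fun β t => V.tD _ t ∈ S.forest Λ β (n + 1)) (fun ht h => ?_)
      (fun σ β t h => ?_) (fun ht h => ?_) (fun k ht h => ?_)
    · obtain ⟨s, hs⟩ := exists_qj ht
      rw [hs, map_sum]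
      exact Submodule.sum_mem _ fun x _ => h x
    · rw [tmv_tD]
      exact forest_tmv σ h
    · obtain ⟨z, hz, rfl⟩ := forest_leaf_le ht h
      rw [tD_map_leaf]
      exact map_leaf_mem_forest (Λ.tD_mem hz)
    · obtain ⟨z, hz, rfl⟩ := forest_fst_le ht h
      rw [tD_nuHat]
      exact neg_mem (nuHat_mem_forest (coinvD_mem fstRep_tD (fun x hx => ih hx) hz))

end Rooted

end Operad

/-! ### Acyclicity of forests -/

namespace Operad

variable {O : Operad R} {E V : DGModule R}

namespace Rooted

variable {S : Rooted O E V} {κ : Type} {X Y : Family E κ}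

lemma forest_le (h : ∀ {m : ℕ} (γ : Fin m → κ), X.sub γ ≤ Y.sub γ) {q : ℕ} (β : Fin q → κ) (n : ℕ) :
    S.forest X β n ≤ S.forest Y β n :=
  Submodule.span_mono fun _ ⟨N, J, p, φ, z, hφ, hN, hz, e⟩ => ⟨N, J, p, φ, z, hφ, hN, h _ hz, e⟩

lemma forest_tmv_iff {q : ℕ} (σ : Perm (Fin q)) {β : Fin q → κ} {n : ℕ} {t : (⨂[R]^q) V} :
    V.tmv σ t ∈ S.forest X β n ↔ t ∈ S.forest X (β ∘ σ) n := by
  refine ⟨fun h => ?_, forest_tmv σ⟩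
  rw [← V.tmv_symm_tmv σ t]
  refine forest_tmv σ.symm ?_
  convert h using 2
  funext l
  simp

lemma fstRep_mem {k q : ℕ} {β : Fin (q + 1) → κ} {n : ℕ} (σ : Perm (Fin k)) :
    ∀ x ∈ S.forest X (flat fun i (_ : Fin (fstArity k q i)) => β i) n,
      fstRep V k q σ x ∈ S.forest X (flat fun i (_ : Fin (fstArity k q i)) => β i) n := by
  intro x hx
  refine forest_tmv _ ?_
  convert hx using 2
  exact flat_blockSum (fun i => (fstPerm σ i).symm) β

lemma forest_strict (hB : O.HasDualBases) (n : ℕ) : ∀ {q : ℕ} {β : Fin q → κ} {t : (⨂[R]^q) V}, t ∈ S.forest Y β n → ∀ {m : ℕ},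
    t ∈ S.forest X β m → t ∈ S.forest X β n := by
  induction n with
  | zero =>
    intro q β t ht m _
    rw [forest_zero] at ht
    rw [(Submodule.mem_bot R).1 ht]
    exact zero_mem _
  | succ n ih =>
    intro q β t ht
    refine forest_rec (fun β t => ∀ {m : ℕ}, t ∈ S.forest X β m → t ∈ S.forest X β (n + 1))
      (fun _ h m hm => ?_) (fun σ β t h m hm => ?_) (fun _ h m hm => ?_) (fun k ht h m hm => ?_) ht
    · obtain ⟨s, hs⟩ := exists_qj hm
      rw [hs]
      exact Submodule.sum_mem _ fun x _ => h x (forest_map (qj_cases x) hm)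
    · exact forest_tmv σ (h ((forest_tmv_iff σ).1 hm))
    · obtain ⟨z, hz, rfl⟩ := forest_leaf_le hm h
      exact map_leaf_mem_forest hz
    · cases m with
      | zero =>
        rw [forest_zero] at hm
        rw [(Submodule.mem_bot R).1 hm]
        exact zero_mem _
      | succ m =>
        obtain ⟨z, hz, rfl⟩ := forest_fst_le ht h
        obtain ⟨x, hx, e⟩ := forest_fst_le hm h
        obtain ⟨B⟩ := hB k
        rw [S.nuHat_injective B _ e] at hx
        refine nuHat_mem_forest ((mem_cspan_iff B _ _ fstRep_mem z).2 fun i => ?_)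
        exact ih ((mem_cspan_iff B _ _ fstRep_mem z).1 hz i) ((mem_cspan_iff B _ _ fstRep_mem z).1 hx i)

lemma forest_relAcyclic [IsDedekindDomain R] (hB : O.HasDualBases) (hbdd : O.Bounded)
    (H : ∀ {m : ℕ} (γ : Fin m → κ), RelAcyclic (E.tD m) (X.sub γ) (Y.sub γ)) (n : ℕ) :
    ∀ {q : ℕ} (β : Fin q → κ), RelAcyclic (V.tD q) (S.forest X β n) (S.forest Y β n) := by
  suffices h : ∀ {q : ℕ} {β : Fin q → κ} {t : (⨂[R]^q) V}, t ∈ S.forest Y β n →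
      V.tD q t ∈ S.forest X β n → ∃ y ∈ S.forest Y β n, t - V.tD q y ∈ S.forest X β n from
    fun {q} β => ⟨forest_le (fun γ => (H γ).1) β n, fun z => h⟩
  induction n with
  | zero =>
    intro q β t ht _
    rw [forest_zero] at ht
    rw [(Submodule.mem_bot R).1 ht]
    exact ⟨0, zero_mem _, by rw [map_zero, sub_zero]; exact zero_mem _⟩
  | succ n ih =>
    intro q β t ht
    refine forest_rec (fun {q} β t => V.tD q t ∈ S.forest X β (n + 1) →
      ∃ y ∈ S.forest Y β (n + 1), t - V.tD q y ∈ S.forest X β (n + 1))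
      (fun {q β t} ht h hm => ?_) (fun σ β t h hm => ?_) (fun {q β t} ht h hm => ?_)
      (fun {q β t} k ht h hm => ?_) ht
    · obtain ⟨s, hs⟩ := exists_qj ht
      choose y hy hy' using fun x => h x (by rw [tD_qj]; exact forest_map (qj_cases x) hm)
      refine ⟨∑ x ∈ s, y x, Submodule.sum_mem _ fun x _ => hy x, ?_⟩
      rw [map_sum]
      nth_rw 1 [hs]
      rw [← Finset.sum_sub_distrib]
      exact Submodule.sum_mem _ fun x _ => hy' x
    · rw [tmv_tD, forest_tmv_iff] at hm
      obtain ⟨y, hy, h'⟩ := h hm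
      refine ⟨V.tmv σ y, forest_tmv σ hy, ?_⟩
      rw [tmv_tD, ← map_sub]
      exact forest_tmv σ h'
    · obtain ⟨z, hz, rfl⟩ := forest_leaf_le ht h
      rw [tD_map_leaf] at hm
      obtain ⟨x, hx, e⟩ := forest_leaf_le hm (by
        rw [← lcmp, ← pmap_comp]
        congr 2
        funext l
        exact lext fun a => by simp [pj_leaf])
      have hr : ∀ w : (⨂[R]^q) E, pow(S.root) (pow(S.leaf) w) = w := fun w => by
        rw [← lcmp, ← pmap_comp, show (fun _ : Fin q => S.root ∘ₗ S.leaf) = fun _ => lid from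
            funext fun _ => lext S.root_leaf, pmap_id, l_id]
      have e' := congrArg pow(S.root) e
      rw [hr, hr] at e'
      subst e'
      obtain ⟨y, hy, h'⟩ := (H β).2 z hz hx
      refine ⟨_, map_leaf_mem_forest hy, ?_⟩
      rw [tD_map_leaf, ← map_sub]
      exact map_leaf_mem_forest h'
    · have hP : V.tD _ (pmap (Fin.cases (S.pj (some k)) fun _ => lid) t) =
          pmap (Fin.cases (S.pj (some k)) fun _ => lid) (V.tD _ t) :=
        V.tD_map _ (Fin.cases (pj_gr (some k)) fun _ _ _ hx => hx) (Fin.cases (pj_d (some k)) fun _ _ => rfl) t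
      rw [h] at hP
      obtain ⟨z, hz, rfl⟩ := forest_fst_le ht h
      obtain ⟨x, hx, e⟩ := forest_fst_le hm hP.symm
      obtain ⟨B⟩ := hB k
      rw [tD_nuHat, ← map_neg] at e
      rw [S.nuHat_injective B _ e] at hx
      obtain ⟨y, hy, h'⟩ := (relAcyclic_coinvD fstRep_tD B fstRep_mem fstRep_mem (fun x => lcongr (V.tD_tD _) x)
        (fun x hx => forest_tD n hx) (fun x hx => forest_tD n hx) (hbdd k)
        ⟨forest_le (fun γ => (H γ).1) _ n, fun z => ih⟩).2 z hz ((Submodule.neg_mem_iff _).1 hx)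
      refine ⟨S.nuHat k _ (-y), nuHat_mem_forest (neg_mem hy), ?_⟩
      rw [map_neg, map_neg, tD_nuHat, neg_neg, ← map_sub]
      exact nuHat_mem_forest h'

end Rooted

end Operad

/-! ### The families of subcomplexes of a partial algebra -/

/-- A bijection that preserves blocks is a block sum. -/
lemma exists_eq_blockSum {j j' : Fin k → ℕ} (f : Fin (∑ i, j i) ≃ Fin (∑ i, j' i))
    (hf : ∀ i m, (fsi (f (fsf ⟨i, m⟩))).1 = i) :
    ∃ τ : ∀ i, Fin (j i) ≃ Fin (j' i), f = blockSum τ := by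
  let g := (fsf).trans (f.trans fsi)
  have hg : ∀ x, (g x).1 = x.1 := fun x => hf x.1 x.2
  have hs : ∀ {j : Fin k → ℕ} {i} {s : Σ i, Fin (j i)}, s.1 = i → ∃ m, s = ⟨i, m⟩ := by
    rintro j i s rfl
    exact ⟨s.2, rfl⟩
  choose a ha using fun i m => (hs (hg ⟨i, m⟩) : ∃ m', g ⟨i, m⟩ = ⟨i, m'⟩)
  choose b hb using fun i m => (hs ((hg _).symm.trans (congrArg Sigma.fst
    (g.apply_symm_apply ⟨i, m⟩))) : ∃ m', g.symm ⟨i, m⟩ = ⟨i, m'⟩)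
  let τ : ∀ i, Fin (j i) ≃ Fin (j' i) := fun i =>
    { toFun := a i
      invFun := b i
      left_inv m := sigma_mk_injective (i := i) (a₂ := m) (by rw [← hb i (a i m), ← ha i m, g.symm_apply_apply])
      right_inv m := sigma_mk_injective (i := i) (a₂ := m) (by rw [← ha i (b i m), ← hb i m, g.apply_symm_apply]) }
  refine ⟨τ, Equiv.ext fun s => ?_⟩
  obtain ⟨⟨i, m⟩, rfl⟩ := (fsf).surjective s
  rw [← (fsi).injective.eq_iff]
  simp only [blockSum, Equiv.trans_apply, symm_apply_apply]
  exact ha i m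

lemma exists_fiber_equiv {k m : ℕ} (γ : Fin m → Fin k) :
    ∃ (J : Fin k → ℕ) (e : Fin (∑ i, J i) ≃ Fin m), γ ∘ e = flat fun i _ => i := by
  refine ⟨fun i => Fintype.card {x // γ x = i}, (fsi).trans
    ((Equiv.sigmaCongrRight fun i => (Fintype.equivFin _).symm).trans (Equiv.sigmaFiberEquiv γ)), ?_⟩
  funext s
  obtain ⟨⟨i, m⟩, rfl⟩ := (fsf).surjective s
  rw [flat_fsf]
  simp only [Function.comp_apply, Equiv.trans_apply, symm_apply_apply]
  exact ((Fintype.equivFin {x // γ x = i}).symm m).2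

namespace DGModule

variable {A : DGModule R} {P : ∀ j, Submodule R ((⨂[R]^j) A)}

lemma tmv_blockSum_mem_prodSub {j j' : Fin k → ℕ} (τ : ∀ i, Fin (j i) ≃ Fin (j' i))
    (hP : ∀ i, ∀ x ∈ P (j i), A.tmv (τ i) x ∈ P (j' i)) {z : (⨂[R]^(∑ i, j i)) A}
    (hz : z ∈ A.prodSub P j) : A.tmv (blockSum τ) z ∈ A.prodSub P j' := by
  rw [mem_prodSub_iff] at hz ⊢
  have h := lcongr (A.split_blockSum τ) z
  rw [lcmp, lcmp] at h
  rw [h]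
  exact map_mem_tspan hP hz

lemma tD_mem_prodSub {j : Fin k → ℕ} (hε : ∀ k, ∀ x ∈ P k, A.teps k 1 x ∈ P k)
    (hP : ∀ k, ∀ x ∈ P k, A.tD k x ∈ P k) {z : (⨂[R]^(∑ i, j i)) A}
    (hz : z ∈ A.prodSub P j) : A.tD _ z ∈ A.prodSub P j := by
  rw [mem_prodSub_iff] at hz ⊢
  have h := lcongr (split_tDer (A := A) lid A.d j) z
  rw [lcmp, lcmp, l_sum] at h
  rw [tD_eq_tDer, h]
  refine Submodule.sum_mem _ fun i _ => ?_
  refine map_mem_tspan (fun l x hx => ?_) hz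
  rw [pmap_id]
  split_ifs
  exacts [hε _ _ hx, hP _ _ hx, hx]

end DGModule

namespace Operad.Ext

variable {O : Operad R} {A : PartialAlgebra O} (H : Ext A)

/-- The images of the subcomplexes `A_m`, regardless of the colouring. -/
def Lf (κ : Type) : Family H.E κ where
  sub {m} _ := H.L m
  tmv_mem e _ _ := H.L_tmv e
  tD_mem := H.L_tD

/-- The tensors that belong to `A_{j₁} ⊗ ⋯ ⊗ A_{j_k}` after the factors have been sorted by colour,
where `j_i` is the number of factors of colour `i`. -/
def Lc (k : ℕ) : Family H.E (Fin k) where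
  sub {m} γ := ⨅ (J : Fin k → ℕ) (e : Fin (∑ i, J i) ≃ Fin m) (_ : γ ∘ e = flat fun i _ => i),
    (H.E.prodSub H.L J).comap (H.E.tmv e.symm)
  tmv_mem e γ z hz := by
    simp only [Submodule.mem_iInf, mem_comap] at hz ⊢
    intro J e' h
    have := hz J (e'.trans e.symm) h
    rw [show (e'.trans e.symm).symm = e.trans e'.symm from rfl, tmv_trans] at this
    exact this
  tD_mem {m γ z} hz := by
    simp only [Submodule.mem_iInf, mem_comap] at hz ⊢
    intro J e h
    rw [← tmv_tD]
    exact tD_mem_prodSub (fun k x => H.L_teps 1) (fun k x => H.L_tD) (hz J e h)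

lemma Lc_flat (J : Fin k → ℕ) : (H.Lc k).sub (flat fun i (_ : Fin (J i)) => i) = H.E.prodSub H.L J := by
  refine le_antisymm (fun z hz => ?_) fun z hz => ?_ <;>
    simp only [Lc, Submodule.mem_iInf, mem_comap] at hz ⊢
  · have := hz J (Equiv.refl _) rfl
    rwa [Equiv.refl_symm, tmv_refl] at this
  · intro J' e h
    obtain ⟨τ, hτ⟩ := exists_eq_blockSum e.symm fun i m => by
      obtain ⟨s, hs⟩ := e.surjective (fsf ⟨i, m⟩)
      have := congrFun h s
      rw [Function.comp_apply, hs, flat_fsf] at this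
      rw [← hs, symm_apply_apply]
      exact this.symm
    rw [hτ]
    exact tmv_blockSum_mem_prodSub τ (fun i x => H.L_tmv _) hz

lemma relAcyclic_Lc {k m : ℕ} (γ : Fin m → Fin k) :
    RelAcyclic (H.E.tD m) ((H.Lf (Fin k)).sub γ) ((H.Lc k).sub γ) := by
  have key : ∀ J : Fin k → ℕ, RelAcyclic (H.E.tD (∑ i, J i)) (H.L _) (H.E.prodSub H.L J) := by
    intro J
    obtain ⟨h1, h2⟩ := RelAcyclic.of_isQuasiIncl (A.dom.quasi_prod J)
    have hle : H.E.prodSub H.L J ≤ (A.cx.prodSub A.dom.sub J).map pow(H.j.f) :=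
      prodSub_le_map _ fun i => le_rfl
    have hmem : ∀ x ∈ A.cx.prodSub A.dom.sub J, pow(H.j.f) x ∈ H.E.prodSub H.L J :=
      fun x hx => map_mem_prodSub (P := A.dom.sub) (Q := H.L) (fun _ => H.j.f)
        (fun i x hx => Submodule.mem_map_of_mem hx) hx
    refine ⟨?_, fun z hz hDz => ?_⟩
    · rintro _ ⟨x, hx, rfl⟩
      exact hmem x (h1 hx)
    · obtain ⟨x, hx, rfl⟩ := hle hz
      rw [map_j_tD] at hDz
      obtain ⟨x', hx', e⟩ := hDz
      rw [H.map_j_injective _ e] at hx'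
      obtain ⟨y, hy, h⟩ := h2 x hx hx'
      refine ⟨_, hmem y hy, ?_⟩
      rw [map_j_tD, ← map_sub]
      exact ⟨_, h, rfl⟩
  obtain ⟨J, e, he⟩ := exists_fiber_equiv γ
  obtain ⟨h1, h2⟩ := key J
  have hsub : ∀ x ∈ H.E.prodSub H.L J, H.E.tmv e x ∈ (H.Lc k).sub γ := fun x hx =>
    Rooted.mem_of_eq ((H.Lc k).tmv_mem e (by rw [Lc_flat]; exact hx)) (by
      rw [← he, Function.comp_assoc, Equiv.self_comp_symm, Function.comp_id])
  refine ⟨fun z hz => ?_, fun z hz hDz => ?_⟩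
  · rw [← H.E.tmv_tmv_symm e z]
    exact hsub _ (h1 (H.L_tmv _ hz))
  · have hz' : H.E.tmv e.symm z ∈ H.E.prodSub H.L J := by
      simp only [Lc, Submodule.mem_iInf, mem_comap] at hz
      exact hz J e he
    obtain ⟨y, hy, h⟩ := h2 _ hz' (by rw [tmv_tD]; exact H.L_tmv _ hDz)
    refine ⟨_, hsub y hy, ?_⟩
    have := H.L_tmv e h
    rwa [map_sub, tmv_tmv_symm, ← tmv_tD] at this

end Operad.Ext

/-! ### Relative acyclicity in free algebras -/

namespace Operad

variable {O : Operad R} {X : DGModule R}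

/-- The elements of the free algebra on `X` with components in given submodules of the tensor powers
of `X`. -/
def frSub (P : ∀ k, Submodule R ((⨂[R]^k) X)) : Submodule R (O.FreeMod X) :=
  ⨅ k, (cspan k (X.trep k) (P k)).comap (O.fpr X k)

variable {P Q : ∀ k, Submodule R ((⨂[R]^k) X)}

lemma mem_frSub {w : O.FreeMod X} : w ∈ O.frSub P ↔ ∀ k, O.fpr X k w ∈ cspan k (X.trep k) (P k) := by simp [frSub]

lemma fin_mem_frSub {z : O.Coinv k (X.trep k)} (hz : z ∈ cspan k (X.trep k) (P k)) :
    O.fin X k z ∈ O.frSub P := by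
  refine mem_frSub.2 fun l => ?_
  by_cases h : k = l
  · subst h
    rwa [fpr_fin]
  · rw [O.fpr_fin_of_ne X h]
    exact zero_mem _

lemma br_mem_frSub (c : O.obj k) {t : (⨂[R]^k) X} (ht : t ∈ P k) : O.br X c t ∈ O.frSub P :=
  fin_mem_frSub (subset_span ⟨c, t, ht, rfl⟩)

lemma exists_sum_fin (w : O.FreeMod X) : ∃ s : Finset ℕ, w = ∑ k ∈ s, O.fin X k (O.fpr X k w) := by
  classical
  exact ⟨DFinsupp.support w, (DirectSum.sum_support_of w).symm⟩

lemma frSub_le {S : Submodule R (O.FreeMod X)} (h : ∀ (k : ℕ) (c : O.obj k), ∀ t ∈ P k, O.br X c t ∈ S) :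
    O.frSub P ≤ S := by
  intro w hw
  obtain ⟨s, hs⟩ := exists_sum_fin w
  rw [hs]
  refine Submodule.sum_mem _ fun k _ => ?_
  have : cspan k (X.trep k) (P k) ≤ S.comap (O.fin X k) := by
    refine span_le.2 ?_
    rintro _ ⟨c, t, ht, rfl⟩
    exact h k c t ht
  exact this (mem_frSub.1 hw k)

lemma frSub_mono (h : ∀ k, P k ≤ Q k) : O.frSub P ≤ O.frSub Q := frSub_le fun k c _ ht => br_mem_frSub c (h k ht)

lemma frD_mem_frSub (hP : ∀ k, ∀ x ∈ P k, X.tD k x ∈ P k) {w : O.FreeMod X} (hw : w ∈ O.frSub P) :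
    O.frD X w ∈ O.frSub P := by
  refine frSub_le (S := (O.frSub P).comap (O.frD X)) (fun k c t ht => ?_) hw
  rw [mem_comap, frD_br]
  exact add_mem (br_mem_frSub _ ht) (br_mem_frSub _ (hP k t ht))

lemma mem_frSub_of_inf (hB : O.HasDualBases) {P' : ∀ k, Submodule R ((⨂[R]^k) X)}
    (hP : ∀ k (σ : Perm (Fin k)), ∀ x ∈ P k, X.tmv σ x ∈ P k)
    (hQ : ∀ k (σ : Perm (Fin k)), ∀ x ∈ Q k, X.tmv σ x ∈ Q k)
    (hP' : ∀ k (σ : Perm (Fin k)), ∀ x ∈ P' k, X.tmv σ x ∈ P' k)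
    (h : ∀ k, P k ⊓ Q k ≤ P' k) {w : O.FreeMod X} (h1 : w ∈ O.frSub P) (h2 : w ∈ O.frSub Q) :
    w ∈ O.frSub P' := by
  refine mem_frSub.2 fun k => ?_
  obtain ⟨B⟩ := hB k
  exact (mem_cspan_iff B _ _ (hP' k) _).2 fun i => h k ⟨(mem_cspan_iff B _ _ (hP k) _).1 (mem_frSub.1 h1 k) i,
      (mem_cspan_iff B _ _ (hQ k) _).1 (mem_frSub.1 h2 k) i⟩

lemma trep_tD (k : ℕ) (σ : Perm (Fin k)) (x : (⨂[R]^k) X) :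
    X.tD k (X.trep k σ x) = X.trep k σ (X.tD k x) := tmv_tD σ x

lemma frD_fin (k : ℕ) (z : O.Coinv k (X.trep k)) :
    O.frD X (O.fin X k z) = O.fin X k (O.coinvD (X.trep k) (X.tD k) (trep_tD k) z) := by
  refine lcongr (f := O.frD X ∘ₗ O.fin X k)
    (g := O.fin X k ∘ₗ O.coinvD (X.trep k) (X.tD k) (trep_tD k)) (O.coinv_ext fun c x => ?_) z
  rw [lcmp, lcmp, coinvD_mk, map_add]
  exact O.frD_br c x

lemma fpr_frD (k : ℕ) (w : O.FreeMod X) :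
    O.fpr X k (O.frD X w) = O.coinvD (X.trep k) (X.tD k) (trep_tD k) (O.fpr X k w) := by
  refine lcongr (f := O.fpr X k ∘ₗ O.frD X)
    (g := O.coinvD (X.trep k) (X.tD k) (trep_tD k) ∘ₗ O.fpr X k) (O.free_fin_ext fun l z => ?_) w
  rw [lcmp, lcmp, frD_fin]
  by_cases h : l = k
  · subst h
    rw [fpr_fin, fpr_fin]
  · rw [O.fpr_fin_of_ne X h, O.fpr_fin_of_ne X h, map_zero]

/-- The free algebra functor preserves relative acyclicity. -/
lemma relAcyclic_frD [IsDedekindDomain R] (hB : O.HasDualBases) (hbdd : O.Bounded)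
    (hP : ∀ k (σ : Perm (Fin k)), ∀ x ∈ P k, X.tmv σ x ∈ P k)
    (hQ : ∀ k (σ : Perm (Fin k)), ∀ x ∈ Q k, X.tmv σ x ∈ Q k)
    (hDP : ∀ k, ∀ x ∈ P k, X.tD k x ∈ P k) (hDQ : ∀ k, ∀ x ∈ Q k, X.tD k x ∈ Q k)
    (h : ∀ k, RelAcyclic (X.tD k) (P k) (Q k)) : RelAcyclic (O.frD X) (O.frSub P) (O.frSub Q) := by
  refine ⟨frSub_mono fun k => (h k).1, fun z hz hDz => ?_⟩
  have key : ∀ k, ∃ y ∈ cspan k (X.trep k) (Q k),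
      O.fpr X k z - O.coinvD (X.trep k) (X.tD k) (trep_tD k) y ∈ cspan k (X.trep k) (P k) := by
    intro k
    obtain ⟨B⟩ := hB k
    exact (relAcyclic_coinvD (trep_tD k) B (hP k) (hQ k)
      (fun x => lcongr (X.tD_tD k) x) (hDP k) (hDQ k) (hbdd k) (h k)).2 _ (mem_frSub.1 hz k)
        (by rw [← fpr_frD]; exact mem_frSub.1 hDz k)
  choose y hy hy' using key
  obtain ⟨s, hs⟩ := exists_sum_fin z
  refine ⟨∑ k ∈ s, O.fin X k (y k), Submodule.sum_mem _ fun k _ => fin_mem_frSub (hy k), ?_⟩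
  rw [map_sum]
  nth_rw 1 [hs]
  rw [← Finset.sum_sub_distrib]
  refine Submodule.sum_mem _ fun k _ => ?_
  rw [frD_fin, ← map_sub]
  exact fin_mem_frSub (hy' k)

end Operad

/-! ### The filtration by the number of nodes -/

namespace Operad.Ext

variable {O : Operad R} {A : PartialAlgebra O} (H : Ext A)

/-- The trees `v` of degree `q` with `N` nodes that are built from an element of the domain of `A`. -/
def IsTree (N : ℕ) (q : ℤ) (v : H.V) : Prop :=
  ∃ (J : ℕ) (p : ℤ) (φ : (⨂[R]^J) H.E →ₗ[R] H.V) (m : ℤ), (O.treeRooted H.E).TOp N J p φ ∧ p + m = q ∧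
    ∃ z ∈ H.L J, z ∈ H.E.tgr J m ∧ v = φ z

/-- The span of the forests with less than `n` nodes, each of whose trees is built from an element of
the domain of `A`. -/
def Wt (n k : ℕ) : Submodule R ((⨂[R]^k) H.V) :=
  span R {t | ∃ (N : Fin k → ℕ) (q : Fin k → ℤ) (b : Fin k → H.V),
    (∀ l, H.IsTree (N l) (q l) (b l)) ∧ ∑ l, N l < n ∧ t = tp R b}

/-- The span of the forests with less than `n` nodes that are, as a whole, built from an element of
the domain of `A`. -/
def Ut (n k : ℕ) : Submodule R ((⨂[R]^k) H.V) := (O.treeRooted H.E).forest (H.Lf (Fin k)) (fun i => i) n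

/-- The elements of the algebra that involve less than `n` nodes. -/
def W (n : ℕ) : Submodule R H.C := O.frSub (H.Wt n)

/-- The elements of the partial algebra that involve less than `n` nodes. -/
def Uf (n : ℕ) : Submodule R H.C := O.frSub (H.Ut n)

variable {H}

lemma IsTree.mem_gr {N : ℕ} {q : ℤ} {v : H.V} (h : H.IsTree N q v) : v ∈ H.V.gr q := by
  obtain ⟨J, p, φ, m, hφ, rfl, z, -, hm, rfl⟩ := h
  exact hφ.grT m z hm

lemma TOp_mem {N J : ℕ} {p : ℤ} {φ : (⨂[R]^J) H.E →ₗ[R] H.V} (h : (O.treeRooted H.E).TOp N J p φ)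
    {S : Submodule R H.V} (hS : ∀ q v, H.IsTree N q v → v ∈ S) {z : (⨂[R]^J) H.E} (hz : z ∈ H.L J) :
    φ z ∈ S :=
  (iSup_le (a := S.comap φ) fun m y hy => hS _ _ ⟨J, p, φ, m, h, rfl, y, hy.1, hy.2, rfl⟩) (H.L_graded J hz)

lemma forest_Lc (n k : ℕ) : (O.treeRooted H.E).forest (H.Lc k) (fun i => i) n = H.Wt n k := by
  refine le_antisymm (span_le.2 ?_) (span_le.2 ?_)
  · rintro _ ⟨N, J, p, φ, z, hφ, hN, hz, rfl⟩
    change z ∈ (H.Lc k).sub (flat fun i _ => i) at hz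
    rw [Lc_flat, mem_prodSub_iff] at hz
    refine tspan_le (fun b hb => ?_) (bop_mem_tspan (p := p) (φ := φ) (fun J n y => H.L_teps n) hz)
    refine MultilinearMap.mem_of_forall_span (tp R) (fun i => {v | ∃ q, H.IsTree (N i) q v})
      _ (fun s hs => ?_) b fun i => ?_
    · choose q hq using hs
      exact subset_span ⟨N, q, s, hq, hN, rfl⟩
    · obtain ⟨y, hy, e⟩ := hb i
      rw [← e]
      exact TOp_mem (hφ i) (S := span R {v | ∃ q, H.IsTree (N i) q v}) (fun q v hv => subset_span ⟨q, hv⟩) hy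
  · rintro _ ⟨N, q, b, hb, hN, rfl⟩
    choose J p φ m hφ hq z hz hm e using hb
    obtain rfl : b = fun l => φ l (z l) := funext e
    have h1 : bop H.E H.V J p φ (H.E.join J (tp R z)) =
        sgn R (∑ i, suf p i * m i) • tp R fun l => φ l (z l) := by
      rw [bop, lcmp, split_join, map_tp, sgn_sum, ← map_smul_univ]
      refine congrArg _ (funext fun i => ?_)
      rw [lcmp, H.E.teps_of_mem _ (hm i), map_smul]
    rw [← sgn_smul_smul (R := R) (∑ i, suf p i * m i) (tp R fun l => φ l (z l)), ← h1]
    refine smul_mem _ _ (subset_span ⟨N, J, p, φ, _, hφ, hN, ?_, rfl⟩)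
    change _ ∈ (H.Lc k).sub (flat fun i _ => i)
    rw [Lc_flat, mem_prodSub_iff, split_join]
    exact tp_mem_tspan hz

lemma Wt_tmv (n k : ℕ) (σ : Perm (Fin k)) : ∀ x ∈ H.Wt n k, H.V.tmv σ x ∈ H.Wt n k := by
  suffices h : H.Wt n k ≤ (H.Wt n k).comap (H.V.tmv σ) from h
  refine span_le.2 ?_
  rintro _ ⟨N, q, b, hb, hN, rfl⟩
  rw [Submodule.comap_coe, Set.mem_preimage, H.V.tmv_tprod σ q b fun l => (hb l).mem_gr]
  refine smul_mem _ _ (subset_span ⟨N ∘ σ.symm, q ∘ σ.symm, _, fun l => hb _, ?_, rfl⟩)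
  rwa [← Equiv.sum_comp σ.symm] at hN

lemma Ut_tmv (n k : ℕ) (σ : Perm (Fin k)) : ∀ x ∈ H.Ut n k, H.V.tmv σ x ∈ H.Ut n k :=
  fun _ hx => Rooted.forest_tmv σ hx

lemma Wt_tD (n k : ℕ) : ∀ x ∈ H.Wt n k, H.V.tD k x ∈ H.Wt n k := by
  rw [← forest_Lc]
  exact fun x hx => Rooted.forest_tD n hx

lemma Ut_tD (n k : ℕ) : ∀ x ∈ H.Ut n k, H.V.tD k x ∈ H.Ut n k := fun _ hx => Rooted.forest_tD n hx

lemma Ut_le_Wt (n k : ℕ) : H.Ut n k ≤ H.Wt n k := by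
  rw [← forest_Lc]
  exact Rooted.forest_le (fun γ => (H.relAcyclic_Lc γ).1) _ n

lemma Uf_le_W (n : ℕ) : H.Uf n ≤ H.W n := frSub_mono (Ut_le_Wt n)

lemma Wt_mono {n n' : ℕ} (h : n ≤ n') (k : ℕ) : H.Wt n k ≤ H.Wt n' k :=
  Submodule.span_mono fun _ ⟨N, q, b, hb, hN, e⟩ => ⟨N, q, b, hb, hN.trans_le h, e⟩

lemma W_mono {n n' : ℕ} (h : n ≤ n') : H.W n ≤ H.W n' := frSub_mono (Wt_mono h)

lemma Uf_mono {n n' : ℕ} (h : n ≤ n') : H.Uf n ≤ H.Uf n' :=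
  frSub_mono fun k => Rooted.forest_mono (Λ := H.Lf (Fin k)) _ h

lemma W_le {n : ℕ} {S : Submodule R H.C} (h : ∀ (k : ℕ) (p : ℤ) (c : O.obj k) (N : Fin k → ℕ)
    (q : Fin k → ℤ) (b : Fin k → H.V), c ∈ (O.obj k).gr p → (∀ l, H.IsTree (N l) (q l) (b l)) →
      ∑ l, N l < n → O.br H.V c (tp R b) ∈ S) : H.W n ≤ S := by
  refine frSub_le fun k c t ht => ?_
  have : H.Wt n k ≤ S.comap (O.br H.V c) := by
    refine span_le.2 ?_
    rintro _ ⟨N, q, b, hb, hN, rfl⟩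
    exact (O.obj k).gr_induction (S := S.comap ((O.br H.V).flip (tp R b)))
      (fun p c hc => h k p c N q b hc hb hN) c
  exact this ht

lemma W_zero : H.W 0 = ⊥ := le_bot_iff.1 (W_le fun _ _ _ _ _ _ _ _ h => absurd h (Nat.not_lt_zero _))

lemma br_mem_W {k n : ℕ} (c : O.obj k) {N : Fin k → ℕ} {q : Fin k → ℤ} {b : Fin k → H.V}
    (hb : ∀ l, H.IsTree (N l) (q l) (b l)) (hN : ∑ l, N l < n) :
    O.br H.V c (tp R b) ∈ H.W n :=
  br_mem_frSub c (subset_span ⟨N, q, b, hb, hN, rfl⟩)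

/-- The filtration is compatible with the action of the operad. -/
lemma act_mem_W {k M : ℕ} (c : O.obj k) {n : Fin k → ℕ} {x : Fin k → H.C} (hx : ∀ l, x l ∈ H.W (n l))
    (hM : ∀ s : Fin k → ℕ, (∀ l, s l < n l) → ∑ l, s l < M) :
    O.frAct H.V c (tp R x) ∈ H.W M := by
  let G : ℕ → Set H.C := fun n =>
    {w | ∃ (k : ℕ) (p : ℤ) (c : O.obj k) (N : Fin k → ℕ) (q : Fin k → ℤ) (b : Fin k → H.V),
      c ∈ (O.obj k).gr p ∧ (∀ l, H.IsTree (N l) (q l) (b l)) ∧ ∑ l, N l < n ∧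
      w = O.br H.V c (tp R b)}
  refine MultilinearMap.mem_of_forall_span ((O.frAct H.V c).compMultilinearMap (tp R))
    (fun l => G (n l)) _ (fun s hs => ?_) x
    fun l => W_le (S := span R (G (n l))) (fun k p c N q b hc hb hN => subset_span ⟨k, p, c, N, q, b, hc, hb, hN, rfl⟩) (hx l)
  choose a p cs N q b hc hb hN e using hs
  obtain rfl : s = fun l => O.br H.V (cs l) (tp R (b l)) := funext e
  have h1 := bop_flat_homog H.V (O.free H.V) a p (fun i => O.br H.V (cs i)) q b fun i m => (hb i m).mem_gr
  have h2 := lcongr (O.frAct_bop H.V a p c cs hc) (tp R (flat b))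
  rw [lcmp, h1, map_smul] at h2
  rw [l_mult, ← sgn_smul_smul (R := R) _ (O.frAct H.V c _), h2]
  refine smul_mem _ _ (br_mem_W _ (N := flat N) (q := flat q) (fun s => hb _ _) ?_)
  rw [sum_flat]
  exact hM _ hN

lemma frEta_mem_W {N J : ℕ} {p : ℤ} {φ : (⨂[R]^J) H.E →ₗ[R] H.V} (h : (O.treeRooted H.E).TOp N J p φ)
    {z : (⨂[R]^J) H.E} (hz : z ∈ H.L J) : O.frEta H.V (φ z) ∈ H.W (N + 1) := by
  refine TOp_mem h (S := (H.W (N + 1)).comap (O.frEta H.V)) (fun q v hv => ?_) hz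
  rw [mem_comap, frEta_apply, tone_apply]
  exact br_mem_W O.one (N := fun _ => N) (q := fun _ => q) (fun _ => hv) (by simp)

end Operad.Ext

namespace DGModule

lemma tDer_sub {A B : DGModule R} (f δ δ' : A →ₗ[R] B) (k : ℕ) (t : (⨂[R]^k) A) :
    A.tDer f (δ - δ') k t = A.tDer f δ k t - A.tDer f δ' k t := by
  refine lcongr (f := A.tDer f (δ - δ') k) (g := A.tDer f δ k - A.tDer f δ' k)
    (pext (mext fun a => ?_)) t
  change A.tDer f (δ - δ') k (tp R a) = A.tDer f δ k (tp R a) - A.tDer f δ' k (tp R a)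
  simp only [tDer, l_sum, map_tp, ← Finset.sum_sub_distrib]
  refine sum_congr rfl fun i _ => ?_
  have h : ∀ T : A →ₗ[R] B, (fun l => (if l < i then f ∘ₗ A.eps 1 else if l = i then T else f) (a l)) =
      update (fun l => (if l < i then f ∘ₗ A.eps 1 else f) (a l)) i (T (a i)) := fun T => by
    funext l
    rcases eq_or_ne l i with rfl | hl
    · simp
    · simp [hl]
  rw [h, h, h, l_sub, MultilinearMap.map_update_sub]

end DGModule

namespace Operad.Ext

variable {O : Operad R} {A : PartialAlgebra O} {H : Ext A}

lemma TOp_cop {N J : ℕ} {p : ℤ} {φ : (⨂[R]^J) H.E →ₗ[R] H.V} (h : (O.treeRooted H.E).TOp N J p φ) :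
    H.COp J p (O.frEta H.V ∘ₗ φ) := by
  induction h with
  | leaf => exact COp.inc
  | @node k N J p φ q c hc _ ih =>
    have := (COp.act c hc ih).con
    refine Eq.mp (congrArg (H.COp _ _) ?_) this
    rw [← comp_bop (A := H.E) (B := H.V) (C := H.C) J p φ fun _ => O.frEta H.V]
    exact lext fun x => congrArg H.con (O.frAct_eta c _)

lemma Uf_le (n : ℕ) : H.Uf n ≤ H.U₁ := by
  refine frSub_le fun k c t ht => ?_
  refine (O.obj k).gr_induction (S := H.U₁.comap ((O.br H.V).flip t)) (fun r c hc => ?_) c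
  have : H.Ut n k ≤ H.U₁.comap (O.br H.V c) := by
    refine span_le.2 ?_
    rintro _ ⟨N, J, p, φ, z, hφ, -, hz, rfl⟩
    have h := (COp.act c hc fun i => TOp_cop (hφ i)).mem_U₁ hz
    rw [← comp_bop (A := H.E) (B := H.V) (C := H.C) J p φ fun _ => O.frEta H.V] at h
    exact (O.frAct_eta c _ ▸ h : O.br H.V c _ ∈ H.U₁)
  exact this ht

lemma frEta_normal {J : ℕ} (p : ℤ) (φ : (⨂[R]^J) H.E →ₗ[R] H.V) : O.frEta H.V ∘ₗ φ = O.br H.V O.one ∘ₗ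
    bop H.E H.V (fun _ : Fin 1 => J) (fun _ => p) (fun _ => φ) ∘ₗ H.E.tmv (finCongr (by simp)) := by
  have hJ : ∑ _i : Fin 1, J = J := by simp
  rw [bop_fin_one]
  exact lext fun x => congrArg (fun x => O.frEta H.V (φ x)) (H.E.tmv_symm_tmv (finCongr hJ.symm) x).symm

/-- Every operation is, up to a relabelling and a scalar, a product of operations with values in the
trees. -/
lemma COp.normal {J : ℕ} {p : ℤ} {g : (⨂[R]^J) H.E →ₗ[R] H.C} (h : H.COp J p g) :
    ∃ (k : ℕ) (q : ℤ) (c : O.obj k) (N J' : Fin k → ℕ) (p' : Fin k → ℤ)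
      (φ : ∀ i, (⨂[R]^(J' i)) H.E →ₗ[R] H.V) (e : Fin J ≃ Fin (∑ i, J' i)) (r : R),
      c ∈ (O.obj k).gr q ∧ (∀ i, (O.treeRooted H.E).TOp (N i) (J' i) (p' i) (φ i)) ∧ p = q + ∑ i, p' i ∧
      g = r • (O.br H.V c ∘ₗ bop H.E H.V J' p' φ ∘ₗ H.E.tmv e) := by
  induction h with
  | inc =>
    refine ⟨1, 0, O.one, _, _, fun _ => 0, _, finCongr (by simp), 1, O.one_gr, fun _ => Rooted.TOp.leaf, by simp, ?_⟩
    rw [one_smul]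
    exact frEta_normal 0 ((O.treeRooted H.E).leaf ∘ₗ H.E.unTone)
  | smul r _ ih =>
    obtain ⟨k, q, c, N, J', p', φ, e, s, hc, hφ, hp, rfl⟩ := ih
    exact ⟨k, q, c, N, J', p', φ, e, r * s, hc, hφ, hp, (mul_smul _ _ _).symm⟩
  | con _ ih =>
    obtain ⟨k, q, c, N, J', p', φ, e, s, hc, hφ, rfl, rfl⟩ := ih
    refine ⟨1, 0, O.one, _, _, fun _ => q + ∑ i, p' i + 1, _, e.trans (finCongr (by simp)), s, O.one_gr,
      fun _ => Rooted.TOp.node c hc hφ, by simp, ?_⟩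
    rw [LinearMap.comp_smul, tmv_trans]
    exact congrArg (fun f => s • (f ∘ₗ H.E.tmv e))
      (frEta_normal (q + ∑ i, p' i + 1) ((O.treeRooted H.E).graft ∘ₗ O.br H.V c ∘ₗ bop H.E H.V J' p' φ))
  | @act k J p g q c hc _ ih =>
    choose a q' cs N P p' φ e r hcs hφ hp hg using ih
    obtain rfl : p = fun i => q' i + ∑ m, p' i m := funext hp
    obtain rfl : g = fun i => r i • (O.br H.V (cs i) ∘ₗ bop H.E H.V (P i) (p' i) (φ i) ∘ₗ H.E.tmv (e i)) := funext hg
    refine ⟨_, q + ∑ i, q' i, O.comp a c cs, flat N, _, flat p', _,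
      (blockSum e).trans (finCongr (sum_arity a P)).symm,
      (∏ i, r i) * sgn R (unshuffleExp q' fun i => ∑ m, p' i m),
      O.comp_gr a q q' c cs hc hcs, fun s => hφ _ _, ?_, ?_⟩
    · rw [sum_flat, sum_add_distrib, add_assoc]
    · have h1 := bop_comp_bop H.E H.V (O.free H.V) a P p' φ (fun i m => (hφ i m).grT.tpar) q'
        (fun i => O.br H.V (cs i)) e
      rw [← bopM_apply, map_smul_univ, bopM_apply, h1, mul_smul, LinearMap.comp_smul,
        LinearMap.comp_smul, ← l_assoc, O.frAct_bop H.V a q' c cs hcs]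

lemma exists_mem_Uf {w : H.C} (hw : w ∈ H.U₁) : ∃ n, w ∈ H.Uf n := by
  rw [← mem_iSup_of_directed H.Uf (directed_of_isDirected_le fun _ _ => Uf_mono)]
  refine U₁_le (fun J p g hg z hz => ?_) hw
  obtain ⟨k, q, c, N, J', p', φ, e, r, -, hφ, -, rfl⟩ := hg.normal
  refine mem_iSup_of_mem (∑ i, N i + 1) (smul_mem _ _ (br_mem_frSub c
    (subset_span ⟨N, J', p', φ, _, hφ, Nat.lt_succ_self _, ?_, rfl⟩)))
  exact H.L_tmv e hz

lemma mem_Uf (hB : O.HasDualBases) {n : ℕ} {w : H.C} (h : w ∈ H.U₁) (h' : w ∈ H.W n) : w ∈ H.Uf n := by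
  obtain ⟨m, hm⟩ := exists_mem_Uf h
  refine mem_frSub_of_inf hB (Ut_tmv m) (Wt_tmv n) (Ut_tmv n) (fun k t ht => ?_) hm h'
  rw [← forest_Lc] at ht
  exact Rooted.forest_strict hB n ht.2 ht.1

variable (H) in
/-- The difference between the twisted differential and the differential of the free algebra. -/
def tau : H.C →ₗ[R] H.C := H.D - O.frD H.V

lemma D_eq (w : H.C) : H.D w = O.frD H.V w + H.tau w := by simp [tau]

lemma tau_br (c : O.obj k) (t : (⨂[R]^k) H.V) : H.tau (O.br H.V c t) = O.frAct H.V ((O.obj k).eps 1 c)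
      (H.V.tDer (N := H.C) (O.frEta H.V) (H.twist - O.frEta H.V ∘ₗ H.V.d) k t) := by
  have h1 := map_tDer (A := H.V) (B := H.V) (A' := H.V) (B' := H.C) (f := lid) (δ := H.V.d)
    (f' := O.frEta H.V) (δ' := O.frEta H.V ∘ₗ H.V.d) (g := lid) (F := O.frEta H.V)
    H.V.hasPar_id (fun _ => rfl) (fun _ => rfl) k t
  rw [pmap_id, l_id] at h1
  have h2 : H.V.tDer (N := H.C) (O.frEta H.V) (H.twist - O.frEta H.V ∘ₗ H.V.d) k t =
    H.V.tDer (N := H.C) (O.frEta H.V) H.twist k t -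
      H.V.tDer (N := H.C) (O.frEta H.V) (O.frEta H.V ∘ₗ H.V.d) k t := tDer_sub _ _ _ _ _
  rw [h2, ← h1, map_sub]
  have h3 := O.frAct_eta ((O.obj k).eps 1 c) (H.V.tDer lid H.V.d k t)
  have h4 : H.D (O.br H.V c t) = _ := O.frDer_br H.twist_gr c t
  rw [tau, l_sub, h4, O.frD_br, h3, tD_eq_tDer]
  abel

lemma tau_mem_W_of {n : ℕ} (h : ∀ N < n, ∀ q v, H.IsTree N q v →
    (H.twist - O.frEta H.V ∘ₗ H.V.d) v ∈ H.W N) {w : H.C} (hw : w ∈ H.W n) : H.tau w ∈ H.W (n - 1) := by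
  refine W_le (S := (H.W (n - 1)).comap H.tau) (fun k p c N q b hc hb hN => ?_) hw
  rw [mem_comap, tau_br, tDer, l_sum, map_sum]
  refine Submodule.sum_mem _ fun i _ => W_mono (Nat.le_sub_one_of_lt hN) ?_
  rw [map_tp]
  refine act_mem_W _ (n := fun l => if l = i then N l else N l + 1) (fun l => ?_) fun s hs => ?_
  · have hη : O.frEta H.V (b l) ∈ H.W (N l + 1) := by
      obtain ⟨J, p, φ, m, hφ, -, z, hz, -, e⟩ := hb l
      rw [e]
      exact frEta_mem_W hφ hz
    split_ifs with h1 h2 h2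
    · exact absurd h1 h2.ne
    · exact h _ ((single_le_sum (fun _ _ => Nat.zero_le _) (mem_univ l)).trans_lt hN) _ _ (hb l)
    · rw [lcmp, H.V.eps_of_mem 1 (hb l).mem_gr, map_smul]
      exact smul_mem _ _ hη
    · exact hη
  · have hs' : ∀ l, s l ≤ N l := fun l => by
      have := hs l
      split_ifs at this <;> omega
    exact Finset.sum_lt_sum (fun l _ => hs' l) ⟨i, mem_univ i, by simpa using hs i⟩

lemma con_mem_W {n : ℕ} {w : H.C} (hw : w ∈ H.Uf n) : H.con w ∈ H.W (n + 1) := by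
  refine frSub_le (S := (H.W (n + 1)).comap H.con) (fun k c t ht => ?_) hw
  refine (O.obj k).gr_induction (S := (H.W (n + 1)).comap (H.con ∘ₗ (O.br H.V).flip t)) (fun r c hc => ?_) c
  have : H.Ut n k ≤ (H.W (n + 1)).comap (H.con ∘ₗ O.br H.V c) := by
    refine span_le.2 ?_
    rintro _ ⟨N, J, p, φ, z, hφ, hN, hz, rfl⟩
    exact W_mono (Nat.succ_le_succ hN) (frEta_mem_W (Rooted.TOp.node c hc hφ) hz)
  exact this ht

lemma twist_mem_W (hB : O.HasDualBases) (N : ℕ) : ∀ q v, H.IsTree N q v →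
    (H.twist - O.frEta H.V ∘ₗ H.V.d) v ∈ H.W N := by
  induction N using Nat.strong_induction_on with
  | _ N ih =>
    rintro q v ⟨J, p, φ, m, hφ, -, z, hz, -, rfl⟩
    cases hφ with
    | leaf =>
      have h1 : (O.tree H.E).d ((O.leaf H.E).f (H.E.unTone z)) = (O.leaf H.E).f (H.E.d (H.E.unTone z)) :=
        ((O.leaf H.E).f_d _).symm
      have : (H.twist - O.frEta H.V ∘ₗ H.V.d) ((O.leaf H.E).f (H.E.unTone z)) = 0 := by
        rw [l_sub, lcmp, twist_eq, h1, root_leaf, ungraft_leaf]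
        simp [inc]
      refine Eq.mpr (congrArg (· ∈ H.W 0) this) (zero_mem _)
    | @node k N J p φ r c hc hφ =>
      set w := O.br H.V c (bop H.E H.V J p φ z) with hw
      have hU : w ∈ H.Uf (∑ i, N i + 1) := br_mem_frSub c
        (subset_span ⟨N, J, p, φ, z, hφ, Nat.lt_succ_self _, hz, rfl⟩)
      have h1 : H.V.d (O.graft H.E w) = - O.graft H.E (O.frD H.V w) := O.d_graft H.E w
      have h2 : (H.twist - O.frEta H.V ∘ₗ H.V.d) (O.graft H.E w) = w - H.inc (H.aug w) - H.con (H.tau w) := by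
        rw [l_sub, lcmp, twist_eq, h1, root_graft, ungraft_graft, map_neg, tau, l_sub, map_sub]
        simp [D, con]
        abel
      refine Eq.mpr (congrArg (· ∈ H.W _) h2) (sub_mem (sub_mem (Uf_le_W _ hU) ?_) (con_mem_W (mem_Uf hB ?_ ?_)))
      · obtain ⟨a, ha⟩ := exists_aug_eq (Uf_le _ hU)
        rw [← ha]
        have := frEta_mem_W (H := H) Rooted.TOp.leaf (H.tone_mem_L a)
        rw [lcmp, unTone_tone] at this
        exact W_mono (Nat.le_add_left 1 _) this
      · exact sub_mem (D_mem_U₁ (Uf_le _ hU)) (Uf_le _ (frD_mem_frSub (Ut_tD _) hU))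
      · exact tau_mem_W_of ih (Uf_le_W _ hU)

lemma tau_mem_W (hB : O.HasDualBases) {n : ℕ} {w : H.C} (hw : w ∈ H.W n) :
    H.tau w ∈ H.W (n - 1) := tau_mem_W_of (fun N _ => twist_mem_W hB N) hw

lemma frD_mem_W {n : ℕ} {w : H.C} (hw : w ∈ H.W n) : O.frD H.V w ∈ H.W n := frD_mem_frSub (Wt_tD n) hw

end Operad.Ext

/-! ### The algebra -/

namespace Operad.Ext

variable {O : Operad R} {A : PartialAlgebra O} {H : Ext A}

variable (H) in
/-- The module underlying the algebra: the span of the products of trees, each of which is built from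
an element of the domain of `A`. -/
def W₁ : Submodule R H.C := ⨆ n, H.W n

lemma mem_W₁ {w : H.C} : w ∈ H.W₁ ↔ ∃ n, w ∈ H.W n :=
  mem_iSup_of_directed H.W (directed_of_isDirected_le fun _ _ => W_mono)

lemma U₁_le_W₁ : H.U₁ ≤ H.W₁ := fun _ hw => by
  obtain ⟨n, hn⟩ := exists_mem_Uf hw
  exact mem_W₁.2 ⟨n, Uf_le_W n hn⟩

lemma W₁_le {S : Submodule R H.C} (h : ∀ (k : ℕ) (p : ℤ) (c : O.obj k) (q : Fin k → ℤ) (b : Fin k → H.V),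
    c ∈ (O.obj k).gr p → (∀ l, b l ∈ H.V.gr (q l)) → (∀ l, O.frEta H.V (b l) ∈ H.U₁) →
      O.br H.V c (tp R b) ∈ H.W₁ → O.br H.V c (tp R b) ∈ S) :
    H.W₁ ≤ S := by
  refine iSup_le fun n => W_le fun k p c N q b hc hb hN => h k p c q b hc (fun l => (hb l).mem_gr)
    (fun l => ?_) (mem_W₁.2 ⟨n, br_mem_W c hb hN⟩)
  obtain ⟨J, p, φ, m, hφ, -, z, hz, -, e⟩ := hb l
  rw [e]
  exact (TOp_cop hφ).mem_U₁ hz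

lemma act_mem_W₁ (c : O.obj k) {x : Fin k → H.C} (hx : ∀ l, x l ∈ H.W₁) :
    O.frAct H.V c (tp R x) ∈ H.W₁ := by
  choose n hn using fun l => mem_W₁.1 (hx l)
  exact mem_W₁.2 ⟨∑ l, n l + 1, act_mem_W c hn fun s hs => Nat.lt_succ_of_le (Finset.sum_le_sum fun l _ => (hs l).le)⟩

lemma W₁_graded : H.W₁ ≤ ⨆ n, H.W₁ ⊓ H.C.gr n :=
  W₁_le fun _ _ _ q _ hc hb _ h => mem_iSup_of_mem _ ⟨h, O.br_mem_gr hc (H.V.tprod_mem_tgr q _ hb)⟩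

lemma D_D_W {w : H.C} (hw : w ∈ H.W₁) : H.D (H.D w) = 0 := by
  refine W₁_le (S := ker (H.D ∘ₗ H.D)) (fun k p c q b _ _ hU _ => ?_) hw
  rw [LinearMap.mem_ker, lcmp, ← O.frAct_eta, map_tp, D_D_act, tDer_tDer_tprod fun i => D_D (hU i), map_zero]

lemma D_mem_W (hB : O.HasDualBases) {n : ℕ} {w : H.C} (hw : w ∈ H.W n) : H.D w ∈ H.W n := by
  rw [D_eq]
  exact add_mem (frD_mem_W hw) (W_mono (Nat.sub_le n 1) (tau_mem_W hB hw))

lemma D_mem_W₁ (hB : O.HasDualBases) {w : H.C} (hw : w ∈ H.W₁) : H.D w ∈ H.W₁ := by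
  obtain ⟨n, hn⟩ := mem_W₁.1 hw
  exact mem_W₁.2 ⟨n, D_mem_W hB hn⟩

lemma frD_mem_Uf {n : ℕ} {w : H.C} (hw : w ∈ H.Uf n) : O.frD H.V w ∈ H.Uf n := frD_mem_frSub (Ut_tD n) hw

lemma frD_frD (w : H.C) : O.frD H.V (O.frD H.V w) = 0 := (O.free H.V).d_d w

lemma tau_mem_W_succ (hB : O.HasDualBases) {n : ℕ} {w : H.C} (hw : w ∈ H.W (n + 1)) :
    H.tau w ∈ H.W n := Nat.add_sub_cancel n 1 ▸ tau_mem_W hB hw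

/-- The subquotients of the filtration are acyclic by the acyclicity of forests, since the twisted
differential differs from the differential of the free algebra by an operator that lowers the
filtration. -/
lemma relAcyclic_D [IsDedekindDomain R] (hB : O.HasDualBases) (hbdd : O.Bounded) : RelAcyclic H.D H.U₁ H.W₁ := by
  have hRA : ∀ n, RelAcyclic (O.frD H.V) (H.Uf n) (H.W n) := fun n =>
    relAcyclic_frD hB hbdd (Ut_tmv n) (Wt_tmv n) (Ut_tD n) (Wt_tD n) fun k => by
      rw [← forest_Lc]
      exact Rooted.forest_relAcyclic hB hbdd H.relAcyclic_Lc n _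
  refine ⟨U₁_le_W₁, fun z hz => ?_⟩
  obtain ⟨n, hn⟩ := mem_W₁.1 hz
  clear hz
  induction n generalizing z with
  | zero =>
    rw [W_zero, Submodule.mem_bot] at hn
    rw [hn]
    exact fun _ => ⟨0, zero_mem _, by rw [map_zero, sub_zero]; exact zero_mem _⟩
  | succ n ih =>
    intro hDz
    have hU := mem_Uf hB hDz (D_mem_W hB hn)
    have hw := tau_mem_W_succ hB hn
    -- The component `tau z` is a cycle modulo `U`, because `frD z + tau z` lies in `U`.
    have hfw : O.frD H.V (H.tau z) ∈ H.Uf n := by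
      have h1 := frD_mem_Uf hU
      rw [D_eq, map_add, frD_frD, zero_add] at h1
      exact mem_Uf hB (Uf_le _ h1) (frD_mem_W hw)
    obtain ⟨y, hy, h1⟩ := (hRA n).2 _ hw hfw
    obtain ⟨x, hx, h2⟩ := (hRA (n + 1)).2 (z + y) (add_mem hn (W_mono n.le_succ hy)) (by
      rw [map_add, show O.frD H.V z + O.frD H.V y = H.D z - (H.tau z - O.frD H.V y) by rw [D_eq]; abel]
      exact sub_mem hU (Uf_mono n.le_succ h1))
    have h3 : z - H.D x - (z + y - O.frD H.V x) = - y - H.tau x := by rw [D_eq]; abel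
    have hx' := mem_W₁.2 ⟨_, hx⟩
    obtain ⟨x', hx'', h4⟩ := ih (- y - H.tau x) (sub_mem (neg_mem hy) (tau_mem_W_succ hB hx)) (by
      rw [← h3, map_sub, map_sub, D_D_W hx', sub_zero]
      exact sub_mem hDz (D_mem_U₁ (Uf_le _ h2)))
    refine ⟨x + x', add_mem hx' hx'', ?_⟩
    have := add_mem h4 (Uf_le _ h2)
    rwa [← h3, sub_right_comm, sub_add_cancel, sub_sub, ← map_add] at this

end Operad.Ext

namespace Operad.Ext

variable {O : Operad R} {A : PartialAlgebra O}

variable (H : Ext A) (hB : O.HasDualBases)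

/-- The complex of products of trees, with the twisted differential. -/
def Wc : DGModule R := subcx H.C H.W₁ H.D W₁_graded H.D_gr (fun _ => D_mem_W₁ hB) fun _ => D_D_W

/-- The inclusion in the free algebra on trees. -/
def inclW : H.Wc hB →ₗ[R] H.C := H.W₁.subtype

/-- The operations on products of trees. -/
def actW : O.obj k →ₗ[R] MultilinearMap R (fun _ : Fin k => (H.Wc hB : Type u)) (H.Wc hB) where
  toFun c := MultilinearMap.codRestrict (((O.frAct H.V c).compMultilinearMap
    (tp R)).compLinearMap fun _ => H.inclW hB) H.W₁ fun x => act_mem_W₁ c fun l => (x l).2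
  map_add' c c' := mext fun x => Subtype.ext
    (lcongr (map_add (O.frAct H.V) c c') (tp R fun l => H.inclW hB (x l)))
  map_smul' r c := mext fun x => Subtype.ext
    (lcongr (map_smul (O.frAct H.V) r c) (tp R fun l => H.inclW hB (x l)))

lemma inclW_actW (c : O.obj k) (x : Fin k → H.Wc hB) : H.inclW hB (H.actW hB c x) =
    O.frAct H.V c (tp R fun l => H.inclW hB (x l)) := rfl

lemma inclW_injective : Injective (H.inclW hB) := Subtype.val_injective

/-- The algebra of products of trees. -/
def Walg [IsDedekindDomain R] : OperadAlgebra O where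
  cx := H.Wc hB
  flat := flat_sub hB H.W₁
  act := H.actW hB
  act_gr p q c a hc ha := O.frAct_mem_gr hc (H.C.tprod_mem_tgr q _ ha)
  d_act c a := by
    apply H.inclW_injective
    refine (H.D_act c (tp R fun l => H.inclW hB (a l))).trans ?_
    rw [map_add, map_sum, inclW_actW, tDer, l_sum, map_sum]
    refine congrArg _ (sum_congr rfl fun i _ => ?_)
    rw [inclW_actW, map_tp]
    refine congrArg _ (congrArg _ (funext fun l => ?_))
    split_ifs
    · exact (map_eps (A := H.Wc hB) (B := H.C) (g := H.inclW hB) (fun _ _ h => h) 1 (a l)).symm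
    · rfl
    · rfl
  act_one a := by
    apply H.inclW_injective
    refine Eq.trans ?_ (O.frAct_one (H.inclW hB a))
    exact congrArg (O.frAct H.V O.one) (tone_apply H.C _).symm
  act_relabel σ q c a ha := by
    apply H.inclW_injective
    have h : H.C.tmv σ (tp R fun l => H.inclW hB (a (σ l))) =
        koszul R σ (fun l => q (σ l)) • tp R fun l => H.inclW hB (a l) := by
      rw [tmv_perm]
      refine (tperm_tprod H.C σ _ _ fun l => ha (σ l)).trans ?_
      simp only [apply_symm_apply]
      rfl
    have h2 : koszul R σ (fun l => q (σ l)) • O.frAct H.V (O.relabel σ c) (tp R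
        fun l => H.inclW hB (a l)) = O.frAct H.V c (tp R fun l => H.inclW hB (a (σ l))) :=
      (map_smul _ _ _).symm.trans ((congrArg (O.frAct H.V _) h.symm).trans (O.frAct_relabel σ c _))
    rw [map_smul, inclW_actW, inclW_actW, ← h2, smul_smul, koszul_mul_self, one_smul]
  act_comp j p q c cs a hcs ha := by
    apply H.inclW_injective
    rw [map_smul, inclW_actW, inclW_actW, O.frAct_comp j p c cs hcs]
    refine (congrArg (O.frAct H.V c) (bop_flat_homog H.C H.C j p _ q (fun i m => H.inclW hB (a i m)) ha)).trans ?_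
    exact map_smul _ _ _

/-- The inclusion of the values of operations on the domain. -/
def UinW : H.Uc →ₗ[R] H.Wc hB := Submodule.inclusion U₁_le_W₁

/-- The inclusion of the values of operations on the domain, as a morphism of partial algebras. -/
def inclHom [IsDedekindDomain R] : H.Upa hB ⟶ (H.Walg hB).toPartialObj where
  f := H.UinW hB
  f_gr _ _ h := h
  f_d _ := rfl
  map_mem _ _ := trivial
  map_θ {k} c x := by
    apply H.inclW_injective
    change O.frAct H.V c (pow(H.incl) x.1) =
      H.inclW hB (PiTensorProduct.lift (H.actW hB c) (pow(H.UinW hB) x.1))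
    refine lcongr (f := O.frAct H.V c ∘ₗ pmap fun _ => H.incl)
      (g := H.inclW hB ∘ₗ PiTensorProduct.lift (H.actW hB c) ∘ₗ pmap fun _ => H.UinW hB)
      (pext (mext fun a => ?_)) x.1
    simp only [l_mult, lcmp, map_tp, PiTensorProduct.lift.tprod]
    rfl

lemma inclHom_isQuasiIso [IsDedekindDomain R] (hbdd : O.Bounded) : PartialAlgebra.IsQuasiIso (H.inclHom hB) := by
  obtain ⟨-, h1, h2⟩ := (relAcyclic_D (H := H) hB hbdd).isQuasiIncl fun _ => D_D_W
  constructor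
  · rintro x - ⟨y, hy⟩
    obtain ⟨x', hx', e⟩ := h1 x.1 x.2 ⟨y.1, y.2, congrArg Subtype.val hy⟩
    exact ⟨⟨x', hx'⟩, Subtype.ext e⟩
  · intro y hy
    obtain ⟨x, hx, e, y', hy', e'⟩ := h2 y.1 y.2 (congrArg Subtype.val hy)
    exact ⟨⟨x, hx⟩, Subtype.ext e, ⟨y', hy'⟩, Subtype.ext e'⟩

end Operad.Ext

/-! ### Functoriality -/

namespace Operad

variable (O : Operad R)

variable {E E' E'' : DGModule R}

lemma _root_.DGModule.GrMap.gr {X Y : DGModule R} {φ : X →ₗ[R] Y} (h : GrMap X Y φ 0) (n : ℤ) (x : X)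
    (hx : x ∈ X.gr n) : φ x ∈ Y.gr n := zero_add n ▸ h n x hx

/-- The operator whose fixed point is the map of trees induced by a map of the labels of the leaves. -/
def treeStep (F : Mor E E') (φ : {φ : O.tree E →ₗ[R] O.tree E' // GrMap (O.tree E) (O.tree E') φ 0}) :
    {φ : O.tree E →ₗ[R] O.tree E' // GrMap (O.tree E) (O.tree E') φ 0} :=
  ⟨(O.leaf E').f ∘ₗ F.f ∘ₗ (O.root E).f + O.graft E' ∘ₗ O.freeFun φ.1 φ.2.gr ∘ₗ O.ungraft E, fun n x hx => by
    rw [zero_add]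
    refine add_mem ((O.leaf E').f_gr _ _ (F.f_gr _ _ ((O.root E).f_gr _ _ hx))) ?_
    have := O.graft_gr E' _ _ (O.freeFun_mem_gr _ φ.2.gr _ _ (O.ungraft_gr E n x hx))
    rwa [sub_add_cancel] at this⟩

lemma treeStep_leaf (F : Mor E E') (φ) (a : E) : (O.treeStep F φ).1 ((O.leaf E).f a) = (O.leaf E').f (F.f a) := by
  refine (congrArg (fun t => (O.leaf E').f (F.f a) + O.graft E' (O.freeFun φ.1 φ.2.gr t)) (O.ungraft_leaf E a)).trans ?_
  simp only [map_zero, add_zero]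

lemma treeStep_graft (F : Mor E E') (φ) (w : O.FreeMod (O.tree E)) :
    (O.treeStep F φ).1 (O.graft E w) = O.graft E' (O.freeFun φ.1 φ.2.gr w) := by
  refine (congrArg (fun t => (O.leaf E').f (F.f 0) + O.graft E' (O.freeFun φ.1 φ.2.gr t)) (O.ungraft_graft E w)).trans ?_
  simp only [map_zero, zero_add]

lemma exists_treeMap (F : Mor E E') : ∃ φ, O.treeStep F φ = φ := by
  refine O.tree_rec E _ (fun φ ψ a => ?_) fun φ ψ k c x h => ?_
  · rw [treeStep_leaf, treeStep_leaf]
  · rw [treeStep_graft, treeStep_graft, freeFun_br, freeFun_br, map_tp, map_tp]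
    exact congrArg _ (congrArg _ (congrArg _ (funext h)))

/-- The map of trees induced by a map of the labels of the leaves. -/
def treeMap (F : Mor E E') : O.tree E →ₗ[R] O.tree E' := (O.exists_treeMap F).choose.1

lemma treeMap_gr (F : Mor E E') : ∀ n, ∀ x ∈ (O.tree E).gr n, O.treeMap F x ∈ (O.tree E').gr n :=
  (O.exists_treeMap F).choose.2.gr

lemma treeMap_leaf (F : Mor E E') (a : E) : O.treeMap F ((O.leaf E).f a) = (O.leaf E').f (F.f a) :=
  (lcongr (congrArg Subtype.val (O.exists_treeMap F).choose_spec) _).symm.trans (O.treeStep_leaf F _ a)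

lemma treeMap_graft (F : Mor E E') (w : O.FreeMod (O.tree E)) :
    O.treeMap F (O.graft E w) = O.graft E' (O.freeFun (O.treeMap F) (O.treeMap_gr F) w) :=
  (lcongr (congrArg Subtype.val (O.exists_treeMap F).choose_spec) _).symm.trans (O.treeStep_graft F _ w)

lemma treeMap_id (E : DGModule R) : O.treeMap (Mor.id E) = lid :=
  O.tree_ext E (fun a => O.treeMap_leaf _ a) fun k c x h => by
    rw [treeMap_graft, freeFun_br, map_tp]
    exact congrArg _ (congrArg _ (congrArg _ (funext h)))

lemma treeMap_comp (G : Mor E' E'') (F : Mor E E') : O.treeMap (G.comp F) = O.treeMap G ∘ₗ O.treeMap F :=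
  O.tree_ext E (fun a => by
    rw [treeMap_leaf, lcmp, treeMap_leaf, treeMap_leaf]; rfl) fun k c x h => by
    rw [lcmp, treeMap_graft, treeMap_graft, treeMap_graft, freeFun_br, freeFun_br, freeFun_br,
      map_tp, map_tp, map_tp]
    exact congrArg _ (congrArg _ (congrArg _ (funext h)))

variable {O}

namespace Ext

variable {A B C : PartialAlgebra O} {H : Ext A} {H' : Ext B} {H'' : Ext C}

/-- A morphism of partial algebras with an extension to the hulls, which need not be compatible with
the extended structure maps. -/
structure Hom (H : Ext A) (H' : Ext B) where
  f : A ⟶ B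
  F : Mor H.E H'.E
  comm : ∀ a, F.f (H.j.f a) = H'.j.f (PartialAlgebra.Hom.f f a)

namespace Hom

/-- The induced map of free algebras on trees. -/
def G (Φ : H.Hom H') : H.C →ₗ[R] H'.C := O.freeFun (O.treeMap Φ.F) (O.treeMap_gr Φ.F)

lemma G_gr (Φ : H.Hom H') : ∀ n, ∀ x ∈ H.C.gr n, Φ.G x ∈ H'.C.gr n := O.freeFun_mem_gr _ _

lemma G_act (Φ : H.Hom H') (c : O.obj k) (w : (⨂[R]^k) H.C) :
    Φ.G (O.frAct H.V c w) = O.frAct H'.V c (pow(Φ.G) w) := O.freeFun_act _ _ c w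

lemma G_inc (Φ : H.Hom H') (e : H.E) : Φ.G (H.inc e) = H'.inc (Φ.F.f e) :=
  (O.freeFun_eta _ _ _).trans (congrArg (O.frEta H'.V) (O.treeMap_leaf _ _))

lemma G_con (Φ : H.Hom H') (w : H.C) : Φ.G (H.con w) = H'.con (Φ.G w) :=
  (O.freeFun_eta _ _ _).trans (congrArg (O.frEta H'.V) (O.treeMap_graft _ _))

lemma map_F_j (Φ : H.Hom H') (x : (⨂[R]^k) A.cx) : pow(Φ.F.f) (pow(H.j.f) x) =
      pow(H'.j.f) (pow(PartialAlgebra.Hom.f Φ.f) x) := by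
  refine lcongr (f := pow(Φ.F.f) ∘ₗ pmap fun _ => H.j.f)
    (g := pow(H'.j.f) ∘ₗ pmap fun _ => PartialAlgebra.Hom.f Φ.f)
    (pext (mext fun a => ?_)) x
  simp only [l_mult, lcmp, map_tp, Φ.comm]

lemma map_F_mem_L (Φ : H.Hom H') {z : (⨂[R]^k) H.E} (hz : z ∈ H.L k) :
    pow(Φ.F.f) z ∈ H'.L k := by
  obtain ⟨x, hx, rfl⟩ := hz
  exact ⟨_, PartialAlgebra.Hom.map_mem Φ.f k ⟨x, hx⟩, (Φ.map_F_j x).symm⟩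

lemma map_G_bop (Φ : H.Hom H') {J : Fin k → ℕ} {p : Fin k → ℤ} {g : ∀ i, (⨂[R]^(J i)) H.E →ₗ[R] H.C}
    {g' : ∀ i, (⨂[R]^(J i)) H'.E →ₗ[R] H'.C} (h : ∀ i x, Φ.G (g i x) = g' i (pow(Φ.F.f) x))
    (z : (⨂[R]^(∑ i, J i)) H.E) : pow(Φ.G) (bop H.E H.C J p g z) =
      bop H'.E H'.C J p g' (pow(Φ.F.f) z) :=
  lcongr (map_bop (A := H.E) (B := H.C) (A' := H'.E) (B' := H'.C) J p g g' Φ.F.f Φ.F.hasPar Φ.G h) z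

end Hom

/-- On the values of operations on the domain, the induced map commutes with the augmentation and the
differential. -/
lemma COp.exists_map (Φ : H.Hom H') {J : ℕ} {p : ℤ} {g : (⨂[R]^J) H.E →ₗ[R] H.C} (hg : H.COp J p g) :
    ∃ g', H'.COp J p g' ∧ (∀ x, Φ.G (g x) = g' (pow(Φ.F.f) x)) ∧
      ∀ z ∈ H.L J, H'.aug (Φ.G (g z)) = Φ.F.f (H.aug (g z)) ∧ H'.D (Φ.G (g z)) = Φ.G (H.D (g z)) := by
  induction hg with
  | inc =>
    refine ⟨_, COp.inc, fun x => ?_, fun z hz => ?_⟩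
    · rw [lcmp, lcmp, Φ.G_inc, ← H.E.tone_unTone x, tone_map, unTone_tone, unTone_tone]
    · obtain ⟨a, rfl⟩ := H.L_one hz
      have h1 : ∀ e, H.D (H.inc e) = H.inc (H.E.d e) := H.D_inc
      have h2 : ∀ e, H'.D (H'.inc e) = H'.inc (H'.E.d e) := H'.D_inc
      rw [lcmp, unTone_tone, Φ.G_inc, aug_inc, Φ.comm, aug_inc, h1, Φ.G_inc, h2, Φ.F.f_d, Φ.comm]
      exact ⟨rfl, rfl⟩
  | smul r _ ih =>
    obtain ⟨g', h1, h2, h3⟩ := ih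
    refine ⟨_, h1.smul r, fun x => ?_, fun z hz => ?_⟩
    · rw [l_smul, map_smul, h2, l_smul]
    · obtain ⟨h4, h5⟩ := h3 z hz
      simp only [l_smul, map_smul, h4, h5, and_self]
  | con _ ih =>
    obtain ⟨g', h1, h2, h3⟩ := ih
    refine ⟨_, h1.con, fun x => ?_, fun z hz => ?_⟩
    · rw [lcmp, Φ.G_con, h2, lcmp]
    · obtain ⟨h4, h5⟩ := h3 z hz
      have h6 : ∀ w, H.D (H.con w) = w - H.inc (H.aug w) - H.con (H.D w) := H.D_con
      have h7 : ∀ w, H'.D (H'.con w) = w - H'.inc (H'.aug w) - H'.con (H'.D w) := H'.D_con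
      rw [lcmp, Φ.G_con, aug_con, aug_con, map_zero, h6, h7, map_sub, map_sub, Φ.G_con, Φ.G_inc, h4, h5]
      exact ⟨rfl, rfl⟩
  | @act k J p g q c hc hg ih =>
    choose g' h1 h2 h3 using ih
    have hb := Φ.map_G_bop (p := p) h2
    refine ⟨_, COp.act c hc h1, fun x => ?_, fun z hz => ?_⟩
    · rw [lcmp, Φ.G_act, hb, lcmp]
    rw [lcmp]
    have hu := COp.bop_mem hg hz
    have hu' := COp.bop_mem h1 (Φ.map_F_mem_L hz)
    rw [← hb] at hu'
    have hs := bop_mem_tspan (p := p) (φ := g) (fun J n y => H.L_teps n) (H.split_mem_L J hz)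
    generalize bop H.E H.C J p g z = u at hu hu' hs
    have key := tspan_le (S := eqLocus (pow(H'.aug) ∘ₗ pow(Φ.G)) (pow(Φ.F.f) ∘ₗ pow(H.aug)) ⊓
        eqLocus (H'.C.tDer lid H'.D k ∘ₗ pow(Φ.G)) (pow(Φ.G) ∘ₗ H.C.tDer lid H.D k)) (fun b hb => by
      have h4 : ∀ i, H'.aug (Φ.G (b i)) = Φ.F.f (H.aug (b i)) ∧ H'.D (Φ.G (b i)) = Φ.G (H.D (b i)) := fun i => by
        obtain ⟨y, hy, e⟩ := hb i
        rw [← e]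
        exact h3 i y hy
      refine ⟨?_, (map_tDer_tprod Φ.G_gr fun i => (h4 i).2.symm).symm⟩
      simp only [SetLike.mem_coe, mem_eqLocus, lcmp, map_tp, fun i => (h4 i).1]) hs
    obtain ⟨k1, k2⟩ : _ = _ ∧ _ = _ := key
    rw [lcmp, lcmp] at k1 k2
    constructor
    · obtain ⟨x, hx, e⟩ := aug_mem hu
      obtain ⟨x', hx', e'⟩ := aug_mem hu'
      have h4 : x' = ⟨_, PartialAlgebra.Hom.map_mem Φ.f k x⟩ := by
        refine Subtype.ext (H'.map_j_injective k ?_)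
        rw [← hx', k1, hx, Φ.map_F_j]
      rw [Φ.G_act, e', e, Φ.comm, PartialAlgebra.Hom.map_θ, h4]
    · rw [D_act, map_add, Φ.G_act, Φ.G_act, Φ.G_act, ← k2]
      exact H'.D_act c _

namespace Hom

lemma G_mem_U (Φ : H.Hom H') {u : (⨂[R]^k) H.C} (hu : u ∈ H.U k) : pow(Φ.G) u ∈ H'.U k := by
  refine U_le (S := (H'.U k).comap pow(Φ.G)) (fun J p g hg z hz => ?_) hu
  choose g' h1 h2 _ using fun i => (hg i).exists_map Φ
  rw [mem_comap, Φ.map_G_bop h2]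
  exact COp.bop_mem h1 (Φ.map_F_mem_L hz)

lemma G_mem_U₁ (Φ : H.Hom H') {w : H.C} (hw : w ∈ H.U₁) : Φ.G w ∈ H'.U₁ := by
  refine U₁_le (S := H'.U₁.comap Φ.G) (fun J p g hg z hz => ?_) hw
  obtain ⟨g', h1, h2, -⟩ := hg.exists_map Φ
  rw [mem_comap, h2]
  exact h1.mem_U₁ (Φ.map_F_mem_L hz)

lemma aug_G (Φ : H.Hom H') {w : H.C} (hw : w ∈ H.U₁) : H'.aug (Φ.G w) = Φ.F.f (H.aug w) :=
  U₁_le (S := eqLocus (H'.aug ∘ₗ Φ.G) (Φ.F.f ∘ₗ H.aug)) (fun _ _ _ hg z hz => by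
    obtain ⟨-, -, -, h⟩ := hg.exists_map Φ
    exact (h z hz).1) hw

lemma D_G (Φ : H.Hom H') {w : H.C} (hw : w ∈ H.U₁) : H'.D (Φ.G w) = Φ.G (H.D w) :=
  U₁_le (S := eqLocus (H'.D ∘ₗ Φ.G) (Φ.G ∘ₗ H.D)) (fun _ _ _ hg z hz => by
    obtain ⟨-, -, -, h⟩ := hg.exists_map Φ
    exact (h z hz).2) hw

lemma G_mem_W₁ (Φ : H.Hom H') {w : H.C} (hw : w ∈ H.W₁) : Φ.G w ∈ H'.W₁ := by
  refine W₁_le (S := H'.W₁.comap Φ.G) (fun k p c q b _ _ hb _ => ?_) hw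
  rw [mem_comap, ← O.frAct_eta, Φ.G_act, map_tp, map_tp]
  exact act_mem_W₁ c fun l => U₁_le_W₁ (Φ.G_mem_U₁ (hb l))

lemma D_G_W (Φ : H.Hom H') {w : H.C} (hw : w ∈ H.W₁) : H'.D (Φ.G w) = Φ.G (H.D w) := by
  refine W₁_le (S := eqLocus (H'.D ∘ₗ Φ.G) (Φ.G ∘ₗ H.D)) (fun k p c q b _ _ hb _ => ?_) hw
  rw [mem_eqLocus, lcmp, lcmp, ← O.frAct_eta, map_tp,
    D_act, map_add, Φ.G_act, Φ.G_act, Φ.G_act, map_tDer_tprod Φ.G_gr fun i => (Φ.D_G (hb i)).symm]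
  exact H'.D_act c _

end Hom

end Ext

end Operad

namespace Operad.Ext

variable {O : Operad R} {A B C : PartialAlgebra O} {H : Ext A} {H' : Ext B} {H'' : Ext C}

namespace Hom

lemma G_id (Φ : H.Hom H) (h : Φ.F = Mor.id H.E) : Φ.G = lid := O.freeFun_id (by rw [h, treeMap_id]) _

lemma G_comp {Φ : H.Hom H'} {Ψ : H'.Hom H''} {Χ : H.Hom H''} (h : Χ.F = Ψ.F.comp Φ.F) : Χ.G = Ψ.G ∘ₗ Φ.G :=
  O.freeFun_comp (by rw [h, treeMap_comp]) _ _ _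

/-- The induced map of the values of operations on the domain. -/
def GU (Φ : H.Hom H') : H.Uc →ₗ[R] H'.Uc := Φ.G.restrict fun _ => Φ.G_mem_U₁

lemma map_incl_GU (Φ : H.Hom H') (x : (⨂[R]^k) H.Uc) : pow(H'.incl) (pow(Φ.GU) x) =
      pow(Φ.G) (pow(H.incl) x) := by
  refine lcongr (f := pow(H'.incl) ∘ₗ pmap fun _ => Φ.GU)
    (g := pow(Φ.G) ∘ₗ pmap fun _ => H.incl) ?_ x
  rw [← pmap_comp, ← pmap_comp]
  rfl

variable [IsDedekindDomain R] (hB : O.HasDualBases)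

/-- The induced morphism of the partial algebras of values of operations. -/
def mapU (Φ : H.Hom H') : H.Upa hB ⟶ H'.Upa hB where
  f := Φ.GU
  f_gr n x hx := Φ.G_gr n x.1 hx
  f_d x := Subtype.ext (Φ.D_G x.2).symm
  map_mem k x := Eq.mpr (congrArg (· ∈ H'.U k) (Φ.map_incl_GU x.1)) (Φ.G_mem_U x.2)
  map_θ c x := Subtype.ext ((Φ.G_act c _).trans (congrArg (O.frAct H'.V c) (Φ.map_incl_GU x.1).symm))

/-- The induced map of the products of trees. -/
def GW (Φ : H.Hom H') : H.Wc hB →ₗ[R] H'.Wc hB := Φ.G.restrict fun _ => Φ.G_mem_W₁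

/-- The induced morphism of algebras. -/
def mapW (Φ : H.Hom H') : H.Walg hB ⟶ H'.Walg hB where
  f := Φ.GW hB
  f_gr n x hx := Φ.G_gr n x.1 hx
  f_d x := Subtype.ext (Φ.D_G_W x.2).symm
  map_act c _ := Subtype.ext ((Φ.G_act c _).trans (congrArg (O.frAct H'.V c) (map_tp _ _)))

lemma mapU_augHom (Φ : H.Hom H') : Φ.mapU hB ≫ H'.augHom hB = H.augHom hB ≫ Φ.f := by
  refine PartialAlgebra.Hom.ext (lext fun x => H'.j_injective ?_)
  refine (H'.j_augA _).trans ((Φ.aug_G x.2).trans ((congrArg Φ.F.f (H.j_augA x).symm).trans ?_))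
  exact Φ.comm _

end Hom

variable [IsDedekindDomain R] (hB : O.HasDualBases)

/-- The extension of the structure maps to the hull `K ⊗ A`, where `K` is the fraction field. -/
def hull (A : PartialAlgebra O) : Ext A where
  E := A.cx.frac
  E_flat := by have := A.flat; exact A.cx.flat_frac
  j := A.cx.toFrac
  j_injective := by have := A.flat; exact A.cx.toFrac_injective
  T := (exists_hull_action hB A).choose
  T_gr := (exists_hull_action hB A).choose_spec.1
  T_br := (exists_hull_action hB A).choose_spec.2

/-- The map of complexes that underlies a morphism of partial algebras. -/
def homMor (f : A ⟶ B) : Mor A.cx B.cx :=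
  ⟨PartialAlgebra.Hom.f f, PartialAlgebra.Hom.f_gr f, PartialAlgebra.Hom.f_d f⟩

/-- The map of hulls induced by a morphism of partial algebras. -/
def hullMap (f : A ⟶ B) : (hull hB A).Hom (hull hB B) where
  f := f
  F := fracMap (homMor f)
  comm _ := rfl

lemma hullMap_id (A : PartialAlgebra O) :
    (hullMap hB (𝟙 A)).G = lid := Hom.G_id _ (fracMap_id _)

lemma hullMap_comp (f : A ⟶ B) (g : B ⟶ C) :
    (hullMap hB (f ≫ g)).G = (hullMap hB g).G ∘ₗ (hullMap hB f).G :=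
  Hom.G_comp (Φ := hullMap hB f) (Ψ := hullMap hB g) (Χ := hullMap hB (f ≫ g)) (fracMap_comp (homMor g) (homMor f))

/-- The functor that replaces a partial algebra by the values of operations on its domain. -/
def functorU : PartialAlgebra O ⥤ PartialAlgebra O where
  obj A := (hull hB A).Upa hB
  map f := (hullMap hB f).mapU hB
  map_id A := PartialAlgebra.Hom.ext (lext fun x => Subtype.ext (lcongr (hullMap_id hB A) x.1))
  map_comp f g := PartialAlgebra.Hom.ext (lext fun x => Subtype.ext (lcongr (hullMap_comp hB f g) x.1))

/-- The functor that replaces a partial algebra by an algebra. -/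
def functorW : PartialAlgebra O ⥤ OperadAlgebra O where
  obj A := (hull hB A).Walg hB
  map f := (hullMap hB f).mapW hB
  map_id A := OperadAlgebra.Hom.ext (lext fun x => Subtype.ext (lcongr (hullMap_id hB A) x.1))
  map_comp f g := OperadAlgebra.Hom.ext (lext fun x => Subtype.ext (lcongr (hullMap_comp hB f g) x.1))

end Operad.Ext

theorem mainTheorem1 {R : Type u} [CommRing R] [IsDedekindDomain R] (O : Operad R) (hproj : ∀ k : ℕ,
      Module.Projective (MonoidAlgebra R (Perm (Fin k))) (O.rep k).asModule)
    (hbdd : ∀ k : ℕ, IsUnit (k.factorial : R) ∨ ∃ N : ℤ, ∀ n < N, (O.obj k).gr n = ⊥) :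
    ∃ W : PartialAlgebra O ⥤ OperadAlgebra O, PartialAlgebra.NaturallyQuasiIsomorphic (𝟭 (PartialAlgebra O))
        (W ⋙ OperadAlgebra.toPartial O) := by
  have hB : ∀ k, Nonempty (O.DualBasis k) := fun k => by
    obtain ⟨ι, b, S, h1, h2⟩ := O.exists_dual_basis (hproj k)
    exact ⟨⟨ι, b, S, h1, h2⟩⟩
  refine ⟨Operad.Ext.functorW hB, .trans _ (Operad.Ext.functorU hB) _ (.symm _ _ (.rel _ _ ?_)) (.rel _ _ ?_)⟩
  · exact ⟨{ app := fun A => (Operad.Ext.hull hB A).augHom hB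
             naturality := fun _ _ f => (Operad.Ext.hullMap hB f).mapU_augHom hB },
      fun A => Operad.Ext.augHom_isQuasiIso hB⟩
  · exact ⟨{ app := fun A => (Operad.Ext.hull hB A).inclHom hB
             naturality := fun _ _ _ => rfl },
      fun A => (Operad.Ext.hull hB A).inclHom_isQuasiIso hB hbdd⟩
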